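/- **Setting.** Equip $\mathbb R^{1,4}$ with the scalar product of signature $(-,+,+,+,+)$, and let $\mathcal I\cong S^3$ be the set of future-pointing null directions, i.e. the asymptotic boundary of elliptic de Sitter space $dS_4/\mathbb Z_2$ and also of Euclidean $AdS_4$. Boundary data $\Pi$ are smooth real functions on the future light cone with $\Pi(r\ell)=r^{-2}\Pi(\ell)$ for $r>0$; they are the Neumann data of an antipodally even conformally coupled massless scalar $$F(x)=\int_{\mathcal I}\Pi(\ell)\,\frac{\delta(x\cdot\ell)}{4\pi}\,d^3\ell .$$ The Euclidean on-shell action and the Hartle–Hawking functional are $$S_E[\Pi]=-\frac12\int_{\mathcal I}\Phi_E\,\Pi\,d^3\ell,\qquad \Phi_E(\ell)=\int_{\mathcal I}\frac{\Pi(\ell')}{4\pi^2\,\ell\cdot\ell'}\,d^3\ell',\qquad \Psi[\Pi]=e^{-S_E[\Pi]} ,$$ computed on the section $\ell=(1,n)$, $n\in S^3$, of the light cone with its round measure. An observer is given by an orthochronous Lorentz frame $\Lambda$, with coordinates $\Lambda(\cosh t,\sinh t,\cos\theta,\sin\theta\cos\varphi,\sin\theta\sin\varphi)$ on $\mathcal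 I$ and $\Lambda(e^\eta,e^\eta,\cos\theta,\sin\theta\cos\varphi,\sin\theta\sin\varphi)$ on the future horizon. Let $c_{lm}(\omega)$ $(\omega>0,\ |m|\le l)$ be the coefficients in $$\Pi=\int_0^\infty\frac{d\omega}{2\pi}\sum_{lm}\bigl(e^{-i\omega t}Y_{lm}c_{lm}(\omega)+\text{c.c.}\bigr),\qquad c_{lm}(\omega)=\int dt\,d\Omega\;e^{i\omega t}\,\overline{Y_{lm}}\,\Pi .$$ The observer's oscillator variables are $a_{lm}(\omega)=N_l(\omega)c_{lm}(\omega)$, where the measurable functions $N_l(\omega)$ are normalized so that, for all $\Pi$, the energy of the solution (its flux through the future horizon) is $$\int d\eta\,d\Omega\,(\partial_\eta F)^2=\int_0^\infty\frac{d\omega}{2\pi}\sum_{lm}\omega\,|a_{lm}(\omega)|^2 .$$ The observer's Hilbert space is the bosonic Fock space over $L^2\bigl((0,\infty)\times\{(l,m)\},\tfrac{d\omega}{2\pi}\otimes\text{counting}\bigr)$, on which $[\hat a_{lm}(\omega),\hat a^\dagger_{l'm'}(\omega')]=2\pi\delta(\omega-\omega')\delta_{ll'}\delta_{mm'}$, with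 $$\hat H=\int_0^\infty\frac{d\omega}{2\pi}\sum_{lm}\omega\,\hat a^\dagger_{lm}(\omega)\hat a_{lm}(\omega),\qquad \hat L=\int_0^\infty\frac{d\omega}{2\pi}\sum_{lm}l\,\hat a^\dagger_{lm}(\omega)\hat a_{lm}(\omega),\qquad \hat R=(-1)^{\hat L}.$$ For a functional $A$ of the oscillators in an $n$-dimensional space $V$ of one-particle states, with $A(\alpha)=\int \tilde A(\xi)\,e^{\xi\cdot\bar\alpha-\bar\xi\cdot\alpha}\,d^{2n}\xi$, the Wigner–Weyl transform is $\int\tilde A(\xi)\,e^{\xi\cdot\hat a^\dagger-\bar\xi\cdot\hat a}\,d^{2n}\xi$. For a functional $A$ of all oscillators, $\hat A\sim B$ (with $B\neq0$ bounded) means that there is a dense domain of one-particle states such that, after multiplication by suitable nonzero normalization constants, the Wigner–Weyl transforms of the restrictions $A|_V$ converge strongly to $B$ along the finite-dimensional subspaces $V$ of the domain, directed by inclusion. **Theorem.** 1. For every observer, a normalization $N_l(\omega)$ as above exists, and for every such normalization and all boundary data $\Pi$, $$e^{-S_E[\Pi]}=\exp\Bigl(-2\int_0^\infty\frac{d\omega}{2\pi}\sum_{lm}\tanh\bigl(\tfrac{\pi}{2}(\omega+il)\bigr)\,|a_{lm}(\omega)|^2\Bigr),$$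 where the integral and sum converge absolutely. In particular the Gaussian functional of the oscillator variables on the right-hand side is the same for every observer. 2. The Wigner–Weyl transform of this Gaussian functional is, up to normalization, $\hat\Psi\sim\hat R\,e^{-\pi\hat H}$, where the domain is the dense space of one-particle states $a$ with $\int_0^\infty\frac{d\omega}{2\pi}\sum_{lm}\tanh(\tfrac\pi2(\omega+il))|a_{lm}(\omega)|^2<\infty$. Moreover $\hat R$ is the antipodal operator on $S^2$: $Y_{lm}(\pi-\theta,\varphi+\pi)=(-1)^l\,Y_{lm}(\theta,\varphi)$. 3. Its square is the (unnormalized) thermal density matrix $$\bigl(\hat R\,e^{-\pi\hat H}\bigr)^2=e^{-2\pi\hat H}=e^{-\hat H/T},\qquad T=\frac1{2\pi},$$ at the de Sitter temperature, and hence is the same for every observer. -/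

import Mathlib

open MeasureTheory Filter Topology
open scoped ContDiff NNReal ENNReal ComplexConjugate

noncomputable section

namespace EllipticDS

/-! ### The common boundary `𝓘` and the Hartle–Hawking functional -/

/-- The ambient space `ℝ^{1,4}`; coordinate `0` is the time coordinate. -/
abbrev Mink := Fin 5 → ℝ

/-- The scalar product of `ℝ^{1,4}` with signature `(-,+,+,+,+)`. -/
def mdot (x y : Mink) : ℝ := - (x 0 * y 0) + ∑ i : Fin 4, x i.succ * y i.succ

/-- Future-pointing null vectors; the null directions form the boundary `𝓘`. -/
def IsFutureNull (v : Mink) : Prop := 0 < v 0 ∧ mdot v v = 0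

/-- Smooth Neumann boundary data on `𝓘`: a function on the future light cone of conformal
weight `2`.  Smoothness on the cone is expressed by a smooth extension to `x⁰ > 0`; the values
off the cone are never used. -/
structure BoundaryData where
  toFun : Mink → ℝ
  smooth : ContDiffOn ℝ ∞ toFun {x | 0 < x 0}
  weight_two : ∀ v, IsFutureNull v → ∀ r : ℝ, 0 < r → toFun (r • v) = (r ^ 2)⁻¹ * toFun v

/-- The round section `ℓ = (1, n)`, `n ∈ S³`, of the light cone. -/
abbrev ThreeSphere := Metric.sphere (0 : EuclideanSpace ℝ (Fin 4)) 1

def roundSection (n : ThreeSphere) : Mink :=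
  Fin.cons 1 (fun i : Fin 4 => (n : EuclideanSpace ℝ (Fin 4)) i)

/-- The surface measure `d³ℓ` of the round section. -/
def roundMeasure : Measure ThreeSphere :=
  (volume : Measure (EuclideanSpace ℝ (Fin 4))).toSphere

/-- The boundary two-point function `G_E(ℓ;ℓ') = 1 / (4π² ℓ·ℓ')` of Euclidean `AdS₄`. -/
def twoPoint (v w : Mink) : ℝ := 1 / (4 * Real.pi ^ 2) * (1 / mdot v w)

/-- The Dirichlet data `Φ_E` induced on Euclidean `AdS₄` by the Neumann data `P`. -/
def dirichletData (P : BoundaryData) (v : Mink) : ℝ :=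
  ∫ n, twoPoint v (roundSection n) * P.toFun (roundSection n) ∂roundMeasure

/-- The on-shell Euclidean action `S_E = -½ ∫ Φ_E Π d³ℓ`. -/
def euclideanAction (P : BoundaryData) : ℝ :=
  -(1 / 2) * ∫ n, dirichletData P (roundSection n) * P.toFun (roundSection n) ∂roundMeasure

/-- The Hartle–Hawking functional `e^{-S_E}`. -/
def hartleHawking (P : BoundaryData) : ℝ := Real.exp (-euclideanAction P)

/-! ### Observers and their mode decomposition -/

/-- An observer, given by an adapted orthonormal frame of `ℝ^{1,4}`, i.e. by an orthochronous
Lorentz transformation `Λ`.  The endpoints of the worldline are the null directions of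
`Λ (1, -1, 0, 0, 0)` (initial) and `Λ (1, 1, 0, 0, 0)` (final). -/
structure Observer where
  frame : Matrix (Fin 5) (Fin 5) ℝ
  isometry : ∀ x y, mdot (frame.mulVec x) (frame.mulVec y) = mdot x y
  orthochronous : 0 < frame 0 0

/-- The point of `𝓘` with the observer's coordinates `(t, θ, φ)`. -/
def Observer.scri (o : Observer) (t θ φ : ℝ) : Mink :=
  o.frame.mulVec ![Real.cosh t, Real.sinh t, Real.cos θ, Real.sin θ * Real.cos φ,
    Real.sin θ * Real.sin φ]

/-- The point of the observer's future horizon with coordinates `(η, θ, φ)`. -/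
def Observer.horizon (o : Observer) (η θ φ : ℝ) : Mink :=
  o.frame.mulVec ![Real.exp η, Real.exp η, Real.cos θ, Real.sin θ * Real.cos φ,
    Real.sin θ * Real.sin φ]

/-- The solid-angle measure `sin θ dθ dφ` in the coordinates `(θ, φ)`. -/
def solidAngle : Measure (ℝ × ℝ) :=
  (volume.restrict (Set.Ioo 0 Real.pi ×ˢ Set.Ioo 0 (2 * Real.pi))).withDensity
    (fun p => ENNReal.ofReal (Real.sin p.1))

/-- The Legendre polynomial `P_l` (Rodrigues' formula). -/
def legendre (l : ℕ) : Polynomial ℝ :=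
  Polynomial.C (1 / (2 ^ l * (l.factorial : ℝ))) *
    Polynomial.derivative^[l] ((Polynomial.X ^ 2 - 1) ^ l)

/-- The spherical harmonic `Y_{lm}` for `|m| ≤ l`, with the Condon–Shortley phase. -/
def sphericalHarmonic (l : ℕ) (m : ℤ) (θ φ : ℝ) : ℂ :=
  (if 0 ≤ m then (-1) ^ m.natAbs else 1) *
    (Real.sqrt ((2 * l + 1) / (4 * Real.pi) *
      (((l - m.natAbs).factorial : ℝ) / ((l + m.natAbs).factorial : ℝ))) : ℝ) *
    (Real.sin θ ^ m.natAbs *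
      (Polynomial.derivative^[m.natAbs] (legendre l)).eval (Real.cos θ) : ℝ) *
    Complex.exp (Complex.I * m * φ)

/-- Angular momentum labels: `⟨l, j⟩` with `0 ≤ j ≤ 2l` stands for `(l, m)`, `m = j - l`. -/
abbrev AngLabel := Σ l : ℕ, Fin (2 * l + 1)

def AngLabel.m (a : AngLabel) : ℤ := (a.2 : ℤ) - a.1

/-- Mode labels `(ω, (l, m))`; the frequencies are restricted to `ω > 0` by `modeMeasure`. -/
abbrev Mode := ℝ × AngLabel

/-- The measure `∫₀^∞ dω/2π ∑_{lm}` on mode labels. -/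
def modeMeasure : Measure Mode :=
  ((2 * NNReal.pi)⁻¹ • volume.restrict (Set.Ioi (0 : ℝ))).prod Measure.count

/-- The coefficient `c_{lm}(ω)` in the expansion
`Π(t,θ,φ) = ∫₀^∞ dω/2π ∑_{lm} (e^{-iωt} Y_{lm}(θ,φ) c_{lm}(ω) + c.c.)`. -/
def Observer.coeff (o : Observer) (P : BoundaryData) (x : Mode) : ℂ :=
  ∫ p : ℝ × (ℝ × ℝ), Complex.exp (Complex.I * x.1 * p.1) *
      conj (sphericalHarmonic x.2.1 x.2.m p.2.1 p.2.2) *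
      (P.toFun (o.scri p.1 p.2.1 p.2.2) : ℂ) ∂((volume : Measure ℝ).prod solidAngle)

/-- The solution `F(x) = ∫ Π(ℓ) G(x;ℓ) d³ℓ` with the propagator `G(x;ℓ) = δ(x·ℓ)/4π`.  As usual
`∫ f(ℓ) δ(g(ℓ)) d³ℓ` is the derivative at `s = 0` of the integral of `f` over `{g ≤ s}`. -/
def fieldAt (P : BoundaryData) (x : Mink) : ℝ :=
  1 / (4 * Real.pi) *
    deriv (fun s : ℝ => ∫ n in {n : ThreeSphere | mdot x (roundSection n) ≤ s},
      P.toFun (roundSection n) ∂roundMeasure) 0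

/-- The static-patch energy of the solution, as the flux `∫ dη dΩ (∂F/∂η)²` of the stress tensor
contracted with the Killing field `∂_η` through the future horizon. -/
def Observer.energy (o : Observer) (P : BoundaryData) : ℝ≥0∞ :=
  ∫⁻ p : ℝ × (ℝ × ℝ),
    ENNReal.ofReal ((deriv (fun η => fieldAt P (o.horizon η p.2.1 p.2.2)) p.1) ^ 2)
      ∂((volume : Measure ℝ).prod solidAngle)

/-- The oscillator variables `a_{lm}(ω) = N_l(ω) c_{lm}(ω)`. -/
def Observer.oscillator (o : Observer) (N : ℕ → ℝ → ℂ) (P : BoundaryData) (x : Mode) : ℂ :=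
  N x.2.1 x.1 * o.coeff P x

/-- `N` normalizes the observer's oscillators: `E = ∫₀^∞ dω/2π ∑_{lm} ω |a_{lm}(ω)|²` for all
boundary data. -/
def Observer.IsNormalization (o : Observer) (N : ℕ → ℝ → ℂ) : Prop :=
  (∀ l, Measurable (N l)) ∧
    ∀ P : BoundaryData, o.energy P =
      ∫⁻ x, ENNReal.ofReal x.1 * ‖o.oscillator N P x‖ₑ ^ 2 ∂modeMeasure

/-- `tanh (π (ω + i l) / 2)`. -/
def modeTanh (x : Mode) : ℂ :=
  Complex.tanh (Real.pi / 2 * (x.1 + Complex.I * x.2.1))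

/-- The Gaussian functional `exp (-2 ∫₀^∞ dω/2π ∑_{lm} tanh (π(ω+il)/2) |a_{lm}(ω)|²)` of the
oscillator variables. -/
def hhGaussian (a : Mode → ℂ) : ℂ :=
  Complex.exp (-2 * ∫ x, modeTanh x * (‖a x‖ ^ 2 : ℝ) ∂modeMeasure)

/-! ### The observer's Hilbert space -/

instance : MeasurableSingletonClass AngLabel :=
  ⟨fun a => by
    rw [MeasurableSpace.measurableSet_iInf]
    intro l
    exact MeasurableSet.of_discrete (s := Sigma.mk l ⁻¹' {a})⟩

instance : SigmaFinite modeMeasure := by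
  unfold modeMeasure
  infer_instance

/-- Wave functions of a single quantum: `L²` of the mode labels. -/
abbrev OneParticle := Lp ℂ 2 modeMeasure

/-- Finite sequences of mode labels. -/
abbrev Config := Σ n : ℕ, (Fin n → Mode)

/-- The measure on `⨆ₙ Modeⁿ` whose `L²` space is the direct sum of the spaces `L²(Modeⁿ)`. -/
def configMeasure : Measure Config :=
  Measure.sum fun n : ℕ => (Measure.pi fun _ : Fin n => modeMeasure).map (Sigma.mk n)

/-- The `n`-particle components `f ⊗ ⋯ ⊗ f / √n!` of the exponential vector (unnormalized coherent
state) of `f`. -/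
def expFun (f : Mode → ℂ) (y : Config) : ℂ :=
  ((Real.sqrt (y.1.factorial) : ℝ) : ℂ)⁻¹ * ∏ i, f (y.2 i)

theorem measurable_sigma_mk (n : ℕ) : Measurable (fun x : Fin n → Mode => (⟨n, x⟩ : Config)) := by
  intro s hs
  exact (MeasurableSpace.measurableSet_iInf.1 hs) n

theorem measurable_config {β : Type*} [MeasurableSpace β] {g : Config → β}
    (h : ∀ n, Measurable fun x : Fin n → Mode => g ⟨n, x⟩) : Measurable g := by
  intro s hs
  rw [MeasurableSpace.measurableSet_iInf]
  intro n
  exact h n hs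

theorem ae_config {p : Config → Prop} (hp : MeasurableSet {y | p y}) :
    (∀ᵐ y ∂configMeasure, p y) ↔
      ∀ n, ∀ᵐ x ∂(Measure.pi fun _ : Fin n => modeMeasure), p ⟨n, x⟩ := by
  unfold configMeasure
  rw [Measure.ae_sum_iff' hp]
  refine forall_congr' fun n => ?_
  rw [ae_map_iff (measurable_sigma_mk n).aemeasurable hp]

theorem measurable_expFun {f : Mode → ℂ} (hf : Measurable f) : Measurable (expFun f) := by
  refine measurable_config fun n => ?_
  unfold expFun
  have h : Measurable fun x : Fin n → Mode => ∏ i, f (x i) :=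
    Finset.measurable_prod _ fun i _ => hf.comp (measurable_pi_apply i)
  exact h.const_mul ((Real.sqrt (n.factorial) : ℝ) : ℂ)⁻¹

theorem memLp_expFun (f : OneParticle) : MemLp (expFun f) 2 configMeasure := by
  have hf : Measurable (f : Mode → ℂ) := (Lp.stronglyMeasurable f).measurable
  have hm := measurable_expFun hf
  refine ⟨hm.aestronglyMeasurable, ?_⟩
  rw [eLpNorm_lt_top_iff_lintegral_rpow_enorm_lt_top (by norm_num) (by norm_num)]
  have hint : Integrable (fun x => ‖f x‖ ^ 2) modeMeasure :=
    (memLp_two_iff_integrable_sq_norm (Lp.memLp f).1).1 (Lp.memLp f)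
  set c : ℝ := ∫ x, ‖f x‖ ^ 2 ∂modeMeasure with hc
  have hc0 : 0 ≤ c := integral_nonneg fun x => by positivity
  unfold configMeasure
  rw [lintegral_sum_measure]
  have key : ∀ n : ℕ, ∫⁻ y, ‖expFun f y‖ₑ ^ (2 : ℝ≥0∞).toReal
      ∂((Measure.pi fun _ : Fin n => modeMeasure).map (Sigma.mk n)) =
      ENNReal.ofReal (c ^ n / n.factorial) := by
    intro n
    rw [lintegral_map (by fun_prop) (measurable_sigma_mk n)]
    have h1 : ∀ x : Fin n → Mode, ‖expFun f ⟨n, x⟩‖ₑ ^ (2 : ℝ≥0∞).toReal =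
        ENNReal.ofReal ((n.factorial : ℝ)⁻¹ * ∏ i, ‖f (x i)‖ ^ 2) := by
      intro x
      rw [← ofReal_norm, ENNReal.ofReal_rpow_of_nonneg (norm_nonneg _) (by norm_num)]
      congr 1
      have : ((2 : ℝ≥0∞).toReal) = ((2 : ℕ) : ℝ) := by norm_num
      rw [this, Real.rpow_natCast]
      unfold expFun
      rw [norm_mul, norm_inv, Complex.norm_real, Real.norm_of_nonneg (Real.sqrt_nonneg _),
        mul_pow, inv_pow, Real.sq_sqrt (by positivity), norm_prod, Finset.prod_pow]
    simp_rw [h1]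
    rw [← ofReal_integral_eq_lintegral_ofReal]
    · congr 1
      rw [integral_const_mul, integral_fintype_prod_eq_pow (fun x => ‖f x‖ ^ 2), Fintype.card_fin]
      ring
    · exact (Integrable.fintype_prod (f := fun (_ : Fin n) x => ‖f x‖ ^ 2) fun _ => hint).const_mul _
    · exact ae_of_all _ fun x => by positivity
  simp_rw [key]
  rw [← ENNReal.ofReal_tsum_of_nonneg (fun n => by positivity)
    (Real.summable_pow_div_factorial c)]
  exact ENNReal.ofReal_lt_top

/-- The exponential vector of `f` as an element of the full Fock space. -/
def fullExp (f : OneParticle) : Lp ℂ 2 configMeasure := (memLp_expFun f).toLp _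

/-- The bosonic Fock space, i.e. the permutation-symmetric wave functions in `⨁ₙ L²(Modeⁿ)`, as the
closed linear span of the exponential vectors. -/
def fock : Submodule ℂ (Lp ℂ 2 configMeasure) :=
  (Submodule.span ℂ (Set.range fullExp)).topologicalClosure

abbrev Fock : Type := fock

instance : CompleteSpace Fock :=
  (Submodule.isClosed_topologicalClosure _).completeSpace_coe

/-- The exponential vector of `f` as an element of the bosonic Fock space. -/
def expVec (f : OneParticle) : Fock :=
  ⟨fullExp f, Submodule.le_topologicalClosure _ (Submodule.subset_span ⟨f, rfl⟩)⟩

/-! ### The Hamiltonian, the antipodal operator and thermal operators -/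

/-- The value of `Ĥ = ∫ dω/2π ∑ ω a†a` on a configuration: the sum of the frequencies. -/
def energyOf (y : Config) : ℝ := ∑ i, (y.2 i).1

/-- The value of `L̂ = ∫ dω/2π ∑ l a†a` on a configuration: the sum of the `l`'s. -/
def angularOf (y : Config) : ℕ := ∑ i, (y.2 i).2.1

/-- The operator-valued distribution `â_{lm}(ω)`:
`(a(x) ψ)(x₁, …, xₙ) = √(n+1) ψ(x, x₁, …, xₙ)`. -/
def annihilate (x : Mode) (ψ : Config → ℂ) (y : Config) : ℂ :=
  (Real.sqrt (y.1 + 1) : ℝ) * ψ ⟨y.1 + 1, Fin.cons x y.2⟩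

/-- The multiplication operator with value `E` on configurations is `∫ dω/2π ∑ w a†a`, in the sense
of quadratic forms. -/
def IsModeSum (w : Mode → ℝ) (E : Config → ℝ) : Prop :=
  ∀ ψ : Fock,
    ∫⁻ y, ENNReal.ofReal (E y) * ‖(ψ : Lp ℂ 2 configMeasure) y‖ₑ ^ 2 ∂configMeasure =
      ∫⁻ x, ENNReal.ofReal (w x) *
        ∫⁻ y, ‖annihilate x (ψ : Lp ℂ 2 configMeasure) y‖ₑ ^ 2 ∂configMeasure ∂modeMeasure

theorem memLp_multiplier {X : Type*} [MeasurableSpace X] {μ : Measure X} {m : X → ℂ}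
    (hm : Measurable m) (hb : ∀ᵐ y ∂μ, ‖m y‖ ≤ 1) (ψ : Lp ℂ 2 μ) :
    MemLp (fun y => m y * ψ y) 2 μ := by
  refine (Lp.memLp ψ).of_le (hm.aestronglyMeasurable.mul (Lp.aestronglyMeasurable ψ)) ?_
  filter_upwards [hb] with y hy
  rw [norm_mul]
  exact mul_le_of_le_one_left (norm_nonneg _) hy

/-- Multiplication by a measurable function of modulus at most `1` on an `L²` space. -/
def multiplier {X : Type*} [MeasurableSpace X] {μ : Measure X} (m : X → ℂ)
    (hm : Measurable m) (hb : ∀ᵐ y ∂μ, ‖m y‖ ≤ 1) : Lp ℂ 2 μ →L[ℂ] Lp ℂ 2 μ :=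
  LinearMap.mkContinuous
    { toFun := fun ψ => (memLp_multiplier hm hb ψ).toLp _
      map_add' := fun ψ φ => by
        ext1
        filter_upwards [(memLp_multiplier hm hb (ψ + φ)).coeFn_toLp,
          (memLp_multiplier hm hb ψ).coeFn_toLp, (memLp_multiplier hm hb φ).coeFn_toLp,
          Lp.coeFn_add ψ φ, Lp.coeFn_add ((memLp_multiplier hm hb ψ).toLp _)
            ((memLp_multiplier hm hb φ).toLp _)] with y h1 h2 h3 h4 h5
        rw [h1, h5, Pi.add_apply, h2, h3, h4, Pi.add_apply, mul_add]
      map_smul' := fun c ψ => by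
        ext1
        filter_upwards [(memLp_multiplier hm hb (c • ψ)).coeFn_toLp,
          (memLp_multiplier hm hb ψ).coeFn_toLp, Lp.coeFn_smul c ψ,
          Lp.coeFn_smul c ((memLp_multiplier hm hb ψ).toLp _)] with y h1 h2 h3 h4
        rw [h1, RingHom.id_apply, h4, Pi.smul_apply, h2, h3, Pi.smul_apply, smul_eq_mul,
          smul_eq_mul]
        ring } 1
    (fun ψ => by
      rw [one_mul]
      refine Lp.norm_le_norm_of_ae_le ?_
      filter_upwards [(memLp_multiplier hm hb ψ).coeFn_toLp, hb] with y h1 h2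
      simp only [LinearMap.coe_mk, AddHom.coe_mk]
      rw [h1, norm_mul]
      exact mul_le_of_le_one_left (norm_nonneg _) h2)

theorem coeFn_multiplier {X : Type*} [MeasurableSpace X] {μ : Measure X} {m : X → ℂ}
    (hm : Measurable m) (hb : ∀ᵐ y ∂μ, ‖m y‖ ≤ 1) (ψ : Lp ℂ 2 μ) :
    multiplier m hm hb ψ =ᵐ[μ] fun y => m y * ψ y :=
  (memLp_multiplier hm hb ψ).coeFn_toLp

theorem measurable_prod_config {g : Mode → ℂ} (hg : Measurable g) :
    Measurable fun y : Config => ∏ i, g (y.2 i) := by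
  refine measurable_config fun n => ?_
  have h : Measurable fun x : Fin n → Mode => ∏ i, g (x i) :=
    Finset.measurable_prod _ fun i _ => hg.comp (measurable_pi_apply i)
  exact h

theorem ae_config_of_ae {p : Mode → Prop} (h : ∀ᵐ x ∂modeMeasure, p x) :
    ∀ᵐ y ∂configMeasure, ∀ i, p (y.2 i) := by
  obtain ⟨t, ht, htm, ht0⟩ := exists_measurable_superset_of_null (ae_iff.1 h)
  have hmeas : MeasurableSet {y : Config | ∀ i, y.2 i ∉ t} := by
    have : {y : Config | ∀ i, y.2 i ∉ t} = {y : Config | ∏ i, tᶜ.indicator 1 (y.2 i) = (1 : ℂ)} := by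
      ext y
      simp only [Set.mem_ofPred_eq]
      constructor
      · intro hy
        exact Finset.prod_eq_one fun i _ => by simp [hy i]
      · intro hy i hi
        rw [Finset.prod_eq_zero (Finset.mem_univ i) (by simp [hi])] at hy
        exact zero_ne_one hy
    rw [this]
    exact measurable_prod_config (measurable_one.indicator htm.compl) (measurableSet_singleton 1)
  have h2 : ∀ᵐ y ∂configMeasure, ∀ i, y.2 i ∉ t := by
    rw [ae_config hmeas]
    intro n
    change ∀ᵐ x : Fin n → Mode ∂(Measure.pi fun _ : Fin n => modeMeasure), ∀ i : Fin n, x i ∉ t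
    rw [ae_all_iff]
    intro i
    have := (Measure.quasiMeasurePreserving_eval (fun _ : Fin n => modeMeasure) i).ae
      (p := fun x => x ∉ t) (measure_eq_zero_iff_ae_notMem.1 ht0)
    exact this
  filter_upwards [h2] with y hy i
  by_contra hcon
  exact hy i (ht hcon)

theorem ae_norm_prod_le {g : Mode → ℂ} (hb : ∀ᵐ x ∂modeMeasure, ‖g x‖ ≤ 1) :
    ∀ᵐ y ∂configMeasure, ‖∏ i, g (y.2 i)‖ ≤ 1 := by
  filter_upwards [ae_config_of_ae hb] with y hy
  rw [norm_prod]
  exact Finset.prod_le_one (fun i _ => norm_nonneg _) fun i _ => hy i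

theorem multiplier_fullExp {g : Mode → ℂ} (hg : Measurable g)
    (hb : ∀ᵐ x ∂modeMeasure, ‖g x‖ ≤ 1) (f : OneParticle) :
    multiplier (fun y : Config => ∏ i, g (y.2 i)) (measurable_prod_config hg)
      (ae_norm_prod_le hb) (fullExp f) = fullExp (multiplier g hg hb f) := by
  ext1
  filter_upwards [coeFn_multiplier (measurable_prod_config hg) (ae_norm_prod_le hb) (fullExp f),
    (memLp_expFun f).coeFn_toLp, (memLp_expFun (multiplier g hg hb f)).coeFn_toLp,
    ae_config_of_ae (coeFn_multiplier hg hb f)] with y h1 h2 h3 h4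
  rw [h1]
  unfold fullExp
  rw [h2, h3]
  unfold expFun
  rw [Finset.prod_congr rfl fun i _ => h4 i, Finset.prod_mul_distrib]
  ring

/-- The operator on the bosonic Fock space that multiplies by `M = ∏ᵢ g(xᵢ)`. -/
def fockMultiplier (M : Config → ℂ) (g : Mode → ℂ) (hg : Measurable g)
    (hb : ∀ᵐ x ∂modeMeasure, ‖g x‖ ≤ 1) (hM : ∀ y, M y = ∏ i, g (y.2 i)) : Fock →L[ℂ] Fock :=
  ((multiplier M (by rw [funext hM]; exact measurable_prod_config hg)
      (by rw [funext hM]; exact ae_norm_prod_le hb)).comp fock.subtypeL).codRestrict fock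
    (by
      obtain rfl : M = _ := funext hM
      intro ψ
      have hle : fock ≤ fock.comap (multiplier (fun y : Config => ∏ i, g (y.2 i))
          (measurable_prod_config hg) (ae_norm_prod_le hb)).toLinearMap := by
        refine Submodule.topologicalClosure_minimal _ (Submodule.span_le.2 ?_) ?_
        · rintro _ ⟨f, rfl⟩
          change multiplier _ _ _ (fullExp f) ∈ fock
          rw [multiplier_fullExp hg hb f]
          exact (expVec _).2
        · exact (Submodule.isClosed_topologicalClosure _).preimage
            (multiplier (fun y : Config => ∏ i, g (y.2 i))
              (measurable_prod_config hg) (ae_norm_prod_le hb)).continuous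
      exact hle ψ.2)

theorem ae_freq_pos : ∀ᵐ x ∂modeMeasure, 0 < x.1 := by
  have h : ∀ᵐ w ∂((2 * NNReal.pi)⁻¹ • volume.restrict (Set.Ioi (0 : ℝ))), 0 < w :=
    Measure.ae_smul_measure (ae_restrict_mem measurableSet_Ioi) _
  exact Measure.quasiMeasurePreserving_fst.ae h

/-- The operator `e^{-βĤ}`, `β ≥ 0`. -/
def expNegHamiltonian (β : ℝ≥0) : Fock →L[ℂ] Fock :=
  fockMultiplier (fun y => Complex.exp (-β * energyOf y)) (fun x => Complex.exp (-β * x.1))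
    (by fun_prop)
    (by
      filter_upwards [ae_freq_pos] with x hx
      rw [Complex.norm_exp]
      simpa using mul_nonneg β.2 hx.le)
    (fun y => by
      rw [← Complex.exp_sum]
      simp [energyOf, Finset.mul_sum])

/-- The unnormalized thermal density matrix `e^{-Ĥ/T}` at temperature `T`. -/
def thermalOperator (T : ℝ≥0) : Fock →L[ℂ] Fock := expNegHamiltonian T⁻¹

theorem measurable_angLabel {β : Type*} [MeasurableSpace β] (g : AngLabel → β) : Measurable g := by
  intro s _
  exact (Set.to_countable _).measurableSet

/-- The antipodal operator `R̂ = (-1)^L̂`. -/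
def antipodalOperator : Fock →L[ℂ] Fock :=
  fockMultiplier (fun y => (-1) ^ angularOf y) (fun x => (-1) ^ x.2.1)
    ((measurable_angLabel fun a => ((-1 : ℂ) ^ a.1)).comp measurable_snd)
    (ae_of_all _ fun x => by simp)
    (fun y => by rw [angularOf, Finset.prod_pow_eq_pow_sum])

/-! ### The Wigner–Weyl transform -/

/-- `D f = exp (a†(f) - a(f))`, given by its action on exponential vectors. -/
def IsWeylSystem (D : OneParticle → Fock →L[ℂ] Fock) : Prop :=
  ∀ f g, D f (expVec g) =
    Complex.exp (-(‖f‖ ^ 2 : ℝ) / 2 - inner ℂ f g) • expVec (f + g)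

section Weyl

variable (V : Submodule ℂ OneParticle) [FiniteDimensional ℂ V]

/-- The point of `V` with complex coordinates `z` in an orthonormal basis. -/
def ofCoords (z : Fin (Module.finrank ℂ V) → ℂ) : OneParticle :=
  ∑ i, z i • (stdOrthonormalBasis ℂ V i : OneParticle)

/-- The symplectic Fourier transform `Ã` of `A` on `V`, normalized by
`A(α) = ∫ Ã(ξ) exp (ξ·α* - ξ*·α) d²ξ`. -/
def symplecticFourier (A : (Mode → ℂ) → ℂ) (ξ : Fin (Module.finrank ℂ V) → ℂ) : ℂ :=
  (1 / (Real.pi : ℂ) ^ (2 * Module.finrank ℂ V)) *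
    ∫ α : Fin (Module.finrank ℂ V) → ℂ,
      A (ofCoords V α) * Complex.exp (∑ i, (conj (ξ i) * α i - ξ i * conj (α i)))

/-- The Wigner–Weyl transform (symmetric ordering) of the functional `A`, restricted to the
oscillators in `V`: the operator `∫ Ã(ξ) exp (ξ·a† - ξ*·a) d²ξ`, applied to `ψ`. -/
def weylTransform (D : OneParticle → Fock →L[ℂ] Fock) (A : (Mode → ℂ) → ℂ) (ψ : Fock) : Fock :=
  ∫ ξ : Fin (Module.finrank ℂ V) → ℂ, symplecticFourier V A ξ • D (ofCoords V ξ) ψ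

end Weyl

/-- The finite-dimensional spaces of oscillators within a domain `Q`, directed by inclusion. -/
abbrev FiniteModes (Q : Submodule ℂ OneParticle) :=
  {V : Submodule ℂ OneParticle // V ≤ Q ∧ FiniteDimensional ℂ V}

/-- `B` is, up to normalization, the Wigner–Weyl transform of the functional `A` of infinitely many
oscillators with dense domain `Q`: suitably normalized, the Wigner–Weyl transforms of the
restrictions of `A` to finitely many oscillators converge strongly to `B ≠ 0` as the finite set of
oscillators exhausts `Q`. -/
def IsWeylTransform (D : OneParticle → Fock →L[ℂ] Fock) (Q : Submodule ℂ OneParticle)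
    (A : (Mode → ℂ) → ℂ) (B : Fock →L[ℂ] Fock) : Prop :=
  Dense (Q : Set OneParticle) ∧ B ≠ 0 ∧
    ∃ z : FiniteModes Q → ℂ, (∀ V, z V ≠ 0) ∧
      ∀ ψ : Fock, Tendsto
        (fun V : FiniteModes Q =>
          haveI : FiniteDimensional ℂ V.1 := V.2.2
          z V • weylTransform V.1 D A ψ) atTop (𝓝 (B ψ))

theorem measurable_modeTanh : Measurable modeTanh := by
  have h : Measurable fun x : Mode => (Real.pi / 2 * (x.1 + Complex.I * x.2.1) : ℂ) :=
    ((Complex.measurable_ofReal.comp measurable_fst).add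
      (((measurable_angLabel fun a => (a.1 : ℂ)).comp measurable_snd).const_mul _)).const_mul _
  unfold modeTanh
  simp only [Complex.tanh]
  exact (Complex.measurable_sinh.comp h).div (Complex.measurable_cosh.comp h)

/-- The oscillator configurations for which the action
`∫₀^∞ dω/2π ∑_{lm} tanh (π(ω+il)/2) |a_{lm}(ω)|²` is finite. -/
def finiteAction : Submodule ℂ OneParticle where
  carrier := {f | Integrable (fun x => modeTanh x * (‖f x‖ ^ 2 : ℝ)) modeMeasure}
  zero_mem' := by
    refine (integrable_zero Mode ℂ modeMeasure).congr ?_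
    filter_upwards [Lp.coeFn_zero ℂ 2 modeMeasure] with x hx
    rw [hx]
    simp
  add_mem' := by
    intro f g hf hg
    have hfg := ((hf.norm.const_mul 2).add (hg.norm.const_mul 2))
    refine hfg.mono' (measurable_modeTanh.aestronglyMeasurable.mul
      (Complex.measurable_ofReal.comp_aemeasurable
        ((Lp.aestronglyMeasurable (f + g)).norm.aemeasurable.pow_const 2)).aestronglyMeasurable) ?_
    filter_upwards [Lp.coeFn_add f g] with x hx
    have h1 : ‖(f + g : OneParticle) x‖ ^ 2 ≤ 2 * ‖f x‖ ^ 2 + 2 * ‖g x‖ ^ 2 := by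
      rw [hx, Pi.add_apply]
      have := norm_add_le (f x) (g x)
      nlinarith [sq_nonneg (‖f x‖ - ‖g x‖), norm_nonneg (f x + g x)]
    simp only [norm_mul, Complex.norm_real, norm_pow, norm_norm, Pi.add_apply]
    nlinarith [norm_nonneg (modeTanh x), mul_le_mul_of_nonneg_left h1 (norm_nonneg (modeTanh x))]
  smul_mem' := by
    intro c f hf
    refine (hf.const_mul ((‖c‖ ^ 2 : ℝ) : ℂ)).congr ?_
    filter_upwards [Lp.coeFn_smul c f] with x hx
    rw [hx, Pi.smul_apply, smul_eq_mul, norm_mul, mul_pow]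
    push_cast
    ring

end EllipticDS

end

/-!
# The Hartle–Hawking functional in the oscillators of a de Sitter observer

*The action.*  The measure `d⁴x / ‖x‖` on the light cone is Lorentz invariant
(`Observer.lintegral_coneMap`), so in the coordinates `(t, n)` of any observer the action is the
quadratic form of the kernel `1 / (cosh (t - t') - n·n')` on the cylinder `ℝ × S²`.  This kernel is
invariant under time translations and rotations, hence diagonal in the modes `e^{-iωt} Y_{lm}`: the
Funk–Hecke formula (`funk_hecke`) and the Fourier transform of `1 / (cosh τ - cos γ)`
(`timeFourier_inv_cosh_sub`) give its spectral function `kernelCoeff`, and Parseval on the cylinder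
gives `Observer.euclideanAction_eq_integral`.

*The energy.*  On the future horizon the field is the average of the boundary data over a
hemisphere, at the times `t = η - log (n₀·n)` (`Observer.fieldAt_horizonAt`).  By Funk–Hecke again,
its `η`-derivative has the coefficients `-horizonFactor/2` times those of the data, whence
`Observer.energy_eq`.  The functions `kernelCoeff` and `|horizonFactor|²` obey the same recursion from
`l` to `l + 2`, so their ratio is determined by the cases `l = 0, 1`, and it is
`tanh (π(ω+il)/2) / ω` (`kernelCoeff_eq_modeTau`).  A normalization exists since only `|N_l(ω)|² = |horizonFactor|² / 2ω` is
required.  It is unique in modulus: boundary data with a single `l`, superposed with their time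
translates, have energies that yield the cosine transform of `ω |N_l|²` against a nowhere vanishing
weight (`Observer.IsNormalization.ae_eq`).

*The Wigner–Weyl transform.*  Write `τ` for the function `tanh (π(ω+il)/2)` and
`β = (-1)^l e^{-πω}` for the eigenvalues of `R̂ e^{-πĤ}` on one particle, so that
`β = (1 - τ) / (1 + τ)`.  The Weyl operators are given by their action on exponential vectors
(`weylOp`).  On a finite-dimensional space `V` of oscillators the Gaussian is diagonal in an
orthonormal basis, with eigenvalues `tᵢ`; its symplectic Fourier transform is a Gaussian, and the
corresponding average of Weyl operators is a multiple of the second quantization of the Cayley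
transform `(1 - T) / (1 + T)` of the compression `T` of `τ` to `V` (`exists_gaussWeyl_expVec`).  These
operators are contractions (`norm_le_of_second_quantized`).  Once `V` contains `g` and `βg`, the
compressed Cayley transform maps `g` to `βg` exactly, since `τ (g + βg) = g - βg`
(`cayley_eq_oneBoltz`).  Strong convergence follows on exponential vectors, and on all of Fock space
by density (`isWeylTransform_hhGaussian`).

*The thermal state.*  `R̂² = 1` and `R̂` commutes with `Ĥ`, as both are multiplication operators on
configurations.  The parity of `Y_{lm}` is the parity of the associated Legendre functions times that
of `e^{imφ}`.
-/

open MeasureTheory Filter Topology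
open scoped ContDiff NNReal ENNReal ComplexConjugate

noncomputable section

namespace EllipticDS

/-! ### Multiplication operators on Fock space -/

theorem coeFn_fockMultiplier {M : Config → ℂ} {g : Mode → ℂ} (hg : Measurable g)
    (hb : ∀ᵐ x ∂modeMeasure, ‖g x‖ ≤ 1) (hM : ∀ y, M y = ∏ i, g (y.2 i)) (ψ : Fock) :
    ((fockMultiplier M g hg hb hM ψ : Fock) : Lp ℂ 2 configMeasure) =ᵐ[configMeasure]
      fun y => M y * (ψ : Lp ℂ 2 configMeasure) y :=
  coeFn_multiplier (m := M) (by rw [funext hM]; exact measurable_prod_config hg)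
    (by rw [funext hM]; exact ae_norm_prod_le hb) _

theorem coeFn_expNegHamiltonian (β : ℝ≥0) (ψ : Fock) :
    ((expNegHamiltonian β ψ : Fock) : Lp ℂ 2 configMeasure) =ᵐ[configMeasure]
      fun y => Complex.exp (-β * energyOf y) * (ψ : Lp ℂ 2 configMeasure) y := by
  unfold expNegHamiltonian
  exact coeFn_fockMultiplier _ _ _ _

theorem coeFn_antipodalOperator (ψ : Fock) :
    ((antipodalOperator ψ : Fock) : Lp ℂ 2 configMeasure) =ᵐ[configMeasure]
      fun y => (-1) ^ angularOf y * (ψ : Lp ℂ 2 configMeasure) y := by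
  unfold antipodalOperator
  exact coeFn_fockMultiplier _ _ _ _

theorem fockMultiplier_expVec {M : Config → ℂ} {g : Mode → ℂ} (hg : Measurable g)
    (hb : ∀ᵐ x ∂modeMeasure, ‖g x‖ ≤ 1) (hM : ∀ y, M y = ∏ i, g (y.2 i)) (f : OneParticle) :
    fockMultiplier M g hg hb hM (expVec f) = expVec (multiplier g hg hb f) := by
  obtain rfl : M = _ := funext hM
  exact Subtype.ext (multiplier_fullExp hg hb f)

theorem antipodal_mul_expNeg_sq :
    (antipodalOperator * expNegHamiltonian NNReal.pi) ^ 2 = expNegHamiltonian (2 * NNReal.pi) := by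
  ext1 ψ
  apply Subtype.ext
  ext1
  rw [sq]
  change ((antipodalOperator (expNegHamiltonian NNReal.pi
      (antipodalOperator (expNegHamiltonian NNReal.pi ψ))) : Fock) : Lp ℂ 2 configMeasure)
    =ᵐ[configMeasure] _
  filter_upwards [coeFn_antipodalOperator (expNegHamiltonian NNReal.pi
      (antipodalOperator (expNegHamiltonian NNReal.pi ψ))),
    coeFn_expNegHamiltonian NNReal.pi (antipodalOperator (expNegHamiltonian NNReal.pi ψ)),
    coeFn_antipodalOperator (expNegHamiltonian NNReal.pi ψ),
    coeFn_expNegHamiltonian NNReal.pi ψ, coeFn_expNegHamiltonian (2 * NNReal.pi) ψ]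
    with y h0 h1 h2 h3 h4
  rw [h0, h1, h2, h3, h4]
  have e1 : ((-1 : ℂ) ^ angularOf y) * (-1) ^ angularOf y = 1 := by
    rw [← mul_pow]; simp
  have e2 : Complex.exp (-((2 * NNReal.pi : ℝ≥0) : ℂ) * energyOf y) =
      Complex.exp (-NNReal.pi * energyOf y) * Complex.exp (-NNReal.pi * energyOf y) := by
    rw [← Complex.exp_add]
    congr 1
    push_cast
    ring
  rw [e2]
  linear_combination (Complex.exp (-NNReal.pi * energyOf y) ^ 2 *
    (ψ : Lp ℂ 2 configMeasure) y) * e1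

theorem expNegHamiltonian_eq_thermal :
    expNegHamiltonian (2 * NNReal.pi) = thermalOperator (1 / (2 * NNReal.pi)) := by
  unfold thermalOperator
  rw [one_div, inv_inv]

/-! ### Parity of the spherical harmonics -/

theorem legendre_comp_neg (l : ℕ) :
    (legendre l).comp (-Polynomial.X) = Polynomial.C ((-1) ^ l) * legendre l := by
  unfold legendre
  have h : ∀ (n : ℕ) (p : Polynomial ℝ), (Polynomial.derivative^[n] p).comp (-Polynomial.X) =
      (-1) ^ n * Polynomial.derivative^[n] (p.comp (-Polynomial.X)) := by
    intro n
    induction n with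
    | zero => intro p; simp
    | succ n ih =>
      intro p
      rw [Function.iterate_succ_apply, ih, Function.iterate_succ_apply, Polynomial.derivative_comp]
      have : -Polynomial.derivative (Polynomial.X : Polynomial ℝ) = (-1 : Polynomial ℝ) := by simp
      rw [Polynomial.derivative_neg, this]
      have e : (-1 : Polynomial ℝ) * (Polynomial.derivative p).comp (-Polynomial.X) =
        Polynomial.C (-1 : ℝ) * (Polynomial.derivative p).comp (-Polynomial.X) := by simp
      rw [e, Polynomial.iterate_derivative_C_mul]
      simp [pow_succ]
  simp only [Polynomial.mul_comp, Polynomial.C_comp, h, Polynomial.pow_comp, Polynomial.sub_comp,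
    Polynomial.X_comp, Polynomial.one_comp, neg_sq, map_pow, map_neg, map_one]
  ring

theorem eval_neg_iterate_derivative_legendre (l k : ℕ) (x : ℝ) :
    (Polynomial.derivative^[k] (legendre l)).eval (-x) =
      (-1) ^ (l + k) * (Polynomial.derivative^[k] (legendre l)).eval x := by
  have h : ∀ (n : ℕ), (Polynomial.derivative^[n] (legendre l)).comp (-Polynomial.X) =
      Polynomial.C ((-1) ^ (l + n)) * Polynomial.derivative^[n] (legendre l) := by
    intro n
    induction n with
    | zero => simpa using legendre_comp_neg l
    | succ n ih =>
      have := congrArg Polynomial.derivative ih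
      rw [Polynomial.derivative_comp, Polynomial.derivative_C_mul] at this
      rw [Function.iterate_succ_apply']
      simp only [Polynomial.derivative_neg, Polynomial.derivative_X] at this
      rw [← add_assoc, pow_succ, mul_neg_one, map_neg, neg_mul, ← this]
      ring
  have := congrArg (Polynomial.eval x) (h k)
  simpa [Polynomial.eval_comp] using this

theorem sphericalHarmonic_antipode (l : ℕ) (m : ℤ) (θ φ : ℝ) :
    sphericalHarmonic l m (Real.pi - θ) (φ + Real.pi) = (-1) ^ l * sphericalHarmonic l m θ φ := by
  unfold sphericalHarmonic
  rw [Real.sin_pi_sub, Real.cos_pi_sub, eval_neg_iterate_derivative_legendre]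
  have e : Complex.exp (Complex.I * m * ((φ + Real.pi : ℝ) : ℂ)) =
      (-1) ^ m.natAbs * Complex.exp (Complex.I * m * φ) := by
    have : Complex.I * m * ((φ + Real.pi : ℝ) : ℂ) =
        m * (Real.pi * Complex.I) + Complex.I * m * φ := by push_cast; ring
    rw [this, Complex.exp_add, Complex.exp_int_mul, Complex.exp_pi_mul_I]
    congr 1
    rcases Int.natAbs_eq m with h | h
    · conv_lhs => rw [h]
      rw [zpow_natCast]
    · conv_lhs => rw [h]
      rw [zpow_neg, zpow_natCast]
      rcases Nat.even_or_odd m.natAbs with h' | h' <;> simp [h']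
  rw [e]
  have e2 : ((-1 : ℂ) ^ (l + m.natAbs)) * (-1) ^ m.natAbs = (-1) ^ l := by
    rw [pow_add, mul_assoc, ← mul_pow]; simp
  push_cast
  rw [← e2]
  ring

/-! ### Permutation symmetry of Fock vectors and second-quantized sums -/

/-- The permutation `σ n` of the entries in each `n`-particle sector. -/
def permConfig (σ : ∀ n, Equiv.Perm (Fin n)) (y : Config) : Config := ⟨y.1, y.2 ∘ σ y.1⟩

theorem measurePreserving_permFin {n : ℕ} (σ : Equiv.Perm (Fin n)) :
    MeasurePreserving (fun x : Fin n → Mode => x ∘ σ) (Measure.pi fun _ => modeMeasure)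
      (Measure.pi fun _ => modeMeasure) := by
  have h := measurePreserving_piCongrLeft (fun _ : Fin n => modeMeasure) σ.symm
  convert! h using 1
  ext1 x
  ext1 i
  obtain ⟨j, rfl⟩ := σ.symm.surjective i
  rw [MeasurableEquiv.coe_piCongrLeft, Equiv.piCongrLeft_apply_apply]
  simp

theorem measurePreserving_permConfig (σ : ∀ n, Equiv.Perm (Fin n)) :
    MeasurePreserving (permConfig σ) configMeasure configMeasure := by
  have hm : Measurable (permConfig σ) := measurable_config fun n =>
    (measurable_sigma_mk n).comp (measurePreserving_permFin (σ n)).measurable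
  refine ⟨hm, ?_⟩
  unfold configMeasure
  rw [Measure.map_sum hm.aemeasurable]
  congr 1
  ext1 n
  rw [Measure.map_map hm (measurable_sigma_mk n)]
  change Measure.map ((fun z : Fin n → Mode => (⟨n, z⟩ : Config)) ∘
    fun x : Fin n → Mode => x ∘ σ n) _ = _
  rw [← Measure.map_map (measurable_sigma_mk n)
    (measurePreserving_permFin (σ n)).measurable, (measurePreserving_permFin (σ n)).map_eq]

theorem expFun_permConfig (σ : ∀ n, Equiv.Perm (Fin n)) (f : Mode → ℂ) (y : Config) :
    expFun f (permConfig σ y) = expFun f y := by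
  unfold expFun permConfig
  congr 1
  exact Equiv.prod_comp (σ y.1) fun i => f (y.2 i)

/-- Fock vectors are symmetric functions: this closed condition holds for the exponential vectors. -/
theorem fock_perm_invariant (σ : ∀ n, Equiv.Perm (Fin n)) (ψ : Fock) :
    (fun y => (ψ : Lp ℂ 2 configMeasure) (permConfig σ y)) =ᵐ[configMeasure]
      (ψ : Lp ℂ 2 configMeasure) := by
  set T := Lp.compMeasurePreservingₗᵢ ℂ (E := ℂ) (p := 2) (permConfig σ)
    (measurePreserving_permConfig σ) with hT
  have hcl : IsClosed (LinearMap.eqLocus T.toLinearMap LinearMap.id : Set (Lp ℂ 2 configMeasure)) :=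
    isClosed_eq T.continuous continuous_id
  have hle : fock ≤ LinearMap.eqLocus T.toLinearMap LinearMap.id := by
    refine Submodule.topologicalClosure_minimal _ (Submodule.span_le.2 ?_) hcl
    rintro _ ⟨f, rfl⟩
    change Lp.compMeasurePreserving (permConfig σ) (measurePreserving_permConfig σ) (fullExp f)
      = fullExp f
    ext1
    have h1 := Lp.coeFn_compMeasurePreserving (fullExp f) (measurePreserving_permConfig σ)
    have h2 := (memLp_expFun f).coeFn_toLp
    filter_upwards [h1, h2, (measurePreserving_permConfig σ).quasiMeasurePreserving.ae h2]
      with y a b c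
    rw [a]
    change (fullExp f) (permConfig σ y) = fullExp f y
    unfold fullExp
    rw [b, c, expFun_permConfig]
  have h := hle ψ.2
  change Lp.compMeasurePreserving (permConfig σ) (measurePreserving_permConfig σ) ψ.1 = ψ.1 at h
  have h1 := Lp.coeFn_compMeasurePreserving ψ.1 (measurePreserving_permConfig σ)
  rw [h] at h1
  exact h1.symm

theorem lintegral_config {F : Config → ℝ≥0∞} (hF : Measurable F) :
    ∫⁻ y, F y ∂configMeasure =
      ∑' n, ∫⁻ x : Fin n → Mode, F ⟨n, x⟩ ∂(Measure.pi fun _ => modeMeasure) := by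
  unfold configMeasure
  rw [lintegral_sum_measure]
  congr 1
  ext1 n
  rw [lintegral_map hF (measurable_sigma_mk n)]

theorem ae_config' {p : Config → Prop} (h : ∀ᵐ y ∂configMeasure, p y) (n : ℕ) :
    ∀ᵐ x : Fin n → Mode ∂(Measure.pi fun _ : Fin n => modeMeasure), p ⟨n, x⟩ := by
  unfold configMeasure at h
  exact ae_of_ae_map (measurable_sigma_mk n).aemeasurable
    (Measure.ae_sum_iff.1 h n)

theorem lintegral_coord_eq_zero_coord (ψ : Fock) {v : Mode → ℝ≥0∞} (hv : Measurable v) {n : ℕ}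
    (i : Fin (n + 1)) :
    ∫⁻ x : Fin (n + 1) → Mode, v (x i) * ‖(ψ : Lp ℂ 2 configMeasure) ⟨n + 1, x⟩‖ₑ ^ 2
        ∂(Measure.pi fun _ => modeMeasure) =
      ∫⁻ x : Fin (n + 1) → Mode, v (x 0) * ‖(ψ : Lp ℂ 2 configMeasure) ⟨n + 1, x⟩‖ₑ ^ 2
        ∂(Measure.pi fun _ => modeMeasure) := by
  have hψ : Measurable fun x : Fin (n + 1) → Mode => (ψ : Lp ℂ 2 configMeasure) ⟨n + 1, x⟩ :=
    (Lp.stronglyMeasurable ψ.1).measurable.comp (measurable_sigma_mk _)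
  set σ : ∀ k, Equiv.Perm (Fin k) := fun k =>
    if h : i.1 < k then Equiv.swap ⟨0, (Nat.zero_le _).trans_lt h⟩ ⟨i.1, h⟩ else 1 with hσ
  have hs : σ (n + 1) = Equiv.swap 0 i := by
    simp [hσ, i.2, -Fin.mk_zero']
  have hp := measurePreserving_permFin (σ (n + 1))
  rw [← hp.lintegral_comp (f := fun x => v (x i) * ‖(ψ : Lp ℂ 2 configMeasure) ⟨n + 1, x⟩‖ₑ ^ 2)
    (((hv.comp (measurable_pi_apply i))).mul (hψ.enorm.pow_const 2))]
  refine lintegral_congr_ae ?_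
  filter_upwards [ae_config' (fock_perm_invariant σ ψ) (n + 1)] with x hx
  change v (x (σ (n + 1) i)) * ‖(ψ : Lp ℂ 2 configMeasure) (permConfig σ ⟨n + 1, x⟩)‖ₑ ^ 2 = _
  rw [hx, hs, Equiv.swap_apply_right]

theorem measurable_sector (ψ : Fock) (n : ℕ) :
    Measurable fun x : Fin n → Mode => (ψ : Lp ℂ 2 configMeasure) ⟨n, x⟩ :=
  (Lp.stronglyMeasurable ψ.1).measurable.comp (measurable_sigma_mk _)

theorem measurable_sector_cons (ψ : Fock) (n : ℕ) :
    Measurable fun p : Mode × (Fin n → Mode) =>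
      (ψ : Lp ℂ 2 configMeasure) ⟨n + 1, Fin.cons p.1 p.2⟩ := by
  have h := (measurable_sector ψ (n + 1)).comp
    (MeasurableEquiv.piFinSuccAbove (fun _ : Fin (n + 1) => Mode) 0).symm.measurable
  convert! h using 1
  ext1 p
  simp [MeasurableEquiv.piFinSuccAbove, Fin.insertNthEquiv]

/-- The squared norm of the annihilated vector, sector by sector. -/
theorem lintegral_annihilate (ψ : Fock) (x : Mode) :
    ∫⁻ y, ‖annihilate x (ψ : Lp ℂ 2 configMeasure) y‖ₑ ^ 2 ∂configMeasure =
      ∑' n : ℕ, ∫⁻ z : Fin n → Mode, (n + 1) *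
        ‖(ψ : Lp ℂ 2 configMeasure) ⟨n + 1, Fin.cons x z⟩‖ₑ ^ 2
          ∂(Measure.pi fun _ => modeMeasure) := by
  have hm : Measurable (annihilate x (ψ : Lp ℂ 2 configMeasure)) := by
    refine measurable_config fun n => ?_
    have := ((measurable_sector_cons ψ n).comp (measurable_prodMk_left (x := x))).const_mul
      ((Real.sqrt (n + 1) : ℝ) : ℂ)
    exact this
  rw [lintegral_config (hm.enorm.pow_const 2)]
  congr 1
  ext1 n
  refine lintegral_congr fun z => ?_
  unfold annihilate
  rw [enorm_mul, mul_pow]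
  congr 1
  rw [← ofReal_norm, ← ENNReal.ofReal_pow (norm_nonneg _), Complex.norm_real,
    Real.norm_of_nonneg (Real.sqrt_nonneg _), Real.sq_sqrt (by positivity)]
  rw [ENNReal.ofReal_add (by positivity) (by positivity)]
  simp

/-- In the `(n+1)`-particle sector, a sum over the particles is `n + 1` times the contribution of
the first one. -/
theorem lintegral_sector_sum (ψ : Fock) {v : Mode → ℝ≥0∞} (hv : Measurable v) (n : ℕ) :
    ∫⁻ x : Fin (n + 1) → Mode, (∑ i, v (x i)) * ‖(ψ : Lp ℂ 2 configMeasure) ⟨n + 1, x⟩‖ₑ ^ 2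
        ∂(Measure.pi fun _ => modeMeasure) =
      ∫⁻ x, v x * ∫⁻ z : Fin n → Mode, (n + 1) *
        ‖(ψ : Lp ℂ 2 configMeasure) ⟨n + 1, Fin.cons x z⟩‖ₑ ^ 2
          ∂(Measure.pi fun _ => modeMeasure) ∂modeMeasure := by
  have hψ := measurable_sector ψ (n + 1)
  have hc := measurable_sector_cons ψ n
  have hFi : ∀ i, Measurable fun x : Fin (n + 1) → Mode =>
      v (x i) * ‖(ψ : Lp ℂ 2 configMeasure) ⟨n + 1, x⟩‖ₑ ^ 2 := fun i =>
    (hv.comp (measurable_pi_apply i)).mul (hψ.enorm.pow_const 2)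
  have hF := hFi 0
  simp_rw [Finset.sum_mul]
  rw [lintegral_finsetSum _ fun i _ => hFi i]
  rw [Finset.sum_congr rfl fun i _ => lintegral_coord_eq_zero_coord ψ hv i]
  rw [Finset.sum_const, Finset.card_univ, Fintype.card_fin, nsmul_eq_mul]
  have hmp := (measurePreserving_piFinSuccAbove (fun _ : Fin (n + 1) => modeMeasure) 0).symm
  have e : ∀ p : Mode × (Fin n → Mode),
      (MeasurableEquiv.piFinSuccAbove (fun _ : Fin (n + 1) => Mode) 0).symm p =
      Fin.cons p.1 p.2 := by
    intro p
    simp [MeasurableEquiv.piFinSuccAbove, Fin.insertNthEquiv]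
  have hF2 : Measurable fun p : Mode × (Fin n → Mode) =>
      v p.1 * ‖(ψ : Lp ℂ 2 configMeasure) ⟨n + 1, Fin.cons p.1 p.2⟩‖ₑ ^ 2 :=
    (hv.comp measurable_fst).mul (hc.enorm.pow_const 2)
  rw [← hmp.lintegral_comp hF]
  simp_rw [e, Fin.cons_zero]
  rw [lintegral_prod _ hF2.aemeasurable, ← lintegral_const_mul _ hF2.lintegral_prod_right']
  refine lintegral_congr fun x => ?_
  have hc2 : Measurable fun z : Fin n → Mode =>
      ‖(ψ : Lp ℂ 2 configMeasure) ⟨n + 1, Fin.cons x z⟩‖ₑ ^ 2 :=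
    (hc.comp (measurable_prodMk_left (x := x))).enorm.pow_const 2
  dsimp only
  rw [lintegral_const_mul _ hc2, lintegral_const_mul _ hc2]
  push_cast
  ring

theorem tsum_eq_tsum_succ_of_zero {f : ℕ → ℝ≥0∞} (h : f 0 = 0) :
    ∑' n, f n = ∑' n, f (n + 1) := by
  rw [tsum_eq_zero_add' ENNReal.summable, h, zero_add]

/-- A function on configurations that adds up a weight over the particles is the second
quantization of that weight, `∫ w(x) a†(x) a(x) dx`, as a quadratic form. -/
theorem isModeSum_of_sum {w : Mode → ℝ} (hw : Measurable w) (hw0 : ∀ᵐ x ∂modeMeasure, 0 ≤ w x)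
    {E : Config → ℝ} (hE : ∀ y, E y = ∑ i, w (y.2 i)) : IsModeSum w E := by
  intro ψ
  have hv : Measurable fun x => ENNReal.ofReal (w x) := hw.ennreal_ofReal
  have hsum : ∀ᵐ y ∂configMeasure, ENNReal.ofReal (E y) *
      ‖(ψ : Lp ℂ 2 configMeasure) y‖ₑ ^ 2 =
      (∑ i, ENNReal.ofReal (w (y.2 i))) * ‖(ψ : Lp ℂ 2 configMeasure) y‖ₑ ^ 2 := by
    filter_upwards [ae_config_of_ae hw0] with y hy
    rw [hE, ENNReal.ofReal_sum_of_nonneg fun i _ => hy i]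
  have hEm : Measurable fun y : Config => ∑ i, ENNReal.ofReal (w (y.2 i)) :=
    measurable_config fun n => by
      have : Measurable fun x : Fin n → Mode => ∑ i, ENNReal.ofReal (w (x i)) :=
        Finset.measurable_sum _ fun i _ => hv.comp (measurable_pi_apply i)
      exact this
  have hF : Measurable fun y : Config => (∑ i, ENNReal.ofReal (w (y.2 i))) *
      ‖(ψ : Lp ℂ 2 configMeasure) y‖ₑ ^ 2 :=
    hEm.mul ((Lp.stronglyMeasurable ψ.1).measurable.enorm.pow_const 2)
  obtain ⟨S, hS⟩ : ∃ S : ℕ → ℝ≥0∞, ∀ n, S n = ∫⁻ x : Fin n → Mode,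
      (∑ i, ENNReal.ofReal (w (x i))) * ‖(ψ : Lp ℂ 2 configMeasure) ⟨n, x⟩‖ₑ ^ 2
        ∂(Measure.pi fun _ => modeMeasure) := ⟨_, fun _ => rfl⟩
  have h0 : S 0 = 0 := by
    rw [hS]
    simp only [Finset.univ_eq_empty, Finset.sum_empty, zero_mul, lintegral_zero]
  have hm : ∀ n : ℕ, Measurable fun x : Mode => ENNReal.ofReal (w x) *
      ∫⁻ z : Fin n → Mode, (n + 1) *
        ‖(ψ : Lp ℂ 2 configMeasure) ⟨n + 1, Fin.cons x z⟩‖ₑ ^ 2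
          ∂(Measure.pi fun _ => modeMeasure) := fun n =>
    hv.mul (((measurable_sector_cons ψ n).enorm.pow_const 2).const_mul
      ((n : ℝ≥0∞) + 1)).lintegral_prod_right'
  have h1 : ∫⁻ y, (∑ i, ENNReal.ofReal (w (y.2 i))) * ‖(ψ : Lp ℂ 2 configMeasure) y‖ₑ ^ 2
      ∂configMeasure = ∑' n, S n := by
    rw [lintegral_config hF]
    exact tsum_congr fun n => (hS n).symm
  have h2 : ∀ n, S (n + 1) = ∫⁻ x, ENNReal.ofReal (w x) * ∫⁻ z : Fin n → Mode, (n + 1) *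
        ‖(ψ : Lp ℂ 2 configMeasure) ⟨n + 1, Fin.cons x z⟩‖ₑ ^ 2
          ∂(Measure.pi fun _ => modeMeasure) ∂modeMeasure := fun n => by
    rw [hS]
    exact lintegral_sector_sum ψ hv n
  rw [lintegral_congr_ae hsum, h1, tsum_eq_tsum_succ_of_zero h0]
  simp_rw [h2]
  rw [← lintegral_tsum fun n => (hm n).aemeasurable]
  refine lintegral_congr fun x => ?_
  rw [lintegral_annihilate, ENNReal.tsum_mul_left]

theorem isModeSum_energyOf : IsModeSum (fun x => x.1) energyOf :=
  isModeSum_of_sum measurable_fst (ae_freq_pos.mono fun _ h => h.le) fun _ => rfl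

theorem isModeSum_angularOf :
    IsModeSum (fun x => (x.2.1 : ℝ)) (fun y => (angularOf y : ℝ)) :=
  isModeSum_of_sum ((measurable_angLabel fun a => (a.1 : ℝ)).comp measurable_snd)
    (ae_of_all _ fun x => Nat.cast_nonneg _) fun y => by simp [angularOf]

/-! ### Exponential vectors and the Weyl system -/

/-- The inner product of Fock space, as that of an inner product space. -/
instance instInnerFock : Inner ℂ Fock := InnerProductSpace.toInner

theorem hasSum_integral_config {F : Config → ℂ} (hF : Integrable F configMeasure) :
    HasSum (fun n => ∫ x : Fin n → Mode, F ⟨n, x⟩ ∂(Measure.pi fun _ => modeMeasure))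
      (∫ y, F y ∂configMeasure) := by
  have h := hasSum_integral_measure (μ := fun n : ℕ =>
    (Measure.pi fun _ : Fin n => modeMeasure).map
      (fun x : Fin n → Mode => (⟨n, x⟩ : Config))) (f := F) hF
  refine h.congr_fun ?_
  intro n
  have hi : Integrable F ((Measure.pi fun _ : Fin n => modeMeasure).map
      (fun x : Fin n → Mode => (⟨n, x⟩ : Config))) :=
    hF.mono_measure (Measure.le_sum (fun n : ℕ => (Measure.pi fun _ : Fin n => modeMeasure).map
      (fun x : Fin n → Mode => (⟨n, x⟩ : Config))) n)
  rw [integral_map (measurable_sigma_mk n).aemeasurable hi.1]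

/-- Summing the sectors gives the exponential series of the one-particle inner product. -/
theorem inner_fullExp (f g : OneParticle) :
    inner ℂ (fullExp f) (fullExp g) = Complex.exp (inner ℂ f g) := by
  rw [L2.inner_def]
  have hint := L2.integrable_inner (𝕜 := ℂ) (fullExp f) (fullExp g)
  have hcongr : (fun y => inner ℂ (fullExp f y) (fullExp g y)) =ᵐ[configMeasure]
      fun y => conj (expFun f y) * expFun g y := by
    filter_upwards [(memLp_expFun f).coeFn_toLp, (memLp_expFun g).coeFn_toLp] with y h1 h2
    unfold fullExp
    rw [h1, h2, RCLike.inner_apply']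
  rw [integral_congr_ae hcongr]
  have h := hasSum_integral_config (hint.congr hcongr)
  have h2 : HasSum (fun n : ℕ => ((n.factorial : ℂ))⁻¹ * (inner ℂ f g) ^ n)
      (Complex.exp (inner ℂ f g)) := by
    have := NormedSpace.expSeries_div_hasSum_exp (𝔸 := ℂ) (inner ℂ f g)
    rw [← Complex.exp_eq_exp_ℂ] at this
    convert! this using 2 with n
    rw [div_eq_inv_mul]
  refine (h.congr_fun ?_).unique h2
  intro n
  have e : ∀ x : Fin n → Mode, conj (expFun f ⟨n, x⟩) * expFun g ⟨n, x⟩ =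
      ((n.factorial : ℂ))⁻¹ * ∏ i, conj (f (x i)) * g (x i) := by
    intro x
    unfold expFun
    have hs : ((Real.sqrt n.factorial : ℝ) : ℂ) * ((Real.sqrt n.factorial : ℝ) : ℂ) =
        n.factorial := by
      rw [← Complex.ofReal_mul, Real.mul_self_sqrt (by positivity)]
      simp
    rw [map_mul, map_prod, map_inv₀, Complex.conj_ofReal, Finset.prod_mul_distrib, ← hs, mul_inv]
    ring
  simp_rw [e]
  rw [integral_const_mul, integral_fintype_prod_eq_pow (fun x => conj (f x) * g x),
    Fintype.card_fin, L2.inner_def]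
  simp_rw [RCLike.inner_apply']

theorem inner_expVec (f g : OneParticle) :
    inner ℂ (expVec f) (expVec g) = Complex.exp (inner ℂ f g) := inner_fullExp f g

/-- Finite linear combinations of exponential vectors. -/
def expComb : (OneParticle →₀ ℂ) →ₗ[ℂ] Fock := Finsupp.linearCombination ℂ expVec

theorem denseRange_expComb : DenseRange expComb := by
  intro ψ
  rw [closure_subtype]
  have h := ψ.2
  refine closure_mono ?_ h
  intro v hv
  have : Submodule.span ℂ (Set.range fullExp) ≤ (LinearMap.range expComb).map fock.subtype := by
    rw [Submodule.span_le]
    rintro _ ⟨f, rfl⟩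
    exact ⟨expVec f, ⟨Finsupp.single f 1, by simp [expComb]⟩, rfl⟩
  obtain ⟨w, ⟨x, rfl⟩, rfl⟩ := this hv
  exact ⟨expComb x, ⟨x, rfl⟩, rfl⟩

/-- Two bounded operators on Fock space agree if they agree on exponential vectors. -/
theorem ext_expVec {A B : Fock →L[ℂ] Fock} (h : ∀ f, A (expVec f) = B (expVec f)) : A = B := by
  have h2 : ∀ x, A (expComb x) = B (expComb x) := by
    intro x
    unfold expComb
    simp only [Finsupp.linearCombination_apply, Finsupp.sum, map_sum, map_smul, h]
  ext1 ψ
  exact congrFun (denseRange_expComb.equalizer A.continuous B.continuous (funext h2)) ψ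

theorem ext_inner_expVec {ψ φ : Fock} (h : ∀ f, inner ℂ (expVec f) ψ = inner ℂ (expVec f) φ) :
    ψ = φ := by
  have h2 : ∀ x, inner ℂ (expComb x) ψ = inner ℂ (expComb x) φ := by
    intro x
    unfold expComb
    simp only [Finsupp.linearCombination_apply, Finsupp.sum, sum_inner, inner_smul_left, h]
  refine ext_inner_left ℂ fun v => ?_
  have h3 := denseRange_expComb.equalizer (g := fun v => inner ℂ v ψ)
    (h := fun v => inner ℂ v φ) (by fun_prop) (by fun_prop) (funext h2)
  exact congrFun h3 v

theorem continuous_expVec : Continuous expVec := by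
  rw [continuous_iff_continuousAt]
  intro f
  rw [ContinuousAt, tendsto_iff_norm_sub_tendsto_zero]
  have h : ∀ g, ‖expVec g - expVec f‖ ^ 2 = (Complex.exp (inner ℂ g g)).re -
      2 * (Complex.exp (inner ℂ g f)).re + (Complex.exp (inner ℂ f f)).re := by
    intro g
    rw [@norm_sub_sq ℂ, ← inner_expVec, ← inner_expVec, ← inner_expVec]
    rw [inner_self_eq_norm_sq_to_K, inner_self_eq_norm_sq_to_K]
    norm_cast
  have hc : Continuous fun g : OneParticle => (Complex.exp (inner ℂ g g)).re -
      2 * (Complex.exp (inner ℂ g f)).re + (Complex.exp (inner ℂ f f)).re := by fun_prop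
  have h0 := hc.tendsto f
  simp_rw [← h] at h0
  have h1 := h0.sqrt
  simpa using h1

/-- The action of the Weyl operator of `f` on finite combinations of exponential vectors. -/
def weylComb (f : OneParticle) : (OneParticle →₀ ℂ) →ₗ[ℂ] Fock :=
  Finsupp.linearCombination ℂ fun g =>
    Complex.exp (-(‖f‖ ^ 2 : ℝ) / 2 - inner ℂ f g) • expVec (f + g)

theorem inner_weyl_expVec (f g h : OneParticle) :
    inner ℂ (Complex.exp (-(‖f‖ ^ 2 : ℝ) / 2 - inner ℂ f g) • expVec (f + g))
      (Complex.exp (-(‖f‖ ^ 2 : ℝ) / 2 - inner ℂ f h) • expVec (f + h)) =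
    inner ℂ (expVec g) (expVec h) := by
  rw [inner_smul_left (E := Fock), inner_smul_right (E := Fock), inner_expVec, inner_expVec, ← Complex.exp_conj,
    ← Complex.exp_add, ← Complex.exp_add]
  congr 1
  simp only [inner_add_left, inner_add_right, map_sub, map_div₀, map_neg, Complex.conj_ofReal,
    map_ofNat, inner_conj_symm]
  rw [inner_self_eq_norm_sq_to_K]
  push_cast
  simp only [Complex.coe_algebraMap]
  ring

theorem norm_weylComb (f : OneParticle) (x : OneParticle →₀ ℂ) : ‖weylComb f x‖ = ‖expComb x‖ := by
  have h : inner ℂ (weylComb f x) (weylComb f x) = inner ℂ (expComb x) (expComb x) := by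
    unfold weylComb expComb
    simp only [Finsupp.linearCombination_apply, Finsupp.sum, sum_inner, inner_sum]
    refine Finset.sum_congr rfl fun i _ => Finset.sum_congr rfl fun j _ => ?_
    rw [inner_smul_left, inner_smul_right, inner_weyl_expVec, inner_smul_left, inner_smul_right]
  rw [inner_self_eq_norm_sq_to_K, inner_self_eq_norm_sq_to_K] at h
  have h' : ‖weylComb f x‖ ^ 2 = ‖expComb x‖ ^ 2 := by exact_mod_cast h
  exact (sq_eq_sq₀ (norm_nonneg _) (norm_nonneg _)).1 h'

/-- The Weyl operator of `f`. -/
def weylOp (f : OneParticle) : Fock →L[ℂ] Fock := (weylComb f).extendOfNorm expComb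

theorem weylOp_expComb (f : OneParticle) (x : OneParticle →₀ ℂ) :
    weylOp f (expComb x) = weylComb f x :=
  LinearMap.extendOfNorm_eq denseRange_expComb ⟨1, fun x => by rw [norm_weylComb, one_mul]⟩ x

theorem isWeylSystem_weylOp : IsWeylSystem weylOp := by
  intro f g
  have h := weylOp_expComb f (Finsupp.single g 1)
  simpa [expComb, weylComb] using h

/-- The action on exponential vectors determines a Weyl system, since these are total. -/
theorem IsWeylSystem.eq {D D' : OneParticle → Fock →L[ℂ] Fock} (h : IsWeylSystem D)
    (h' : IsWeylSystem D') : D' = D := by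
  ext1 f
  exact ext_expVec fun g => by rw [h f g, h' f g]

theorem norm_weylOp_le (f : OneParticle) (ψ : Fock) : ‖weylOp f ψ‖ ≤ ‖ψ‖ := by
  have h := LinearMap.norm_extendOfNorm_apply_le (f := weylComb f) denseRange_expComb 1
    (fun x => by rw [norm_weylComb, one_mul]) ψ
  rwa [one_mul] at h

/-- Strong continuity of the Weyl system. -/
theorem continuous_weylOp (ψ : Fock) : Continuous fun f => weylOp f ψ := by
  have h0 : ∀ x, Continuous fun f => weylOp f (expComb x) := by
    intro x
    simp_rw [weylOp_expComb]
    unfold weylComb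
    simp only [Finsupp.linearCombination_apply, Finsupp.sum]
    refine continuous_finsetSum _ fun g _ => ?_
    have := continuous_expVec
    fun_prop
  rw [Metric.continuous_iff]
  intro f ε hε
  -- the operators are contractions, so continuity on a dense subspace suffices
  obtain ⟨x, hx⟩ := denseRange_expComb.exists_dist_lt ψ (show 0 < ε / 3 by positivity)
  obtain ⟨δ, hδ, H⟩ := Metric.continuous_iff.1 (h0 x) f (ε / 3) (by positivity)
  refine ⟨δ, hδ, fun g hg => ?_⟩
  have h1 : ∀ g, dist (weylOp g ψ) (weylOp g (expComb x)) < ε / 3 := by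
    intro g
    rw [dist_eq_norm, ← map_sub]
    exact (norm_weylOp_le _ _).trans_lt (by rwa [← dist_eq_norm])
  calc dist (weylOp g ψ) (weylOp f ψ) ≤ dist (weylOp g ψ) (weylOp g (expComb x)) +
        dist (weylOp g (expComb x)) (weylOp f (expComb x)) +
        dist (weylOp f (expComb x)) (weylOp f ψ) := dist_triangle4 _ _ _ _
    _ < ε / 3 + ε / 3 + ε / 3 := by
      have := h1 f
      rw [dist_comm] at this
      gcongr
      · exact h1 g
      · exact H g hg
    _ = ε := by ring

/-! ### Complex Gaussian integrals -/

/-- `z ↦ p z + q z̄` is an arbitrary real-linear source, with `p` and `q` independent. -/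
theorem integral_complex_gaussian {b : ℝ} (hb : 0 < b) (p q : ℂ) :
    ∫ z : ℂ, Complex.exp (-b * (‖z‖ ^ 2 : ℝ) + p * z + q * conj z) =
      Real.pi / b * Complex.exp (p * q / b) := by
  rw [← Complex.volume_preserving_equiv_real_prod.symm.integral_comp
    Complex.measurableEquivRealProd.symm.measurableEmbedding]
  have e : ∀ x : ℝ × ℝ, Complex.exp (-b * (‖Complex.measurableEquivRealProd.symm x‖ ^ 2 : ℝ) +
      p * Complex.measurableEquivRealProd.symm x + q * conj (Complex.measurableEquivRealProd.symm x))
      = Complex.exp ((-b : ℂ) * x.1 ^ 2 + (p + q) * x.1 + 0) *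
        Complex.exp ((-b : ℂ) * x.2 ^ 2 + (Complex.I * (p - q)) * x.2 + 0) := by
    intro x
    rw [← Complex.exp_add]
    congr 1
    have h1 : Complex.measurableEquivRealProd.symm x = x.1 + x.2 * Complex.I := by
      apply Complex.ext <;> simp
    rw [h1, Complex.sq_norm, Complex.normSq_add_mul_I]
    simp only [map_add, map_mul, Complex.conj_ofReal, Complex.conj_I]
    push_cast
    ring
  simp_rw [e]
  have hre : ((-b : ℂ)).re < 0 := by simpa using hb
  rw [Measure.volume_eq_prod, integral_prod_mul
    (fun x : ℝ => Complex.exp ((-b : ℂ) * x ^ 2 + (p + q) * x + 0))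
    (fun x : ℝ => Complex.exp ((-b : ℂ) * x ^ 2 + (Complex.I * (p - q)) * x + 0)), integral_cexp_quadratic hre,
    integral_cexp_quadratic hre]
  have hb' : (b : ℂ) ≠ 0 := by exact_mod_cast hb.ne'
  have h2 : (Real.pi / - -(b : ℂ)) ^ (1 / 2 : ℂ) * (Real.pi / - -(b : ℂ)) ^ (1 / 2 : ℂ) =
      Real.pi / b := by
    rw [neg_neg, ← Complex.cpow_add _ _ (by
      exact div_ne_zero (by exact_mod_cast Real.pi_ne_zero) hb')]
    norm_num
  rw [mul_mul_mul_comm, h2, ← Complex.exp_add]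
  congr 2
  field_simp
  ring_nf
  rw [Complex.I_sq]
  ring

theorem integral_pi_complex_gaussian {ι : Type*} [Fintype ι] {b : ι → ℝ} (hb : ∀ i, 0 < b i)
    (p q : ι → ℂ) :
    ∫ z : ι → ℂ, Complex.exp (∑ i, (-b i * (‖z i‖ ^ 2 : ℝ) + p i * z i + q i * conj (z i))) =
      (∏ i, (Real.pi / b i : ℂ)) * Complex.exp (∑ i, p i * q i / b i) := by
  simp_rw [Complex.exp_sum]
  rw [integral_fintype_prod_volume_eq_prod
    (f := fun i z => Complex.exp (-b i * (‖z‖ ^ 2 : ℝ) + p i * z + q i * conj z)),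
    ← Finset.prod_mul_distrib]
  exact Finset.prod_congr rfl fun i _ => integral_complex_gaussian (hb i) _ _

theorem integrable_complex_gaussian {b : ℝ} (hb : 0 < b) :
    Integrable fun z : ℂ => Real.exp (-b * ‖z‖ ^ 2) := by
  have h := (GaussianFourier.integrable_cexp_neg_mul_sq_norm_add (V := ℂ) (b := b)
    (by simpa using hb) 0 0).norm
  refine h.congr (ae_of_all _ fun z => ?_)
  simp only [zero_mul, add_zero, Complex.norm_exp]
  norm_cast

theorem integrable_pi_complex_gaussian {ι : Type*} [Fintype ι] {b : ι → ℝ} (hb : ∀ i, 0 < b i) :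
    Integrable fun z : ι → ℂ => Real.exp (∑ i, -b i * ‖z i‖ ^ 2) := by
  simp_rw [Real.exp_sum]
  exact Integrable.fintype_prod fun i => integrable_complex_gaussian (hb i)

/-- An invertible linear substitution changes integrals by a constant factor. -/
theorem exists_integral_comp_linearEquiv {n : ℕ} (U : (Fin n → ℂ) ≃ₗ[ℂ] (Fin n → ℂ)) :
    ∃ c : ℝ, 0 < c ∧ ∀ {E : Type} [NormedAddCommGroup E] [NormedSpace ℝ E] (f : (Fin n → ℂ) → E),
      ∫ z, f (U z) = c • ∫ z, f z := by
  set L : (Fin n → ℂ) ≃L[ℝ] (Fin n → ℂ) := (U.restrictScalars ℝ).toContinuousLinearEquiv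
  have hdet : LinearMap.det (L : (Fin n → ℂ) →ₗ[ℝ] (Fin n → ℂ)) ≠ 0 := by
    exact (LinearEquiv.isUnit_det' L.toLinearEquiv).ne_zero
  refine ⟨(|(LinearMap.det (L : (Fin n → ℂ) →ₗ[ℝ] (Fin n → ℂ)))⁻¹|), by positivity, ?_⟩
  intro E _ _ f
  have h := Measure.map_linearMap_addHaar_eq_smul_addHaar (volume : Measure (Fin n → ℂ)) hdet
  have h2 : ∫ z, f (U z) = ∫ z, f z ∂(Measure.map L volume) := by
    exact (L.toHomeomorph.toMeasurableEquiv.measurableEmbedding.integral_map f).symm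
  rw [h2]
  have h3 : Measure.map L (volume : Measure (Fin n → ℂ)) =
    Measure.map (L : (Fin n → ℂ) →ₗ[ℝ] (Fin n → ℂ)) volume := rfl
  rw [h3, h, integral_smul_measure, ENNReal.toReal_ofReal (abs_nonneg _)]

/-- A symmetric bounded operator does not increase the norm of a vector with a bounded orbit. -/
theorem norm_le_of_bounded_orbit {H : Type*} [NormedAddCommGroup H] [InnerProductSpace ℂ H]
    (A : H →L[ℂ] H) (hA : ∀ x y, inner ℂ (A x) y = inner ℂ x (A y)) (ψ : H) {M : ℝ}
    (hM : ∀ k : ℕ, ‖(A ^ k) ψ‖ ≤ M) : ‖A ψ‖ ≤ ‖ψ‖ := by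
  have hk : ∀ (k : ℕ) (x y : H), inner ℂ ((A ^ k) x) y = inner ℂ x ((A ^ k) y) := by
    intro k
    induction k with
    | zero => intro x y; rfl
    | succ k ih =>
      intro x y
      rw [pow_succ]
      change inner ℂ ((A ^ k) (A x)) y = inner ℂ x ((A ^ k * A) y)
      rw [ih, hA, ← pow_succ, pow_succ']
      rfl
  -- `‖Aᵏψ‖² = ⟪ψ, A²ᵏψ⟫`, so `‖Aᵏψ‖ / ‖ψ‖` is at least squared when `k` doubles; a ratio
  -- `‖Aψ‖ / ‖ψ‖ > 1` would therefore grow without bound along `k = 2ʲ`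
  have hstep : ∀ k : ℕ, ‖(A ^ k) ψ‖ ^ 2 ≤ ‖ψ‖ * ‖(A ^ (2 * k)) ψ‖ := by
    intro k
    have h1 : inner ℂ ((A ^ k) ψ) ((A ^ k) ψ) = inner ℂ ψ ((A ^ (2 * k)) ψ) := by
      rw [hk, two_mul, pow_add]
      rfl
    have h2 := norm_inner_le_norm (𝕜 := ℂ) ψ ((A ^ (2 * k)) ψ)
    rw [← h1, inner_self_eq_norm_sq_to_K] at h2
    simpa using h2
  by_contra hcon
  rw [not_le] at hcon
  rcases eq_or_ne ψ 0 with rfl | hψ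
  · simp at hcon
  have hψ0 : 0 < ‖ψ‖ := norm_pos_iff.2 hψ
  set r := ‖A ψ‖ / ‖ψ‖ with hr
  have hr1 : 1 < r := (one_lt_div hψ0).2 hcon
  have hind : ∀ k : ℕ, r ^ 2 ^ k ≤ ‖(A ^ 2 ^ k) ψ‖ / ‖ψ‖ := by
    intro k
    induction k with
    | zero => simp [hr]
    | succ k ih =>
      rw [pow_succ 2 k, pow_mul]
      calc (r ^ 2 ^ k) ^ 2 ≤ (‖(A ^ 2 ^ k) ψ‖ / ‖ψ‖) ^ 2 := by gcongr
        _ = ‖(A ^ 2 ^ k) ψ‖ ^ 2 / ‖ψ‖ ^ 2 := by rw [div_pow]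
        _ ≤ (‖ψ‖ * ‖(A ^ (2 ^ k * 2)) ψ‖) / ‖ψ‖ ^ 2 := by
          gcongr
          rw [mul_comm (2 ^ k) 2]
          exact hstep _
        _ = ‖(A ^ (2 ^ k * 2)) ψ‖ / ‖ψ‖ := by field_simp
  obtain ⟨n, hn⟩ := pow_unbounded_of_one_lt (M / ‖ψ‖) hr1
  have h1 : r ^ n ≤ r ^ 2 ^ n := pow_le_pow_right₀ hr1.le (Nat.lt_two_pow_self).le
  have h2 : ‖(A ^ 2 ^ n) ψ‖ / ‖ψ‖ ≤ M / ‖ψ‖ := by gcongr; exact hM _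
  exact absurd (hn.trans_le (h1.trans ((hind n).trans h2))) (lt_irrefl _)

/-! ### The quadratic form of the action -/

/-- The eigenvalue `(-1)^l e^{-πω}` of `R̂ e^{-πĤ}` on one-particle states. -/
def boltz (x : Mode) : ℝ := (-1) ^ x.2.1 * Real.exp (-Real.pi * x.1)

/-- The real value `(1 - (-1)^l e^{-πω}) / (1 + (-1)^l e^{-πω})` of `tanh (π(ω+il)/2)`. -/
def modeTau (x : Mode) : ℝ := (1 - boltz x) / (1 + boltz x)

theorem measurable_boltz : Measurable boltz :=
  ((measurable_angLabel fun a => ((-1 : ℝ) ^ a.1)).comp measurable_snd).mul (by fun_prop)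

theorem measurable_modeTau : Measurable modeTau :=
  (measurable_const.sub measurable_boltz).div (measurable_const.add measurable_boltz)

theorem abs_boltz_lt_one {x : Mode} (hx : 0 < x.1) : |boltz x| < 1 := by
  unfold boltz
  rw [abs_mul, abs_pow, abs_neg, abs_one, one_pow, one_mul, abs_of_pos (Real.exp_pos _),
    Real.exp_lt_one_iff]
  nlinarith [Real.pi_pos]

theorem modeTau_pos {x : Mode} (hx : 0 < x.1) : 0 < modeTau x := by
  have h := abs_lt.1 (abs_boltz_lt_one hx)
  exact div_pos (by linarith) (by linarith)

/-- `tanh` has period `iπ`, so that `tanh (π(ω+il)/2)` is `tanh (πω/2)` for even `l` and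
`coth (πω/2)` for odd `l`. -/
theorem modeTanh_eq_modeTau {x : Mode} (hx : 0 < x.1) : modeTanh x = modeTau x := by
  have h := abs_lt.1 (abs_boltz_lt_one hx)
  unfold modeTanh
  set z : ℂ := Real.pi / 2 * (x.1 + Complex.I * x.2.1) with hz
  have he : Complex.exp (-z) = Complex.exp z * boltz x := by
    have : -z = z + (-(x.2.1 : ℂ) * (Real.pi * Complex.I) + ((-Real.pi * x.1 : ℝ) : ℂ)) := by
      rw [hz]; push_cast; ring
    rw [this, Complex.exp_add, Complex.exp_add, boltz]
    congr 1
    have h2 : Complex.exp (-(x.2.1 : ℂ) * (Real.pi * Complex.I)) = (-1) ^ x.2.1 := by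
      rw [neg_mul, Complex.exp_neg, Complex.exp_nat_mul, Complex.exp_pi_mul_I, ← inv_pow]
      norm_num
    rw [h2]
    push_cast
    rfl
  have hc : (1 + boltz x : ℂ) ≠ 0 := by
    have : (1 + boltz x : ℝ) ≠ 0 := by linarith
    exact_mod_cast this
  rw [Complex.tanh_eq_sinh_div_cosh, Complex.sinh, Complex.cosh, he, modeTau]
  push_cast
  have hez := Complex.exp_ne_zero z
  have hc2 : Complex.exp z + Complex.exp z * boltz x ≠ 0 := by
    rw [← mul_one_add]
    exact mul_ne_zero hez hc
  field_simp

theorem mem_finiteAction_iff {f : OneParticle} :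
    f ∈ finiteAction ↔ Integrable (fun x => modeTau x * ‖f x‖ ^ 2) modeMeasure := by
  have h : (fun x => modeTanh x * (‖f x‖ ^ 2 : ℝ)) =ᵐ[modeMeasure]
      fun x => ((modeTau x * ‖f x‖ ^ 2 : ℝ) : ℂ) := by
    filter_upwards [ae_freq_pos] with x hx
    rw [modeTanh_eq_modeTau hx]
    push_cast
    rfl
  change Integrable (fun x => modeTanh x * (‖f x‖ ^ 2 : ℝ)) modeMeasure ↔ _
  rw [integrable_congr h]
  exact ⟨fun h => h.re.congr (ae_of_all _ fun x => Complex.ofReal_re _), fun h => h.ofReal⟩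

theorem memLp_sqrtTau {f : OneParticle} (hf : f ∈ finiteAction) :
    MemLp (fun x => (Real.sqrt (modeTau x) : ℂ) * f x) 2 modeMeasure := by
  have hm : AEStronglyMeasurable (fun x => (Real.sqrt (modeTau x) : ℂ) * f x) modeMeasure :=
    (Complex.measurable_ofReal.comp measurable_modeTau.sqrt).aestronglyMeasurable.mul
      (Lp.aestronglyMeasurable f)
  rw [memLp_two_iff_integrable_sq_norm hm]
  refine (mem_finiteAction_iff.1 hf).congr ?_
  filter_upwards [ae_freq_pos] with x hx
  rw [norm_mul, mul_pow, Complex.norm_real, Real.norm_of_nonneg (Real.sqrt_nonneg _),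
    Real.sq_sqrt (modeTau_pos hx).le]

/-- Multiplication by `√tanh(π(ω+il)/2)` on the domain of the action. -/
def sqrtTau : finiteAction →ₗ[ℂ] OneParticle where
  toFun f := (memLp_sqrtTau f.2).toLp _
  map_add' f g := by
    ext1
    filter_upwards [(memLp_sqrtTau (f + g).2).coeFn_toLp, (memLp_sqrtTau f.2).coeFn_toLp,
      (memLp_sqrtTau g.2).coeFn_toLp, Lp.coeFn_add f.1 g.1,
      Lp.coeFn_add ((memLp_sqrtTau f.2).toLp _) ((memLp_sqrtTau g.2).toLp _)] with x h1 h2 h3 h4 h5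
    rw [h1, h5, Pi.add_apply, h2, h3, ← mul_add]
    congr 1
  map_smul' c f := by
    ext1
    filter_upwards [(memLp_sqrtTau (c • f).2).coeFn_toLp, (memLp_sqrtTau f.2).coeFn_toLp,
      Lp.coeFn_smul c f.1, Lp.coeFn_smul c ((memLp_sqrtTau f.2).toLp _)] with x h1 h2 h3 h4
    rw [h1, RingHom.id_apply, h4, Pi.smul_apply, h2, smul_eq_mul]
    have : ((c • f : finiteAction) : OneParticle) x = c * f.1 x := h3
    rw [this]
    ring

theorem coeFn_sqrtTau (f : finiteAction) :
    sqrtTau f =ᵐ[modeMeasure] fun x => (Real.sqrt (modeTau x) : ℂ) * (f : OneParticle) x :=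
  (memLp_sqrtTau f.2).coeFn_toLp

theorem sqrtTau_injective : Function.Injective sqrtTau := by
  rw [injective_iff_map_eq_zero]
  intro f hf
  apply Subtype.ext
  ext1
  have h := coeFn_sqrtTau f
  rw [hf] at h
  filter_upwards [h, Lp.coeFn_zero ℂ 2 modeMeasure, ae_freq_pos] with x h1 h2 h3
  rw [h2] at h1
  have h4 : (Real.sqrt (modeTau x) : ℂ) ≠ 0 := by
    exact_mod_cast (Real.sqrt_pos.2 (modeTau_pos h3)).ne'
  have h5 : (f : OneParticle) x = 0 := by
    simpa [h4] using h1.symm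
  rw [h5]
  exact h2.symm

theorem integral_modeTanh_eq (f : finiteAction) :
    ∫ x, modeTanh x * (‖(f : OneParticle) x‖ ^ 2 : ℝ) ∂modeMeasure = (‖sqrtTau f‖ ^ 2 : ℝ) := by
  have h := inner_self_eq_norm_sq_to_K (𝕜 := ℂ) (sqrtTau f)
  rw [L2.inner_def] at h
  push_cast
  refine Eq.trans ?_ h
  refine integral_congr_ae ?_
  filter_upwards [coeFn_sqrtTau f, ae_freq_pos] with x h1 h2
  rw [h1, modeTanh_eq_modeTau h2, RCLike.inner_apply', map_mul, Complex.conj_ofReal]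
  have h3 : (Real.sqrt (modeTau x) : ℂ) * Real.sqrt (modeTau x) = modeTau x := by
    exact_mod_cast Real.mul_self_sqrt (modeTau_pos h2).le
  rw [mul_mul_mul_comm, h3, Complex.conj_mul']

/-- The operator `R̂ e^{-πĤ}` on one-particle states. -/
def oneBoltz : OneParticle →L[ℂ] OneParticle :=
  multiplier (fun x => (boltz x : ℂ)) (Complex.measurable_ofReal.comp measurable_boltz)
    (by
      filter_upwards [ae_freq_pos] with x hx
      rw [Complex.norm_real]
      exact (abs_boltz_lt_one hx).le)

theorem coeFn_oneBoltz (g : OneParticle) :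
    oneBoltz g =ᵐ[modeMeasure] fun x => (boltz x : ℂ) * g x := coeFn_multiplier _ _ _

theorem oneBoltz_mem {g : OneParticle} (hg : g ∈ finiteAction) : oneBoltz g ∈ finiteAction := by
  rw [mem_finiteAction_iff] at hg ⊢
  refine hg.mono' (measurable_modeTau.aestronglyMeasurable.mul
    ((Lp.aestronglyMeasurable _).norm.pow 2)) ?_
  filter_upwards [coeFn_oneBoltz g, ae_freq_pos] with x h1 h2
  rw [h1, norm_mul, Real.norm_of_nonneg (modeTau_pos h2).le, Real.norm_of_nonneg (sq_nonneg _),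
    norm_mul, Complex.norm_real, Real.norm_eq_abs]
  have h3 := (abs_boltz_lt_one h2).le
  have := (modeTau_pos h2).le
  gcongr
  exact mul_le_of_le_one_left (norm_nonneg _) h3

/-- `u = (g + R̂ e^{-πĤ} g) / 2` solves `u + τ u = g` in the sense of forms. -/
theorem inner_add_inner_sqrtTau (f g : finiteAction) :
    inner ℂ (f : OneParticle) ((g : OneParticle) + oneBoltz g) +
      inner ℂ (sqrtTau f) (sqrtTau (g + ⟨oneBoltz g, oneBoltz_mem g.2⟩)) =
      2 * inner ℂ (f : OneParticle) (g : OneParticle) := by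
  rw [L2.inner_def, L2.inner_def, L2.inner_def,
    ← integral_add (L2.integrable_inner _ _) (L2.integrable_inner _ _), ← integral_const_mul]
  refine integral_congr_ae ?_
  filter_upwards [coeFn_sqrtTau f, coeFn_sqrtTau (g + ⟨oneBoltz g, oneBoltz_mem g.2⟩), ae_freq_pos,
    coeFn_oneBoltz g, Lp.coeFn_add g.1 (oneBoltz g)] with x h1 h2 h3 h4 h5
  have h6 : ((g + ⟨oneBoltz g, oneBoltz_mem g.2⟩ : finiteAction) : OneParticle) x =
    (g : OneParticle) x + (boltz x : ℂ) * (g : OneParticle) x := by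
    rw [← h4]; exact h5
  have h7 : ((g : OneParticle) + oneBoltz g : OneParticle) x =
    (g : OneParticle) x + (boltz x : ℂ) * (g : OneParticle) x := h6
  rw [h1, h2, h6, h7]
  simp only [RCLike.inner_apply', map_mul, Complex.conj_ofReal]
  have h8 : (Real.sqrt (modeTau x) : ℂ) * Real.sqrt (modeTau x) = modeTau x := by
    exact_mod_cast Real.mul_self_sqrt (modeTau_pos h3).le
  have h9 : (modeTau x : ℂ) * (1 + boltz x) = 1 - boltz x := by
    have h := abs_lt.1 (abs_boltz_lt_one h3)
    have : modeTau x * (1 + boltz x) = 1 - boltz x :=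
      div_mul_cancel₀ _ (by linarith)
    exact_mod_cast this
  linear_combination conj ((f : OneParticle) x) * (g : OneParticle) x * (1 + boltz x) * h8 +
    conj ((f : OneParticle) x) * (g : OneParticle) x * h9

/-- `τ` is unbounded only where `R̂ e^{-πĤ}` is close to `-1`, that is, for odd `l` and small `ω`. -/
theorem dense_finiteAction : Dense (finiteAction : Set OneParticle) := by
  have h : finiteAction.topologicalClosure = ⊤ := by
    rw [Submodule.topologicalClosure_eq_top_iff, Submodule.eq_bot_iff]
    intro f hf
    -- multiplication by `(1 + β) / 2` maps into the domain, as `τ ((1 + β) / 2)² = (1 - β²) / 4`;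
    -- a vector orthogonal to the domain is thus orthogonal to its own image
    have hm : Measurable fun x => ((1 + boltz x) / 2 : ℂ) := by
      have := Complex.measurable_ofReal.comp measurable_boltz
      exact (measurable_const.add this).div_const _
    have hb : ∀ᵐ x ∂modeMeasure, ‖((1 + boltz x) / 2 : ℂ)‖ ≤ 1 := by
      filter_upwards [ae_freq_pos] with x hx
      have h := abs_lt.1 (abs_boltz_lt_one hx)
      have : ((1 + boltz x) / 2 : ℂ) = (((1 + boltz x) / 2 : ℝ) : ℂ) := by push_cast; rfl
      rw [this, Complex.norm_real, Real.norm_eq_abs, abs_le]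
      constructor <;> linarith
    set g := multiplier _ hm hb f
    have hg : g ∈ finiteAction := by
      rw [mem_finiteAction_iff]
      have hi : Integrable (fun x => ‖f x‖ ^ 2) modeMeasure :=
        (memLp_two_iff_integrable_sq_norm (Lp.memLp f).1).1 (Lp.memLp f)
      refine hi.mono' (measurable_modeTau.aestronglyMeasurable.mul
        ((Lp.aestronglyMeasurable _).norm.pow 2)) ?_
      filter_upwards [coeFn_multiplier hm hb f, ae_freq_pos] with x h1 h2
      have h := abs_lt.1 (abs_boltz_lt_one h2)
      rw [h1, norm_mul, Real.norm_of_nonneg (modeTau_pos h2).le,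
        Real.norm_of_nonneg (sq_nonneg _), norm_mul]
      have e : ((1 + boltz x) / 2 : ℂ) = (((1 + boltz x) / 2 : ℝ) : ℂ) := by push_cast; rfl
      rw [e, Complex.norm_real, Real.norm_of_nonneg (by linarith), mul_pow, ← mul_assoc]
      refine mul_le_of_le_one_left (by positivity) ?_
      unfold modeTau
      have h0 : 1 + boltz x ≠ 0 := by linarith
      have : (1 - boltz x) / (1 + boltz x) * ((1 + boltz x) / 2) ^ 2 = (1 - boltz x ^ 2) / 4 := by
        field_simp
        ring
      rw [this]
      nlinarith [sq_nonneg (boltz x)]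
    have h0 := hf g hg
    have h1 : ∫ x, (1 + boltz x) / 2 * ‖f x‖ ^ 2 ∂modeMeasure = 0 := by
      rw [L2.inner_def] at h0
      have : ((∫ x, (1 + boltz x) / 2 * ‖f x‖ ^ 2 ∂modeMeasure : ℝ) : ℂ) = 0 := by
        rw [← h0, ← integral_complex_ofReal]
        refine integral_congr_ae ?_
        filter_upwards [coeFn_multiplier hm hb f] with x h1
        have e : ((1 + boltz x) / 2 : ℂ) = (((1 + boltz x) / 2 : ℝ) : ℂ) := by push_cast; rfl
        rw [h1, RCLike.inner_apply', map_mul, mul_assoc, Complex.conj_mul', e, Complex.conj_ofReal]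
        push_cast
        rfl
      exact_mod_cast this
    have hi : Integrable (fun x => (1 + boltz x) / 2 * ‖f x‖ ^ 2) modeMeasure := by
      have hi : Integrable (fun x => ‖f x‖ ^ 2) modeMeasure :=
        (memLp_two_iff_integrable_sq_norm (Lp.memLp f).1).1 (Lp.memLp f)
      refine hi.mono' (((measurable_const.add measurable_boltz).div_const
        _).aestronglyMeasurable.mul ((Lp.aestronglyMeasurable _).norm.pow 2)) ?_
      filter_upwards [ae_freq_pos] with x hx
      have h := abs_lt.1 (abs_boltz_lt_one hx)
      rw [norm_mul, norm_pow, norm_norm]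
      refine mul_le_of_le_one_left (by positivity) ?_
      rw [Real.norm_eq_abs, abs_le]
      constructor <;> linarith
    have h2 := (integral_eq_zero_iff_of_nonneg_ae (by
      filter_upwards [ae_freq_pos] with x hx
      have h := abs_lt.1 (abs_boltz_lt_one hx)
      exact mul_nonneg (by linarith) (by positivity)) hi).1 h1
    ext1
    filter_upwards [h2, ae_freq_pos, Lp.coeFn_zero ℂ 2 modeMeasure] with x h3 h4 h5
    have h := abs_lt.1 (abs_boltz_lt_one h4)
    have h6 : (1 + boltz x) / 2 ≠ 0 := by linarith
    rw [h5]
    simpa [h6] using h3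
  rw [← Submodule.dense_iff_topologicalClosure_eq_top] at h
  exact h

/-- `R̂ e^{-πĤ}` is the second quantization of `oneBoltz`. -/
theorem antipodal_expNeg_expVec (g : OneParticle) :
    (antipodalOperator * expNegHamiltonian NNReal.pi) (expVec g) = expVec (oneBoltz g) := by
  change antipodalOperator (expNegHamiltonian NNReal.pi (expVec g)) = _
  have h1 : expNegHamiltonian NNReal.pi (expVec g) = expVec (multiplier _ _ _ g) :=
    fockMultiplier_expVec _ _ _ _
  have h2 : ∀ f, antipodalOperator (expVec f) = expVec (multiplier _ _ _ f) := fun f =>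
    fockMultiplier_expVec _ _ _ _
  rw [h1, h2]
  congr 1
  ext1
  refine (coeFn_multiplier _ _ _).trans ?_
  refine EventuallyEq.trans ?_ (coeFn_oneBoltz g).symm
  filter_upwards [coeFn_multiplier (m := fun x : Mode => Complex.exp (-NNReal.pi * x.1))
    (by fun_prop) (by
      filter_upwards [ae_freq_pos] with x hx
      rw [Complex.norm_exp]
      simpa using mul_nonneg NNReal.pi.2 hx.le) g] with x hx
  rw [hx, boltz]
  push_cast
  rw [mul_assoc]
  rfl

theorem norm_antipodal_expNeg_le (ψ : Fock) :
    ‖(antipodalOperator * expNegHamiltonian NNReal.pi) ψ‖ ≤ ‖ψ‖ := by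
  have h : ∀ᵐ y ∂configMeasure,
      ‖(((antipodalOperator * expNegHamiltonian NNReal.pi) ψ : Fock) : Lp ℂ 2 configMeasure) y‖ ≤
        ‖(ψ : Lp ℂ 2 configMeasure) y‖ := by
    filter_upwards [coeFn_antipodalOperator (expNegHamiltonian NNReal.pi ψ),
      coeFn_expNegHamiltonian NNReal.pi ψ, ae_config_of_ae ae_freq_pos] with y h1 h2 h3
    change ‖((antipodalOperator (expNegHamiltonian NNReal.pi ψ) : Fock) :
      Lp ℂ 2 configMeasure) y‖ ≤ _
    rw [h1, h2, norm_mul, norm_mul, norm_pow, norm_neg, norm_one, one_pow, one_mul]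
    refine mul_le_of_le_one_left (norm_nonneg _) ?_
    rw [Complex.norm_exp]
    have : 0 ≤ energyOf y := Finset.sum_nonneg fun i _ => (h3 i).le
    simpa using mul_nonneg Real.pi_pos.le this
  exact Lp.norm_le_norm_of_ae_le h

theorem antipodal_expNeg_ne_zero : antipodalOperator * expNegHamiltonian NNReal.pi ≠ 0 := by
  intro h
  have h1 := antipodal_expNeg_expVec 0
  rw [h, map_zero] at h1
  have h2 := inner_expVec 0 0
  rw [← h1] at h2
  simp at h2

/-! ### The Wigner–Weyl transform on finitely many oscillators -/

theorem norm_sq_eq_of_inner_self {f : OneParticle} {r : ℝ} (h : inner ℂ f f = (r : ℂ)) :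
    ‖f‖ ^ 2 = r := by
  have h1 := inner_self_eq_norm_sq (𝕜 := ℂ) f
  rw [h] at h1
  exact h1.symm

section FiniteDim

variable {V : Submodule ℂ OneParticle}

/-- The action is diagonal in the orthonormal basis `b` of `V`, with eigenvalues `t`. -/
def IsDiagonal (hV : V ≤ finiteAction) (b : OrthonormalBasis (Fin (Module.finrank ℂ V)) ℂ V)
    (t : Fin (Module.finrank ℂ V) → ℝ) : Prop :=
  ∀ i (v : V), inner ℂ (sqrtTau ⟨b i, hV (b i).2⟩) (sqrtTau ⟨v, hV v.2⟩) =
    t i * inner ℂ (b i : OneParticle) (v : OneParticle)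

/-- The action is diagonal in some orthonormal basis of a finite-dimensional space of
oscillators. -/
theorem exists_isDiagonal [FiniteDimensional ℂ V] (hV : V ≤ finiteAction) :
    ∃ (b : OrthonormalBasis (Fin (Module.finrank ℂ V)) ℂ V)
      (t : Fin (Module.finrank ℂ V) → ℝ), (∀ i, 0 < t i) ∧ IsDiagonal hV b t := by
  -- `b` is an eigenbasis of `S*S`, where `S` is the restriction of `√τ` to `V`
  set S : V →ₗ[ℂ] OneParticle := sqrtTau ∘ₗ Submodule.inclusion hV with hS
  set S' : V →L[ℂ] OneParticle := LinearMap.toContinuousLinearMap S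
  set T : V →L[ℂ] V := (ContinuousLinearMap.adjoint S').comp S'
  have hT1 : ∀ x y : V, @inner ℂ V InnerProductSpace.toInner (T x) y = inner ℂ (S x) (S y) :=
    fun x y => ContinuousLinearMap.adjoint_inner_left S' y (S' x)
  have hT2 : ∀ x y : V, @inner ℂ V InnerProductSpace.toInner x (T y) = inner ℂ (S x) (S y) :=
    fun x y => ContinuousLinearMap.adjoint_inner_right S' x (S' y)
  have hsym : (T : V →ₗ[ℂ] V).IsSymmetric := fun x y => (hT1 x y).trans (hT2 x y).symm
  have hkey : ∀ i (v : V), inner ℂ (S (hsym.eigenvectorBasis rfl i)) (S v) =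
      hsym.eigenvalues rfl i * inner ℂ ((hsym.eigenvectorBasis rfl i : V) : OneParticle)
        (v : OneParticle) := by
    intro i v
    have h := hsym.apply_eigenvectorBasis rfl i
    rw [← hT1]
    have h' : T (hsym.eigenvectorBasis rfl i) =
      ((hsym.eigenvalues rfl i : ℝ) : ℂ) • hsym.eigenvectorBasis rfl i := h
    rw [h', inner_smul_left (E := V), Complex.conj_ofReal]
    rfl
  refine ⟨hsym.eigenvectorBasis rfl, hsym.eigenvalues rfl, fun i => ?_, hkey⟩
  have h1 := hkey i (hsym.eigenvectorBasis rfl i)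
  have h2 : inner ℂ ((hsym.eigenvectorBasis rfl i : V) : OneParticle)
      ((hsym.eigenvectorBasis rfl i : V) : OneParticle) = 1 := by
    rw [inner_self_eq_norm_sq_to_K]
    have : ‖((hsym.eigenvectorBasis rfl i : V) : OneParticle)‖ = 1 :=
      (hsym.eigenvectorBasis rfl).orthonormal.1 i
    rw [this]
    simp
  rw [h2, mul_one] at h1
  have h3 : ‖S (hsym.eigenvectorBasis rfl i)‖ ^ 2 = hsym.eigenvalues rfl i :=
    norm_sq_eq_of_inner_self h1
  rw [← h3]
  have hinj : Function.Injective S := sqrtTau_injective.comp (Submodule.inclusion_injective hV)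
  have : S (hsym.eigenvectorBasis rfl i) ≠ 0 := by
    rw [Ne, map_eq_zero_iff S hinj]
    exact (hsym.eigenvectorBasis rfl).toBasis.ne_zero i |> fun h => by simpa using h
  positivity

variable (b : OrthonormalBasis (Fin (Module.finrank ℂ V)) ℂ V)

/-- The vector of `V` with coordinates `η` in the orthonormal basis `b`. -/
def coordVec (η : Fin (Module.finrank ℂ V) → ℂ) : OneParticle := ∑ i, η i • (b i : OneParticle)

theorem orthonormal_coe : Orthonormal ℂ fun i => (b i : OneParticle) := by
  have h := b.orthonormal
  rw [orthonormal_iff_ite] at h ⊢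
  exact h

theorem inner_coordVec (η ζ : Fin (Module.finrank ℂ V) → ℂ) :
    inner ℂ (coordVec b η) (coordVec b ζ) = ∑ i, conj (η i) * ζ i :=
  (orthonormal_coe b).inner_sum η ζ Finset.univ

theorem norm_coordVec_sq (η : Fin (Module.finrank ℂ V) → ℂ) :
    ‖coordVec b η‖ ^ 2 = ∑ i, ‖η i‖ ^ 2 := by
  refine norm_sq_eq_of_inner_self ((inner_coordVec b η η).trans ?_)
  simp_rw [Complex.conj_mul']
  push_cast
  rfl

theorem continuous_coordVec : Continuous (coordVec b) := by
  unfold coordVec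
  exact continuous_finsetSum _ fun i _ => (continuous_apply i).smul continuous_const

theorem coordVec_mem (η : Fin (Module.finrank ℂ V) → ℂ) : coordVec b η ∈ V :=
  V.sum_mem fun i _ => V.smul_mem _ (b i).2

variable [FiniteDimensional ℂ V]

/-- The change of coordinates from the standard orthonormal basis to `b`. -/
def changeCoords :
    (Fin (Module.finrank ℂ V) → ℂ) ≃ₗ[ℂ] (Fin (Module.finrank ℂ V) → ℂ) :=
  (stdOrthonormalBasis ℂ V).toBasis.equivFun.symm.trans b.toBasis.equivFun

theorem coordVec_changeCoords (α : Fin (Module.finrank ℂ V) → ℂ) :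
    coordVec b (changeCoords b α) = ofCoords V α := by
  have h1 : ∀ η, coordVec b η = ((b.toBasis.equivFun.symm η : V) : OneParticle) := by
    intro η
    rw [Module.Basis.equivFun_symm_apply]
    simp [coordVec]
  have h2 : ofCoords V α =
      (((stdOrthonormalBasis ℂ V).toBasis.equivFun.symm α : V) : OneParticle) := by
    rw [Module.Basis.equivFun_symm_apply]
    simp [ofCoords]
  rw [h1, h2, changeCoords, LinearEquiv.trans_apply, LinearEquiv.symm_apply_apply]

theorem sum_changeCoords (ξ α : Fin (Module.finrank ℂ V) → ℂ) :
    ∑ i, (conj (ξ i) * α i - ξ i * conj (α i)) =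
      ∑ i, (conj (changeCoords b ξ i) * changeCoords b α i -
        changeCoords b ξ i * conj (changeCoords b α i)) := by
  have h : ∀ x y : Fin (Module.finrank ℂ V) → ℂ, ∑ i, conj (x i) * y i =
      ∑ i, conj (changeCoords b x i) * changeCoords b y i := by
    intro x y
    rw [← inner_coordVec, ← inner_coordVec, coordVec_changeCoords, coordVec_changeCoords]
    rfl
  have e : ∀ x y : Fin (Module.finrank ℂ V) → ℂ, ∑ i, x i * conj (y i) =
      ∑ i, conj (y i) * x i := fun x y => Finset.sum_congr rfl fun i _ => mul_comm _ _
  rw [Finset.sum_sub_distrib, Finset.sum_sub_distrib, e, e (changeCoords b ξ), h ξ α, h α ξ]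

variable {b} {t : Fin (Module.finrank ℂ V) → ℝ} {hV : V ≤ finiteAction}

theorem norm_sqrtTau_coordVec_sq (hb : IsDiagonal hV b t) (η : Fin (Module.finrank ℂ V) → ℂ) :
    ‖sqrtTau ⟨coordVec b η, hV (coordVec_mem b η)⟩‖ ^ 2 =
      ∑ i, t i * ‖η i‖ ^ 2 := by
  have h0 : sqrtTau ⟨coordVec b η, hV (coordVec_mem b η)⟩ =
      ∑ i, η i • sqrtTau ⟨b i, hV (b i).2⟩ := by
    simp_rw [← map_smul, ← map_sum]
    congr 1
    apply Subtype.ext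
    simp [coordVec]
  refine norm_sq_eq_of_inner_self ?_
  nth_rewrite 1 [h0]
  rw [sum_inner]
  have h1 : ∀ i, inner ℂ (η i • sqrtTau ⟨b i, hV (b i).2⟩)
      (sqrtTau ⟨coordVec b η, hV (coordVec_mem b η)⟩) = ((t i * ‖η i‖ ^ 2 : ℝ) : ℂ) := by
    intro i
    rw [inner_smul_left, hb i ⟨coordVec b η, coordVec_mem b η⟩]
    have : inner ℂ (b i : OneParticle) (coordVec b η) = η i :=
      (orthonormal_coe b).inner_right_fintype η i
    rw [this, mul_left_comm, Complex.conj_mul']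
    push_cast
    rfl
  simp_rw [h1]
  rw [Complex.ofReal_sum]

theorem hhGaussian_coordVec (hb : IsDiagonal hV b t) (η : Fin (Module.finrank ℂ V) → ℂ) :
    hhGaussian (coordVec b η) = Complex.exp (∑ i, -(2 * t i : ℝ) * (‖η i‖ ^ 2 : ℝ)) := by
  unfold hhGaussian
  have h := integral_modeTanh_eq ⟨coordVec b η, hV (coordVec_mem b η)⟩
  rw [norm_sqrtTau_coordVec_sq hb] at h
  change ∫ x, modeTanh x * (‖(coordVec b η) x‖ ^ 2 : ℝ) ∂modeMeasure = _ at h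
  rw [h]
  congr 1
  push_cast
  rw [Finset.mul_sum]
  exact Finset.sum_congr rfl fun i _ => by ring

/-- The symplectic Fourier transform of the Gaussian is again Gaussian. -/
theorem exists_symplecticFourier_eq (hb : IsDiagonal hV b t) (ht : ∀ i, 0 < t i) : ∃ C : ℂ, C ≠ 0 ∧
    ∀ ξ, symplecticFourier V hhGaussian ξ =
      C * (Real.exp (∑ i, -(1 / (2 * t i)) * ‖changeCoords b ξ i‖ ^ 2) : ℝ) := by
  obtain ⟨c, hc, H⟩ := exists_integral_comp_linearEquiv (changeCoords b)
  refine ⟨(1 / (Real.pi : ℂ) ^ (2 * Module.finrank ℂ V)) * (c * ∏ i, (Real.pi / (2 * t i : ℝ) : ℂ)),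
    ?_, fun ξ => ?_⟩
  · have hpi : (Real.pi : ℂ) ≠ 0 := by exact_mod_cast Real.pi_ne_zero
    have hc' : (c : ℂ) ≠ 0 := by exact_mod_cast hc.ne'
    refine mul_ne_zero (one_div_ne_zero (pow_ne_zero _ hpi)) (mul_ne_zero hc' ?_)
    rw [Finset.prod_ne_zero_iff]
    intro i _
    have : ((2 * t i : ℝ) : ℂ) ≠ 0 := by
      have := ht i
      exact_mod_cast (by positivity : (2 * t i : ℝ) ≠ 0)
    exact div_ne_zero hpi this
  · unfold symplecticFourier
    rw [mul_assoc]
    congr 1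
    set ζ := changeCoords b ξ with hζ
    have e : ∀ α : Fin (Module.finrank ℂ V) → ℂ, hhGaussian (ofCoords V α) *
        Complex.exp (∑ i, (conj (ξ i) * α i - ξ i * conj (α i))) =
        (fun η : Fin (Module.finrank ℂ V) → ℂ =>
          Complex.exp (∑ i, (-(2 * t i : ℝ) * (‖η i‖ ^ 2 : ℝ) + conj (ζ i) * η i +
            -ζ i * conj (η i)))) (changeCoords b α) := by
      intro α
      dsimp only
      rw [← coordVec_changeCoords b, hhGaussian_coordVec hb, ← Complex.exp_add,
        sum_changeCoords b, ← Finset.sum_add_distrib]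
      congr 1
      exact Finset.sum_congr rfl fun i _ => by ring
    refine (integral_congr_ae (ae_of_all _ e)).trans ?_
    rw [H (fun η : Fin (Module.finrank ℂ V) → ℂ =>
          Complex.exp (∑ i, (-(2 * t i : ℝ) * (‖η i‖ ^ 2 : ℝ) + conj (ζ i) * η i +
            -ζ i * conj (η i)))), integral_pi_complex_gaussian (b := fun i => 2 * t i) (fun i => by have := ht i; positivity),
      Complex.real_smul, mul_assoc]
    congr 2
    rw [Complex.ofReal_exp]
    congr 1
    push_cast
    refine Finset.sum_congr rfl fun i _ => ?_
    rw [mul_neg, Complex.conj_mul']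
    ring

end FiniteDim

/-! ### Gaussian averages of Weyl operators -/

section FiniteDim

variable {V : Submodule ℂ OneParticle} [FiniteDimensional ℂ V]
  {b : OrthonormalBasis (Fin (Module.finrank ℂ V)) ℂ V} {t : Fin (Module.finrank ℂ V) → ℝ}

variable (t) in
/-- The Gaussian weight `exp (-∑ᵢ |ζᵢ|² / 2tᵢ)`. -/
def weylWeight (ζ : Fin (Module.finrank ℂ V) → ℂ) : ℝ :=
  Real.exp (∑ i, -(1 / (2 * t i)) * ‖ζ i‖ ^ 2)

theorem integrable_weylWeight (ht : ∀ i, 0 < t i) : Integrable (weylWeight t) :=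
  integrable_pi_complex_gaussian (b := fun i => 1 / (2 * t i))
    (fun i => by have := ht i; positivity)

theorem continuous_weylWeight : Continuous (weylWeight t) := by
  unfold weylWeight
  fun_prop

theorem integrable_weylWeight_smul (ht : ∀ i, 0 < t i) (ψ : Fock) :
    Integrable fun ζ => (weylWeight t ζ : ℂ) • weylOp (coordVec b ζ) ψ := by
  refine ((integrable_weylWeight ht).mul_const ‖ψ‖).mono' ?_ (ae_of_all _ fun ζ => ?_)
  · exact ((Complex.continuous_ofReal.comp continuous_weylWeight).smul
      ((continuous_weylOp ψ).comp (continuous_coordVec b))).aestronglyMeasurable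
  · rw [norm_smul, Complex.norm_real,
      Real.norm_of_nonneg (show 0 ≤ weylWeight t ζ from (Real.exp_pos _).le)]
    exact mul_le_mul_of_nonneg_left (norm_weylOp_le _ _) (Real.exp_pos _).le

variable (b) in
/-- The Gaussian average `∫ exp (-∑ᵢ |ζᵢ|² / 2tᵢ) D(ζ) dζ` of Weyl operators. -/
def gaussWeyl (ht : ∀ i, 0 < t i) : Fock →L[ℂ] Fock :=
  LinearMap.mkContinuous
    { toFun := fun ψ => ∫ ζ, (weylWeight t ζ : ℂ) • weylOp (coordVec b ζ) ψ
      map_add' := fun ψ φ => by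
        rw [← integral_add (integrable_weylWeight_smul ht ψ) (integrable_weylWeight_smul ht φ)]
        congr 1
        ext1 ζ
        rw [map_add, smul_add]
      map_smul' := fun c ψ => by
        rw [RingHom.id_apply, ← integral_smul]
        congr 1
        ext1 ζ
        rw [map_smul, smul_comm] } (∫ ζ, weylWeight t ζ)
    (fun ψ => by
      rw [← integral_mul_const]
      refine norm_integral_le_of_norm_le ((integrable_weylWeight ht).mul_const ‖ψ‖)
        (ae_of_all _ fun ζ => ?_)
      rw [norm_smul, Complex.norm_real,
      Real.norm_of_nonneg (show 0 ≤ weylWeight t ζ from (Real.exp_pos _).le)]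
      exact mul_le_mul_of_nonneg_left (norm_weylOp_le _ _) (Real.exp_pos _).le)

theorem gaussWeyl_apply (ht : ∀ i, 0 < t i) (ψ : Fock) :
    gaussWeyl b ht ψ = ∫ ζ, (weylWeight t ζ : ℂ) • weylOp (coordVec b ζ) ψ := rfl

variable (b t) in
/-- The one-particle operator `1 - 2T/(1+T)` on `V` (with `T` the matrix of the action), extended
by the identity on the orthogonal complement. -/
def cayley (g : OneParticle) : OneParticle :=
  g - coordVec b fun i => ((2 * t i / (1 + t i) : ℝ) : ℂ) * inner ℂ (b i : OneParticle) g

theorem inner_coordVec_right (h : OneParticle) (η : Fin (Module.finrank ℂ V) → ℂ) :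
    inner ℂ h (coordVec b η) = ∑ i, η i * inner ℂ h (b i : OneParticle) := by
  unfold coordVec
  rw [inner_sum]
  simp_rw [inner_smul_right]

theorem inner_cayley_right (h g : OneParticle) :
    inner ℂ h (cayley b t g) = inner ℂ h g - ∑ i, ((2 * t i / (1 + t i) : ℝ) : ℂ) *
      inner ℂ h (b i : OneParticle) * inner ℂ (b i : OneParticle) g := by
  rw [cayley, inner_sub_right, inner_coordVec_right]
  congr 1
  exact Finset.sum_congr rfl fun i _ => by ring

theorem inner_cayley_left (h g : OneParticle) :
    inner ℂ (cayley b t h) g = inner ℂ h (cayley b t g) := by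
  rw [← inner_conj_symm, inner_cayley_right, inner_cayley_right, map_sub, inner_conj_symm, map_sum]
  congr 1
  refine Finset.sum_congr rfl fun i _ => ?_
  rw [map_mul, map_mul, Complex.conj_ofReal, inner_conj_symm, inner_conj_symm]
  ring

/-- The eigenvalues of `cayley` are `(1 - tᵢ) / (1 + tᵢ)` and `1`. -/
theorem norm_cayley_le (ht : ∀ i, 0 < t i) (g : OneParticle) : ‖cayley b t g‖ ≤ ‖g‖ := by
  have h : ‖cayley b t g‖ ^ 2 = ‖g‖ ^ 2 - ∑ i, (2 * (2 * t i / (1 + t i)) -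
      (2 * t i / (1 + t i)) ^ 2) * ‖inner ℂ (b i : OneParticle) g‖ ^ 2 := by
    rw [cayley, @norm_sub_sq ℂ, norm_coordVec_sq, inner_coordVec_right]
    have e : ∀ i, ((2 * t i / (1 + t i) : ℝ) : ℂ) * inner ℂ (b i : OneParticle) g *
        inner ℂ g (b i : OneParticle) =
        ((2 * t i / (1 + t i) * ‖inner ℂ (b i : OneParticle) g‖ ^ 2 : ℝ) : ℂ) := by
      intro i
      rw [mul_assoc, ← inner_conj_symm g (b i : OneParticle), Complex.mul_conj']
      push_cast
      rfl
    simp_rw [e]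
    rw [← Complex.ofReal_sum]
    change _ - 2 * (∑ i, 2 * t i / (1 + t i) * ‖inner ℂ (b i : OneParticle) g‖ ^ 2) + _ = _
    have e2 : ∀ i, ‖((2 * t i / (1 + t i) : ℝ) : ℂ) * inner ℂ (b i : OneParticle) g‖ ^ 2 =
        (2 * t i / (1 + t i)) ^ 2 * ‖inner ℂ (b i : OneParticle) g‖ ^ 2 := by
      intro i
      rw [norm_mul, mul_pow, Complex.norm_real, Real.norm_eq_abs, sq_abs]
    simp_rw [e2, sub_mul, Finset.sum_sub_distrib, mul_assoc]
    rw [← Finset.mul_sum]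
    ring
  have h0 : 0 ≤ ∑ i, (2 * (2 * t i / (1 + t i)) -
      (2 * t i / (1 + t i)) ^ 2) * ‖inner ℂ (b i : OneParticle) g‖ ^ 2 := by
    refine Finset.sum_nonneg fun i _ => mul_nonneg ?_ (sq_nonneg _)
    have h1 : 0 ≤ 2 * t i / (1 + t i) := by have := ht i; positivity
    have h2 : 2 * t i / (1 + t i) ≤ 2 := by
      have := ht i
      rw [div_le_iff₀ (by linarith)]
      linarith
    nlinarith
  exact (sq_le_sq₀ (norm_nonneg _) (norm_nonneg _)).1 (by linarith)

/-- The Gaussian average of Weyl operators second-quantizes `cayley`, up to a constant. -/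
theorem exists_gaussWeyl_expVec (ht : ∀ i, 0 < t i) : ∃ K : ℂ, K ≠ 0 ∧
    ∀ g, gaussWeyl b ht (expVec g) = K • expVec (cayley b t g) := by
  have hs : ∀ i, 0 < 1 / (2 * t i) + 1 / 2 := fun i => by have := ht i; positivity
  refine ⟨∏ i, (Real.pi / (1 / (2 * t i) + 1 / 2 : ℝ) : ℂ), ?_, fun g => ?_⟩
  · rw [Finset.prod_ne_zero_iff]
    intro i _
    refine div_ne_zero (by exact_mod_cast Real.pi_ne_zero) ?_
    exact_mod_cast (hs i).ne'
  refine ext_inner_expVec fun h => ?_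
  rw [gaussWeyl_apply, inner_smul_right (E := Fock), inner_expVec, inner_cayley_right,
    ← integral_inner (integrable_weylWeight_smul ht _)]
  have e : ∀ ζ : Fin (Module.finrank ℂ V) → ℂ,
      inner ℂ (expVec h) ((weylWeight t ζ : ℂ) • weylOp (coordVec b ζ) (expVec g)) =
      Complex.exp (inner ℂ h g) * Complex.exp (∑ i, (-((1 / (2 * t i) + 1 / 2 : ℝ) : ℂ) *
        (‖ζ i‖ ^ 2 : ℝ) + inner ℂ h (b i : OneParticle) * ζ i +
          -inner ℂ (b i : OneParticle) g * conj (ζ i))) := by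
    intro ζ
    rw [isWeylSystem_weylOp, inner_smul_right (E := Fock), inner_smul_right (E := Fock),
      inner_expVec, weylWeight, Complex.ofReal_exp, ← Complex.exp_add, ← Complex.exp_add,
      ← Complex.exp_add]
    congr 1
    rw [inner_add_right, inner_coordVec_right, norm_coordVec_sq,
      ← inner_conj_symm (coordVec b ζ) g, inner_coordVec_right, map_sum]
    simp_rw [map_mul, inner_conj_symm]
    push_cast
    simp only [Finset.sum_add_distrib, add_mul, neg_mul, Finset.sum_neg_distrib, neg_add]
    rw [show ∀ a : ℂ, -a / 2 = -(1 / 2 * a) from fun a => by ring, Finset.mul_sum]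
    simp_rw [mul_comm (inner ℂ (_ : OneParticle) g) (conj _),
      mul_comm (inner ℂ h (_ : OneParticle)) _]
    ring
  simp_rw [e]
  rw [integral_const_mul, integral_pi_complex_gaussian (b := fun i => 1 / (2 * t i) + 1 / 2) hs,
    sub_eq_add_neg, Complex.exp_add, mul_left_comm]
  congr 3
  rw [← Finset.sum_neg_distrib]
  refine Finset.sum_congr rfl fun i _ => ?_
  have h1 : (t i : ℂ) ≠ 0 := by exact_mod_cast (ht i).ne'
  have h2 : (1 + t i : ℂ) ≠ 0 := by
    have := ht i
    exact_mod_cast (by positivity : 1 + t i ≠ 0)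
  push_cast
  have h3 : (1 / (2 * (t i : ℂ)) + 1 / 2) = (1 + t i) / (2 * t i) := by
    field_simp
  rw [h3]
  field_simp

/-- Second quantization preserves contractions.  Sums of exponential vectors have bounded orbits, as
`‖expVec g‖ = exp (‖g‖² / 2)` only decreases along the orbit, and `A` is symmetric. -/
theorem norm_le_of_second_quantized (ht : ∀ i, 0 < t i) {A : Fock →L[ℂ] Fock}
    (hA : ∀ g, A (expVec g) = expVec (cayley b t g)) (ψ : Fock) : ‖A ψ‖ ≤ ‖ψ‖ := by
  have hsymm : ∀ x y : Fock, inner ℂ (A x) y = inner ℂ x (A y) := by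
    have h1 : ∀ x y, inner ℂ (A (expComb x)) (expComb y) = inner ℂ (expComb x) (A (expComb y)) := by
      intro x y
      unfold expComb
      simp only [Finsupp.linearCombination_apply, Finsupp.sum, map_sum, map_smul, hA, sum_inner,
        inner_sum]
      refine Finset.sum_congr rfl fun i _ => Finset.sum_congr rfl fun j _ => ?_
      rw [inner_smul_left (E := Fock), inner_smul_right (E := Fock), inner_smul_left (E := Fock),
        inner_smul_right (E := Fock), inner_expVec, inner_expVec, inner_cayley_left]
    have h2 : ∀ x y, inner ℂ (A (expComb x)) y = inner ℂ (expComb x) (A y) := by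
      intro x y
      have h3 := denseRange_expComb.equalizer (g := fun v => inner ℂ (A (expComb x)) v)
        (h := fun v => inner ℂ (expComb x) (A v)) (by fun_prop) (by fun_prop) (funext (h1 x))
      exact congrFun h3 y
    intro x y
    have h3 := denseRange_expComb.equalizer (g := fun v => inner ℂ (A v) y)
        (h := fun v => inner ℂ v (A y)) (by fun_prop) (by fun_prop) (funext fun x => h2 x y)
    exact congrFun h3 x
  have hpow : ∀ (k : ℕ) (g : OneParticle), ∃ g', ‖g'‖ ≤ ‖g‖ ∧ (A ^ k) (expVec g) = expVec g' := by
    intro k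
    induction k with
    | zero => exact fun g => ⟨g, le_rfl, rfl⟩
    | succ k ih =>
      intro g
      obtain ⟨g', h1, h2⟩ := ih (cayley b t g)
      refine ⟨g', h1.trans (norm_cayley_le ht g), ?_⟩
      rw [pow_succ]
      change (A ^ k) (A (expVec g)) = _
      rw [hA, h2]
  have hnorm : ∀ g : OneParticle, ‖expVec g‖ = Real.exp (‖g‖ ^ 2 / 2) := by
    intro g
    have h1 := inner_self_eq_norm_sq (𝕜 := ℂ) (expVec g)
    rw [inner_expVec, inner_self_eq_norm_sq_to_K] at h1
    have h2 : ‖expVec g‖ ^ 2 = Real.exp (‖g‖ ^ 2) := by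
      rw [← h1]
      change (Complex.exp ((‖g‖ : ℂ) ^ 2)).re = _
      rw [← Complex.ofReal_pow, Complex.exp_ofReal_re]
    have h3 : ‖expVec g‖ ^ 2 = Real.exp (‖g‖ ^ 2 / 2) ^ 2 := by
      rw [h2, ← Real.exp_nat_mul]
      congr 1
      push_cast
      ring
    exact (sq_eq_sq₀ (norm_nonneg _) (Real.exp_pos _).le).1 h3
  have hcomb : ∀ x, ‖A (expComb x)‖ ≤ ‖expComb x‖ := by
    intro x
    refine norm_le_of_bounded_orbit A hsymm _
      (M := ∑ g ∈ x.support, ‖x g‖ * Real.exp (‖g‖ ^ 2 / 2)) fun k => ?_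
    unfold expComb
    simp only [Finsupp.linearCombination_apply, Finsupp.sum, map_sum, map_smul]
    refine (norm_sum_le _ _).trans (Finset.sum_le_sum fun g _ => ?_)
    obtain ⟨g', h1, h2⟩ := hpow k g
    rw [h2, norm_smul, hnorm]
    gcongr
  exact denseRange_expComb.induction_on (p := fun ψ => ‖A ψ‖ ≤ ‖ψ‖) ψ
    (isClosed_le (by fun_prop) (by fun_prop)) hcomb

/-- Galerkin exactness: once `V` contains `g` and `R̂ e^{-πĤ} g`, the finite-dimensional operator
agrees with `R̂ e^{-πĤ}` on `g`. -/
theorem cayley_eq_oneBoltz {hV : V ≤ finiteAction} (hb : IsDiagonal hV b t) (ht : ∀ i, 0 < t i)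
    {g : OneParticle} (hg : g ∈ V) (hg' : oneBoltz g ∈ V) : cayley b t g = oneBoltz g := by
  have hrep : ∀ v ∈ V, v = coordVec b fun i => inner ℂ (b i : OneParticle) v := by
    intro v hv
    have h := b.sum_repr' ⟨v, hv⟩
    have h2 := congrArg Subtype.val h
    simp only [Submodule.coe_sum, Submodule.coe_smul] at h2
    exact h2.symm
  have hcoef : ∀ i, (1 + t i) * (inner ℂ (b i : OneParticle) g +
      inner ℂ (b i : OneParticle) (oneBoltz g)) = 2 * inner ℂ (b i : OneParticle) g := by
    intro i
    have h1 := inner_add_inner_sqrtTau ⟨b i, hV (b i).2⟩ ⟨g, hV hg⟩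
    have h2 := hb i (⟨g, hg⟩ + ⟨oneBoltz g, hg'⟩)
    have h3 : inner ℂ (sqrtTau ⟨b i, hV (b i).2⟩)
        (sqrtTau (⟨g, hV hg⟩ + ⟨oneBoltz g, oneBoltz_mem (hV hg)⟩)) =
        t i * inner ℂ (b i : OneParticle) (g + oneBoltz g) := h2
    rw [h3, inner_add_right] at h1
    rw [← h1]
    ring
  have hsub : g - oneBoltz g =
      coordVec b fun i => ((2 * t i / (1 + t i) : ℝ) : ℂ) * inner ℂ (b i : OneParticle) g := by
    rw [hrep _ (V.sub_mem hg hg')]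
    congr 1
    ext1 i
    rw [inner_sub_right]
    have h2 : (1 + t i : ℂ) ≠ 0 := by
      have := ht i
      exact_mod_cast (by positivity : 1 + t i ≠ 0)
    push_cast
    rw [div_mul_eq_mul_div, eq_div_iff h2]
    linear_combination -(hcoef i)
  rw [cayley, ← hsub, sub_sub_cancel]

end FiniteDim

/-- On each finite-dimensional space of oscillators, the normalized Wigner–Weyl transform of the
Gaussian is the second quantization of a self-adjoint contraction. -/
theorem exists_weylTransform_eq (V : Submodule ℂ OneParticle) [FiniteDimensional ℂ V]
    (hV : V ≤ finiteAction) : ∃ z : ℂ, z ≠ 0 ∧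
      ∃ A : Fock →L[ℂ] Fock, (∀ ψ, z • weylTransform V weylOp hhGaussian ψ = A ψ) ∧
        (∀ ψ, ‖A ψ‖ ≤ ‖ψ‖) ∧
        ∀ g, g ∈ V → oneBoltz g ∈ V → A (expVec g) = expVec (oneBoltz g) := by
  obtain ⟨b, t, ht, hb⟩ := exists_isDiagonal hV
  obtain ⟨C, hC, HC⟩ := exists_symplecticFourier_eq hb ht
  obtain ⟨K, hK, HK⟩ := exists_gaussWeyl_expVec (b := b) ht
  obtain ⟨c, hc, Hc⟩ := exists_integral_comp_linearEquiv (changeCoords b)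
  have hc' : (c : ℂ) ≠ 0 := by exact_mod_cast hc.ne'
  have hA : ∀ g, (K⁻¹ • gaussWeyl b ht) (expVec g) = expVec (cayley b t g) := by
    intro g
    rw [smul_apply, HK, inv_smul_smul₀ hK]
  refine ⟨(C * c * K)⁻¹, inv_ne_zero (mul_ne_zero (mul_ne_zero hC hc') hK), K⁻¹ • gaussWeyl b ht,
    fun ψ => ?_, norm_le_of_second_quantized ht hA, fun g hg hg' => ?_⟩
  · have h1 : weylTransform V weylOp hhGaussian ψ = (C * c) • gaussWeyl b ht ψ := by
      unfold weylTransform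
      have e : ∀ ξ, symplecticFourier V hhGaussian ξ • weylOp (ofCoords V ξ) ψ =
          (fun ζ => C • ((weylWeight t ζ : ℂ) • weylOp (coordVec b ζ) ψ)) (changeCoords b ξ) := by
        intro ξ
        dsimp only
        rw [HC, coordVec_changeCoords, smul_smul]
        rfl
      refine (integral_congr_ae (ae_of_all _ e)).trans ?_
      rw [Hc (fun ζ => C • ((weylWeight t ζ : ℂ) • weylOp (coordVec b ζ) ψ)), integral_smul,
        ← gaussWeyl_apply ht, mul_comm C, mul_smul]
      rfl
    rw [h1, smul_smul, smul_apply]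
    congr 1
    field_simp
  · rw [hA, cayley_eq_oneBoltz hb ht hg hg']

/-- The Galerkin operators are contractions that converge on exponential vectors of the domain, and
these are total. -/
theorem isWeylTransform_hhGaussian :
    IsWeylTransform weylOp finiteAction hhGaussian
      (antipodalOperator * expNegHamiltonian NNReal.pi) := by
  refine ⟨dense_finiteAction, antipodal_expNeg_ne_zero, ?_⟩
  choose z hz A hA1 hA2 hA3 using fun V : FiniteModes finiteAction =>
    have : FiniteDimensional ℂ V.1 := V.2.2
    exists_weylTransform_eq V.1 V.2.1
  refine ⟨z, hz, fun ψ => ?_⟩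
  have hgoal : Tendsto (fun V => A V ψ) atTop
      (𝓝 ((antipodalOperator * expNegHamiltonian NNReal.pi) ψ)) := by
    set B := antipodalOperator * expNegHamiltonian NNReal.pi
    -- the exponential vectors of the domain are total
    have hclosed : IsClosed {ψ : Fock | Tendsto (fun V => A V ψ) atTop (𝓝 (B ψ))} := by
      rw [← closure_subset_iff_isClosed]
      intro φ hφ
      rw [Set.mem_ofPred_eq, Metric.tendsto_nhds]
      intro ε hε
      obtain ⟨χ, hχ, hd⟩ := Metric.mem_closure_iff.1 hφ (ε / 3) (by positivity)
      filter_upwards [Metric.tendsto_nhds.1 hχ (ε / 3) (by positivity)] with V hV'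
      have h1 : dist (A V φ) (A V χ) < ε / 3 := by
        rw [dist_eq_norm, ← map_sub]
        exact (hA2 V _).trans_lt (by rwa [← dist_eq_norm])
      have h2 : dist (B χ) (B φ) < ε / 3 := by
        rw [dist_eq_norm, ← map_sub]
        refine (norm_antipodal_expNeg_le _).trans_lt ?_
        rwa [← dist_eq_norm, dist_comm]
      calc dist (A V φ) (B φ) ≤ dist (A V φ) (A V χ) + dist (A V χ) (B χ) + dist (B χ) (B φ) :=
            dist_triangle4 _ _ _ _
        _ < ε / 3 + ε / 3 + ε / 3 := by gcongr
        _ = ε := by ring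
    have hdom : ∀ g ∈ finiteAction, Tendsto (fun V => A V (expVec g)) atTop (𝓝 (B (expVec g))) := by
      intro g hg
      set V₀ : FiniteModes finiteAction := ⟨Submodule.span ℂ {g, oneBoltz g}, by
        rw [Submodule.span_le]
        rintro x (rfl | rfl)
        · exact hg
        · exact oneBoltz_mem hg, FiniteDimensional.span_of_finite ℂ (Set.toFinite _)⟩
      refine tendsto_const_nhds.congr' ?_
      filter_upwards [eventually_ge_atTop V₀] with V hV
      have hle : Submodule.span ℂ {g, oneBoltz g} ≤ V.1 := hV
      rw [antipodal_expNeg_expVec, hA3 V g (hle (Submodule.subset_span (by simp)))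
        (hle (Submodule.subset_span (by simp)))]
    have hall : ∀ g, Tendsto (fun V => A V (expVec g)) atTop (𝓝 (B (expVec g))) := by
      intro g
      have h1 : IsClosed {g : OneParticle | Tendsto (fun V => A V (expVec g)) atTop
          (𝓝 (B (expVec g)))} := hclosed.preimage continuous_expVec
      exact h1.closure_subset_iff.2 hdom (dense_finiteAction g)
    refine denseRange_expComb.induction_on
      (p := fun ψ => Tendsto (fun V => A V ψ) atTop (𝓝 (B ψ))) ψ hclosed fun x => ?_
    unfold expComb
    simp only [Finsupp.linearCombination_apply, Finsupp.sum, map_sum, map_smul]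
    exact tendsto_finsetSum _ fun g _ => (hall g).const_smul _
  refine hgoal.congr fun V => ?_
  exact (hA1 V ψ).symm

/-! ### The round two-sphere in spherical coordinates -/

/-- Integration in polar coordinates in a Euclidean space. -/
theorem lintegral_eq_lintegral_toSphere {E : Type*} [NormedAddCommGroup E] [NormedSpace ℝ E]
    [FiniteDimensional ℝ E] [Nontrivial E] [MeasurableSpace E] [BorelSpace E] (μ : Measure E)
    [μ.IsAddHaarMeasure] {d : ℕ} (hd : Module.finrank ℝ E = d + 1) {g : E → ℝ≥0∞}
    (hg : Measurable g) :
    ∫⁻ x, g x ∂μ = ∫⁻ n, (∫⁻ r in Set.Ioi (0 : ℝ),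
      ENNReal.ofReal (r ^ d) * g (r • (n : E))) ∂μ.toSphere := by
  have h1 : ∫⁻ x, g x ∂μ = ∫⁻ x : ({0}ᶜ : Set E), g x ∂(μ.comap (↑)) := by
    rw [lintegral_subtype_comap (measurableSet_singleton _).compl, restrict_compl_singleton]
  have hm : Measurable fun p : Metric.sphere (0 : E) 1 × Set.Ioi (0 : ℝ) =>
      g ((p.2 : ℝ) • (p.1 : E)) := by fun_prop
  have h2 : ∫⁻ x : ({0}ᶜ : Set E), g x ∂(μ.comap (↑)) =
      ∫⁻ p, g ((p.2 : ℝ) • (p.1 : E)) ∂(μ.toSphere.prod (.volumeIoiPow d)) := by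
    have h := μ.measurePreserving_homeomorphUnitSphereProd.lintegral_comp hm
    rw [hd, Nat.add_sub_cancel] at h
    rw [← h]
    refine lintegral_congr fun x => ?_
    have hx : ‖(x : E)‖ ≠ 0 := norm_ne_zero_iff.2 x.2
    simp [smul_smul, mul_inv_cancel₀ hx]
  rw [h1, h2, lintegral_prod _ hm.aemeasurable]
  refine lintegral_congr fun n => ?_
  have hm2 : Measurable fun r : Set.Ioi (0 : ℝ) => g ((r : ℝ) • (n : E)) := by fun_prop
  rw [Measure.volumeIoiPow, lintegral_withDensity_eq_lintegral_mul _ (by fun_prop) hm2]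
  have h3 := lintegral_subtype_comap (μ := (volume : Measure ℝ)) (s := Set.Ioi (0 : ℝ)) measurableSet_Ioi
    (fun r : ℝ => ENNReal.ofReal (r ^ d) * g (r • (n : E)))
  exact h3

/-- Three-dimensional Euclidean space, which contains the celestial sphere of the observer. -/
abbrev E3 := EuclideanSpace ℝ (Fin 3)

/-- The round two-sphere. -/
abbrev TwoSphere := Metric.sphere (0 : E3) 1

/-- The area measure of the round two-sphere. -/
def sphereMeasure : Measure TwoSphere := (volume : Measure E3).toSphere

instance : IsFiniteMeasure sphereMeasure := by unfold sphereMeasure; infer_instance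

theorem norm_vec3_sq (x y z : ℝ) : ‖(!₂[x, y, z] : E3)‖ ^ 2 = x ^ 2 + y ^ 2 + z ^ 2 := by
  rw [EuclideanSpace.norm_sq_eq]
  simp [Fin.sum_univ_three]

/-- The point of the two-sphere with spherical coordinates `(θ, φ)`; the polar axis is the first
coordinate axis. -/
def sphericalPoint (θ φ : ℝ) : TwoSphere :=
  ⟨!₂[Real.cos θ, Real.sin θ * Real.cos φ, Real.sin θ * Real.sin φ], by
    rw [mem_sphere_zero_iff_norm, ← sq_eq_sq₀ (norm_nonneg _) zero_le_one, norm_vec3_sq]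
    nlinarith [Real.sin_sq_add_cos_sq θ, Real.sin_sq_add_cos_sq φ]⟩

theorem coe_sphericalPoint (θ φ : ℝ) : (sphericalPoint θ φ : E3) =
    !₂[Real.cos θ, Real.sin θ * Real.cos φ, Real.sin θ * Real.sin φ] := rfl

theorem continuous_sphericalPoint : Continuous fun p : ℝ × ℝ => sphericalPoint p.1 p.2 := by
  refine Continuous.subtype_mk ?_ _
  refine (PiLp.continuous_toLp 2 _).comp (continuous_pi fun i => ?_)
  fin_cases i <;> simp <;> fun_prop

theorem lintegral_E3 {g : E3 → ℝ≥0∞} (hg : Measurable g) :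
    ∫⁻ v, g v = ∫⁻ x : ℝ, ∫⁻ p : ℝ × ℝ, g !₂[x, p.1, p.2] := by
  rw [← (PiLp.volume_preserving_toLp (Fin 3)).lintegral_comp hg]
  change ∫⁻ a, (g ∘ WithLp.toLp 2) a = _
  rw [← (volume_preserving_piFinSuccAbove (fun _ : Fin 3 => ℝ) 0).symm.lintegral_comp
      (hg.comp (PiLp.volume_preserving_toLp (Fin 3)).measurable)]
  have hm := hg.comp ((PiLp.volume_preserving_toLp (Fin 3)).measurable.comp
    (volume_preserving_piFinSuccAbove (fun _ : Fin 3 => ℝ) 0).symm.measurable)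
  change ∫⁻ a : ℝ × (Fin 2 → ℝ), (g ∘ WithLp.toLp 2 ∘
    (MeasurableEquiv.piFinSuccAbove (fun _ : Fin 3 => ℝ) 0).symm) a = _
  rw [Measure.volume_eq_prod, lintegral_prod _ hm.aemeasurable]
  refine lintegral_congr fun x => ?_
  refine ((volume_preserving_finTwoArrow ℝ).symm.lintegral_comp
    (hm.comp measurable_prodMk_left)).symm.trans ?_
  refine lintegral_congr fun p => ?_
  simp only [Function.comp]
  congr 2
  ext i
  fin_cases i <;> rfl

/-- Polar coordinates on the half-plane `ρ > 0`. -/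
theorem lintegral_polar_halfplane {f : ℝ × ℝ → ℝ≥0∞} (hf : Measurable f) :
    ∫⁻ x : ℝ, ∫⁻ ρ in Set.Ioi (0 : ℝ), f (x, ρ) =
      ∫⁻ r in Set.Ioi (0 : ℝ), ∫⁻ θ in Set.Ioo 0 Real.pi,
        ENNReal.ofReal r * f (r * Real.cos θ, r * Real.sin θ) := by
  have hS : MeasurableSet {p : ℝ × ℝ | 0 < p.2} := measurableSet_lt measurable_const measurable_snd
  have h1 : ∫⁻ x : ℝ, ∫⁻ ρ in Set.Ioi (0 : ℝ), f (x, ρ) =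
      ∫⁻ p : ℝ × ℝ, {p : ℝ × ℝ | 0 < p.2}.indicator f p := by
    rw [Measure.volume_eq_prod, lintegral_prod _ (hf.indicator hS).aemeasurable]
    refine lintegral_congr fun x => ?_
    rw [← lintegral_indicator measurableSet_Ioi]
    rfl
  rw [h1, ← lintegral_comp_polarCoord_symm]
  simp only [polarCoord_target, polarCoord_symm_apply, smul_eq_mul]
  rw [Measure.volume_eq_prod, ← Measure.prod_restrict, lintegral_prod]
  · refine setLIntegral_congr_fun measurableSet_Ioi fun r hr => ?_
    rw [← lintegral_indicator measurableSet_Ioo, ← lintegral_indicator measurableSet_Ioo]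
    refine lintegral_congr fun θ => ?_
    have hr' : 0 < r := hr
    by_cases h : θ ∈ Set.Ioo (-Real.pi) Real.pi
    · rw [Set.indicator_of_mem h]
      by_cases h0 : 0 < θ
      · rw [Set.indicator_of_mem (Set.mem_Ioo.2 ⟨h0, (Set.mem_Ioo.1 h).2⟩), Set.indicator_of_mem]
        exact mul_pos hr' (Real.sin_pos_of_pos_of_lt_pi h0 (Set.mem_Ioo.1 h).2)
      · rw [Set.indicator_of_notMem (s := Set.Ioo 0 Real.pi) (fun h' => h0 (Set.mem_Ioo.1 h').1),
          Set.indicator_of_notMem, mul_zero]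
        intro h'
        have h2 := Real.sin_nonpos_of_nonpos_of_neg_pi_le (not_lt.1 h0) (Set.mem_Ioo.1 h).1.le
        have h3 : 0 < r * Real.sin θ := h'
        nlinarith
    · rw [Set.indicator_of_notMem h, Set.indicator_of_notMem]
      exact fun h' => h (Set.mem_Ioo.2
        ⟨by linarith [(Set.mem_Ioo.1 h').1, Real.pi_pos], (Set.mem_Ioo.1 h').2⟩)
  · have hm : Measurable fun p : ℝ × ℝ => (p.1 * Real.cos p.2, p.1 * Real.sin p.2) := by fun_prop
    exact ((by fun_prop : Measurable fun p : ℝ × ℝ => ENNReal.ofReal p.1).mul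
      ((hf.indicator hS).comp hm)).aemeasurable

/-- Polar coordinates with the angle in `(0, 2π)`. -/
theorem lintegral_polar_plane {f : ℝ × ℝ → ℝ≥0∞} (hf : Measurable f) :
    ∫⁻ p, f p = ∫⁻ ρ in Set.Ioi (0 : ℝ), ∫⁻ φ in Set.Ioo 0 (2 * Real.pi),
        ENNReal.ofReal ρ * f (ρ * Real.cos φ, ρ * Real.sin φ) := by
  have h0 : ∫⁻ p, f p = ∫⁻ p : ℝ × ℝ, f (-p) := (lintegral_neg_eq_self f).symm
  rw [h0, ← lintegral_comp_polarCoord_symm]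
  simp only [polarCoord_target, polarCoord_symm_apply, smul_eq_mul]
  rw [Measure.volume_eq_prod, ← Measure.prod_restrict, lintegral_prod]
  · refine lintegral_congr fun ρ => ?_
    have hmp := measurePreserving_sub_right (volume : Measure ℝ) Real.pi
    have h2 := hmp.restrict_preimage (s := Set.Ioo (-Real.pi) Real.pi) measurableSet_Ioo
    have h3 : (fun x => x - Real.pi) ⁻¹' Set.Ioo (-Real.pi) Real.pi = Set.Ioo 0 (2 * Real.pi) := by
      rw [Set.preimage_sub_const_Ioo]
      congr 1 <;> ring
    rw [h3] at h2
    have hm : Measurable fun θ : ℝ => -(ρ * Real.cos θ, ρ * Real.sin θ) := by fun_prop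
    refine (h2.lintegral_comp ((hf.comp hm).const_mul (ENNReal.ofReal ρ))).symm.trans ?_
    refine lintegral_congr fun φ => ?_
    simp [Real.cos_sub_pi, Real.sin_sub_pi]
  · have hm : Measurable fun p : ℝ × ℝ => -(p.1 * Real.cos p.2, p.1 * Real.sin p.2) := by fun_prop
    exact ((by fun_prop : Measurable fun p : ℝ × ℝ => ENNReal.ofReal p.1).mul
      (hf.comp hm)).aemeasurable

instance : SFinite solidAngle := by unfold solidAngle; infer_instance

theorem lintegral_solidAngle {f : ℝ × ℝ → ℝ≥0∞} (hf : Measurable f) :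
    ∫⁻ p, f p ∂solidAngle = ∫⁻ φ in Set.Ioo 0 (2 * Real.pi), ∫⁻ θ in Set.Ioo 0 Real.pi,
      ENNReal.ofReal (Real.sin θ) * f (θ, φ) := by
  unfold solidAngle
  rw [lintegral_withDensity_eq_lintegral_mul _ (by fun_prop) hf, Measure.volume_eq_prod,
    ← Measure.prod_restrict, lintegral_prod_symm]
  · rfl
  · exact ((by fun_prop : Measurable fun p : ℝ × ℝ => ENNReal.ofReal (Real.sin p.1)).mul
      hf).aemeasurable

/-- Spherical coordinates in three-space. -/
theorem lintegral_E3_spherical {g : E3 → ℝ≥0∞} (hg : Measurable g) :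
    ∫⁻ v, g v = ∫⁻ p, (∫⁻ r in Set.Ioi (0 : ℝ),
      ENNReal.ofReal (r ^ 2) * g (r • (sphericalPoint p.1 p.2 : E3))) ∂solidAngle := by
  have hc : Measurable fun q : ℝ × ℝ × ℝ => (!₂[q.1, q.2.1, q.2.2] : E3) := by
    refine (PiLp.continuous_toLp 2 _).measurable.comp (measurable_pi_lambda _ fun i => ?_)
    fin_cases i <;> simp <;> fun_prop
  have hcoe : Measurable fun q : ℝ × ℝ => ((sphericalPoint q.1 q.2 : TwoSphere) : E3) :=
    measurable_subtype_coe.comp continuous_sphericalPoint.measurable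
  have hinner : Measurable fun q : (ℝ × ℝ) × ℝ =>
      ENNReal.ofReal (q.2 ^ 2) * g (q.2 • (sphericalPoint q.1.1 q.1.2 : E3)) :=
    (by fun_prop : Measurable fun q : (ℝ × ℝ) × ℝ => ENNReal.ofReal (q.2 ^ 2)).mul
      (hg.comp (measurable_snd.smul (hcoe.comp measurable_fst)))
  rw [lintegral_E3 hg, lintegral_solidAngle (Measurable.lintegral_prod_right' hinner)]
  have h1 : ∀ x : ℝ, ∫⁻ p : ℝ × ℝ, g !₂[x, p.1, p.2] =
      ∫⁻ ρ in Set.Ioi (0 : ℝ), ∫⁻ φ in Set.Ioo 0 (2 * Real.pi),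
        ENNReal.ofReal ρ * g !₂[x, ρ * Real.cos φ, ρ * Real.sin φ] := fun x =>
    lintegral_polar_plane (f := fun p => g !₂[x, p.1, p.2])
      (hg.comp (hc.comp measurable_prodMk_left))
  simp_rw [h1]
  have hm3 : Measurable fun q : (ℝ × ℝ) × ℝ =>
      ENNReal.ofReal q.1.2 * g !₂[q.1.1, q.1.2 * Real.cos q.2, q.1.2 * Real.sin q.2] := by
    have : Measurable fun q : (ℝ × ℝ) × ℝ =>
      ((q.1.1, q.1.2 * Real.cos q.2, q.1.2 * Real.sin q.2) : ℝ × ℝ × ℝ) := by fun_prop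
    exact (by fun_prop : Measurable fun q : (ℝ × ℝ) × ℝ => ENNReal.ofReal q.1.2).mul
      (hg.comp (hc.comp this))
  rw [lintegral_polar_halfplane (f := fun q => ∫⁻ φ in Set.Ioo 0 (2 * Real.pi),
        ENNReal.ofReal q.2 * g !₂[q.1, q.2 * Real.cos φ, q.2 * Real.sin φ])
      (Measurable.lintegral_prod_right' hm3)]
  -- move the integration over `φ` outside
  have hA : Measurable fun q : (ℝ × ℝ) × ℝ => ENNReal.ofReal q.1.1 *
      (ENNReal.ofReal (q.1.1 * Real.sin q.1.2) * g !₂[q.1.1 * Real.cos q.1.2,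
        q.1.1 * Real.sin q.1.2 * Real.cos q.2, q.1.1 * Real.sin q.1.2 * Real.sin q.2]) := by
    have : Measurable fun q : (ℝ × ℝ) × ℝ => (q.1.1 * Real.cos q.1.2,
      q.1.1 * Real.sin q.1.2 * Real.cos q.2, q.1.1 * Real.sin q.1.2 * Real.sin q.2) := by
      fun_prop
    exact (by fun_prop : Measurable fun q : (ℝ × ℝ) × ℝ => ENNReal.ofReal q.1.1).mul
      ((by fun_prop : Measurable fun q : (ℝ × ℝ) × ℝ =>
        ENNReal.ofReal (q.1.1 * Real.sin q.1.2)).mul (hg.comp (hc.comp this)))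
  calc _ = ∫⁻ r in Set.Ioi (0 : ℝ), ∫⁻ θ in Set.Ioo 0 Real.pi, ∫⁻ φ in Set.Ioo 0 (2 * Real.pi),
        ENNReal.ofReal r * (ENNReal.ofReal (r * Real.sin θ) *
          g !₂[r * Real.cos θ, r * Real.sin θ * Real.cos φ, r * Real.sin θ * Real.sin φ]) := by
        refine lintegral_congr fun r => lintegral_congr fun θ => ?_
        exact (lintegral_const_mul _
          (hm3.comp (measurable_prodMk_left (x := (r * Real.cos θ, r * Real.sin θ))))).symm
    _ = ∫⁻ r in Set.Ioi (0 : ℝ), ∫⁻ φ in Set.Ioo 0 (2 * Real.pi), ∫⁻ θ in Set.Ioo 0 Real.pi,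
        ENNReal.ofReal r * (ENNReal.ofReal (r * Real.sin θ) *
          g !₂[r * Real.cos θ, r * Real.sin θ * Real.cos φ, r * Real.sin θ * Real.sin φ]) := by
        refine lintegral_congr fun r => ?_
        rw [lintegral_lintegral_swap]
        exact (hA.comp (f := fun p : ℝ × ℝ => ((r, p.1), p.2)) (by fun_prop)).aemeasurable
    _ = ∫⁻ φ in Set.Ioo 0 (2 * Real.pi), ∫⁻ r in Set.Ioi (0 : ℝ), ∫⁻ θ in Set.Ioo 0 Real.pi,
        ENNReal.ofReal r * (ENNReal.ofReal (r * Real.sin θ) *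
          g !₂[r * Real.cos θ, r * Real.sin θ * Real.cos φ, r * Real.sin θ * Real.sin φ]) := by
        rw [lintegral_lintegral_swap]
        refine (Measurable.lintegral_prod_right' (f := fun q : (ℝ × ℝ) × ℝ =>
          ENNReal.ofReal q.1.1 * (ENNReal.ofReal (q.1.1 * Real.sin q.2) *
            g !₂[q.1.1 * Real.cos q.2, q.1.1 * Real.sin q.2 * Real.cos q.1.2,
              q.1.1 * Real.sin q.2 * Real.sin q.1.2])) ?_).aemeasurable
        exact hA.comp (f := fun p : (ℝ × ℝ) × ℝ => ((p.1.1, p.2), p.1.2)) (by fun_prop)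
    _ = ∫⁻ φ in Set.Ioo 0 (2 * Real.pi), ∫⁻ θ in Set.Ioo 0 Real.pi, ∫⁻ r in Set.Ioi (0 : ℝ),
        ENNReal.ofReal r * (ENNReal.ofReal (r * Real.sin θ) *
          g !₂[r * Real.cos θ, r * Real.sin θ * Real.cos φ, r * Real.sin θ * Real.sin φ]) := by
        refine lintegral_congr fun φ => ?_
        rw [lintegral_lintegral_swap]
        exact (hA.comp (f := fun p : ℝ × ℝ => ((p.1, p.2), φ)) (by fun_prop)).aemeasurable
    _ = _ := by
        refine lintegral_congr fun φ => lintegral_congr fun θ => ?_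
        rw [← lintegral_const_mul]
        · refine setLIntegral_congr_fun measurableSet_Ioi fun r hr => ?_
          have hr' : 0 < r := hr
          have h2 : (r • (sphericalPoint θ φ : E3)) =
              !₂[r * Real.cos θ, r * Real.sin θ * Real.cos φ, r * Real.sin θ * Real.sin φ] := by
            rw [coe_sphericalPoint]
            ext i
            fin_cases i <;> simp [mul_assoc]
          simp only [h2]
          rw [← mul_assoc, ← mul_assoc, ← ENNReal.ofReal_mul hr'.le,
            mul_comm (ENNReal.ofReal (Real.sin θ)), ← ENNReal.ofReal_mul (by positivity)]
          congr 2
          ring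
        · exact hinner.comp (measurable_prodMk_left (x := (θ, φ)))

/-- A measure on the unit sphere is the surface measure if it yields integration in polar
coordinates. -/
theorem eq_toSphere_of_lintegral {E : Type*} [NormedAddCommGroup E] [NormedSpace ℝ E]
    [FiniteDimensional ℝ E] [Nontrivial E] [MeasurableSpace E] [BorelSpace E] (μ : Measure E)
    [μ.IsAddHaarMeasure] {d : ℕ} (hd : Module.finrank ℝ E = d + 1)
    {ν : Measure (Metric.sphere (0 : E) 1)}
    (hν : ∀ g : E → ℝ≥0∞, Measurable g → ∫⁻ x, g x ∂μ = ∫⁻ n, (∫⁻ r in Set.Ioi (0 : ℝ),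
      ENNReal.ofReal (r ^ d) * g (r • (n : E))) ∂ν) : ν = μ.toSphere := by
  refine Measure.ext_of_lintegral _ fun G hG => ?_
  classical
  -- test on `g (r n) = G n` for `0 < r < 1`; its radial integral is positive and finite
  let g : E → ℝ≥0∞ := fun v => if h : v ∈ ({0}ᶜ : Set E) then
    (if ‖v‖ < 1 then G (homeomorphUnitSphereProd E ⟨v, h⟩).1 else 0) else 0
  have hg : Measurable g := by
    have hin : Measurable fun v : ({0}ᶜ : Set E) =>
        if ‖(v : E)‖ < 1 then G (homeomorphUnitSphereProd E v).1 else 0 :=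
      Measurable.ite (measurableSet_lt (by fun_prop) measurable_const)
        (hG.comp (measurable_fst.comp (homeomorphUnitSphereProd E).measurable)) measurable_const
    exact Measurable.dite (s := ({0}ᶜ : Set E)) hin
      (measurable_const (a := (0 : ℝ≥0∞))) (measurableSet_singleton _).compl
  have hval : ∀ (n : Metric.sphere (0 : E) 1) (r : ℝ), 0 < r →
      g (r • (n : E)) = if r < 1 then G n else 0 := by
    intro n r hr
    have hn : ‖(n : E)‖ = 1 := mem_sphere_zero_iff_norm.1 n.2
    have h0 : r • (n : E) ∈ ({0}ᶜ : Set E) := by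
      refine smul_ne_zero hr.ne' ?_
      rw [← norm_ne_zero_iff, hn]
      exact one_ne_zero
    have h1 : ‖r • (n : E)‖ = r := by rw [norm_smul, hn, mul_one, Real.norm_of_nonneg hr.le]
    have h2 : (homeomorphUnitSphereProd E ⟨r • (n : E), h0⟩).1 = n := by
      apply Subtype.ext
      simp only [homeomorphUnitSphereProd_apply_fst_coe, h1]
      rw [smul_smul, inv_mul_cancel₀ hr.ne', one_smul]
    simp only [g, dif_pos h0, h1, h2]
  have hmr : Measurable fun r : ℝ => ENNReal.ofReal (r ^ d) * if r < 1 then (1 : ℝ≥0∞) else 0 :=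
    (by fun_prop : Measurable fun r : ℝ => ENNReal.ofReal (r ^ d)).mul
        (Measurable.ite measurableSet_Iio measurable_const measurable_const)
  have hI : ∀ n : Metric.sphere (0 : E) 1,
      ∫⁻ r in Set.Ioi (0 : ℝ), ENNReal.ofReal (r ^ d) * g (r • (n : E)) =
      (∫⁻ r in Set.Ioi (0 : ℝ), ENNReal.ofReal (r ^ d) * if r < 1 then 1 else 0) * G n := by
    intro n
    rw [← lintegral_mul_const _ hmr]
    refine setLIntegral_congr_fun measurableSet_Ioi fun r hr => ?_
    simp only [hval n r hr]
    split_ifs <;> simp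
  have h2 := lintegral_eq_lintegral_toSphere μ hd hg
  rw [hν g hg] at h2
  simp only [hI] at h2
  rw [lintegral_const_mul _ hG, lintegral_const_mul _ hG] at h2
  refine (ENNReal.mul_right_inj ?_ ?_).1 h2
  · intro h0
    rw [lintegral_eq_zero_iff hmr] at h0
    have h3 := (ae_restrict_iff' measurableSet_Ioi).1 h0
    have h4 : volume (Set.Ioo (0 : ℝ) 1) = 0 := by
      refine measure_mono_null (fun r hr => ?_) (ae_iff.1 h3)
      have : ¬ (ENNReal.ofReal (r ^ d) = 0) := by
        rw [ENNReal.ofReal_eq_zero, not_le]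
        exact pow_pos hr.1 d
      simp only [Set.mem_ofPred_eq, Set.mem_Ioi, hr.1, hr.2, if_true, mul_one, Pi.zero_apply, this,
        imp_false, not_true_eq_false, not_false_eq_true]
    simp at h4
  · refine ((setLIntegral_mono' (g := (Set.Iio (1 : ℝ)).indicator 1) measurableSet_Ioi
      ?_).trans_lt ?_).ne
    · intro r hr
      have hr' : 0 < r := hr
      by_cases h : r < 1
      · simp only [h, if_true, mul_one, Set.indicator_of_mem (show r ∈ Set.Iio (1 : ℝ) from h),
          Pi.one_apply, ENNReal.ofReal_le_one]
        exact pow_le_one₀ hr'.le h.le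
      · simp [h]
    · rw [lintegral_indicator_one measurableSet_Iio, Measure.restrict_apply measurableSet_Iio,
        Set.inter_comm, Set.Ioi_inter_Iio]
      simp

/-- The solid-angle measure is the area measure in spherical coordinates. -/
theorem map_solidAngle :
    solidAngle.map (fun p => sphericalPoint p.1 p.2) = sphereMeasure := by
  have hmeas : Measurable fun p : ℝ × ℝ => sphericalPoint p.1 p.2 :=
    continuous_sphericalPoint.measurable
  refine eq_toSphere_of_lintegral (volume : Measure E3) (d := 2) (by simp) fun g hg => ?_
  rw [lintegral_E3_spherical hg, lintegral_map _ hmeas]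
  have hinner : Measurable fun q : TwoSphere × ℝ =>
      ENNReal.ofReal (q.2 ^ 2) * g (q.2 • (q.1 : E3)) := by fun_prop
  exact Measurable.lintegral_prod_right' hinner

/-! ### Lorentz invariance of the measure on the light cone -/

/-- Four-dimensional Euclidean space, which parametrizes the light cone by its spatial part. -/
abbrev E4 := EuclideanSpace ℝ (Fin 4)

open Matrix in
theorem Observer.frame_gram (o : Observer) (i j : Fin 5) :
    -(o.frame 0 i * o.frame 0 j) + ∑ k : Fin 4, o.frame k.succ i * o.frame k.succ j =
      if i = j then (if i = 0 then -1 else 1) else 0 := by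
  have h := o.isometry (Pi.single i 1) (Pi.single j 1)
  simp only [Matrix.mulVec_single_one, mdot, Matrix.col_apply] at h
  rw [h]
  by_cases hij : i = j
  · subst hij
    refine Fin.cases ?_ (fun k => ?_) i
    · simp
    · simp [Pi.single_apply]
  · rw [if_neg hij]
    have : ∀ k : Fin 5, (Pi.single i 1 : Fin 5 → ℝ) k * (Pi.single j 1 : Fin 5 → ℝ) k = 0 := by
      intro k
      simp only [Pi.single_apply]
      split_ifs with h1 h2
      · exact absurd (h1.symm.trans h2) hij
      all_goals simp
    simp [this]

/-- The sign of the coordinate direction `i` in the scalar product. -/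
def signAt (i : Fin 5) : ℝ := if i = 0 then -1 else 1

/-- The inverse `η Λᵀ η` of a Lorentz matrix. -/
def Observer.invMatrix (o : Observer) : Matrix (Fin 5) (Fin 5) ℝ :=
  Matrix.of fun i j => signAt i * signAt j * o.frame j i

theorem Observer.invMatrix_mul (o : Observer) : o.invMatrix * o.frame = 1 := by
  ext i j
  have h := o.frame_gram i j
  have h2 : (o.invMatrix * o.frame) i j = signAt i * (-(o.frame 0 i * o.frame 0 j) +
      ∑ k : Fin 4, o.frame k.succ i * o.frame k.succ j) := by
    rw [Matrix.mul_apply, Fin.sum_univ_succ, mul_add, Finset.mul_sum]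
    simp only [Observer.invMatrix, Matrix.of_apply]
    congr 1
    · simp [signAt]
    · exact Finset.sum_congr rfl fun k _ => by simp [signAt]
  rw [h2, h, Matrix.one_apply]
  unfold signAt
  split_ifs <;> simp

theorem Observer.mul_invMatrix (o : Observer) : o.frame * o.invMatrix = 1 :=
  mul_eq_one_comm.1 o.invMatrix_mul

/-- The observer of the inverse Lorentz frame. -/
def Observer.inv (o : Observer) : Observer where
  frame := o.invMatrix
  isometry x y := by
    rw [← o.isometry, Matrix.mulVec_mulVec, Matrix.mulVec_mulVec, o.mul_invMatrix,
      Matrix.one_mulVec, Matrix.one_mulVec]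
  orthochronous := by
    simpa [Observer.invMatrix, signAt] using o.orthochronous

theorem Observer.inv_mulVec_frame (o : Observer) (x : Mink) :
    o.inv.frame.mulVec (o.frame.mulVec x) = x := by
  rw [Matrix.mulVec_mulVec]
  exact (congrArg (fun M => M.mulVec x) o.invMatrix_mul).trans (Matrix.one_mulVec x)

theorem Observer.frame_mulVec_inv (o : Observer) (x : Mink) :
    o.frame.mulVec (o.inv.frame.mulVec x) = x := by
  rw [Matrix.mulVec_mulVec]
  exact (congrArg (fun M => M.mulVec x) o.mul_invMatrix).trans (Matrix.one_mulVec x)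

theorem Observer.row_zero (o : Observer) :
    ∑ k : Fin 4, o.frame 0 k.succ ^ 2 = o.frame 0 0 ^ 2 - 1 := by
  have h := o.inv.frame_gram 0 0
  simp only [Observer.inv, Observer.invMatrix, Matrix.of_apply, signAt, if_true,
    Fin.succ_ne_zero, if_false] at h
  have h2 : ∑ k : Fin 4, o.frame 0 k.succ ^ 2 =
      ∑ x : Fin 4, 1 * -1 * o.frame 0 x.succ * (1 * -1 * o.frame 0 x.succ) :=
    Finset.sum_congr rfl fun k _ => by ring
  rw [h2]
  linarith

theorem IsFutureNull.sum_sq {v : Mink} (h : IsFutureNull v) :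
    ∑ k : Fin 4, v k.succ ^ 2 = v 0 ^ 2 := by
  have h2 : -(v 0 * v 0) + ∑ k : Fin 4, v k.succ * v k.succ = 0 := h.2
  simp only [pow_two]
  linarith

theorem Observer.isFutureNull_mulVec (o : Observer) {w : Mink} (hw : IsFutureNull w) :
    IsFutureNull (o.frame.mulVec w) := by
  refine ⟨?_, by rw [o.isometry]; exact hw.2⟩
  have h1 : o.frame.mulVec w 0 = o.frame 0 0 * w 0 + ∑ k : Fin 4, o.frame 0 k.succ * w k.succ := by
    simp only [Matrix.mulVec, dotProduct]
    rw [Fin.sum_univ_succ]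
  have h2 := Finset.sum_mul_sq_le_sq_mul_sq Finset.univ (fun k : Fin 4 => o.frame 0 k.succ)
    (fun k => w k.succ)
  rw [o.row_zero, hw.sum_sq] at h2
  rw [h1]
  have h3 := o.orthochronous
  have h4 := hw.1
  set s := ∑ k : Fin 4, o.frame 0 k.succ * w k.succ
  have h5 : s ^ 2 < (o.frame 0 0 * w 0) ^ 2 := by nlinarith [pow_pos h4 2]
  have h6 := abs_lt_of_sq_lt_sq h5 (by positivity)
  linarith [(abs_lt.1 h6).1]

/-- The null vector with spatial part `x`. -/
def nullLift (x : E4) : Mink := Fin.cons ‖x‖ fun i => x i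

theorem isFutureNull_nullLift {x : E4} (hx : x ≠ 0) : IsFutureNull (nullLift x) := by
  refine ⟨by simpa [nullLift] using hx, ?_⟩
  have h := EuclideanSpace.norm_sq_eq x
  simp only [Real.norm_eq_abs, sq_abs] at h
  simp only [mdot, nullLift, Fin.cons_zero, Fin.cons_succ, ← pow_two]
  linarith

/-- The spatial part of a vector. -/
def spatial (v : Mink) : E4 := WithLp.toLp 2 fun i => v i.succ

theorem IsFutureNull.norm_spatial {v : Mink} (h : IsFutureNull v) : ‖spatial v‖ = v 0 := by
  rw [← sq_eq_sq₀ (norm_nonneg _) h.1.le, EuclideanSpace.norm_sq_eq, ← h.sum_sq]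
  simp [spatial]

theorem IsFutureNull.nullLift_spatial {v : Mink} (h : IsFutureNull v) :
    nullLift (spatial v) = v := by
  funext i
  refine Fin.cases ?_ (fun k => ?_) i
  · simpa [nullLift] using h.norm_spatial
  · simp [nullLift, spatial]

theorem spatial_nullLift (x : E4) : spatial (nullLift x) = x := by
  ext i
  simp [spatial, nullLift]

/-- The action of a Lorentz frame on the light cone, parametrized by spatial parts. -/
def Observer.coneMap (o : Observer) (x : E4) : E4 := spatial (o.frame.mulVec (nullLift x))

theorem Observer.nullLift_coneMap (o : Observer) {x : E4} (hx : x ≠ 0) :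
    nullLift (o.coneMap x) = o.frame.mulVec (nullLift x) :=
  (o.isFutureNull_mulVec (isFutureNull_nullLift hx)).nullLift_spatial

theorem Observer.coneMap_ne_zero (o : Observer) {x : E4} (hx : x ≠ 0) : o.coneMap x ≠ 0 := by
  have h := o.isFutureNull_mulVec (isFutureNull_nullLift hx)
  rw [← norm_ne_zero_iff]
  exact (h.norm_spatial.trans_ne h.1.ne')

theorem Observer.inv_coneMap (o : Observer) {x : E4} (hx : x ≠ 0) :
    o.inv.coneMap (o.coneMap x) = x := by
  unfold Observer.coneMap at *
  have h := o.nullLift_coneMap hx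
  unfold Observer.coneMap at h
  rw [h, o.inv_mulVec_frame, spatial_nullLift]

theorem Observer.coneMap_inv (o : Observer) {x : E4} (hx : x ≠ 0) :
    o.coneMap (o.inv.coneMap x) = x := by
  have h := o.inv.nullLift_coneMap hx
  unfold Observer.coneMap at *
  rw [h, o.frame_mulVec_inv, spatial_nullLift]

/-- The energy `Λ(1, x/|x|)⁰` in the new frame of the null vector with spatial direction `x`. -/
def Observer.dilation (o : Observer) (x : E4) : ℝ :=
  o.frame 0 0 + ‖x‖⁻¹ * ∑ k : Fin 4, o.frame 0 k.succ * x k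

theorem Observer.dilation_mul_norm (o : Observer) {x : E4} (hx : x ≠ 0) :
    o.dilation x * ‖x‖ = o.frame.mulVec (nullLift x) 0 := by
  have h0 : ‖x‖ ≠ 0 := norm_ne_zero_iff.2 hx
  simp only [Matrix.mulVec, dotProduct]
  rw [Fin.sum_univ_succ]
  simp only [nullLift, Fin.cons_zero, Fin.cons_succ, Observer.dilation]
  field_simp

theorem Observer.dilation_pos (o : Observer) {x : E4} (hx : x ≠ 0) : 0 < o.dilation x := by
  have h := (o.isFutureNull_mulVec (isFutureNull_nullLift hx)).1
  rw [← o.dilation_mul_norm hx] at h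
  exact pos_of_mul_pos_left h (norm_nonneg _)

/-- The Jacobian matrix of the action of a Lorentz frame on the light cone. -/
def Observer.jacobian (o : Observer) (x : E4) : Matrix (Fin 4) (Fin 4) ℝ :=
  Matrix.of fun i j => o.frame i.succ 0 * (‖x‖⁻¹ * x j) + o.frame i.succ j.succ

/-- On spatial parts the frame acts as `y ↦ ‖y‖ b + A y`, in terms of its blocks `b` and `A`. -/
theorem Observer.hasFDerivAt_coneMap (o : Observer) {x : E4} (hx : x ≠ 0) :
    HasFDerivAt o.coneMap (Matrix.toEuclideanCLM (𝕜 := ℝ) (o.jacobian x)) x := by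
  rw [← hasFDerivWithinAt_univ, hasFDerivWithinAt_euclidean]
  intro i
  rw [hasFDerivWithinAt_univ]
  have hn : HasFDerivAt (fun y : E4 => ‖y‖) (‖x‖⁻¹ • innerSL ℝ x) x := by
    have h := (hasStrictFDerivAt_norm_sq x).hasFDerivAt.sqrt (pow_ne_zero 2 (norm_ne_zero_iff.2 hx))
    simp only [Real.sqrt_sq (norm_nonneg _)] at h
    refine h.congr_fderiv ?_
    ext v
    simp
    field_simp
  have h1 : HasFDerivAt (fun y : E4 => o.frame i.succ 0 * ‖y‖ +
      ∑ j : Fin 4, o.frame i.succ j.succ * y j)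
      (o.frame i.succ 0 • (‖x‖⁻¹ • innerSL ℝ x) +
        ∑ j : Fin 4, o.frame i.succ j.succ • (EuclideanSpace.proj j : E4 →L[ℝ] ℝ)) x := by
    refine (hn.const_mul _).add (HasFDerivAt.fun_sum fun j _ => ?_)
    exact ((EuclideanSpace.proj j : E4 →L[ℝ] ℝ).hasFDerivAt).const_mul _
  have h2 : (fun y : E4 => o.coneMap y i) = fun y : E4 => o.frame i.succ 0 * ‖y‖ +
      ∑ j : Fin 4, o.frame i.succ j.succ * y j := by
    funext y
    simp only [Observer.coneMap, spatial, Matrix.mulVec, dotProduct]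
    rw [Fin.sum_univ_succ]
    simp [nullLift]
  rw [h2]
  refine h1.congr_fderiv ?_
  ext v
  refine Eq.trans ?_ (show (o.jacobian x).mulVec (fun j => v j) i = _ from rfl)
  simp only [Matrix.mulVec, dotProduct, Observer.jacobian, Matrix.of_apply, add_mul,
    Finset.sum_add_distrib]
  simp [PiLp.inner_apply, Finset.mul_sum]
  exact Finset.sum_congr rfl fun j _ => by ring

/-- From the Lorentz relations: `JᵀJ = 1 - u uᵀ + c cᵀ` with `u = x / ‖x‖`, whose determinant is
`(u·c)²` by the Weinstein–Aronszajn identity. -/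
theorem Observer.abs_det_jacobian (o : Observer) {x : E4} (hx : x ≠ 0) :
    |(o.jacobian x).det| = o.dilation x := by
  have h0 : ‖x‖ ≠ 0 := norm_ne_zero_iff.2 hx
  set u : Fin 4 → ℝ := fun j => ‖x‖⁻¹ * x j with hu
  set c : Fin 4 → ℝ := fun j => o.frame 0 j.succ + o.frame 0 0 * u j with hc
  have huu : ∑ j, u j * u j = 1 := by
    have h := EuclideanSpace.norm_sq_eq x
    simp only [Real.norm_eq_abs, sq_abs] at h
    calc ∑ j, u j * u j = ‖x‖⁻¹ ^ 2 * ∑ j, x j ^ 2 := by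
          rw [Finset.mul_sum]; exact Finset.sum_congr rfl fun j _ => by rw [hu]; ring
      _ = 1 := by rw [← h]; field_simp
  have huc : ∑ j, u j * c j = o.dilation x := by
    calc ∑ j, u j * c j = o.frame 0 0 * ∑ j, u j * u j + ∑ j, ‖x‖⁻¹ * (o.frame 0 j.succ * x j) := by
          rw [Finset.mul_sum, ← Finset.sum_add_distrib]
          exact Finset.sum_congr rfl fun j _ => by rw [hc, hu]; ring
      _ = o.dilation x := by rw [huu, ← Finset.mul_sum, Observer.dilation]; ring
  -- `JᵀJ = 1 - u uᵀ + c cᵀ`, a rank-two perturbation of the identity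
  let U : Matrix (Fin 4) (Fin 2) ℝ := Matrix.of fun i => ![-u i, c i]
  let W : Matrix (Fin 2) (Fin 4) ℝ := Matrix.of ![u, c]
  have hgram : (o.jacobian x).transpose * o.jacobian x = 1 + U * W := by
    ext i j
    have h1 := o.frame_gram i.succ j.succ
    have h2 := o.frame_gram 0 i.succ
    have h3 := o.frame_gram 0 j.succ
    have h4 := o.frame_gram 0 0
    simp only [Fin.succ_ne_zero, (Fin.succ_ne_zero _).symm, if_false, if_true,
      Fin.succ_inj] at h1 h2 h3 h4
    simp only [Matrix.mul_apply, Matrix.transpose_apply, Matrix.add_apply, Matrix.one_apply,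
      Fin.sum_univ_two, U, W, Matrix.of_apply, Matrix.cons_val_zero, Matrix.cons_val_one,
      Observer.jacobian]
    calc ∑ k : Fin 4, (o.frame k.succ 0 * u i + o.frame k.succ i.succ) *
          (o.frame k.succ 0 * u j + o.frame k.succ j.succ)
        = u i * u j * ∑ k : Fin 4, o.frame k.succ 0 * o.frame k.succ 0 +
          u j * ∑ k : Fin 4, o.frame k.succ 0 * o.frame k.succ i.succ +
          u i * ∑ k : Fin 4, o.frame k.succ 0 * o.frame k.succ j.succ +
          ∑ k : Fin 4, o.frame k.succ i.succ * o.frame k.succ j.succ := by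
          rw [Finset.mul_sum, Finset.mul_sum, Finset.mul_sum, ← Finset.sum_add_distrib,
            ← Finset.sum_add_distrib, ← Finset.sum_add_distrib]
          exact Finset.sum_congr rfl fun k _ => by ring
      _ = _ := by
          rw [show ∑ k : Fin 4, o.frame k.succ 0 * o.frame k.succ 0 =
              -1 + o.frame 0 0 * o.frame 0 0 by linarith,
            show ∑ k : Fin 4, o.frame k.succ 0 * o.frame k.succ i.succ =
              o.frame 0 0 * o.frame 0 i.succ by linarith,
            show ∑ k : Fin 4, o.frame k.succ 0 * o.frame k.succ j.succ =
              o.frame 0 0 * o.frame 0 j.succ by linarith,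
            show ∑ k : Fin 4, o.frame k.succ i.succ * o.frame k.succ j.succ =
              o.frame 0 i.succ * o.frame 0 j.succ + if i = j then 1 else 0 by linarith]
          simp only [hc]
          ring
  have hdet : (o.jacobian x).det ^ 2 = o.dilation x ^ 2 := by
    have h1 := congrArg Matrix.det hgram
    rw [Matrix.det_mul, Matrix.det_transpose, Matrix.det_one_add_mul_comm, Matrix.det_fin_two] at h1
    simp only [Matrix.add_apply, Matrix.mul_apply, U, W, Matrix.of_apply, Matrix.cons_val_zero,
      Matrix.cons_val_one, mul_neg, Finset.sum_neg_distrib, huu, huc] at h1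
    have h2 : ∑ j, c j * u j = o.dilation x := by
      rw [← huc]; exact Finset.sum_congr rfl fun j _ => mul_comm _ _
    rw [h2] at h1
    simp at h1
    rw [pow_two, h1]
    ring
  rw [← abs_of_pos (o.dilation_pos hx)]
  exact (sq_eq_sq_iff_abs_eq_abs _ _).1 hdet

/-- Lorentz invariance of the measure `d⁴x / ‖x‖` on the light cone. -/
theorem Observer.lintegral_coneMap (o : Observer) (g : E4 → ℝ≥0∞) :
    ∫⁻ x, g x = ∫⁻ x, ENNReal.ofReal (o.dilation x) * g (o.coneMap x) := by
  have himg : o.coneMap '' {0}ᶜ = {0}ᶜ := by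
    ext y
    constructor
    · rintro ⟨x, hx, rfl⟩
      exact o.coneMap_ne_zero hx
    · intro hy
      exact ⟨o.inv.coneMap y, o.inv.coneMap_ne_zero hy, o.coneMap_inv hy⟩
  have h := lintegral_image_eq_lintegral_abs_det_fderiv_mul (volume : Measure E4)
    (measurableSet_singleton (0 : E4)).compl
    (fun x hx => (o.hasFDerivAt_coneMap hx).hasFDerivWithinAt)
    (fun x hx y hy hxy => by rw [← o.inv_coneMap hx, hxy, o.inv_coneMap hy]) g
  rw [himg, restrict_compl_singleton] at h
  rw [h]
  refine lintegral_congr_ae ?_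
  filter_upwards [compl_mem_ae_iff.2 (measure_singleton (0 : E4))] with x hx
  have h2 : (Matrix.toEuclideanCLM (𝕜 := ℝ) (o.jacobian x)).det = (o.jacobian x).det := by
    have : ((Matrix.toEuclideanCLM (𝕜 := ℝ) (o.jacobian x) : E4 →L[ℝ] E4) : E4 →ₗ[ℝ] E4) =
        Matrix.toLin (EuclideanSpace.basisFun (Fin 4) ℝ).toBasis
          (EuclideanSpace.basisFun (Fin 4) ℝ).toBasis (o.jacobian x) := by
      rfl
    rw [ContinuousLinearMap.det, this, LinearMap.det_toLin]
  simp only [h2, o.abs_det_jacobian hx]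

/-- The point of `𝓘` with the observer's time `t` and direction `n ∈ S²`. -/
def Observer.scriAt (o : Observer) (t : ℝ) (n : TwoSphere) : Mink :=
  o.frame.mulVec ![Real.cosh t, Real.sinh t, (n : E3) 0, (n : E3) 1, (n : E3) 2]

theorem Observer.scriAt_sphericalPoint (o : Observer) (t θ φ : ℝ) :
    o.scriAt t (sphericalPoint θ φ) = o.scri t θ φ := by
  simp [Observer.scriAt, Observer.scri, coe_sphericalPoint]

theorem sum_sq_twoSphere (n : TwoSphere) :
    (n : E3) 0 ^ 2 + (n : E3) 1 ^ 2 + (n : E3) 2 ^ 2 = 1 := by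
  have h := EuclideanSpace.norm_sq_eq (n : E3)
  rw [mem_sphere_zero_iff_norm.1 n.2] at h
  simp [Fin.sum_univ_three] at h
  linarith

theorem isFutureNull_cosh (t : ℝ) (n : TwoSphere) : IsFutureNull
    ![Real.cosh t, Real.sinh t, (n : E3) 0, (n : E3) 1, (n : E3) 2] := by
  refine ⟨Real.cosh_pos t, ?_⟩
  have h := sum_sq_twoSphere n
  have h2 := Real.cosh_sq t
  simp [mdot, Fin.sum_univ_four]
  nlinarith

theorem Observer.isFutureNull_scriAt (o : Observer) (t : ℝ) (n : TwoSphere) :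
    IsFutureNull (o.scriAt t n) := o.isFutureNull_mulVec (isFutureNull_cosh t n)

/-- The point of the round three-sphere in the null direction of the observer's coordinates. -/
def Observer.direction (o : Observer) (p : ℝ × TwoSphere) : ThreeSphere :=
  ⟨(o.scriAt p.1 p.2 0)⁻¹ • spatial (o.scriAt p.1 p.2), by
    have h := o.isFutureNull_scriAt p.1 p.2
    rw [mem_sphere_zero_iff_norm, norm_smul, h.norm_spatial, norm_inv,
      Real.norm_of_nonneg h.1.le, inv_mul_cancel₀ h.1.ne']⟩

theorem Observer.roundSection_direction (o : Observer) (p : ℝ × TwoSphere) :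
    roundSection (o.direction p) = (o.scriAt p.1 p.2 0)⁻¹ • o.scriAt p.1 p.2 := by
  have h := o.isFutureNull_scriAt p.1 p.2
  funext i
  refine Fin.cases ?_ (fun k => ?_) i
  · simp [roundSection, inv_mul_cancel₀ h.1.ne']
  · simp [roundSection, Observer.direction, spatial]

theorem Observer.continuous_scriAt (o : Observer) :
    Continuous fun p : ℝ × TwoSphere => o.scriAt p.1 p.2 := by
  unfold Observer.scriAt
  refine Continuous.matrix_mulVec continuous_const (continuous_pi fun i => ?_)
  fin_cases i <;> simp <;> fun_prop

theorem Observer.continuous_direction (o : Observer) : Continuous o.direction := by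
  have h1 : Continuous fun p : ℝ × TwoSphere => o.scriAt p.1 p.2 0 :=
    (continuous_apply 0).comp o.continuous_scriAt
  have h2 : Continuous fun p : ℝ × TwoSphere => spatial (o.scriAt p.1 p.2) :=
    (PiLp.continuous_toLp 2 _).comp (continuous_pi fun i =>
      (continuous_apply i.succ).comp o.continuous_scriAt)
  exact Continuous.subtype_mk
    ((h1.inv₀ fun p => (o.isFutureNull_scriAt p.1 p.2).1.ne').smul h2) _

theorem lintegral_E4 {g : E4 → ℝ≥0∞} (hg : Measurable g) :
    ∫⁻ v, g v = ∫⁻ w : E3, ∫⁻ x : ℝ, g !₂[x, w 0, w 1, w 2] := by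
  rw [← (PiLp.volume_preserving_toLp (Fin 4)).lintegral_comp hg]
  change ∫⁻ a, (g ∘ WithLp.toLp 2) a = _
  rw [← (volume_preserving_piFinSuccAbove (fun _ : Fin 4 => ℝ) 0).symm.lintegral_comp
      (hg.comp (PiLp.volume_preserving_toLp (Fin 4)).measurable)]
  have hm := hg.comp ((PiLp.volume_preserving_toLp (Fin 4)).measurable.comp
    (volume_preserving_piFinSuccAbove (fun _ : Fin 4 => ℝ) 0).symm.measurable)
  change ∫⁻ a : ℝ × (Fin 3 → ℝ), (g ∘ WithLp.toLp 2 ∘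
    (MeasurableEquiv.piFinSuccAbove (fun _ : Fin 4 => ℝ) 0).symm) a = _
  rw [Measure.volume_eq_prod, lintegral_prod_symm _ hm.aemeasurable]
  have hm2 := Measurable.lintegral_prod_left' (μ := (volume : Measure ℝ)) hm
  rw [← (PiLp.volume_preserving_ofLp (Fin 3)).lintegral_comp hm2]
  refine lintegral_congr fun w => lintegral_congr fun x => ?_
  simp only [Function.comp]
  congr 2
  ext i
  fin_cases i <;> rfl

theorem lintegral_sinh {r : ℝ} (hr : 0 < r) (f : ℝ → ℝ≥0∞) :
    ∫⁻ x, f x = ∫⁻ t, ENNReal.ofReal (r * Real.cosh t) * f (r * Real.sinh t) := by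
  have h := lintegral_image_eq_lintegral_abs_deriv_mul (f := fun t => r * Real.sinh t)
    (f' := fun t => r * Real.cosh t) MeasurableSet.univ
    (fun t _ => ((Real.hasDerivAt_sinh t).const_mul r).hasDerivWithinAt)
    (fun t _ s _ hts => Real.sinh_injective (mul_left_cancel₀ hr.ne' hts)) f
  have himg : (fun t => r * Real.sinh t) '' Set.univ = Set.univ := by
    rw [Set.image_univ, Set.range_eq_univ]
    intro y
    obtain ⟨t, ht⟩ := Real.sinh_surjective (r⁻¹ * y)
    exact ⟨t, by simp only [ht]; rw [mul_inv_cancel_left₀ hr.ne']⟩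
  rw [himg, Measure.restrict_univ] at h
  rw [h]
  refine lintegral_congr fun t => ?_
  rw [abs_of_pos (mul_pos hr (Real.cosh_pos t))]

theorem setLIntegral_Ioi_comp_mul {c : ℝ} (hc : 0 < c) (f : ℝ → ℝ≥0∞) :
    ∫⁻ r in Set.Ioi (0 : ℝ), f r = ∫⁻ r in Set.Ioi (0 : ℝ), ENNReal.ofReal c * f (r * c) := by
  have h := lintegral_image_eq_lintegral_abs_deriv_mul (f := fun r => r * c)
    (f' := fun _ => c) (s := Set.Ioi (0 : ℝ)) measurableSet_Ioi
    (fun t _ => (hasDerivAt_mul_const c).hasDerivWithinAt)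
    (fun t _ s _ hts => mul_right_cancel₀ hc.ne' hts) f
  have himg : (fun t => t * c) '' Set.Ioi (0 : ℝ) = Set.Ioi 0 := by
    ext y
    constructor
    · rintro ⟨t, ht, rfl⟩
      exact mul_pos (Set.mem_Ioi.1 ht) hc
    · intro hy
      exact ⟨y / c, Set.mem_Ioi.2 (div_pos (Set.mem_Ioi.1 hy) hc), div_mul_cancel₀ y hc.ne'⟩
  rw [himg] at h
  rw [h, abs_of_pos hc]

theorem Observer.measurable_coneMap (o : Observer) : Measurable o.coneMap := by
  unfold Observer.coneMap spatial
  refine (PiLp.continuous_toLp 2 _).measurable.comp (measurable_pi_lambda _ fun i => ?_)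
  have h : Measurable nullLift := by
    refine measurable_pi_lambda _ fun j => ?_
    refine Fin.cases ?_ (fun k => ?_) j
    · simpa [nullLift] using measurable_norm
    · simp [nullLift]
      fun_prop
  have h2 : Continuous fun v : Mink => o.frame.mulVec v :=
    Continuous.matrix_mulVec continuous_const continuous_id
  exact (measurable_pi_apply _).comp (h2.measurable.comp h)

/-- The action of the Lorentz frame in the coordinates `x = r (sinh t, n)` of the cone. -/
theorem Observer.coneMap_coordinates (o : Observer) {r : ℝ} (hr : 0 < r) (t : ℝ) (n : TwoSphere)
    {x : E4} (hx : x = !₂[r * Real.sinh t, (r • (n : E3)) 0, (r • (n : E3)) 1,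
      (r • (n : E3)) 2]) :
    o.dilation x = o.scriAt t n 0 / Real.cosh t ∧
      o.coneMap x = (r * o.scriAt t n 0) • (o.direction (t, n) : E4) := by
  have hρ : 0 < o.scriAt t n 0 := (o.isFutureNull_scriAt t n).1
  have hw := isFutureNull_cosh t n
  set w : Mink := ![Real.cosh t, Real.sinh t, (n : E3) 0, (n : E3) 1, (n : E3) 2] with hwdef
  have hx : x = r • spatial w := by
    rw [hx]
    ext i
    fin_cases i <;> simp [w, spatial]
  have hnorm : ‖x‖ = r * Real.cosh t := by
    rw [hx, norm_smul, hw.norm_spatial, Real.norm_of_nonneg hr.le]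
    rfl
  have hx0 : x ≠ 0 := by
    rw [← norm_ne_zero_iff, hnorm]
    exact (mul_pos hr (Real.cosh_pos t)).ne'
  have hl : nullLift x = r • w := by
    funext i
    refine Fin.cases ?_ (fun k => ?_) i
    · simp [nullLift, hnorm, w]
    · simp [nullLift, hx, spatial]
  have h1 : o.frame.mulVec (nullLift x) = r • o.scriAt t n := by
    rw [hl, Matrix.mulVec_smul]
    rfl
  constructor
  · have h := o.dilation_mul_norm hx0
    rw [h1, hnorm, Pi.smul_apply, smul_eq_mul] at h
    rw [eq_div_iff (Real.cosh_pos t).ne']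
    have h' : r * (o.dilation x * Real.cosh t) = r * o.scriAt t n 0 := by linarith
    exact mul_left_cancel₀ hr.ne' h'
  · unfold Observer.coneMap
    rw [h1]
    simp only [Observer.direction]
    rw [smul_smul, mul_assoc, mul_inv_cancel₀ hρ.ne', mul_one]
    rfl

/-- The coordinates `x = r (sinh t, n)` on the cone of the observer, transported by the frame. -/
theorem Observer.lintegral_E4_coordinates (o : Observer) {g : E4 → ℝ≥0∞} (hg : Measurable g) :
    ∫⁻ x, g x = ∫⁻ n, (∫⁻ r in Set.Ioi (0 : ℝ), ∫⁻ t, ENNReal.ofReal (r ^ 3 * o.scriAt t n 0) *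
        g ((r * o.scriAt t n 0) • (o.direction (t, n) : E4))) ∂sphereMeasure := by
  have hcm := o.measurable_coneMap
  have hdil : Measurable o.dilation := by unfold Observer.dilation; fun_prop
  have hG : Measurable fun x => ENNReal.ofReal (o.dilation x) * g (o.coneMap x) := by fun_prop
  have hvec : Measurable fun q : E3 × ℝ => (!₂[q.2, q.1 0, q.1 1, q.1 2] : E4) := by
    refine (PiLp.continuous_toLp 2 _).measurable.comp (measurable_pi_lambda _ fun i => ?_)
    fin_cases i <;> simp <;> fun_prop
  have hG2 := hG.comp hvec
  rw [o.lintegral_coneMap g, lintegral_E4 hG]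
  refine (lintegral_eq_lintegral_toSphere (volume : Measure E3) (d := 2) (by simp)
    (Measurable.lintegral_prod_right' (ν := (volume : Measure ℝ)) hG2)).trans ?_
  refine lintegral_congr fun n => setLIntegral_congr_fun measurableSet_Ioi fun r hr => ?_
  have hr' : 0 < r := hr
  have hm : Measurable fun x : ℝ =>
      ((r • (n : E3), x) : E3 × ℝ) := measurable_const.prodMk measurable_id
  have hG3 := hG2.comp hm
  -- substitute `r sinh t` for the remaining cartesian coordinate
  refine (congrArg _ (lintegral_sinh hr' _)).trans ?_
  rw [← lintegral_const_mul]
  · refine lintegral_congr fun t => ?_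
    obtain ⟨h1, h2⟩ := o.coneMap_coordinates hr' t n rfl
    simp only [Function.comp]
    rw [h1, h2, ← mul_assoc, ← mul_assoc, ← ENNReal.ofReal_mul (by positivity),
      ← ENNReal.ofReal_mul (by have := Real.cosh_pos t; positivity)]
    congr 2
    have := (Real.cosh_pos t).ne'
    field_simp
  · refine Measurable.mul (by fun_prop) ?_
    exact hG3.comp (f := fun t => r * Real.sinh t) (by fun_prop)


/-- In any observer's coordinates, the round measure of the three-sphere is
`ρ⁻³ dt d²n`, where `ρ` is the time component of the point of the light cone. -/
theorem Observer.roundMeasure_eq_map (o : Observer) :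
    roundMeasure = (((volume : Measure ℝ).prod sphereMeasure).withDensity fun p =>
      ENNReal.ofReal ((o.scriAt p.1 p.2 0 ^ 3)⁻¹)).map o.direction := by
  symm
  have hρ : Measurable fun p : ℝ × TwoSphere => o.scriAt p.1 p.2 0 :=
    ((continuous_apply 0).comp o.continuous_scriAt).measurable
  have hρ0 : ∀ p : ℝ × TwoSphere, 0 < o.scriAt p.1 p.2 0 := fun p =>
    (o.isFutureNull_scriAt p.1 p.2).1
  have hdir : Measurable fun p => (o.direction p : E4) :=
    measurable_subtype_coe.comp o.continuous_direction.measurable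
  refine eq_toSphere_of_lintegral (volume : Measure E4) (d := 3) (by simp) fun g hg => ?_
  have hinner : Measurable fun q : (ℝ × TwoSphere) × ℝ =>
      ENNReal.ofReal (q.2 ^ 3) * g (q.2 • (o.direction q.1 : E4)) :=
    Measurable.mul (by fun_prop) (hg.comp (measurable_snd.smul (hdir.comp measurable_fst)))
  have hinner' : Measurable fun p : ℝ × TwoSphere => ∫⁻ r in Set.Ioi (0 : ℝ),
      ENNReal.ofReal (r ^ 3) * g (r • (o.direction p : E4)) :=
    Measurable.lintegral_prod_right' hinner
  have houter : Measurable fun n : ThreeSphere => ∫⁻ r in Set.Ioi (0 : ℝ),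
      ENNReal.ofReal (r ^ 3) * g (r • (n : E4)) :=
    Measurable.lintegral_prod_right' (f := fun q : ThreeSphere × ℝ =>
      ENNReal.ofReal (q.2 ^ 3) * g (q.2 • (q.1 : E4))) (by fun_prop)
  have hdens : Measurable fun p : ℝ × TwoSphere => ENNReal.ofReal ((o.scriAt p.1 p.2 0 ^ 3)⁻¹) :=
    (hρ.pow_const 3).inv.ennreal_ofReal
  refine Eq.trans ?_ (lintegral_map houter o.continuous_direction.measurable).symm
  refine Eq.trans ?_ (lintegral_withDensity_eq_lintegral_mul _ hdens hinner').symm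
  refine Eq.trans ?_ (lintegral_prod_symm _ (hdens.mul hinner').aemeasurable).symm
  refine (o.lintegral_E4_coordinates hg).trans ?_
  refine lintegral_congr fun n => ?_
  have e0 : Measurable fun q : ℝ × ℝ => (q.2, n) := measurable_snd.prodMk measurable_const
  have e1 := hρ.comp e0
  have e2 := hdir.comp e0
  have hsw : Measurable fun q : ℝ × ℝ => ENNReal.ofReal (q.1 ^ 3 * o.scriAt q.2 n 0) *
      g ((q.1 * o.scriAt q.2 n 0) • (o.direction (q.2, n) : E4)) :=
    ((measurable_fst.pow_const 3).mul e1).ennreal_ofReal.mul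
      (hg.comp ((measurable_fst.mul e1).smul e2))
  refine (lintegral_lintegral_swap hsw.aemeasurable).trans ?_
  refine lintegral_congr fun t => ?_
  have hp : 0 < o.scriAt t n 0 := hρ0 (t, n)
  have hgm : Measurable fun r : ℝ => ENNReal.ofReal (r ^ 3) * g (r • (o.direction (t, n) : E4)) := by
    fun_prop
  refine Eq.trans ?_ (congrArg (fun I => ENNReal.ofReal ((o.scriAt t n 0 ^ 3)⁻¹) * I)
    (setLIntegral_Ioi_comp_mul hp _).symm)
  refine Eq.trans ?_ (lintegral_const_mul _ ((hgm.comp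
    (measurable_id.mul_const (o.scriAt t n 0))).const_mul _))
  refine setLIntegral_congr_fun measurableSet_Ioi fun r hr => ?_
  have hr' : 0 < r := hr
  beta_reduce
  rw [← mul_assoc, ← mul_assoc, ← ENNReal.ofReal_mul (by positivity),
    ← ENNReal.ofReal_mul (by positivity)]
  congr 2
  field_simp

/-! ### Legendre polynomials -/

section Legendre

open Polynomial

/-- The scalar `1 / (2^l l!)` of Rodrigues' formula. -/
def rodriguesScalar (l : ℕ) : ℝ := 1 / (2 ^ l * (l.factorial : ℝ))

theorem rodriguesScalar_pos (l : ℕ) : 0 < rodriguesScalar l := by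
  unfold rodriguesScalar; positivity

theorem legendre_eq (l : ℕ) :
    legendre l = C (rodriguesScalar l) * derivative^[l] ((X ^ 2 - 1) ^ l) := rfl

theorem rodriguesScalar_succ (l : ℕ) :
    rodriguesScalar (l + 1) * (2 * (l + 1)) = rodriguesScalar l := by
  unfold rodriguesScalar
  rw [pow_succ, Nat.factorial_succ]
  push_cast
  have : (l : ℝ) + 1 ≠ 0 := by positivity
  field_simp

theorem derivative_X_sq_sub_one_pow (l : ℕ) :
    derivative ((X ^ 2 - 1 : ℝ[X]) ^ (l + 1)) = C (2 * ((l : ℝ) + 1)) * (X * (X ^ 2 - 1) ^ l) := by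
  rw [derivative_pow_succ]
  simp only [derivative_sub, derivative_X_pow, derivative_one, C_mul, C_add, C_1]
  have : (C (2 : ℝ) : ℝ[X]) = 2 := rfl
  simp [this]
  ring

theorem legendre_zero : legendre 0 = 1 := by simp [legendre]

theorem legendre_one : legendre 1 = X := by
  have h : (C (2⁻¹ : ℝ) : ℝ[X]) * C 2 = 1 := by
    rw [← C_mul, inv_mul_cancel₀ (two_ne_zero' ℝ), C_1]
  simp only [legendre, pow_one, Nat.factorial_one, Nat.cast_one, mul_one, one_div,
    Function.iterate_one, derivative_sub, derivative_X_pow, derivative_one, sub_zero,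
    Nat.cast_ofNat, Nat.add_one_sub_one, ← mul_assoc, h, one_mul]

theorem iterate_derivative_X_mul_succ (k : ℕ) (p : ℝ[X]) :
    derivative^[k + 1] (X * p) =
      X * derivative^[k + 1] p + C ((k : ℝ) + 1) * derivative^[k] p := by
  induction k with
  | zero => simp [add_comm]
  | succ k ih =>
    rw [Function.iterate_succ_apply', ih]
    simp only [derivative_add, derivative_mul, derivative_X, derivative_C,
      ← Function.iterate_succ_apply' derivative]
    push_cast
    simp only [C_add, C_1]
    ring

theorem derivative_legendre_succ (n : ℕ) :
    derivative (legendre (n + 1)) = X * derivative (legendre n) + C ((n : ℝ) + 1) * legendre n := by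
  rw [legendre_eq, legendre_eq, derivative_C_mul, ← Function.iterate_succ_apply' derivative,
    Function.iterate_succ_apply, derivative_X_sq_sub_one_pow, iterate_derivative_C_mul,
    iterate_derivative_X_mul_succ, derivative_C_mul,
    ← rodriguesScalar_succ n]
  simp only [C_mul, C_add, C_1, Function.iterate_succ_apply']
  ring

theorem eval_one_legendre (l : ℕ) : (legendre l).eval 1 = 1 := by
  have h1 : (derivative^[l] ((X ^ 2 - 1 : ℝ[X]) ^ l)).eval 1 = l.factorial * 2 ^ l := by
    rw [← factorial_smul_hasseDeriv]
    change (l.factorial • hasseDeriv l ((X ^ 2 - 1 : ℝ[X]) ^ l)).eval 1 = _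
    rw [nsmul_eq_mul, eval_mul, eval_natCast,
      ← taylor_coeff]
    have : taylor (1 : ℝ) ((X ^ 2 - 1) ^ l) = (X + C 2) ^ l * X ^ l := by
      rw [← mul_pow]
      simp only [taylor_apply, pow_comp, sub_comp, X_comp, one_comp, C_1]
      congr 1
      have : (C (2 : ℝ) : ℝ[X]) = 2 := rfl
      rw [this]
      ring
    rw [this, coeff_mul_X_pow', if_pos le_rfl, Nat.sub_self, coeff_zero_eq_eval_zero]
    simp
  rw [legendre_eq, eval_mul, eval_C, h1, rodriguesScalar]
  field_simp

/-- Legendre's differential equation. -/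
theorem legendre_ode (n : ℕ) :
    (X ^ 2 - 1) * derivative (derivative (legendre n)) + 2 * X * derivative (legendre n) =
      C ((n : ℝ) * (n + 1)) * legendre n := by
  rcases n with _ | n
  · simp [legendre_zero]
  set W : ℝ[X] := (X ^ 2 - 1) ^ (n + 1) with hW
  have h0 : X * (X * derivative W) - derivative W = C (2 * ((n : ℝ) + 1)) * (X * W) := by
    rw [hW, derivative_X_sq_sub_one_pow]
    ring
  have h1 := congrArg (derivative^[n + 2]) h0
  set A := derivative^[n + 1] W with hA
  have hA1 : derivative^[n + 2] W = derivative A := Function.iterate_succ_apply' _ _ _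
  have hA2 : derivative^[n + 2] (derivative W) = derivative (derivative A) := by
    rw [← Function.iterate_succ_apply, Function.iterate_succ_apply', hA1]
  have hA3 : derivative^[n + 1] (derivative W) = derivative A := by
    rw [← Function.iterate_succ_apply, hA1]
  have hA4 : derivative^[n] (derivative W) = A := by rw [← Function.iterate_succ_apply]
  rw [iterate_derivative_sub, iterate_derivative_C_mul, iterate_derivative_X_mul_succ,
    iterate_derivative_X_mul_succ, iterate_derivative_X_mul_succ, iterate_derivative_X_mul_succ,
    hA1, hA2, hA3, hA4, ← hA] at h1
  rw [legendre_eq, derivative_C_mul, derivative_C_mul, ← hW, ← hA]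
  simp only [C_mul, C_add, C_1, nsmul_eq_mul, Nat.cast_add, Nat.cast_one, Nat.cast_ofNat,
    map_natCast, map_add, map_one] at h1 ⊢
  have h2 : (C (2 : ℝ) : ℝ[X]) = 2 := rfl
  rw [h2] at h1
  linear_combination (C (rodriguesScalar (n + 1))) * h1

theorem X_sq_sub_one_mul_derivative_legendre (n : ℕ) :
    (X ^ 2 - 1) * derivative (legendre n) =
      C ((n : ℝ) + 1) * (legendre (n + 1) - X * legendre n) := by
  set R := (X ^ 2 - 1) * derivative (legendre n) -
      C ((n : ℝ) + 1) * (legendre (n + 1) - X * legendre n) with hR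
  have hd : derivative R = 0 := by
    rw [hR]
    have h := legendre_ode n
    simp only [derivative_sub, derivative_mul, derivative_C, derivative_X_pow, derivative_one,
      derivative_X, derivative_legendre_succ, C_mul, C_add, C_1, map_natCast] at h ⊢
    have hc : derivative ((n : ℝ[X]) + 1) = 0 := by simp
    simp only [Nat.cast_ofNat, hc] at h ⊢
    linear_combination h
  have h1 : R.eval 1 = 0 := by
    simp [hR, eval_one_legendre]
  obtain ⟨c, hc⟩ : ∃ c, R = C c := ⟨_, eq_C_of_derivative_eq_zero hd⟩
  rw [hc, eval_C] at h1
  rw [h1, C_0] at hc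
  exact sub_eq_zero.1 (hR.symm.trans hc)

theorem derivative_legendre (n : ℕ) :
    derivative (legendre n) =
      X * derivative (legendre (n + 1)) - C ((n : ℝ) + 1) * legendre (n + 1) := by
  have h := X_sq_sub_one_mul_derivative_legendre n
  rw [derivative_legendre_succ]
  linear_combination -h

theorem X_sq_sub_one_mul_derivative_legendre_succ (n : ℕ) :
    (X ^ 2 - 1) * derivative (legendre (n + 1)) =
      C ((n : ℝ) + 1) * (X * legendre (n + 1) - legendre n) := by
  have h := derivative_legendre n
  have h2 := derivative_legendre_succ n
  linear_combination -X * h - h2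

theorem natDegree_legendre_le (l : ℕ) : (legendre l).natDegree ≤ l := by
  rw [legendre_eq]
  refine (natDegree_C_mul_le _ _).trans ((natDegree_iterate_derivative _ _).trans ?_)
  have : ((X ^ 2 - 1 : ℝ[X]) ^ l).natDegree ≤ l * 2 := by
    refine natDegree_pow_le.trans (Nat.mul_le_mul_left l ?_)
    exact (natDegree_sub_le _ _).trans (by simp)
  omega

theorem coeff_legendre_ne_zero (l : ℕ) : (legendre l).coeff l ≠ 0 := by
  rw [legendre_eq, coeff_C_mul, coeff_iterate_derivative]
  have h : ((X ^ 2 - 1 : ℝ[X]) ^ l).coeff (l + l) = 1 := by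
    have hm : ((X ^ 2 - 1 : ℝ[X])).Monic := by
      have := monic_X_pow_sub_C (1 : ℝ) (n := 2) (by norm_num)
      simpa using this
    have hd : ((X ^ 2 - 1 : ℝ[X])).natDegree = 2 := by
      have := natDegree_X_pow_sub_C (n := 2) (r := (1 : ℝ))
      simpa using this
    have h2 : ((X ^ 2 - 1 : ℝ[X]) ^ l).natDegree = l + l := by
      rw [natDegree_pow, hd]; ring
    rw [← h2]
    exact (hm.pow l).coeff_natDegree
  rw [h]
  have : (l + l).descFactorial l ≠ 0 := by
    rw [Ne, Nat.descFactorial_eq_zero_iff_lt]; omega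
  have := (rodriguesScalar_pos l).ne'
  simp_all

/-- The integral of a polynomial over `[-1, 1]`. -/
def polyInt (p : ℝ[X]) : ℝ := ∫ x in (-1 : ℝ)..1, p.eval x

theorem polyInt_add (p q : ℝ[X]) : polyInt (p + q) = polyInt p + polyInt q := by
  unfold polyInt
  simp only [eval_add]
  exact intervalIntegral.integral_add (p.continuous.intervalIntegrable _ _)
    (q.continuous.intervalIntegrable _ _)

theorem polyInt_C_mul (c : ℝ) (p : ℝ[X]) : polyInt (C c * p) = c * polyInt p := by
  unfold polyInt
  simp

theorem polyInt_zero : polyInt 0 = 0 := by simp [polyInt]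

theorem polyInt_derivative (p : ℝ[X]) : polyInt (derivative p) = p.eval 1 - p.eval (-1) :=
  intervalIntegral.integral_eq_sub_of_hasDerivAt (fun x _ => p.hasDerivAt x)
    (p.derivative.continuous.intervalIntegrable _ _)

/-- Integration by parts against a polynomial that vanishes to order `k` at both ends. -/
theorem polyInt_iterate_derivative (k : ℕ) :
    ∀ w r : ℝ[X], (X ^ 2 - 1) ^ k ∣ w →
      polyInt (derivative^[k] w * r) = (-1) ^ k * polyInt (w * derivative^[k] r) := by
  induction k with
  | zero => intro w r _; simp
  | succ k ih =>
    intro w r hw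
    have hdvd : (X ^ 2 - 1) ^ k ∣ derivative w := by
      have := pow_sub_dvd_iterate_derivative_of_pow_dvd 1 hw
      simpa using this
    rw [Function.iterate_succ_apply, ih _ _ hdvd]
    have h1 := polyInt_derivative (w * derivative^[k] r)
    rw [derivative_mul, polyInt_add, ← Function.iterate_succ_apply' derivative] at h1
    obtain ⟨v, rfl⟩ := hw
    have h2 : polyInt (derivative ((X ^ 2 - 1) ^ (k + 1) * v) * derivative^[k] r) =
        - polyInt ((X ^ 2 - 1) ^ (k + 1) * v * derivative^[k + 1] r) := by
      simp [pow_succ] at h1 ⊢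
      linarith
    rw [h2, pow_succ]
    ring

theorem polyInt_legendre_mul {l : ℕ} {q : ℝ[X]} (hq : q.natDegree < l) :
    polyInt (legendre l * q) = 0 := by
  rw [legendre_eq, mul_assoc, polyInt_C_mul, polyInt_iterate_derivative l _ _ dvd_rfl,
    iterate_derivative_eq_zero hq, mul_zero, polyInt_zero, mul_zero, mul_zero]

/-- A polynomial of degree at most `l` differs from a multiple of `P_l` by lower degrees. -/
theorem polyInt_legendre_mul_of_le {l : ℕ} {q : ℝ[X]} (hq : q.natDegree ≤ l) :
    polyInt (legendre l * q) = q.coeff l / (legendre l).coeff l * polyInt (legendre l * legendre l) := by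
  have h0 := coeff_legendre_ne_zero l
  set c := q.coeff l / (legendre l).coeff l with hc
  rcases Nat.eq_zero_or_pos l with rfl | hl
  · have h1 : q = C c * legendre 0 := by
      rw [hc, legendre_zero]
      rw [eq_C_of_natDegree_le_zero hq]
      simp
    nth_rewrite 1 [h1]
    rw [mul_left_comm, polyInt_C_mul]
  have hlt : (q - C c * legendre l).natDegree < l := by
    refine lt_of_le_of_ne ((natDegree_sub_le _ _).trans (max_le hq
      ((natDegree_C_mul_le _ _).trans (natDegree_legendre_le l)))) fun h => ?_
    have h2 : (q - C c * legendre l).coeff l = 0 := by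
      rw [coeff_sub, coeff_C_mul, hc, div_mul_cancel₀ _ h0, sub_self]
    set r := q - C c * legendre l
    have h4 : r = 0 := by
      rw [← leadingCoeff_eq_zero, ← coeff_natDegree, h, h2]
    rw [h4, natDegree_zero] at h
    omega
  have h3 : legendre l * q = legendre l * (q - C c * legendre l) +
      C c * (legendre l * legendre l) := by ring
  rw [h3, polyInt_add, polyInt_legendre_mul hlt, polyInt_C_mul, zero_add]

theorem eval_neg_one_legendre (l : ℕ) : (legendre l).eval (-1) = (-1) ^ l := by
  have h := eval_neg_iterate_derivative_legendre l 0 1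
  simpa [eval_one_legendre] using h

theorem polyInt_legendre_sq (l : ℕ) : polyInt (legendre l * legendre l) = 2 / (2 * l + 1) := by
  have h1 := polyInt_derivative (X * (legendre l * legendre l))
  have h2 : derivative (X * (legendre l * legendre l)) =
      legendre l * legendre l + C 2 * (legendre l * (X * derivative (legendre l))) := by
    simp only [derivative_mul, derivative_X]
    rw [show (C (2 : ℝ) : ℝ[X]) = 2 from rfl]
    ring
  have hdeg : (X * derivative (legendre l)).natDegree ≤ l := by
    rcases Nat.eq_zero_or_pos l with rfl | hl
    · simp [legendre_zero]
    refine natDegree_mul_le.trans ?_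
    have := natDegree_derivative_le (legendre l)
    have := natDegree_legendre_le l
    rw [natDegree_X]
    omega
  have hcoeff : (X * derivative (legendre l)).coeff l = l * (legendre l).coeff l := by
    rcases l with _ | l
    · simp
    · rw [coeff_X_mul, coeff_derivative]
      push_cast
      ring
  rw [h2, polyInt_add, polyInt_C_mul, polyInt_legendre_mul_of_le hdeg, hcoeff,
    mul_div_cancel_right₀ _ (coeff_legendre_ne_zero l)] at h1
  simp only [eval_mul, eval_X, eval_one_legendre, eval_neg_one_legendre] at h1
  have h3 : ((-1 : ℝ) ^ l) * (-1) ^ l = 1 := by rw [← mul_pow]; norm_num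
  rw [h3] at h1
  rw [eq_div_iff (by positivity)]
  linarith

theorem natDegree_X_sq_sub_one_pow_le (k : ℕ) : ((X ^ 2 - 1 : ℝ[X]) ^ k).natDegree ≤ k * 2 :=
  natDegree_pow_le.trans (Nat.mul_le_mul_left k ((natDegree_sub_le _ _).trans (by simp)))

theorem coeff_X_sq_sub_one_pow (k : ℕ) : ((X ^ 2 - 1 : ℝ[X]) ^ k).coeff (k * 2) = 1 := by
  rw [coeff_pow_of_natDegree_le ((natDegree_sub_le _ _).trans (by simp))]
  simp [coeff_one]

theorem polyInt_assocLegendre_mul {l k : ℕ} {q : ℝ[X]} (hq : q.natDegree + k < l) :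
    polyInt ((X ^ 2 - 1) ^ k * (derivative^[k] (legendre l) * q)) = 0 := by
  have h := polyInt_iterate_derivative k ((X ^ 2 - 1) ^ k * q) (legendre l) (dvd_mul_right _ _)
  have h2 : (X ^ 2 - 1) ^ k * (derivative^[k] (legendre l) * q) =
      (X ^ 2 - 1) ^ k * q * derivative^[k] (legendre l) := by ring
  have h3 : (-1 : ℝ) ^ k * (-1) ^ k = 1 := by rw [← mul_pow]; norm_num
  have hdeg : (derivative^[k] ((X ^ 2 - 1) ^ k * q)).natDegree < l := by
    have h4 := natDegree_iterate_derivative ((X ^ 2 - 1) ^ k * q) k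
    have h5 := natDegree_mul_le (p := (X ^ 2 - 1 : ℝ[X]) ^ k) (q := q)
    have h6 := natDegree_X_sq_sub_one_pow_le k
    omega
  rw [h2]
  rw [mul_comm (derivative^[k] _) (legendre l), polyInt_legendre_mul hdeg] at h
  exact (mul_eq_zero.1 h.symm).resolve_left (pow_ne_zero k (by norm_num))

theorem polyInt_assocLegendre_sq {l k : ℕ} (hk : k ≤ l) :
    polyInt ((X ^ 2 - 1) ^ k * (derivative^[k] (legendre l) * derivative^[k] (legendre l))) =
      (-1) ^ k * (2 / (2 * l + 1) * ((l + k).factorial / (l - k).factorial)) := by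
  have h := polyInt_iterate_derivative k ((X ^ 2 - 1) ^ k * derivative^[k] (legendre l))
    (legendre l) (dvd_mul_right _ _)
  have h3 : (-1 : ℝ) ^ k * (-1) ^ k = 1 := by rw [← mul_pow]; norm_num
  set D := derivative^[k] (legendre l) with hD
  have hDdeg : D.natDegree ≤ l - k :=
    (natDegree_iterate_derivative _ _).trans (Nat.sub_le_sub_right (natDegree_legendre_le l) k)
  have hmul : ((X ^ 2 - 1) ^ k * D).coeff (l + k) = D.coeff (l - k) := by
    have := coeff_mul_add_eq_of_natDegree_le (natDegree_X_sq_sub_one_pow_le k) hDdeg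
    rw [coeff_X_sq_sub_one_pow, one_mul, show k * 2 + (l - k) = l + k by omega] at this
    exact this
  have hdeg : (derivative^[k] ((X ^ 2 - 1) ^ k * D)).natDegree ≤ l := by
    have h4 := natDegree_iterate_derivative ((X ^ 2 - 1) ^ k * D) k
    have h5 := natDegree_mul_le (p := (X ^ 2 - 1 : ℝ[X]) ^ k) (q := D)
    have h6 := natDegree_X_sq_sub_one_pow_le k
    omega
  have hc : (derivative^[k] ((X ^ 2 - 1) ^ k * D)).coeff l / (legendre l).coeff l =
      (l + k).factorial / (l - k).factorial := by
    rw [coeff_iterate_derivative, hmul, hD, coeff_iterate_derivative, Nat.sub_add_cancel hk,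
      nsmul_eq_mul, nsmul_eq_mul, Nat.descFactorial_eq_div (by omega), Nat.add_sub_cancel,
      Nat.descFactorial_eq_div hk, Nat.cast_div (Nat.factorial_dvd_factorial (by omega))
        (by positivity), Nat.cast_div (Nat.factorial_dvd_factorial (by omega)) (by positivity)]
    have h1 := coeff_legendre_ne_zero l
    have h2 : (l.factorial : ℝ) ≠ 0 := by positivity
    field_simp
  rw [mul_comm (derivative^[k] ((X ^ 2 - 1) ^ k * D)), polyInt_legendre_mul_of_le hdeg, hc,
    polyInt_legendre_sq] at h
  rw [← mul_assoc]
  linear_combination (norm := ring_nf) -(-1 : ℝ) ^ k * h + (-polyInt ((X ^ 2 - 1) ^ k * D * D)) * h3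

end Legendre

/-! ### Spherical harmonics on the two-sphere -/

section Harmonics

open Polynomial

/-- The coordinate of a point of the two-sphere along the polar axis. -/
def axial (n : TwoSphere) : ℝ := (n : E3) 0

/-- The complex coordinate `y + i z` of a point of the two-sphere. -/
def transverse (n : TwoSphere) : ℂ := ⟨(n : E3) 1, (n : E3) 2⟩

theorem continuous_axial : Continuous axial := by unfold axial; fun_prop

theorem continuous_transverse : Continuous transverse := by
  have : transverse = fun n : TwoSphere => (((n : E3) 1 : ℝ) : ℂ) + ((n : E3) 2 : ℝ) * Complex.I := by
    funext n
    exact (Complex.mk_eq_add_mul_I _ _)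
  rw [this]
  fun_prop

theorem transverse_mul_conj (n : TwoSphere) :
    transverse n * conj (transverse n) = ((1 - axial n ^ 2 : ℝ) : ℂ) := by
  rw [Complex.mul_conj]
  congr 1
  have := sum_sq_twoSphere n
  simp only [transverse, Complex.normSq_mk, axial]
  linarith

theorem axial_sphericalPoint (θ φ : ℝ) : axial (sphericalPoint θ φ) = Real.cos θ := by
  simp [axial, coe_sphericalPoint]

theorem transverse_sphericalPoint (θ φ : ℝ) :
    transverse (sphericalPoint θ φ) = Real.sin θ * Complex.exp (Complex.I * φ) := by
  rw [mul_comm Complex.I, Complex.exp_mul_I]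
  apply Complex.ext <;>
    simp [transverse, coe_sphericalPoint, ← Complex.ofReal_cos, ← Complex.ofReal_sin]

theorem axial_mem (n : TwoSphere) : axial n ∈ Set.Icc (-1 : ℝ) 1 := by
  have := sum_sq_twoSphere n
  constructor <;> unfold axial <;> nlinarith [sq_nonneg ((n : E3) 1), sq_nonneg ((n : E3) 2)]

theorem integral_exp_int (k : ℤ) :
    ∫ φ in Set.Ioo 0 (2 * Real.pi), Complex.exp (Complex.I * k * φ) =
      if k = 0 then 2 * (Real.pi : ℂ) else 0 := by
  rw [← integral_Ioc_eq_integral_Ioo, ← intervalIntegral.integral_of_le (by positivity)]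
  split_ifs with hk
  · simp [hk]
  · rw [integral_exp_mul_complex (by simp [hk])]
    have h : Complex.exp (Complex.I * k * ((2 * Real.pi : ℝ) : ℂ)) = 1 := by
      rw [Complex.exp_eq_one_iff]
      exact ⟨k, by push_cast; ring⟩
    rw [h]
    simp

theorem solidAngle_eq_prod : solidAngle =
    ((volume.restrict (Set.Ioo 0 Real.pi)).withDensity fun θ =>
      ENNReal.ofReal (Real.sin θ)).prod (volume.restrict (Set.Ioo 0 (2 * Real.pi))) := by
  rw [prod_withDensity_left (by fun_prop), Measure.prod_restrict]
  rfl

theorem integral_sin_comp_cos (g : ℝ → ℂ) :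
    ∫ θ in Set.Ioo 0 Real.pi, (Real.sin θ : ℂ) * g (Real.cos θ) =
      ∫ x in Set.Ioo (-1 : ℝ) 1, g x := by
  have himg : Real.cos '' Set.Ioo 0 Real.pi = Set.Ioo (-1) 1 := by
    ext x
    constructor
    · rintro ⟨θ, hθ, rfl⟩
      obtain ⟨h1, h2⟩ := Set.mem_Ioo.1 hθ
      have h3 := Real.cos_lt_cos_of_nonneg_of_le_pi le_rfl h2.le h1
      have h4 := Real.cos_lt_cos_of_nonneg_of_le_pi h1.le le_rfl h2
      rw [Real.cos_zero] at h3
      rw [Real.cos_pi] at h4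
      exact ⟨h4, h3⟩
    · intro hx
      obtain ⟨h1, h2⟩ := Set.mem_Ioo.1 hx
      exact ⟨Real.arccos x, ⟨Real.arccos_pos.2 h2, Real.arccos_lt_pi.2 h1⟩,
        Real.cos_arccos h1.le h2.le⟩
  rw [← himg, integral_image_eq_integral_abs_deriv_smul measurableSet_Ioo
    (fun θ _ => (Real.hasDerivAt_cos θ).hasDerivWithinAt)
    (Real.injOn_cos.mono Set.Ioo_subset_Icc_self)]
  refine setIntegral_congr_fun measurableSet_Ioo fun θ hθ => ?_
  have := Real.sin_pos_of_mem_Ioo hθ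
  simp only [abs_neg, abs_of_pos this, Complex.real_smul]

/-- Zonal functions times `(y + iz)^b (y - iz)^c`: the azimuthal integral selects `b = c`. -/
theorem integral_monomial {f : ℝ → ℂ} (hf : Measurable f) (b c : ℕ) :
    ∫ n, f (axial n) * (transverse n ^ b * conj (transverse n) ^ c) ∂sphereMeasure =
      if b = c then 2 * Real.pi * ∫ x in Set.Ioo (-1 : ℝ) 1, f x * ((1 - x ^ 2 : ℝ) : ℂ) ^ b
      else 0 := by
  have h1 := hf.comp continuous_axial.measurable
  have h2 := continuous_transverse
  have hm : Measurable fun n => f (axial n) * (transverse n ^ b * conj (transverse n) ^ c) :=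
    h1.mul (by fun_prop : Continuous fun n => transverse n ^ b * conj (transverse n) ^ c).measurable
  rw [← map_solidAngle, integral_map continuous_sphericalPoint.measurable.aemeasurable
    hm.aestronglyMeasurable]
  simp only [axial_sphericalPoint, transverse_sphericalPoint]
  have h3 : ∀ p : ℝ × ℝ, f (Real.cos p.1) * ((Real.sin p.1 * Complex.exp (Complex.I * p.2)) ^ b *
      conj (Real.sin p.1 * Complex.exp (Complex.I * p.2)) ^ c) =
      (f (Real.cos p.1) * (Real.sin p.1 : ℂ) ^ (b + c)) *
        Complex.exp (Complex.I * ((b : ℤ) - (c : ℤ) : ℤ) * p.2) := by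
    intro p
    have h4 : Complex.exp (Complex.I * ((b : ℤ) - (c : ℤ) : ℤ) * p.2) =
        Complex.exp (Complex.I * p.2) ^ b * conj (Complex.exp (Complex.I * p.2)) ^ c := by
      rw [← Complex.exp_conj, ← Complex.exp_nat_mul, ← Complex.exp_nat_mul, ← Complex.exp_add]
      congr 1
      simp
      ring
    rw [h4, map_mul, Complex.conj_ofReal]
    ring
  simp only [h3]
  rw [solidAngle_eq_prod, integral_prod_mul (fun θ : ℝ => f (Real.cos θ) * (Real.sin θ : ℂ) ^ (b + c))
    (fun φ : ℝ => Complex.exp (Complex.I * ((b : ℤ) - (c : ℤ) : ℤ) * φ)), integral_exp_int]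
  by_cases hbc : b = c
  · subst hbc
    rw [if_pos (sub_self _), if_pos rfl, mul_comm,
      integral_withDensity_eq_integral_toReal_smul (by fun_prop) (ae_of_all _ fun _ => by simp),
      ← integral_sin_comp_cos]
    congr 1
    refine setIntegral_congr_fun measurableSet_Ioo fun θ hθ => ?_
    rw [ENNReal.toReal_ofReal (Real.sin_pos_of_mem_Ioo hθ).le, Complex.real_smul,
      ← Real.sin_sq, ← two_mul, pow_mul]
    push_cast
    ring
  · rw [if_neg (by omega), if_neg hbc, mul_zero]

theorem setIntegral_poly (p : ℝ[X]) :
    ∫ x in Set.Ioo (-1 : ℝ) 1, ((p.eval x : ℝ) : ℂ) = (polyInt p : ℂ) := by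
  rw [integral_complex_ofReal, ← integral_Ioc_eq_integral_Ioo, polyInt,
    intervalIntegral.integral_of_le (by norm_num)]

theorem integral_poly_monomial (p : ℝ[X]) (b c : ℕ) :
    ∫ n, ((p.eval (axial n) : ℝ) : ℂ) * (transverse n ^ b * conj (transverse n) ^ c)
      ∂sphereMeasure = if b = c then 2 * Real.pi * (polyInt (p * (1 - X ^ 2) ^ b) : ℂ) else 0 := by
  rw [integral_monomial (f := fun x => ((p.eval x : ℝ) : ℂ))
    (Complex.measurable_ofReal.comp p.continuous.measurable), ← setIntegral_poly]
  simp

/-- The factor in front of the harmonic `Y_{lm}`. -/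
def harmonicScalar (l : ℕ) (m : ℤ) : ℂ :=
  (if 0 ≤ m then (-1) ^ m.natAbs else 1) *
    (Real.sqrt ((2 * l + 1) / (4 * Real.pi) *
      (((l - m.natAbs).factorial : ℝ) / ((l + m.natAbs).factorial : ℝ))) : ℝ)

/-- The spherical harmonic `Y_{lm}` as a function on the two-sphere. -/
def sphereHarmonic (l : ℕ) (m : ℤ) (n : TwoSphere) : ℂ :=
  harmonicScalar l m * (((derivative^[m.natAbs] (legendre l)).eval (axial n) : ℝ) *
    (transverse n ^ m.toNat * conj (transverse n) ^ (-m).toNat))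

theorem sphereHarmonic_sphericalPoint (l : ℕ) (m : ℤ) (θ φ : ℝ) :
    sphereHarmonic l m (sphericalPoint θ φ) = sphericalHarmonic l m θ φ := by
  unfold sphereHarmonic sphericalHarmonic harmonicScalar
  rw [axial_sphericalPoint, transverse_sphericalPoint]
  have key : ((Real.sin θ : ℂ) * Complex.exp (Complex.I * φ)) ^ m.toNat *
      conj ((Real.sin θ : ℂ) * Complex.exp (Complex.I * φ)) ^ (-m).toNat =
      (Real.sin θ : ℂ) ^ m.natAbs * Complex.exp (Complex.I * m * φ) := by
    rw [map_mul, Complex.conj_ofReal, ← Complex.exp_conj, mul_pow, mul_pow, ← Complex.exp_nat_mul,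
      ← Complex.exp_nat_mul, mul_mul_mul_comm, ← pow_add, ← Complex.exp_add]
    have h1 : m.toNat + (-m).toNat = m.natAbs := by omega
    have h2 : (m : ℂ) = (m.toNat : ℂ) - ((-m).toNat : ℂ) := by
      have : m = (m.toNat : ℤ) - ((-m).toNat : ℤ) := by omega
      exact_mod_cast congrArg (Int.cast (R := ℂ)) this
    rw [h1]
    congr 2
    simp only [map_mul, Complex.conj_I, Complex.conj_ofReal, h2]
    ring
  rw [key]
  push_cast
  ring

theorem continuous_sphereHarmonic (l : ℕ) (m : ℤ) : Continuous (sphereHarmonic l m) := by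
  have h1 := continuous_axial
  have h2 := continuous_transverse
  unfold sphereHarmonic
  fun_prop

theorem conj_harmonicScalar (l : ℕ) (m : ℤ) : conj (harmonicScalar l m) = harmonicScalar l m := by
  unfold harmonicScalar
  split_ifs <;> simp

theorem harmonicScalar_sq (l : ℕ) (m : ℤ) : harmonicScalar l m * harmonicScalar l m =
    (((2 * l + 1) / (4 * Real.pi) *
      (((l - m.natAbs).factorial : ℝ) / ((l + m.natAbs).factorial : ℝ)) : ℝ) : ℂ) := by
  have h := Real.mul_self_sqrt (show 0 ≤ (2 * l + 1) / (4 * Real.pi) *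
      (((l - m.natAbs).factorial : ℝ) / ((l + m.natAbs).factorial : ℝ)) by positivity)
  unfold harmonicScalar
  rw [mul_mul_mul_comm, ← Complex.ofReal_mul, h]
  have h3 : (-1 : ℂ) ^ m.natAbs * (-1) ^ m.natAbs = 1 := by rw [← mul_pow]; norm_num
  split_ifs
  · rw [h3, one_mul]
  · rw [one_mul, one_mul]

theorem harmonicScalar_ne_zero (l : ℕ) (m : ℤ) : harmonicScalar l m ≠ 0 := by
  intro h
  have h1 := harmonicScalar_sq l m
  rw [h, mul_zero] at h1
  have h2 : (0 : ℝ) < (2 * l + 1) / (4 * Real.pi) *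
      (((l - m.natAbs).factorial : ℝ) / ((l + m.natAbs).factorial : ℝ)) := by
    have := Real.pi_pos
    positivity
  exact h2.ne (by exact_mod_cast h1)

theorem one_sub_X_sq_pow (k : ℕ) :
    (1 - X ^ 2 : ℝ[X]) ^ k = C ((-1) ^ k) * (X ^ 2 - 1) ^ k := by
  rw [map_pow, C_neg, C_1, ← mul_pow]
  ring

theorem integral_conj_sphereHarmonic_mul {l l' : ℕ} {m m' : ℤ} (hm : m.natAbs ≤ l)
    (hm' : m'.natAbs ≤ l') :
    ∫ n, conj (sphereHarmonic l m n) * sphereHarmonic l' m' n ∂sphereMeasure =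
      if l = l' ∧ m = m' then 1 else 0 := by
  set p := derivative^[m.natAbs] (legendre l)
  set p' := derivative^[m'.natAbs] (legendre l')
  have h1 : ∀ n, conj (sphereHarmonic l m n) * sphereHarmonic l' m' n =
      harmonicScalar l m * harmonicScalar l' m' * ((((p * p').eval (axial n) : ℝ) : ℂ) *
        (transverse n ^ (m'.toNat + (-m).toNat) *
          conj (transverse n) ^ ((-m').toNat + m.toNat))) := by
    intro n
    unfold sphereHarmonic
    simp only [map_mul, map_pow, Complex.conj_conj, Complex.conj_ofReal, conj_harmonicScalar,
      eval_mul, Complex.ofReal_mul, pow_add]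
    ring
  simp only [h1]
  rw [integral_const_mul, integral_poly_monomial]
  by_cases hmm : m = m'
  · subst hmm
    have he : m.toNat + (-m).toNat = m.natAbs := by omega
    rw [if_pos (by omega), he, one_sub_X_sq_pow,
      show p * p' * (C ((-1) ^ m.natAbs) * (X ^ 2 - 1) ^ m.natAbs) =
        C ((-1) ^ m.natAbs) * ((X ^ 2 - 1) ^ m.natAbs * (p * p')) by ring, polyInt_C_mul]
    have hdeg : ∀ j : ℕ, (derivative^[m.natAbs] (legendre j)).natDegree ≤ j - m.natAbs := fun j =>
      (natDegree_iterate_derivative _ _).trans (Nat.sub_le_sub_right (natDegree_legendre_le j) _)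
    rcases lt_trichotomy l l' with hl | hl | hl
    · rw [if_neg (by omega), mul_comm p p', polyInt_assocLegendre_mul (by have : p.natDegree ≤ _ := hdeg l; omega)]
      simp
    · subst hl
      rw [if_pos ⟨rfl, rfl⟩, polyInt_assocLegendre_sq hm, harmonicScalar_sq]
      have h3 : (-1 : ℝ) ^ m.natAbs * (-1) ^ m.natAbs = 1 := by rw [← mul_pow]; norm_num
      rw [← mul_assoc ((-1 : ℝ) ^ m.natAbs), h3, one_mul]
      norm_cast
      have := Real.pi_pos.ne'
      field_simp
      norm_num
    · rw [if_neg (by omega), polyInt_assocLegendre_mul (by have : p'.natDegree ≤ _ := hdeg l'; omega)]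
      simp
  · rw [if_neg (by omega), if_neg (fun h => hmm h.2), mul_zero]

/-- Expansion of a polynomial in a sequence of polynomials with exact degrees `0, 1, 2, …`. -/
theorem exists_expansion {p : ℕ → ℝ[X]} (hdeg : ∀ i, (p i).natDegree ≤ i)
    (hc : ∀ i, (p i).coeff i ≠ 0) (n : ℕ) :
    ∀ q : ℝ[X], q.natDegree ≤ n → ∃ c : ℕ → ℝ, q = ∑ i ∈ Finset.range (n + 1), C (c i) * p i := by
  induction n with
  | zero =>
    intro q hq
    refine ⟨fun _ => q.coeff 0 / (p 0).coeff 0, ?_⟩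
    rw [Finset.sum_range_one, eq_C_of_natDegree_le_zero hq, eq_C_of_natDegree_le_zero (hdeg 0)]
    have := hc 0
    simp only [coeff_C_zero, ← C_mul]
    rw [div_mul_cancel₀ _ this]
  | succ n ih =>
    intro q hq
    set c := q.coeff (n + 1) / (p (n + 1)).coeff (n + 1) with hcdef
    set r := q - C c * p (n + 1) with hr
    have h1 : r.natDegree ≤ n + 1 := (natDegree_sub_le _ _).trans
      (max_le hq ((natDegree_C_mul_le _ _).trans (hdeg _)))
    have h2 : r.coeff (n + 1) = 0 := by
      rw [hr, coeff_sub, coeff_C_mul, hcdef, div_mul_cancel₀ _ (hc _), sub_self]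
    have h3 : r.natDegree ≤ n := by
      by_contra! h
      have h4 : r.natDegree = n + 1 := by omega
      have h5 : r = 0 := by rw [← leadingCoeff_eq_zero, ← coeff_natDegree, h4, h2]
      rw [h5, natDegree_zero] at h
      omega
    obtain ⟨d, hd⟩ := ih r h3
    refine ⟨fun i => if i = n + 1 then c else d i, ?_⟩
    rw [Finset.sum_range_succ]
    beta_reduce
    rw [if_pos rfl, ← sub_eq_iff_eq_add, ← hr, hd]
    refine Finset.sum_congr rfl fun i hi => ?_
    rw [if_neg (Finset.mem_range.1 hi).ne]

/-- The restrictions to the sphere of polynomials of degree at most `k`. -/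
def polySpan (k : ℕ) : Submodule ℂ (TwoSphere → ℂ) :=
  Submodule.span ℂ {g | ∃ a b c : ℕ, a + b + c ≤ k ∧
    g = fun n => (axial n : ℂ) ^ a * (transverse n ^ b * conj (transverse n) ^ c)}

theorem mul_mem_polySpan {j k : ℕ} {f g : TwoSphere → ℂ} (hf : f ∈ polySpan j)
    (hg : g ∈ polySpan k) : f * g ∈ polySpan (j + k) := by
  have h := Submodule.mul_mem_mul hf hg
  unfold polySpan at h ⊢
  rw [Submodule.span_mul_span] at h
  refine Submodule.span_mono ?_ h
  rintro _ ⟨f, ⟨a, b, c, h1, rfl⟩, g, ⟨a', b', c', h2, rfl⟩, rfl⟩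
  refine ⟨a + a', b + b', c + c', by omega, ?_⟩
  funext n
  simp only [Pi.mul_apply, pow_add]
  ring

theorem pow_mem_polySpan {f : TwoSphere → ℂ} (hf : f ∈ polySpan 1) (k : ℕ) :
    f ^ k ∈ polySpan k := by
  induction k with
  | zero =>
    rw [pow_zero]
    exact Submodule.subset_span ⟨0, 0, 0, le_rfl, by funext n; simp⟩
  | succ k ih =>
    rw [pow_succ]
    exact mul_mem_polySpan ih hf

theorem linear_mem_polySpan (φ : E3 →ₗ[ℝ] ℂ) : (fun n : TwoSphere => φ n) ∈ polySpan 1 := by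
  have hx : (fun n => (axial n : ℂ)) ∈ polySpan 1 :=
    Submodule.subset_span ⟨1, 0, 0, le_rfl, by funext n; simp⟩
  have hz : transverse ∈ polySpan 1 :=
    Submodule.subset_span ⟨0, 1, 0, le_rfl, by funext n; simp⟩
  have hz' : (fun n => conj (transverse n)) ∈ polySpan 1 :=
    Submodule.subset_span ⟨0, 0, 1, le_rfl, by funext n; simp⟩
  set e := EuclideanSpace.basisFun (Fin 3) ℝ
  have h : (fun n : TwoSphere => φ n) = φ (e 0) • (fun n => (axial n : ℂ)) +
      ((φ (e 1) - Complex.I * φ (e 2)) / 2) • transverse +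
      ((φ (e 1) + Complex.I * φ (e 2)) / 2) • (fun n => conj (transverse n)) := by
    funext n
    have h1 : (n : E3) = ∑ i, (n : E3) i • e i := by
      have := e.sum_repr (n : E3)
      simpa [e] using this.symm
    have h2 : transverse n = ((n : E3) 1 : ℝ) + ((n : E3) 2 : ℝ) * Complex.I :=
      Complex.mk_eq_add_mul_I _ _
    rw [h1, map_sum, Fin.sum_univ_three]
    simp only [map_smul, Complex.real_smul, Pi.add_apply, Pi.smul_apply, smul_eq_mul, h2, axial,
      map_add, map_mul, Complex.conj_ofReal, Complex.conj_I]
    linear_combination (((n : E3) 2 : ℝ) : ℂ) * φ (e 2) * Complex.I_mul_I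
  rw [h]
  exact add_mem (add_mem (Submodule.smul_mem _ _ hx) (Submodule.smul_mem _ _ hz))
    (Submodule.smul_mem _ _ hz')

/-- The action of a rotation on the two-sphere. -/
def rotate (R : E3 ≃ₗᵢ[ℝ] E3) (n : TwoSphere) : TwoSphere :=
  ⟨R n, by rw [mem_sphere_zero_iff_norm, R.norm_map, mem_sphere_zero_iff_norm.1 n.2]⟩

theorem continuous_rotate (R : E3 ≃ₗᵢ[ℝ] E3) : Continuous (rotate R) :=
  Continuous.subtype_mk (R.continuous.comp continuous_subtype_val) _

theorem measurePreserving_rotate (R : E3 ≃ₗᵢ[ℝ] E3) :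
    MeasurePreserving (rotate R) sphereMeasure sphereMeasure := by
  refine ⟨(continuous_rotate R).measurable, ?_⟩
  refine eq_toSphere_of_lintegral (volume : Measure E3) (d := 2) (by simp) fun g hg => ?_
  have hR := R.measurePreserving
  have houter : Measurable fun n : TwoSphere => ∫⁻ r in Set.Ioi (0 : ℝ),
      ENNReal.ofReal (r ^ 2) * g (r • (n : E3)) :=
    Measurable.lintegral_prod_right' (f := fun q : TwoSphere × ℝ =>
      ENNReal.ofReal (q.2 ^ 2) * g (q.2 • (q.1 : E3))) (by fun_prop)
  rw [lintegral_map houter (continuous_rotate R).measurable]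
  refine (hR.lintegral_comp hg).symm.trans ((lintegral_eq_lintegral_toSphere (volume : Measure E3)
    (d := 2) (by simp) (hg.comp R.continuous.measurable)).trans ?_)
  refine lintegral_congr fun n => lintegral_congr fun r => ?_
  simp [rotate]

theorem measurableEmbedding_rotate (R : E3 ≃ₗᵢ[ℝ] E3) : MeasurableEmbedding (rotate R) := by
  refine (continuous_rotate R).measurableEmbedding fun n n' h => ?_
  exact Subtype.ext (R.injective (congrArg Subtype.val h))

/-- Rotations do not raise the degree of a polynomial on the sphere. -/
theorem comp_rotate_mem_polySpan (R : E3 ≃ₗᵢ[ℝ] E3) {k : ℕ} {W : TwoSphere → ℂ}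
    (hW : W ∈ polySpan k) : (fun n => W (rotate R n)) ∈ polySpan k := by
  refine Submodule.span_induction (p := fun W _ => (fun n => W (rotate R n)) ∈ polySpan k)
    ?_ (zero_mem _) (fun _ _ _ _ h1 h2 => add_mem h1 h2)
    (fun c _ _ h => Submodule.smul_mem _ c h) hW
  rintro _ ⟨a, b, c, h, rfl⟩
  have hmono : ∀ {i j : ℕ}, i ≤ j → polySpan i ≤ polySpan j := fun hij =>
    Submodule.span_mono fun g ⟨a, b, c, h, hg⟩ => ⟨a, b, c, h.trans hij, hg⟩
  have hx := linear_mem_polySpan (Complex.ofRealCLM.toLinearMap.comp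
    ((EuclideanSpace.proj 0 : E3 →L[ℝ] ℝ).toLinearMap.comp R.toLinearEquiv.toLinearMap))
  have hy : (fun n => transverse (rotate R n)) ∈ polySpan 1 := by
    have := add_mem (linear_mem_polySpan (Complex.ofRealCLM.toLinearMap.comp
      ((EuclideanSpace.proj 1 : E3 →L[ℝ] ℝ).toLinearMap.comp R.toLinearEquiv.toLinearMap)))
      (Submodule.smul_mem _ Complex.I (linear_mem_polySpan (Complex.ofRealCLM.toLinearMap.comp
      ((EuclideanSpace.proj 2 : E3 →L[ℝ] ℝ).toLinearMap.comp R.toLinearEquiv.toLinearMap))))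
    convert this using 1
    funext n
    rw [transverse, Complex.mk_eq_add_mul_I]
    simp [rotate, mul_comm]
  have hy' : (fun n => conj (transverse (rotate R n))) ∈ polySpan 1 := by
    have := sub_mem (linear_mem_polySpan (Complex.ofRealCLM.toLinearMap.comp
      ((EuclideanSpace.proj 1 : E3 →L[ℝ] ℝ).toLinearMap.comp R.toLinearEquiv.toLinearMap)))
      (Submodule.smul_mem _ Complex.I (linear_mem_polySpan (Complex.ofRealCLM.toLinearMap.comp
      ((EuclideanSpace.proj 2 : E3 →L[ℝ] ℝ).toLinearMap.comp R.toLinearEquiv.toLinearMap))))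
    convert this using 1
    funext n
    rw [transverse, Complex.mk_eq_add_mul_I]
    simp [rotate, mul_comm, sub_eq_add_neg]
  refine hmono (show a + (b + c) ≤ k by omega) ?_
  exact mul_mem_polySpan (pow_mem_polySpan hx a)
    (mul_mem_polySpan (pow_mem_polySpan hy b) (pow_mem_polySpan hy' c))

theorem continuous_of_mem_polySpan {k : ℕ} {W : TwoSphere → ℂ} (hW : W ∈ polySpan k) :
    Continuous W := by
  refine Submodule.span_induction (p := fun W _ => Continuous W) ?_ continuous_const
    (fun _ _ _ _ h1 h2 => h1.add h2) (fun c _ _ h => h.const_smul c) hW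
  rintro _ ⟨a, b, c, -, rfl⟩
  have h1 := continuous_axial
  have h2 := continuous_transverse
  fun_prop

theorem sphereHarmonic_mem_polySpan {l : ℕ} {m : ℤ} (hm : m.natAbs ≤ l) :
    sphereHarmonic l m ∈ polySpan l := by
  have hpoly : ∀ p : ℝ[X], p.natDegree ≤ l - m.natAbs →
      (fun n => ((p.eval (axial n) : ℝ) : ℂ)) ∈ polySpan (l - m.natAbs) := by
    intro p hp
    have : (fun n => ((p.eval (axial n) : ℝ) : ℂ)) =
        ∑ i ∈ Finset.range (l - m.natAbs + 1), (p.coeff i : ℂ) • fun n => (axial n : ℂ) ^ i := by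
      funext n
      rw [eval_eq_sum_range' (Nat.lt_succ_of_le hp)]
      simp
    rw [this]
    refine Submodule.sum_mem _ fun i hi => Submodule.smul_mem _ _ ?_
    exact Submodule.subset_span ⟨i, 0, 0, by have := Finset.mem_range.1 hi; omega, by funext n; simp⟩
  have h1 := hpoly (derivative^[m.natAbs] (legendre l))
    ((natDegree_iterate_derivative _ _).trans (Nat.sub_le_sub_right (natDegree_legendre_le l) _))
  have h2 : (fun n => transverse n ^ m.toNat * conj (transverse n) ^ (-m).toNat) ∈
      polySpan m.natAbs :=
    Submodule.subset_span ⟨0, m.toNat, (-m).toNat, by omega, by funext n; simp⟩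
  have h3 := Submodule.smul_mem _ (harmonicScalar l m) (mul_mem_polySpan h1 h2)
  rw [Nat.sub_add_cancel hm] at h3
  exact h3

/-- `Y_{lm}` is orthogonal to the polynomials of degree less than `l`. -/
theorem integral_sphereHarmonic_mul_eq_zero {l k : ℕ} {m : ℤ} (hk : k < l)
    {W : TwoSphere → ℂ} (hW : W ∈ polySpan k) :
    ∫ n, sphereHarmonic l m n * W n ∂sphereMeasure = 0 := by
  have hint : ∀ {j : ℕ} {W : TwoSphere → ℂ}, W ∈ polySpan j →
      Integrable (fun n => sphereHarmonic l m n * W n) sphereMeasure := fun hW =>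
    ((continuous_sphereHarmonic l m).mul (continuous_of_mem_polySpan hW)).integrable_of_hasCompactSupport
      (HasCompactSupport.of_compactSpace _)
  refine Submodule.span_induction
    (p := fun W _ => ∫ n, sphereHarmonic l m n * W n ∂sphereMeasure = 0) ?_ (by simp)
    (fun f g hf hg h1 h2 => ?_) (fun c f _ h => ?_) hW
  · rintro _ ⟨a, b, c, habc, rfl⟩
    have h1 : ∀ n, sphereHarmonic l m n * ((axial n : ℂ) ^ a * (transverse n ^ b *
        conj (transverse n) ^ c)) = harmonicScalar l m *
        ((((derivative^[m.natAbs] (legendre l) * X ^ a).eval (axial n) : ℝ) : ℂ) *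
        (transverse n ^ (m.toNat + b) * conj (transverse n) ^ ((-m).toNat + c))) := by
      intro n
      unfold sphereHarmonic
      simp only [eval_mul, eval_pow, eval_X, Complex.ofReal_mul, Complex.ofReal_pow, pow_add]
      ring
    simp only [h1]
    rw [integral_const_mul, integral_poly_monomial]
    split_ifs with h
    · obtain ⟨d, hd, hd2⟩ : ∃ d, m.toNat + b = m.natAbs + d ∧ a + 2 * d + m.natAbs ≤ k :=
        ⟨m.toNat + b - m.natAbs, by omega, by omega⟩
      rw [hd, pow_add, one_sub_X_sq_pow m.natAbs,
        show derivative^[m.natAbs] (legendre l) * X ^ a * (C ((-1) ^ m.natAbs) *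
          (X ^ 2 - 1) ^ m.natAbs * (1 - X ^ 2) ^ d) = C ((-1) ^ m.natAbs) *
          ((X ^ 2 - 1) ^ m.natAbs * (derivative^[m.natAbs] (legendre l) *
          (X ^ a * (1 - X ^ 2) ^ d))) by ring, polyInt_C_mul, polyInt_assocLegendre_mul]
      · simp
      · have h2 : ((1 - X ^ 2 : ℝ[X]) ^ d).natDegree ≤ d * 2 :=
          natDegree_pow_le.trans (Nat.mul_le_mul_left d ((natDegree_sub_le _ _).trans (by simp)))
        have h3 := natDegree_mul_le (p := (X : ℝ[X]) ^ a) (q := (1 - X ^ 2) ^ d)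
        rw [natDegree_X_pow] at h3
        omega
    · rw [mul_zero]
  · simp only [Pi.add_apply, mul_add]
    rw [integral_add (hint hf) (hint hg), h1, h2, add_zero]
  · simp only [Pi.smul_apply, smul_eq_mul]
    simp only [mul_left_comm _ c]
    rw [integral_const_mul, h, mul_zero]

/-- The pole `(1, 0, 0)`. -/
def pole : TwoSphere := sphericalPoint 0 0

theorem integrable_axial_mul {f : ℝ → ℂ} (hf : Measurable f) {B : ℝ}
    (hB : ∀ x ∈ Set.Icc (-1 : ℝ) 1, ‖f x‖ ≤ B) {W : TwoSphere → ℂ} (hW : Continuous W) :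
    Integrable (fun n => f (axial n) * W n) sphereMeasure := by
  refine (hW.integrable_of_hasCompactSupport (HasCompactSupport.of_compactSpace _)).bdd_mul
    (c := B) (hf.comp continuous_axial.measurable).aestronglyMeasurable ?_
  exact ae_of_all _ fun n => hB _ (axial_mem n)

/-- The average over rotations about the axis of a polynomial of degree at most `l` is a
polynomial of degree at most `l` in the axial coordinate, here expanded in Legendre polynomials. -/
theorem exists_zonal_average {l : ℕ} {W : TwoSphere → ℂ} (hW : W ∈ polySpan l) :
    ∃ c : ℕ → ℂ, W pole = ∑ i ∈ Finset.range (l + 1), c i ∧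
      ∀ f : ℝ → ℂ, Measurable f → (∃ B, ∀ x ∈ Set.Icc (-1 : ℝ) 1, ‖f x‖ ≤ B) →
        ∫ n, f (axial n) * W n ∂sphereMeasure = ∑ i ∈ Finset.range (l + 1),
          c i * (2 * Real.pi * ∫ x in Set.Ioo (-1 : ℝ) 1, f x * ((legendre i).eval x : ℝ)) := by
  refine Submodule.span_induction (p := fun W _ => ∃ c : ℕ → ℂ, W pole =
      ∑ i ∈ Finset.range (l + 1), c i ∧ ∀ f : ℝ → ℂ, Measurable f →
      (∃ B, ∀ x ∈ Set.Icc (-1 : ℝ) 1, ‖f x‖ ≤ B) → ∫ n, f (axial n) * W n ∂sphereMeasure =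
      ∑ i ∈ Finset.range (l + 1), c i * (2 * Real.pi * ∫ x in Set.Ioo (-1 : ℝ) 1,
        f x * ((legendre i).eval x : ℝ))) ?_ ⟨0, by simp, by simp⟩ ?_ ?_ hW
  · rintro _ ⟨a, b, c, habc, rfl⟩
    have hpole1 : axial pole = 1 := by simp [pole, axial_sphericalPoint]
    have hpole2 : transverse pole = 0 := by simp [pole, transverse_sphericalPoint]
    by_cases hbc : b = c
    · subst hbc
      have hq : (X ^ a * (1 - X ^ 2) ^ b : ℝ[X]).natDegree ≤ l := by
        have h2 : ((1 - X ^ 2 : ℝ[X]) ^ b).natDegree ≤ b * 2 :=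
          natDegree_pow_le.trans (Nat.mul_le_mul_left b ((natDegree_sub_le _ _).trans (by simp)))
        have h3 := natDegree_mul_le (p := (X : ℝ[X]) ^ a) (q := (1 - X ^ 2) ^ b)
        rw [natDegree_X_pow] at h3
        omega
      obtain ⟨c, hc⟩ := exists_expansion natDegree_legendre_le coeff_legendre_ne_zero l _ hq
      have heval : ∀ x : ℝ, x ^ a * (1 - x ^ 2) ^ b =
          ∑ i ∈ Finset.range (l + 1), c i * (legendre i).eval x := by
        intro x
        have := congrArg (eval x) hc
        simpa [eval_finsetSum] using this
      refine ⟨fun i => c i, ?_, fun f hf ⟨B, hB⟩ => ?_⟩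
      · have := heval 1
        simp only [eval_one_legendre, mul_one, one_pow, one_mul, sub_self] at this
        beta_reduce
        rw [hpole1, hpole2]
        simp only [Complex.ofReal_one, one_pow, one_mul, map_zero]
        rw [← mul_pow, mul_zero]
        exact_mod_cast this
      · have h1 : ∀ n, f (axial n) * ((axial n : ℂ) ^ a * (transverse n ^ b *
            conj (transverse n) ^ b)) = (fun x : ℝ => f x * (x : ℂ) ^ a) (axial n) *
            (transverse n ^ b * conj (transverse n) ^ b) := fun n => by ring
        rw [integral_congr_ae (ae_of_all _ h1), integral_monomial (f := fun x : ℝ => f x * (x : ℂ) ^ a)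
          (hf.mul (by fun_prop)),
          if_pos rfl]
        have h2 : ∀ x : ℝ, f x * (x : ℂ) ^ a * ((1 - x ^ 2 : ℝ) : ℂ) ^ b =
            ∑ i ∈ Finset.range (l + 1), (c i : ℂ) * (f x * ((legendre i).eval x : ℝ)) := by
          intro x
          have h3 : (x : ℂ) ^ a * ((1 - x ^ 2 : ℝ) : ℂ) ^ b =
              ∑ i ∈ Finset.range (l + 1), (c i : ℂ) * ((legendre i).eval x : ℝ) := by
            exact_mod_cast congrArg (fun y : ℝ => (y : ℂ)) (heval x)
          rw [mul_assoc, h3, Finset.mul_sum]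
          exact Finset.sum_congr rfl fun i _ => by ring
        simp only [h2]
        rw [integral_finset_sum, Finset.mul_sum]
        · refine Finset.sum_congr rfl fun i _ => ?_
          rw [integral_const_mul]
          ring
        · intro i _
          refine Integrable.const_mul ?_ _
          have hP : IntegrableOn (fun x : ℝ => (((legendre i).eval x : ℝ) : ℂ)) (Set.Ioo (-1) 1) :=
            ((Complex.continuous_ofReal.comp (legendre i).continuous).continuousOn.integrableOn_Icc).mono_set
              Set.Ioo_subset_Icc_self
          refine hP.bdd_mul (c := B) hf.aestronglyMeasurable ?_
          filter_upwards [ae_restrict_mem measurableSet_Ioo] with x hx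
          exact hB x (Set.Ioo_subset_Icc_self hx)
    · refine ⟨0, ?_, fun f hf _ => ?_⟩
      · beta_reduce
        rw [hpole2]
        simp only [map_zero, Pi.zero_apply, Finset.sum_const_zero]
        rcases Nat.eq_zero_or_pos b with hb | hb
        · rw [zero_pow (n := c) (by omega)]; simp
        · rw [zero_pow hb.ne']; simp
      · have h1 : ∀ n, f (axial n) * ((axial n : ℂ) ^ a * (transverse n ^ b *
            conj (transverse n) ^ c)) = (fun x : ℝ => f x * (x : ℂ) ^ a) (axial n) *
            (transverse n ^ b * conj (transverse n) ^ c) := fun n => by ring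
        rw [integral_congr_ae (ae_of_all _ h1), integral_monomial (f := fun x : ℝ => f x * (x : ℂ) ^ a)
          (hf.mul (by fun_prop)),
          if_neg hbc]
        simp
  · rintro W W' hW hW' ⟨c, hc1, hc2⟩ ⟨c', hc1', hc2'⟩
    refine ⟨c + c', by simp [hc1, hc1', Finset.sum_add_distrib], fun f hf hB => ?_⟩
    obtain ⟨B, hB'⟩ := hB
    simp only [Pi.add_apply, mul_add, add_mul, Finset.sum_add_distrib]
    rw [integral_add (integrable_axial_mul hf hB' (continuous_of_mem_polySpan hW))
      (integrable_axial_mul hf hB' (continuous_of_mem_polySpan hW')), hc2 f hf ⟨B, hB'⟩,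
      hc2' f hf ⟨B, hB'⟩]
  · rintro z W - ⟨c, hc1, hc2⟩
    refine ⟨z • c, by simp [hc1, Finset.mul_sum], fun f hf hB => ?_⟩
    simp only [Pi.smul_apply, smul_eq_mul, mul_left_comm _ z]
    rw [integral_const_mul, hc2 f hf hB, Finset.mul_sum]
    exact Finset.sum_congr rfl fun i _ => by ring

/-- The Funk–Hecke formula: zonal kernels act on spherical harmonics as scalars. -/
theorem funk_hecke {l : ℕ} {m : ℤ} (hm : m.natAbs ≤ l) {f : ℝ → ℂ} (hf : Measurable f)
    (hB : ∃ B, ∀ x ∈ Set.Icc (-1 : ℝ) 1, ‖f x‖ ≤ B) (n : TwoSphere) :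
    ∫ n', f (inner ℝ (n : E3) n') * sphereHarmonic l m n' ∂sphereMeasure =
      (2 * Real.pi * ∫ x in Set.Ioo (-1 : ℝ) 1, f x * ((legendre l).eval x : ℝ)) *
        sphereHarmonic l m n := by
  -- a reflection that exchanges `n` and the pole reduces the claim to a kernel in the axial
  -- coordinate, and hence to the zonal average of the reflected harmonic
  set R : E3 ≃ₗᵢ[ℝ] E3 := (ℝ ∙ ((pole : E3) - n))ᗮ.reflection
  have hR : rotate R pole = n := Subtype.ext (Submodule.reflection_sub (by
    rw [mem_sphere_zero_iff_norm.1 pole.2, mem_sphere_zero_iff_norm.1 n.2]))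
  have hpole : ∀ n' : TwoSphere, inner ℝ (n : E3) (rotate R n' : E3) = axial n' := by
    intro n'
    rw [← hR]
    change inner ℝ (R pole) (R n') = _
    rw [R.inner_map_map, pole, coe_sphericalPoint]
    simp [PiLp.inner_apply, Fin.sum_univ_three, axial]
  rw [← (measurePreserving_rotate R).integral_comp (measurableEmbedding_rotate R)]
  simp only [hpole]
  obtain ⟨c, hc1, hc2⟩ := exists_zonal_average
    (comp_rotate_mem_polySpan R (sphereHarmonic_mem_polySpan hm))
  -- test against `P_j`: the reflected harmonic is orthogonal to all polynomials of degree `j < l`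
  have hzero : ∀ j < l, c j = 0 := by
    intro j hj
    have h1 := hc2 (fun x => ((legendre j).eval x : ℝ))
      (Complex.measurable_ofReal.comp (legendre j).continuous.measurable) (by
        obtain ⟨B, hB⟩ := isCompact_Icc.exists_bound_of_continuousOn
          (s := Set.Icc (-1 : ℝ) 1) (f := fun x => (((legendre j).eval x : ℝ) : ℂ))
          (Complex.continuous_ofReal.comp (legendre j).continuous).continuousOn
        exact ⟨B, hB⟩)
    have h2 : ∫ n', (((legendre j).eval (axial n') : ℝ) : ℂ) * sphereHarmonic l m (rotate R n')
        ∂sphereMeasure = 0 := by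
      have h3 := integral_sphereHarmonic_mul_eq_zero (m := m) hj
        (comp_rotate_mem_polySpan R.symm (sphereHarmonic_mem_polySpan (l := j) (m := 0) (by simp)))
      rw [← (measurePreserving_rotate R).integral_comp (measurableEmbedding_rotate R)] at h3
      have h4 : ∀ n', rotate R.symm (rotate R n') = n' := fun n' =>
        Subtype.ext (R.symm_apply_apply _)
      simp only [h4] at h3
      have h5 : ∀ n', sphereHarmonic l m (rotate R n') * sphereHarmonic j 0 n' = harmonicScalar j 0 *
          ((((legendre j).eval (axial n') : ℝ) : ℂ) * sphereHarmonic l m (rotate R n')) := by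
        intro n'
        have : sphereHarmonic j 0 n' = harmonicScalar j 0 * ((legendre j).eval (axial n') : ℝ) := by
          simp [sphereHarmonic]
        rw [this]
        ring
      simp only [h5] at h3
      rw [integral_const_mul] at h3
      exact (mul_eq_zero.1 h3).resolve_left (harmonicScalar_ne_zero _ _)
    rw [h2] at h1
    have h6 : ∀ i, ∫ x in Set.Ioo (-1 : ℝ) 1, (((legendre j).eval x : ℝ) : ℂ) *
        ((legendre i).eval x : ℝ) = (polyInt (legendre j * legendre i) : ℂ) := by
      intro i
      rw [← setIntegral_poly]
      simp
    simp only [h6] at h1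
    rw [Finset.sum_eq_single_of_mem j (Finset.mem_range.2 (by omega))] at h1
    · rw [polyInt_legendre_sq] at h1
      have h7 : (2 * (Real.pi : ℂ) * ((2 / (2 * j + 1) : ℝ) : ℂ)) ≠ 0 := by
        have := Real.pi_pos
        have h8 : (2 * Real.pi * (2 / (2 * j + 1)) : ℝ) ≠ 0 := by positivity
        exact_mod_cast h8
      exact (mul_eq_zero.1 h1.symm).resolve_right h7
    · intro i _ hij
      rcases lt_or_gt_of_ne hij with h | h
      · rw [polyInt_legendre_mul ((natDegree_legendre_le i).trans_lt h)]
        simp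
      · rw [mul_comm (legendre j), polyInt_legendre_mul ((natDegree_legendre_le j).trans_lt h)]
        simp
  have hlast : ∀ g : ℕ → ℂ, ∑ i ∈ Finset.range (l + 1), c i * g i = c l * g l := fun g =>
    Finset.sum_eq_single_of_mem l (Finset.mem_range.2 (by omega)) fun i hi hil => by
      rw [hzero i (by have := Finset.mem_range.1 hi; omega), zero_mul]
  -- only the term with `P_l` is left; its coefficient is read off at the pole, where `P_l = 1`
  have hcl : c l = sphereHarmonic l m n := by
    have := hlast fun _ => 1
    simp only [mul_one] at this
    rw [← this, ← hc1, hR]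
  rw [hc2 f hf hB, hlast, hcl]
  ring

end Harmonics

/-! ### Completeness of the spherical harmonics -/

section Completeness

open Polynomial

theorem AngLabel.natAbs_m_le (a : AngLabel) : a.m.natAbs ≤ a.1 := by
  have := a.2.2
  unfold AngLabel.m
  omega

/-- The harmonic with a given label, as a continuous function. -/
def harmonicMap (a : AngLabel) : C(TwoSphere, ℂ) :=
  ⟨sphereHarmonic a.1 a.m, continuous_sphereHarmonic _ _⟩

theorem exists_angLabel {l : ℕ} {m : ℤ} (hm : m.natAbs ≤ l) :
    ∃ a : AngLabel, a.1 = l ∧ a.m = m := by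
  refine ⟨⟨l, ⟨(m + l).toNat, by omega⟩⟩, rfl, ?_⟩
  simp only [AngLabel.m]
  omega

theorem AngLabel.ext_iff' {a b : AngLabel} : a.1 = b.1 ∧ a.m = b.m ↔ a = b := by
  constructor
  · rintro ⟨h1, h2⟩
    obtain ⟨l, i⟩ := a
    obtain ⟨l', j⟩ := b
    obtain rfl : l = l' := h1
    simp only [AngLabel.m] at h2
    have : i = j := Fin.ext (by omega)
    rw [this]
  · rintro rfl
    exact ⟨rfl, rfl⟩

/-- The coordinate along the polar axis, as a continuous complex function. -/
def axialMap : C(TwoSphere, ℂ) :=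
  ⟨fun n => (axial n : ℂ), Complex.continuous_ofReal.comp continuous_axial⟩

/-- The coordinate `y + i z`, as a continuous complex function. -/
def transverseMap : C(TwoSphere, ℂ) := ⟨transverse, continuous_transverse⟩

/-- With `m = b - c`, the monomial is `(y ± iz)^{|m|}` times a polynomial in the axial coordinate,
which expands in the derivatives `P_{i+|m|}^{(|m|)}` of exact degree `i`. -/
theorem monomial_mem_span (a b c : ℕ) : axialMap ^ a * (transverseMap ^ b * star transverseMap ^ c) ∈
    Submodule.span ℂ (Set.range harmonicMap) := by
  set m : ℤ := (b : ℤ) - c with hm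
  have hdeg : ∀ i, (derivative^[m.natAbs] (legendre (i + m.natAbs))).natDegree ≤ i := fun i =>
    (natDegree_iterate_derivative _ _).trans
      (by have := natDegree_legendre_le (i + m.natAbs); omega)
  have hc : ∀ i, (derivative^[m.natAbs] (legendre (i + m.natAbs))).coeff i ≠ 0 := by
    intro i
    rw [coeff_iterate_derivative, nsmul_eq_mul]
    refine mul_ne_zero ?_ (coeff_legendre_ne_zero _)
    have : (i + m.natAbs).descFactorial m.natAbs ≠ 0 := by
      rw [Ne, Nat.descFactorial_eq_zero_iff_lt]; omega
    exact_mod_cast this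
  obtain ⟨e, he⟩ := exists_expansion hdeg hc _ (X ^ a * (1 - X ^ 2) ^ (min b c)) le_rfl
  have h : axialMap ^ a * (transverseMap ^ b * star transverseMap ^ c) =
      ∑ i ∈ Finset.range ((X ^ a * (1 - X ^ 2) ^ (min b c) : ℝ[X]).natDegree + 1),
        ((e i : ℂ) * (harmonicScalar (i + m.natAbs) m)⁻¹) •
          (⟨sphereHarmonic (i + m.natAbs) m, continuous_sphereHarmonic _ _⟩ : C(TwoSphere, ℂ)) := by
    ext n
    have h1 := congrArg (fun x : ℝ => (x : ℂ)) (congrArg (eval (axial n)) he)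
    simp only [eval_mul, eval_pow, eval_X, eval_sub, eval_one, eval_finsetSum, eval_C,
      Complex.ofReal_sum, Complex.ofReal_mul] at h1
    have h2 : transverse n ^ b * conj (transverse n) ^ c = ((1 - axial n ^ 2 : ℝ) : ℂ) ^ (min b c) *
        (transverse n ^ m.toNat * conj (transverse n) ^ (-m).toNat) := by
      rw [← transverse_mul_conj, mul_pow, mul_mul_mul_comm, ← pow_add, ← pow_add]
      congr 2 <;> omega
    have h3 : (axialMap ^ a * (transverseMap ^ b * star transverseMap ^ c)) n =
        (axial n : ℂ) ^ a * (transverse n ^ b * conj (transverse n) ^ c) := rfl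
    rw [h3, h2, ← mul_assoc]
    simp only [Complex.ofReal_pow] at h1 ⊢
    rw [h1, Finset.sum_mul]
    simp only [ContinuousMap.coe_sum, Finset.sum_apply, ContinuousMap.smul_apply,
      ContinuousMap.coe_mk, smul_eq_mul, sphereHarmonic]
    refine Finset.sum_congr rfl fun i _ => ?_
    have := harmonicScalar_ne_zero (i + m.natAbs) m
    field_simp
  rw [h]
  refine Submodule.sum_mem _ fun i _ => Submodule.smul_mem _ _ (Submodule.subset_span ?_)
  obtain ⟨x, h1, h2⟩ := exists_angLabel (l := i + m.natAbs) (m := m) (by omega)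
  exact ⟨x, by unfold harmonicMap; simp only [h1, h2]⟩

/-- The Stone–Weierstrass theorem, for the algebra generated by the coordinates. -/
theorem span_harmonicMap_dense :
    Dense (Submodule.span ℂ (Set.range harmonicMap) : Set C(TwoSphere, ℂ)) := by
  set A : StarSubalgebra ℂ C(TwoSphere, ℂ) := StarAlgebra.adjoin ℂ {axialMap, transverseMap}
  have hsep : A.SeparatesPoints := by
    intro n n' hne
    by_contra! hcon
    have h1 : axial n = axial n' := by
      have := hcon axialMap ⟨axialMap, StarAlgebra.subset_adjoin _ _ (by simp), rfl⟩
      exact Complex.ofReal_injective this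
    have h2 : transverse n = transverse n' :=
      hcon transverseMap ⟨transverseMap, StarAlgebra.subset_adjoin _ _ (by simp), rfl⟩
    refine hne (Subtype.ext ?_)
    ext i
    fin_cases i
    · exact h1
    · exact congrArg Complex.re h2
    · exact congrArg Complex.im h2
  have htop := ContinuousMap.starSubalgebra_topologicalClosure_eq_top_of_separatesPoints A hsep
  have hle : (A : Set C(TwoSphere, ℂ)) ⊆ Submodule.span ℂ (Set.range harmonicMap) := by
    intro f hf
    have h1 : f ∈ Algebra.adjoin ℂ (({axialMap, transverseMap} : Set C(TwoSphere, ℂ)) ∪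
        star {axialMap, transverseMap}) := by
      rw [← StarAlgebra.adjoin_toSubalgebra]
      exact hf
    rw [← Subalgebra.mem_toSubmodule, Algebra.adjoin_eq_span] at h1
    refine Submodule.span_le.2 ?_ h1
    intro g hg
    have h2 : ∃ a b c : ℕ, g = axialMap ^ a * (transverseMap ^ b * star transverseMap ^ c) := by
      refine Submonoid.closure_induction (motive := fun g _ => ∃ a b c : ℕ,
        g = axialMap ^ a * (transverseMap ^ b * star transverseMap ^ c)) ?_ ⟨0, 0, 0, by simp⟩ ?_ hg
      · have hstar : star axialMap = axialMap := by
          ext n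
          exact Complex.conj_ofReal _
        rintro x (hx | hx)
        · rcases hx with rfl | rfl
          · exact ⟨1, 0, 0, by simp⟩
          · exact ⟨0, 1, 0, by simp⟩
        · rw [Set.mem_star] at hx
          rcases hx with hx | hx
          · exact ⟨1, 0, 0, by rw [← star_star x, hx, hstar]; simp⟩
          · exact ⟨0, 0, 1, by rw [← star_star x, hx]; simp⟩
      · rintro x y _ _ ⟨a, b, c, rfl⟩ ⟨a', b', c', rfl⟩
        exact ⟨a + a', b + b', c + c', by simp only [pow_add]; ring⟩
    obtain ⟨a, b, c, rfl⟩ := h2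
    exact monomial_mem_span a b c
  have hA : Dense (A : Set C(TwoSphere, ℂ)) := by
    rw [dense_iff_closure_eq, ← StarSubalgebra.topologicalClosure_coe, htop]
    rfl
  exact hA.mono hle

/-- The harmonic with a given label, as an element of `L²`. -/
def harmonicLp (a : AngLabel) : Lp ℂ 2 sphereMeasure :=
  ContinuousMap.toLp 2 sphereMeasure ℂ (harmonicMap a)

theorem coeFn_harmonicLp (a : AngLabel) :
    harmonicLp a =ᵐ[sphereMeasure] sphereHarmonic a.1 a.m :=
  ContinuousMap.coeFn_toLp sphereMeasure (harmonicMap a)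

theorem inner_harmonicLp (a : AngLabel) (g : Lp ℂ 2 sphereMeasure) :
    inner ℂ (harmonicLp a) g = ∫ n, conj (sphereHarmonic a.1 a.m n) * g n ∂sphereMeasure := by
  rw [L2.inner_def]
  refine integral_congr_ae ?_
  filter_upwards [coeFn_harmonicLp a] with n hn
  rw [hn, RCLike.inner_apply, mul_comm]

theorem orthonormal_harmonicLp : Orthonormal ℂ harmonicLp := by
  classical
  rw [orthonormal_iff_ite]
  intro a b
  rw [inner_harmonicLp]
  have h : ∫ n, conj (sphereHarmonic a.1 a.m n) * harmonicLp b n ∂sphereMeasure =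
      ∫ n, conj (sphereHarmonic a.1 a.m n) * sphereHarmonic b.1 b.m n ∂sphereMeasure := by
    refine integral_congr_ae ?_
    filter_upwards [coeFn_harmonicLp b] with n hn
    rw [hn]
  rw [h, integral_conj_sphereHarmonic_mul a.natAbs_m_le b.natAbs_m_le]
  simp only [AngLabel.ext_iff']

/-- The spherical harmonics as a Hilbert basis. -/
def harmonicBasis : HilbertBasis AngLabel ℂ (Lp ℂ 2 sphereMeasure) :=
  HilbertBasis.mk orthonormal_harmonicLp (by
    have h1 := ContinuousMap.toLp_denseRange (p := 2) (E := ℂ) sphereMeasure ℂ (by norm_num)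
    have h2 := h1.dense_image (ContinuousMap.toLp 2 sphereMeasure ℂ).continuous
      span_harmonicMap_dense
    have h3 : (ContinuousMap.toLp 2 sphereMeasure ℂ) ''
        (Submodule.span ℂ (Set.range harmonicMap) : Set C(TwoSphere, ℂ)) ⊆
        (Submodule.span ℂ (Set.range harmonicLp) : Set (Lp ℂ 2 sphereMeasure)) := by
      rintro _ ⟨f, hf, rfl⟩
      have h4 := Submodule.mem_map_of_mem
        (f := (ContinuousMap.toLp 2 sphereMeasure ℂ : C(TwoSphere, ℂ) →L[ℂ] _).toLinearMap) hf
      rw [Submodule.map_span, ← Set.range_comp] at h4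
      exact h4
    have h5 := h2.mono h3
    rw [Submodule.dense_iff_topologicalClosure_eq_top] at h5
    rw [h5])

/-- Parseval's identity on the two-sphere. -/
theorem lintegral_enorm_sq_sphere {g : TwoSphere → ℂ} (hg : MemLp g 2 sphereMeasure) :
    ∫⁻ n, ‖g n‖ₑ ^ 2 ∂sphereMeasure =
      ∑' a : AngLabel, ‖∫ n, conj (sphereHarmonic a.1 a.m n) * g n ∂sphereMeasure‖ₑ ^ 2 := by
  set G := hg.toLp g
  have hG : G =ᵐ[sphereMeasure] g := hg.coeFn_toLp
  have h1 : ∀ a, ∫ n, conj (sphereHarmonic a.1 a.m n) * g n ∂sphereMeasure =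
      inner ℂ (harmonicBasis a) G := by
    intro a
    have : harmonicBasis a = harmonicLp a := by
      rw [harmonicBasis, HilbertBasis.coe_mk]
    rw [this, inner_harmonicLp]
    refine integral_congr_ae ?_
    filter_upwards [hG] with n hn
    rw [hn]
  have h2 := harmonicBasis.hasSum_inner_mul_inner G G
  have h3 : HasSum (fun a => ‖inner ℂ (harmonicBasis a) G‖ ^ 2) (‖G‖ ^ 2) := by
    have h4 := Complex.hasSum_re h2
    have h5 : RCLike.re (inner ℂ G G) = ‖G‖ ^ 2 := inner_self_eq_norm_sq G
    rw [← h5]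
    convert h4 using 2 with a
    · rw [← inner_conj_symm G, ← Complex.normSq_eq_conj_mul_self, Complex.ofReal_re,
        Complex.normSq_eq_norm_sq]
    · rfl
  have h6 : ∫⁻ n, ‖g n‖ₑ ^ 2 ∂sphereMeasure = ENNReal.ofReal (‖G‖ ^ 2) := by
    have h7 : ‖G‖ ^ 2 = ∫ n, ‖g n‖ ^ 2 ∂sphereMeasure := by
      rw [← inner_self_eq_norm_sq (𝕜 := ℂ) G, L2.inner_def]
      have : ∫ n, inner ℂ (G n) (G n) ∂sphereMeasure = ((∫ n, ‖g n‖ ^ 2 ∂sphereMeasure : ℝ) : ℂ) := by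
        rw [← integral_complex_ofReal]
        refine integral_congr_ae ?_
        filter_upwards [hG] with n hn
        rw [hn, inner_self_eq_norm_sq_to_K]
        simp
      rw [this]
      exact Complex.ofReal_re _
    rw [h7, ofReal_integral_eq_lintegral_ofReal
      ((memLp_two_iff_integrable_sq_norm hg.1).1 hg) (ae_of_all _ fun _ => by positivity)]
    refine lintegral_congr fun n => ?_
    rw [ENNReal.ofReal_pow (norm_nonneg _), ofReal_norm]
  rw [h6, ← h3.tsum_eq, ENNReal.ofReal_tsum_of_nonneg (fun _ => by positivity) h3.summable]
  refine tsum_congr fun a => ?_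
  rw [ENNReal.ofReal_pow (norm_nonneg _), ofReal_norm, h1]

end Completeness

/-! ### Fourier analysis in the time coordinate -/

section Plancherel

open FourierTransform SchwartzMap

/-- The Fourier transform in the convention `f̂(ω) = ∫ e^{iωt} f(t) dt` of the mode coefficients. -/
def timeFourier (f : ℝ → ℂ) (w : ℝ) : ℂ := ∫ t : ℝ, Complex.exp (Complex.I * w * t) * f t

theorem norm_exp_I_mul (w t : ℝ) : ‖Complex.exp (Complex.I * w * t)‖ = 1 := by
  rw [Complex.norm_exp]
  simp

theorem fourier_eq_timeFourier (f : ℝ → ℂ) (v : ℝ) :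
    𝓕 f v = timeFourier f (-(2 * Real.pi) * v) := by
  rw [Real.fourier_real_eq_integral_exp_smul, timeFourier]
  refine integral_congr_ae (ae_of_all _ fun t => ?_)
  simp only [smul_eq_mul]
  congr 2
  push_cast
  ring

theorem integrable_exp_mul {f : ℝ → ℂ} (hf : Integrable f) (w : ℝ) :
    Integrable fun t : ℝ => Complex.exp (Complex.I * w * t) * f t := by
  refine hf.bdd_mul (c := 1) (by fun_prop) (ae_of_all _ fun t => (norm_exp_I_mul w t).le)

theorem continuous_timeFourier {f : ℝ → ℂ} (hf : Integrable f) : Continuous (timeFourier f) := by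
  refine continuous_of_dominated (bound := fun t => ‖f t‖) (fun w => (integrable_exp_mul hf w).1)
    (fun w => ae_of_all _ fun t => ?_) hf.norm (ae_of_all _ fun t => by fun_prop)
  rw [norm_mul, norm_exp_I_mul, one_mul]

theorem continuous_fourier {f : ℝ → ℂ} (hf : Integrable f) : Continuous (𝓕 f) := by
  have : 𝓕 f = fun v => timeFourier f (-(2 * Real.pi) * v) := funext (fourier_eq_timeFourier f)
  rw [this]
  exact (continuous_timeFourier hf).comp (by fun_prop)

/-- The Fourier transform of `L²` agrees with the Fourier integral on `L¹ ∩ L²`. -/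
theorem coeFn_fourier_toLp {f : ℝ → ℂ} (h1 : Integrable f) (h2 : MemLp f 2) :
    (𝓕 (h2.toLp f) : Lp ℂ 2 (volume : Measure ℝ)) =ᵐ[volume] 𝓕 f := by
  refine ae_eq_of_integral_contDiff_smul_eq
    ((Lp.memLp _).locallyIntegrable (by norm_num)) (continuous_fourier h1).locallyIntegrable ?_
  intro g hg hgs
  have hgc : ContDiff ℝ ∞ fun x => (g x : ℂ) := Complex.ofRealCLM.contDiff.comp hg
  have hgcs : HasCompactSupport fun x => (g x : ℂ) := hgs.comp_left (g := Complex.ofReal) rfl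
  set G : 𝓢(ℝ, ℂ) := hgcs.toSchwartzMap hgc with hG
  have e1 := congrArg (fun T => T G) (Lp.fourier_toTemperedDistribution_eq (h2.toLp f))
  simp only [TemperedDistribution.fourier_apply, Lp.toTemperedDistribution_apply] at e1
  have e2 : ∫ x, G x • (𝓕 f) x = ∫ x, (𝓕 G) x • f x := by
    have := VectorFourier.integral_fourierIntegral_smul_eq_flip (L := innerₗ ℝ)
      (μ := volume) (ν := volume)
      Real.continuous_fourierChar continuous_inner G.integrable h1
    rw [SchwartzMap.fourier_coe]
    simpa using! this.symm
  have e3 : ∫ x, (𝓕 G) x • f x = ∫ x, (𝓕 G) x • (h2.toLp f) x := by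
    refine integral_congr_ae ?_
    filter_upwards [h2.coeFn_toLp] with x hx
    rw [hx]
  exact e1.symm.trans (e3.symm.trans e2.symm)

/-- Plancherel's identity. -/
theorem lintegral_enorm_sq_eq_timeFourier {f : ℝ → ℂ} (h1 : Integrable f) (h2 : MemLp f 2) :
    ∫⁻ t, ‖f t‖ₑ ^ 2 =
      ENNReal.ofReal ((2 * Real.pi)⁻¹) * ∫⁻ w, ‖timeFourier f w‖ₑ ^ 2 := by
  have key : ∀ F : Lp ℂ 2 (volume : Measure ℝ), ∫⁻ t, ‖F t‖ₑ ^ 2 = ‖F‖ₑ ^ 2 := by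
    intro F
    rw [Lp.enorm_def, eLpNorm_eq_lintegral_rpow_enorm_toReal (by norm_num) (by norm_num)]
    rw [← ENNReal.rpow_natCast, ← ENNReal.rpow_mul]
    norm_num
  have e1 : ∫⁻ t, ‖f t‖ₑ ^ 2 = ∫⁻ t, ‖𝓕 f t‖ₑ ^ 2 := by
    calc _ = ∫⁻ t, ‖(h2.toLp f) t‖ₑ ^ 2 := by
          refine lintegral_congr_ae ?_
          filter_upwards [h2.coeFn_toLp] with x hx
          rw [hx]
      _ = ∫⁻ t, ‖(𝓕 (h2.toLp f) : Lp ℂ 2 (volume : Measure ℝ)) t‖ₑ ^ 2 := by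
          rw [key, key, ← ofReal_norm, ← ofReal_norm, Lp.norm_fourier_eq]
      _ = _ := by
          refine lintegral_congr_ae ?_
          filter_upwards [coeFn_fourier_toLp h1 h2] with x hx
          rw [hx]
  have hc : (-(2 * Real.pi)) ≠ 0 := by
    have := Real.pi_pos
    linarith
  have e2 := (lintegral_map (μ := volume) (f := fun w => ‖timeFourier f w‖ₑ ^ 2)
    (g := fun v => -(2 * Real.pi) * v) ((continuous_timeFourier h1).measurable.enorm.pow_const 2)
    (by fun_prop))
  rw [Real.map_volume_mul_left hc, lintegral_smul_measure] at e2
  rw [e1]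
  simp_rw [fourier_eq_timeFourier]
  rw [← e2, smul_eq_mul, inv_neg, abs_neg, abs_of_pos (by positivity)]

end Plancherel

/-! ### Mode expansion on the cylinder -/

section Cylinder

/-- The coefficient of a function on the cylinder `ℝ × S²` with respect to `e^{-iωt} Y_{lm}`. -/
def modeCoeff (f : ℝ × TwoSphere → ℝ) (x : Mode) : ℂ :=
  timeFourier (fun t => ∫ n, conj (sphereHarmonic x.2.1 x.2.m n) * (f (t, n) : ℂ) ∂sphereMeasure) x.1

theorem conj_sphereHarmonic (l : ℕ) (m : ℤ) (n : TwoSphere) :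
    conj (sphereHarmonic l m n) = (-1) ^ m.natAbs * sphereHarmonic l (-m) n := by
  have h1 : conj (harmonicScalar l m) = (-1) ^ m.natAbs * harmonicScalar l (-m) := by
    unfold harmonicScalar
    rw [map_mul, Complex.conj_ofReal, Int.natAbs_neg, ← mul_assoc]
    congr 1
    have h : ((-1 : ℂ) ^ m.natAbs) * (-1) ^ m.natAbs = 1 := by
      rw [← mul_pow]
      simp
    rcases lt_trichotomy m 0 with hm | rfl | hm
    · rw [if_neg (by omega), if_pos (by omega), map_one, h]
    · simp
    · rw [if_pos (by omega), if_neg (by omega)]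
      simp
  unfold sphereHarmonic
  rw [map_mul, map_mul, map_mul, map_pow, map_pow, Complex.conj_conj, Complex.conj_ofReal, h1,
    Int.natAbs_neg, neg_neg]
  ring

/-- Reversal of the magnetic quantum number. -/
def AngLabel.reverse (a : AngLabel) : AngLabel := ⟨a.1, a.2.rev⟩

theorem AngLabel.m_reverse (a : AngLabel) : a.reverse.m = -a.m := by
  have := a.2.2
  simp only [AngLabel.reverse, AngLabel.m, Fin.val_rev]
  omega

theorem AngLabel.reverse_reverse (a : AngLabel) : a.reverse.reverse = a := by
  simp [AngLabel.reverse]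

theorem integrable_harmonic_mul {f : ℝ × TwoSphere → ℝ}
    (h1 : Integrable f ((volume : Measure ℝ).prod sphereMeasure)) (l : ℕ) (m : ℤ) :
    Integrable (fun p : ℝ × TwoSphere => conj (sphereHarmonic l m p.2) * (f p : ℂ))
      ((volume : Measure ℝ).prod sphereMeasure) := by
  obtain ⟨C, hC⟩ := (isCompact_univ (X := TwoSphere)).exists_bound_of_continuousOn
    (continuous_sphereHarmonic l m).continuousOn
  refine h1.ofReal.bdd_mul (c := C) ?_ (ae_of_all _ fun p => ?_)
  · exact (Complex.continuous_conj.comp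
      ((continuous_sphereHarmonic l m).comp continuous_snd)).aestronglyMeasurable
  · rw [RCLike.norm_conj]
    exact hC _ (Set.mem_univ _)

theorem integrable_sphereCoeff {f : ℝ × TwoSphere → ℝ}
    (h1 : Integrable f ((volume : Measure ℝ).prod sphereMeasure)) (l : ℕ) (m : ℤ) :
    Integrable fun t => ∫ n, conj (sphereHarmonic l m n) * (f (t, n) : ℂ) ∂sphereMeasure :=
  (integrable_harmonic_mul h1 l m).integral_prod_left

theorem measurable_modeCoeff {f : ℝ × TwoSphere → ℝ}
    (h1 : Integrable f ((volume : Measure ℝ).prod sphereMeasure)) : Measurable (modeCoeff f) :=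
  measurable_from_prod_countable_left fun a =>
    (continuous_timeFourier (integrable_sphereCoeff h1 a.1 a.m)).measurable

theorem lintegral_modeMeasure {g : Mode → ℝ≥0∞} (hg : Measurable g) :
    ∫⁻ x, g x ∂modeMeasure =
      ENNReal.ofReal ((2 * Real.pi)⁻¹) * ∫⁻ w in Set.Ioi (0 : ℝ), ∑' a, g (w, a) := by
  unfold modeMeasure
  rw [lintegral_prod _ hg.aemeasurable, lintegral_smul_measure]
  simp_rw [lintegral_count]
  congr 1
  rw [← NNReal.coe_inj, Real.coe_toNNReal _ (by positivity)]
  rfl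

theorem enorm_modeCoeff_neg (f : ℝ × TwoSphere → ℝ) (w : ℝ) (a : AngLabel) :
    ‖modeCoeff f (-w, a)‖ₑ = ‖modeCoeff f (w, a.reverse)‖ₑ := by
  have h : modeCoeff f (-w, a) = (-1) ^ a.m.natAbs * conj (modeCoeff f (w, a.reverse)) := by
    unfold modeCoeff timeFourier
    rw [← integral_conj, ← integral_const_mul]
    refine integral_congr_ae (ae_of_all _ fun t => ?_)
    simp only [map_mul, ← integral_conj, Complex.conj_conj, Complex.conj_ofReal]
    rw [mul_left_comm, ← integral_const_mul ((-1 : ℂ) ^ a.m.natAbs)]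
    congr 1
    · rw [← Complex.exp_conj]
      simp
    · refine integral_congr_ae (ae_of_all _ fun n => ?_)
      simp only [conj_sphereHarmonic, AngLabel.m_reverse]
      simp only [AngLabel.reverse, mul_assoc]
  rw [h, enorm_mul, enorm_pow, enorm_neg, enorm_one, one_pow, one_mul]
  simp [← ofReal_norm]

theorem lintegral_sq_lt_top_iff_memLp {X E : Type*} [MeasurableSpace X] {μ : Measure X}
    [NormedAddCommGroup E] {f : X → E} (hf : AEStronglyMeasurable f μ) :
    ∫⁻ x, ‖f x‖ₑ ^ 2 ∂μ < ⊤ ↔ MemLp f 2 μ := by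
  rw [MemLp, eLpNorm_lt_top_iff_lintegral_rpow_enorm_lt_top (by norm_num) (by norm_num)]
  simp [hf]

/-- Parseval's identity on the cylinder `ℝ × S²`, for a real function that need only be integrable
after projection to the spherical harmonics.  The coefficients at `-ω` are determined by those at
`ω`, whence the factor `2`. -/
theorem lintegral_enorm_sq_cylinder_of_coeff {f : ℝ × TwoSphere → ℝ}
    (hm : AEMeasurable (fun p => ‖f p‖ₑ ^ 2) ((volume : Measure ℝ).prod sphereMeasure))
    (hf : ∀ᵐ t, MemLp (fun n => f (t, n)) 2 sphereMeasure)
    (hci : ∀ a : AngLabel, Integrable fun t =>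
      ∫ n, conj (sphereHarmonic a.1 a.m n) * (f (t, n) : ℂ) ∂sphereMeasure)
    (hc2 : ∀ a : AngLabel, MemLp (fun t =>
      ∫ n, conj (sphereHarmonic a.1 a.m n) * (f (t, n) : ℂ) ∂sphereMeasure) 2) :
    ∫⁻ p, ‖f p‖ₑ ^ 2 ∂((volume : Measure ℝ).prod sphereMeasure) =
      2 * ∫⁻ x, ‖modeCoeff f x‖ₑ ^ 2 ∂modeMeasure := by
  set c : AngLabel → ℝ → ℂ := fun a t =>
    ∫ n, conj (sphereHarmonic a.1 a.m n) * (f (t, n) : ℂ) ∂sphereMeasure with hc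
  have e1 : ∫⁻ t, ∫⁻ n, ‖f (t, n)‖ₑ ^ 2 ∂sphereMeasure = ∑' a, ∫⁻ t, ‖c a t‖ₑ ^ 2 := by
    rw [← lintegral_tsum fun a => (hci a).1.enorm.pow_const 2]
    refine lintegral_congr_ae ?_
    filter_upwards [hf] with t ht
    rw [← lintegral_enorm_sq_sphere (g := fun n => (f (t, n) : ℂ)) ht.ofReal]
    refine lintegral_congr fun n => ?_
    simp [← ofReal_norm]
  have e2 : ∀ a, ∫⁻ t, ‖c a t‖ₑ ^ 2 =
      ENNReal.ofReal ((2 * Real.pi)⁻¹) * ∫⁻ w, ‖modeCoeff f (w, a)‖ₑ ^ 2 := fun a =>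
    lintegral_enorm_sq_eq_timeFourier (hci a) (hc2 a)
  have hmc : Measurable (modeCoeff f) :=
    measurable_from_prod_countable_left fun a => (continuous_timeFourier (hci a)).measurable
  have hcm : ∀ a, Measurable fun w => ‖modeCoeff f (w, a)‖ₑ ^ 2 := fun a =>
    (hmc.comp measurable_prodMk_right).enorm.pow_const 2
  rw [lintegral_prod _ hm, e1, lintegral_modeMeasure (hmc.enorm.pow_const 2)]
  simp_rw [e2]
  rw [ENNReal.tsum_mul_left, mul_left_comm]
  congr 1
  rw [lintegral_tsum fun a => (hcm a).aemeasurable, two_mul]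
  -- `f` is real: reflect the negative frequencies and reverse the magnetic quantum number
  have e3 : ∀ a, ∫⁻ w, ‖modeCoeff f (w, a)‖ₑ ^ 2 =
      (∫⁻ w in Set.Ioi 0, ‖modeCoeff f (w, a)‖ₑ ^ 2) +
        ∫⁻ w in Set.Ioi 0, ‖modeCoeff f (w, a.reverse)‖ₑ ^ 2 := by
    intro a
    rw [← lintegral_add_compl _ (measurableSet_Ioi (a := (0 : ℝ)))]
    congr 1
    rw [Set.compl_Ioi, setLIntegral_congr Iio_ae_eq_Iic.symm,
      ← (Measure.measurePreserving_neg (volume : Measure ℝ)).setLIntegral_comp_preimage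
        measurableSet_Iio (hcm a)]
    simp only [Set.neg_preimage, Set.neg_Iio, neg_zero, enorm_modeCoeff_neg]
  simp_rw [e3]
  rw [ENNReal.tsum_add]
  congr 1
  exact (Function.Involutive.toPerm AngLabel.reverse AngLabel.reverse_reverse).tsum_eq
    fun a => ∫⁻ w in Set.Ioi 0, ‖modeCoeff f (w, a)‖ₑ ^ 2

/-- Parseval's identity on the cylinder `ℝ × S²`. -/
theorem lintegral_enorm_sq_cylinder {f : ℝ × TwoSphere → ℝ}
    (h1 : Integrable f ((volume : Measure ℝ).prod sphereMeasure))
    (h2 : MemLp f 2 ((volume : Measure ℝ).prod sphereMeasure)) :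
    ∫⁻ p, ‖f p‖ₑ ^ 2 ∂((volume : Measure ℝ).prod sphereMeasure) =
      2 * ∫⁻ x, ‖modeCoeff f x‖ₑ ^ 2 ∂modeMeasure := by
  have hci : ∀ a : AngLabel, Integrable fun t =>
      ∫ n, conj (sphereHarmonic a.1 a.m n) * (f (t, n) : ℂ) ∂sphereMeasure := fun a =>
    integrable_sphereCoeff h1 a.1 a.m
  have hfin := (lintegral_sq_lt_top_iff_memLp h1.1).2 h2
  have hm : AEMeasurable (fun p => ‖f p‖ₑ ^ 2) ((volume : Measure ℝ).prod sphereMeasure) :=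
    h1.1.enorm.pow_const 2
  rw [lintegral_prod _ hm] at hfin
  have hf : ∀ᵐ t, MemLp (fun n => f (t, n)) 2 sphereMeasure := by
    filter_upwards [ae_lt_top' hm.lintegral_prod_right' hfin.ne, h1.1.prodMk_left] with t ht hmt
    exact (lintegral_sq_lt_top_iff_memLp hmt).1 ht
  refine lintegral_enorm_sq_cylinder_of_coeff hm hf hci fun a => ?_
  rw [← lintegral_sq_lt_top_iff_memLp (hci a).1]
  refine lt_of_le_of_lt (lintegral_mono_ae ?_) hfin
  filter_upwards [hf] with t ht
  have e := lintegral_enorm_sq_sphere (g := fun n => (f (t, n) : ℂ)) ht.ofReal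
  refine (ENNReal.le_tsum a).trans (e.symm.trans_le (lintegral_mono fun n => ?_))
  simp [← ofReal_norm]

end Cylinder

/-! ### The Fourier transform of `1 / (cosh τ - cos γ)` -/

section FourierKernel

theorem one_add_sq_half_le_cosh (t : ℝ) : 1 + t ^ 2 / 2 ≤ Real.cosh t := by
  have h1 : Real.cosh t = 1 + 2 * Real.sinh (t / 2) ^ 2 := by
    have h2 := Real.cosh_two_mul (t / 2)
    have h3 := Real.cosh_sq (t / 2)
    rw [mul_div_cancel₀ t two_ne_zero] at h2
    linarith
  have h4 : (t / 2) ^ 2 ≤ Real.sinh (t / 2) ^ 2 := by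
    rw [sq_le_sq]
    rcases le_total 0 (t / 2) with h | h
    · rw [abs_of_nonneg h]
      exact (Real.self_le_sinh_iff.2 h).trans (le_abs_self _)
    · rw [abs_of_nonpos h]
      have := Real.sinh_le_self_iff.2 h
      exact le_trans (by linarith) (neg_le_abs _)
  nlinarith

theorem cosh_sub_pos {x : ℝ} (hx : x < 1) (t : ℝ) : 0 < Real.cosh t - x := by
  linarith [Real.one_le_cosh t]

theorem inv_add_sq_half_eq {b : ℝ} (hb : 0 < b) (t : ℝ) :
    (b + t ^ 2 / 2)⁻¹ = b⁻¹ * (1 + ((Real.sqrt (2 * b))⁻¹ * t) ^ 2)⁻¹ := by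
  rw [mul_pow, inv_pow, Real.sq_sqrt (by positivity), ← mul_inv]
  congr 1
  field_simp

theorem inv_cosh_sub_le {x : ℝ} (hx : x < 1) (t : ℝ) :
    (Real.cosh t - x)⁻¹ ≤ (1 - x + t ^ 2 / 2)⁻¹ := by
  refine inv_anti₀ (by nlinarith [sq_nonneg t]) ?_
  linarith [one_add_sq_half_le_cosh t]

theorem integrable_inv_add_sq_half {b : ℝ} (hb : 0 < b) :
    Integrable fun t : ℝ => (b + t ^ 2 / 2)⁻¹ := by
  simp_rw [inv_add_sq_half_eq hb]
  refine Integrable.const_mul ?_ _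
  exact integrable_inv_one_add_sq.comp_mul_left' (by positivity)

theorem integrable_inv_cosh_sub {x : ℝ} (hx : x < 1) :
    Integrable fun t : ℝ => (Real.cosh t - x)⁻¹ := by
  refine (integrable_inv_add_sq_half (sub_pos.2 hx)).mono' ?_ (ae_of_all _ fun t => ?_)
  · exact ((Real.continuous_cosh.sub continuous_const).inv₀
      fun t => (cosh_sub_pos hx t).ne').aestronglyMeasurable
  · rw [Real.norm_of_nonneg (inv_nonneg.2 (cosh_sub_pos hx t).le)]
    exact inv_cosh_sub_le hx t

theorem integral_inv_cosh_sub_le {x : ℝ} (hx : x < 1) :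
    ∫ t, (Real.cosh t - x)⁻¹ ≤ Real.pi * Real.sqrt 2 / Real.sqrt (1 - x) := by
  refine (integral_mono (integrable_inv_cosh_sub hx) (integrable_inv_add_sq_half (sub_pos.2 hx))
    fun t => inv_cosh_sub_le hx t).trans_eq ?_
  simp_rw [inv_add_sq_half_eq (sub_pos.2 hx)]
  have hb : 0 < 1 - x := sub_pos.2 hx
  rw [integral_const_mul, Measure.integral_comp_mul_left (fun y => (1 + y ^ 2)⁻¹),
    integral_univ_inv_one_add_sq, inv_inv, abs_of_nonneg (Real.sqrt_nonneg _), smul_eq_mul,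
    Real.sqrt_mul zero_le_two]
  have h := Real.mul_self_sqrt hb.le
  have h0 : 0 < Real.sqrt (1 - x) := Real.sqrt_pos.2 hb
  rw [← h] at h0 ⊢
  rw [Real.sqrt_mul_self (Real.sqrt_nonneg _)]
  have h1 := Real.sqrt_pos.2 hb
  field_simp

/-- The function `sinh ((π - γ) ω) / sinh (π ω)`. -/
def sinhRatio (g w : ℝ) : ℝ := Real.sinh ((Real.pi - g) * w) / Real.sinh (Real.pi * w)

theorem sinhRatio_neg (g w : ℝ) : sinhRatio g (-w) = sinhRatio g w := by
  simp only [sinhRatio, mul_neg, Real.sinh_neg, neg_div_neg_eq]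

theorem sinhRatio_eq (g : ℝ) {w : ℝ} (hw : 0 < w) :
    sinhRatio g w =
      (Real.exp (-g * w) - Real.exp (-(2 * Real.pi - g) * w)) / (1 - Real.exp (-(2 * Real.pi) * w)) := by
  have h1 : Real.exp (-(2 * Real.pi) * w) < 1 := by
    rw [Real.exp_lt_one_iff]
    have := mul_pos Real.pi_pos hw
    nlinarith
  have h2 : 0 < Real.sinh (Real.pi * w) := Real.sinh_pos_iff.2 (mul_pos Real.pi_pos hw)
  rw [sinhRatio, div_eq_div_iff h2.ne' (by linarith), Real.sinh_eq, Real.sinh_eq]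
  have e1 : ∀ a b : ℝ, Real.exp a * Real.exp b = Real.exp (a + b) := fun a b => (Real.exp_add a b).symm
  simp only [mul_sub, sub_mul, mul_one, mul_div_assoc', div_mul_eq_mul_div, e1]
  ring_nf

theorem sinhRatio_nonneg {g : ℝ} (hg : g ∈ Set.Ioo 0 Real.pi) {w : ℝ} (hw : 0 < w) :
    0 ≤ sinhRatio g w :=
  div_nonneg (Real.sinh_nonneg_iff.2 (mul_nonneg (sub_nonneg.2 hg.2.le) hw.le))
    (Real.sinh_nonneg_iff.2 (mul_nonneg Real.pi_pos.le hw.le))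

theorem sinhRatio_le {g : ℝ} (hg : g ∈ Set.Ioo 0 Real.pi) {w : ℝ} (hw : 0 < w) :
    sinhRatio g w ≤ Real.exp (-g * w) := by
  have h1 : Real.exp (-(2 * Real.pi) * w) < 1 := by
    rw [Real.exp_lt_one_iff]
    have := mul_pos Real.pi_pos hw
    nlinarith
  rw [sinhRatio_eq g hw, div_le_iff₀ (by linarith), mul_sub, mul_one, ← Real.exp_add]
  have : Real.exp (-g * w + -(2 * Real.pi) * w) ≤ Real.exp (-(2 * Real.pi - g) * w) := by
    rw [Real.exp_le_exp]
    nlinarith [mul_pos hg.1 hw]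
  linarith

/-- The partial sums of the geometric series of `sinhRatio`. -/
theorem sum_exp_eq (g : ℝ) {w : ℝ} (hw : 0 < w) (N : ℕ) :
    ∑ n ∈ Finset.range N, (Real.exp (-(g + 2 * Real.pi * n) * w) -
        Real.exp (-(2 * Real.pi * (n + 1) - g) * w)) =
      sinhRatio g w * (1 - Real.exp (-(2 * Real.pi) * w) ^ N) := by
  have h1 : Real.exp (-(2 * Real.pi) * w) < 1 := by
    rw [Real.exp_lt_one_iff]
    have := mul_pos Real.pi_pos hw
    nlinarith
  have h2 := geom_sum_mul_neg (Real.exp (-(2 * Real.pi) * w)) N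
  rw [sinhRatio_eq g hw, ← h2, div_mul_eq_mul_div, mul_comm (Finset.sum _ _), ← mul_assoc,
    mul_div_right_comm, mul_div_cancel_right₀ _ (by linarith), Finset.mul_sum]
  refine Finset.sum_congr rfl fun n _ => ?_
  rw [sub_mul, ← Real.exp_nat_mul, ← Real.exp_add, ← Real.exp_add]
  ring_nf

theorem continuousOn_sinhRatio (g : ℝ) : ContinuousOn (sinhRatio g) {0}ᶜ := by
  refine ContinuousOn.div (by fun_prop) (by fun_prop) fun w hw => ?_
  rw [Ne, Real.sinh_eq_zero]
  exact mul_ne_zero Real.pi_pos.ne' hw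

theorem measurable_sinhRatio (g : ℝ) : Measurable (sinhRatio g) := by
  unfold sinhRatio
  fun_prop

theorem norm_sinhRatio_mul_le {g : ℝ} (hg : g ∈ Set.Ioo 0 Real.pi) (t : ℝ) {w : ℝ} (hw : 0 < w) :
    ‖(sinhRatio g w : ℂ) * Complex.exp (Complex.I * t * w)‖ ≤ Real.exp (-g * w) := by
  rw [norm_mul, norm_exp_I_mul, mul_one, Complex.norm_real,
    Real.norm_of_nonneg (sinhRatio_nonneg hg hw)]
  exact sinhRatio_le hg hw

theorem integrableOn_sinhRatio_mul {g : ℝ} (hg : g ∈ Set.Ioo 0 Real.pi) (t : ℝ) :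
    IntegrableOn (fun w : ℝ => (sinhRatio g w : ℂ) * Complex.exp (Complex.I * t * w))
      (Set.Ioi 0) := by
  refine Integrable.mono' (exp_neg_integrableOn_Ioi 0 hg.1) ?_ ?_
  · exact ((Complex.measurable_ofReal.comp (measurable_sinhRatio g)).mul
      (by fun_prop)).aestronglyMeasurable
  · filter_upwards [ae_restrict_mem measurableSet_Ioi] with w hw
    exact norm_sinhRatio_mul_le hg t hw

theorem integral_exp_neg_mul {a : ℝ} (ha : 0 < a) (t : ℝ) :
    IntegrableOn (fun w : ℝ => (Real.exp (-a * w) : ℂ) * Complex.exp (Complex.I * t * w))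
        (Set.Ioi 0) ∧
      ∫ w in Set.Ioi (0 : ℝ), (Real.exp (-a * w) : ℂ) * Complex.exp (Complex.I * t * w) =
        1 / (a - Complex.I * t) := by
  have h : ∀ w : ℝ, (Real.exp (-a * w) : ℂ) * Complex.exp (Complex.I * t * w) =
      Complex.exp ((-a + Complex.I * t) * w) := by
    intro w
    rw [Complex.ofReal_exp, ← Complex.exp_add]
    push_cast
    ring_nf
  have hre : (-a + Complex.I * t : ℂ).re < 0 := by simpa using ha
  simp_rw [h]
  refine ⟨integrableOn_exp_mul_complex_Ioi hre 0, ?_⟩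
  rw [integral_exp_mul_complex_Ioi hre 0]
  simp only [Complex.ofReal_zero, mul_zero, Complex.exp_zero]
  rw [neg_div, ← div_neg]
  congr 1
  ring

/-- Termwise integration of `sinhRatio g w = ∑ₙ (e^{-(g+2πn)w} - e^{-(2π(n+1)-g)w})`. -/
theorem tendsto_sum_integral_sinhRatio {g : ℝ} (hg : g ∈ Set.Ioo 0 Real.pi) (t : ℝ) :
    Tendsto (fun N : ℕ => ∑ n ∈ Finset.range N, (1 / (((g + 2 * Real.pi * n : ℝ) : ℂ) - Complex.I * t) -
        1 / (((2 * Real.pi * (n + 1) - g : ℝ) : ℂ) - Complex.I * t))) atTop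
      (𝓝 (∫ w in Set.Ioi (0 : ℝ), (sinhRatio g w : ℂ) * Complex.exp (Complex.I * t * w))) := by
  have h1 : ∀ n : ℕ, 0 < g + 2 * Real.pi * n := fun n => by
    have := hg.1
    positivity
  have h2 : ∀ n : ℕ, 0 < 2 * Real.pi * (n + 1) - g := fun n => by
    have := hg.2
    have := Real.pi_pos
    have : 0 ≤ 2 * Real.pi * n := by positivity
    nlinarith
  have hpart : ∀ N : ℕ, ∑ n ∈ Finset.range N, (1 / (((g + 2 * Real.pi * n : ℝ) : ℂ) - Complex.I * t) -
        1 / (((2 * Real.pi * (n + 1) - g : ℝ) : ℂ) - Complex.I * t)) =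
      ∫ w in Set.Ioi (0 : ℝ), ((sinhRatio g w * (1 - Real.exp (-(2 * Real.pi) * w) ^ N) : ℝ) : ℂ) *
        Complex.exp (Complex.I * t * w) := by
    intro N
    have : ∀ n : ℕ, (1 / (((g + 2 * Real.pi * n : ℝ) : ℂ) - Complex.I * t) -
        1 / (((2 * Real.pi * (n + 1) - g : ℝ) : ℂ) - Complex.I * t)) =
        ∫ w in Set.Ioi (0 : ℝ), ((Real.exp (-(g + 2 * Real.pi * n) * w) : ℂ) *
          Complex.exp (Complex.I * t * w) - (Real.exp (-(2 * Real.pi * (n + 1) - g) * w) : ℂ) *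
          Complex.exp (Complex.I * t * w)) := by
      intro n
      rw [integral_sub (integral_exp_neg_mul (h1 n) t).1 (integral_exp_neg_mul (h2 n) t).1,
        (integral_exp_neg_mul (h1 n) t).2, (integral_exp_neg_mul (h2 n) t).2]
    simp_rw [this]
    have hint : ∀ n : ℕ, Integrable (fun w : ℝ => (Real.exp (-(g + 2 * Real.pi * n) * w) : ℂ) *
          Complex.exp (Complex.I * t * w) - (Real.exp (-(2 * Real.pi * (n + 1) - g) * w) : ℂ) *
          Complex.exp (Complex.I * t * w)) (volume.restrict (Set.Ioi 0)) := fun n =>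
      (integral_exp_neg_mul (h1 n) t).1.sub (integral_exp_neg_mul (h2 n) t).1
    rw [← integral_finsetSum _ fun n _ => hint n]
    refine setIntegral_congr_fun measurableSet_Ioi fun w hw => ?_
    rw [← sum_exp_eq g hw N, Complex.ofReal_sum, Finset.sum_mul]
    refine Finset.sum_congr rfl fun n _ => ?_
    push_cast
    ring
  simp_rw [hpart]
  refine tendsto_integral_of_dominated_convergence (fun w => Real.exp (-g * w)) (fun N => ?_)
    (exp_neg_integrableOn_Ioi 0 hg.1) (fun N => ?_) ?_
  · exact ((Complex.measurable_ofReal.comp ((measurable_sinhRatio g).mul (by fun_prop))).mul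
      (by fun_prop)).aestronglyMeasurable
  · filter_upwards [ae_restrict_mem measurableSet_Ioi] with w hw
    have hw : 0 < w := hw
    have h3 : Real.exp (-(2 * Real.pi) * w) ≤ 1 := by
      rw [Real.exp_le_one_iff]
      have := mul_pos Real.pi_pos hw
      nlinarith
    have h4 : 0 ≤ Real.exp (-(2 * Real.pi) * w) ^ N := by positivity
    have h5 : Real.exp (-(2 * Real.pi) * w) ^ N ≤ 1 := pow_le_one₀ (Real.exp_pos _).le h3
    rw [Complex.ofReal_mul, mul_right_comm, norm_mul]
    refine (mul_le_of_le_one_right (norm_nonneg _) ?_).trans (norm_sinhRatio_mul_le hg t hw)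
    rw [Complex.norm_real, Real.norm_of_nonneg (by linarith)]
    linarith
  · filter_upwards [ae_restrict_mem measurableSet_Ioi] with w hw
    have hw : 0 < w := hw
    have h3 : Real.exp (-(2 * Real.pi) * w) < 1 := by
      rw [Real.exp_lt_one_iff]
      have := mul_pos Real.pi_pos hw
      nlinarith
    have h4 := tendsto_pow_atTop_nhds_zero_of_lt_one (Real.exp_pos _).le h3
    have h5 : Tendsto (fun N : ℕ => sinhRatio g w * (1 - Real.exp (-(2 * Real.pi) * w) ^ N)) atTop
        (𝓝 (sinhRatio g w)) := by
      simpa using (h4.const_sub 1).const_mul (sinhRatio g w)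
    exact ((Complex.continuous_ofReal.tendsto _).comp h5).mul_const _

/-- The half-line transform, through the partial fraction expansion of the cotangent. -/
theorem re_integral_sinhRatio {g : ℝ} (hg : g ∈ Set.Ioo 0 Real.pi) (t : ℝ) :
    (∫ w in Set.Ioi (0 : ℝ), (sinhRatio g w : ℂ) * Complex.exp (Complex.I * t * w)).re =
      Real.sin g / (Real.cosh t - Real.cos g) / 2 := by
  set z : ℂ := (g - Complex.I * t) / (2 * Real.pi) with hz
  have hpi : (Real.pi : ℂ) ≠ 0 := Complex.ofReal_ne_zero.2 Real.pi_pos.ne'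
  have hzre : z.re = g / (2 * Real.pi) := by
    have : z = ((g / (2 * Real.pi) : ℝ) : ℂ) + ((-t / (2 * Real.pi) : ℝ) : ℂ) * Complex.I := by
      rw [hz]
      push_cast
      field_simp
      ring
    rw [this, Complex.add_re, Complex.ofReal_re, Complex.re_ofReal_mul, Complex.I_re, mul_zero,
      add_zero]
  have hzc : z ∈ Complex.integerComplement := by
    rw [Complex.mem_integerComplement_iff]
    rintro ⟨n, hn⟩
    have h1 : (n : ℝ) = g / (2 * Real.pi) := by rw [← hzre, ← hn, Complex.intCast_re]
    have h2 : (0 : ℝ) < n := by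
      rw [h1]
      exact div_pos hg.1 (by positivity)
    have h3 : (n : ℝ) < 1 := by
      rw [h1, div_lt_one (by positivity)]
      linarith [hg.2, Real.pi_pos]
    have h4 : 0 < n := by exact_mod_cast h2
    have h5 : n < 1 := by exact_mod_cast h3
    omega
  -- the second poles are complex conjugates of `-2π (z - (n + 1))`; on taking real parts the series
  -- becomes the Mittag-Leffler expansion of `π cot (πz)`
  have hlim := tendsto_sum_integral_sinhRatio hg t
  have hre : ∀ N : ℕ, (∑ n ∈ Finset.range N,
      (1 / (((g + 2 * Real.pi * n : ℝ) : ℂ) - Complex.I * t) -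
        1 / (((2 * Real.pi * (n + 1) - g : ℝ) : ℂ) - Complex.I * t))).re =
      (2 * Real.pi)⁻¹ * (1 / z - 1 / (z + N) + ∑ n ∈ Finset.range N, cotTerm z n).re := by
    have hz1 : ∀ n : ℕ, (g : ℂ) + 2 * Real.pi * n - Complex.I * t = 2 * Real.pi * (z + n) := by
      intro n
      rw [hz]
      field_simp
      ring
    have hz2 : ∀ n : ℕ, 2 * Real.pi * ((n : ℂ) + 1) - g - Complex.I * t =
        conj (-(2 * Real.pi * (z - (n + 1)))) := by
      intro n
      rw [hz]
      simp only [map_neg, map_mul, map_sub, map_div₀, map_add, map_one, Complex.conj_ofReal,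
        Complex.conj_I, map_natCast, map_ofNat]
      field_simp
      ring
    intro N
    induction N with
    | zero => simp
    | succ N ih =>
      have e : (1 / (((g + 2 * Real.pi * N : ℝ) : ℂ) - Complex.I * t) -
          1 / (((2 * Real.pi * (N + 1) - g : ℝ) : ℂ) - Complex.I * t)).re =
          (2 * Real.pi)⁻¹ * (1 / (z + N) + 1 / (z - (N + 1))).re := by
        push_cast
        rw [hz1, hz2, Complex.sub_re, ← map_one conj, ← map_div₀, Complex.conj_re, map_one,
          div_neg, Complex.neg_re, sub_neg_eq_add, ← Complex.add_re,
          ← Complex.re_ofReal_mul]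
        congr 1
        push_cast
        simp only [one_div, mul_inv]
        ring
      rw [Finset.sum_range_succ, Complex.add_re, ih, Finset.sum_range_succ, e, ← mul_add,
        ← Complex.add_re]
      congr 2
      simp only [cotTerm]
      push_cast
      ring
  have hinv : Tendsto (fun N : ℕ => 1 / (z + N)) atTop (𝓝 0) := by
    simp_rw [one_div]
    refine tendsto_inv₀_cobounded.comp ?_
    rw [← tendsto_norm_atTop_iff_cobounded]
    refine tendsto_atTop_mono (fun N => Complex.abs_re_le_norm _) ?_
    refine tendsto_atTop_mono (fun N => le_abs_self _) ?_
    simp only [Complex.add_re, Complex.natCast_re]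
    exact tendsto_atTop_add_const_left _ _ tendsto_natCast_atTop_atTop
  have hcot : Tendsto (fun N : ℕ => (2 * Real.pi)⁻¹ *
      (1 / z - 1 / (z + N) + ∑ n ∈ Finset.range N, cotTerm z n).re) atTop
      (𝓝 ((2 * Real.pi)⁻¹ * (Real.pi * Complex.cot (Real.pi * z)).re)) := by
    refine Tendsto.const_mul _ ((Complex.continuous_re.tendsto _).comp ?_)
    have := (hinv.const_sub (1 / z)).add (tendsto_logDeriv_euler_cot_sub hzc)
    simpa using this
  have h1 := tendsto_nhds_unique (((Complex.continuous_re.tendsto _).comp hlim).congr hre) hcot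
  rw [h1]
  have hsin : Complex.sin (Real.pi * z) ≠ 0 := sin_pi_mul_ne_zero hzc
  set u : ℂ := Real.pi * z with hu
  set v : ℂ := (g + Complex.I * t) / 2 with hv
  have hu' : u = (g - Complex.I * t) / 2 := by
    rw [hu, hz]
    field_simp
  have huv : u + v = g := by
    rw [hu', hv]
    ring
  have huv' : u - v = -(t * Complex.I) := by
    rw [hu', hv]
    ring
  have e1 := Complex.cos_add u v
  have e2 := Complex.cos_sub u v
  have e3 := Complex.sin_add u v
  have e4 := Complex.sin_sub u v
  rw [huv] at e1 e3
  rw [huv', Complex.cos_neg, Complex.cos_mul_I] at e2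
  rw [huv', Complex.sin_neg, Complex.sin_mul_I] at e4
  have hd : (Complex.cosh t - Complex.cos g) ≠ 0 := by
    rw [← Complex.ofReal_cosh, ← Complex.ofReal_cos, ← Complex.ofReal_sub,
      Complex.ofReal_ne_zero]
    have h2 : Real.cos g < 1 := by
      have := Real.cos_lt_cos_of_nonneg_of_le_pi le_rfl hg.2.le hg.1
      rwa [Real.cos_zero] at this
    exact (cosh_sub_pos h2 t).ne'
  have hc : Complex.cot u = (Complex.sin g + Complex.sinh t * Complex.I) /
      (Complex.cosh t - Complex.cos g) := by
    rw [Complex.cot_eq_cos_div_sin, div_eq_div_iff hsin hd]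
    linear_combination Complex.cos u * (e2 - e1) - Complex.sin u * (e3 - e4)
  have hc' : (Real.pi * Complex.cot u : ℂ) =
      ((Real.pi * (Real.sin g / (Real.cosh t - Real.cos g)) : ℝ) : ℂ) +
        ((Real.pi * (Real.sinh t / (Real.cosh t - Real.cos g)) : ℝ) : ℂ) * Complex.I := by
    rw [hc]
    push_cast
    ring
  rw [hc', Complex.add_re, Complex.ofReal_re, Complex.re_ofReal_mul, Complex.I_re]
  field_simp
  ring

theorem integrable_sinhRatio {g : ℝ} (hg : g ∈ Set.Ioo 0 Real.pi) (t : ℝ) :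
    Integrable fun w : ℝ => Complex.exp (Complex.I * t * w) * (sinhRatio g w : ℂ) := by
  have h1 : ∀ t : ℝ, IntegrableOn (fun w : ℝ => Complex.exp (Complex.I * t * w) * (sinhRatio g w : ℂ))
      (Set.Ioi 0) := fun t => by
    simpa only [mul_comm (Complex.exp _)] using integrableOn_sinhRatio_mul hg t
  rw [← integrableOn_univ, ← Set.Iic_union_Ioi (a := (0 : ℝ)), integrableOn_union]
  refine ⟨?_, h1 t⟩
  have h2 := h1 (-t)
  rw [← neg_zero, integrableOn_Iic_iff_integrableOn_Iio, ← integrable_indicator_iff measurableSet_Iio]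
  rw [← integrable_indicator_iff measurableSet_Ioi] at h2
  refine h2.comp_neg.congr (ae_of_all _ fun w => ?_)
  simp only [Set.indicator, Set.mem_Ioi, Set.mem_Iio, neg_zero, Left.neg_pos_iff, sinhRatio_neg]
  push_cast
  simp only [mul_neg, neg_mul, neg_neg]

theorem timeFourier_sinhRatio {g : ℝ} (hg : g ∈ Set.Ioo 0 Real.pi) (t : ℝ) :
    timeFourier (fun w => (sinhRatio g w : ℂ)) t =
      ((Real.sin g * (Real.cosh t - Real.cos g)⁻¹ : ℝ) : ℂ) := by
  set A := ∫ w in Set.Ioi (0 : ℝ), (sinhRatio g w : ℂ) * Complex.exp (Complex.I * t * w) with hA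
  have h1 : ∫ w in Set.Ioi (0 : ℝ), Complex.exp (Complex.I * t * w) * (sinhRatio g w : ℂ) = A := by
    simp_rw [mul_comm (Complex.exp _)]
    rfl
  have h2 : ∫ w in Set.Iic (0 : ℝ), Complex.exp (Complex.I * t * w) * (sinhRatio g w : ℂ) =
      conj A := by
    rw [← neg_zero, ← integral_comp_neg_Ioi, hA, ← integral_conj]
    refine setIntegral_congr_fun measurableSet_Ioi fun w _ => ?_
    simp only [sinhRatio_neg, map_mul, Complex.conj_ofReal, ← Complex.exp_conj, Complex.conj_I]
    push_cast
    rw [mul_comm, mul_neg, neg_mul, neg_mul]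
  have hi := integrable_sinhRatio hg t
  rw [timeFourier, ← integral_add_compl measurableSet_Ioi hi (s := Set.Ioi 0), Set.compl_Ioi, h1, h2,
    Complex.add_conj, re_integral_sinhRatio hg t]
  push_cast
  ring

/-- The Fourier transform of `1 / (cosh τ - cos γ)`. -/
theorem timeFourier_inv_cosh_sub {g : ℝ} (hg : g ∈ Set.Ioo 0 Real.pi) {w : ℝ} (hw : w ≠ 0) :
    timeFourier (fun t => ((Real.cosh t - Real.cos g)⁻¹ : ℝ)) w =
      ((2 * Real.pi * sinhRatio g w / Real.sin g : ℝ) : ℂ) := by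
  have hsin : Real.sin g ≠ 0 := (Real.sin_pos_of_mem_Ioo hg).ne'
  have hcos : Real.cos g < 1 := by
    have := Real.cos_lt_cos_of_nonneg_of_le_pi le_rfl hg.2.le hg.1
    rwa [Real.cos_zero] at this
  -- Fourier inversion of `timeFourier_sinhRatio`
  set H : ℝ → ℂ := fun w => (sinhRatio g w : ℂ) with hH
  have hHi : Integrable H := by simpa using integrable_sinhRatio hg 0
  have hF : FourierTransform.fourier H = fun v =>
      ((Real.sin g * (Real.cosh (-(2 * Real.pi) * v) - Real.cos g)⁻¹ : ℝ) : ℂ) := by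
    ext v
    rw [fourier_eq_timeFourier, timeFourier_sinhRatio hg]
  have hpi := Real.pi_pos
  have hFi : Integrable (FourierTransform.fourier H) := by
    rw [hF]
    exact (((integrable_inv_cosh_sub hcos).comp_mul_left' (by linarith)).const_mul _).ofReal
  have hc : ContinuousAt H w :=
    Complex.continuous_ofReal.continuousAt.comp ((continuousOn_sinhRatio g).continuousAt
      (isOpen_compl_singleton.mem_nhds hw))
  have h1 := hHi.fourierInv_fourier_eq hFi hc
  rw [Real.fourierInv_eq_fourier_neg, fourier_eq_timeFourier, hF, timeFourier] at h1
  have h2 := Measure.integral_comp_mul_left (fun t : ℝ => Complex.exp (Complex.I * w * t) *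
    ((Real.sin g * (Real.cosh t - Real.cos g)⁻¹ : ℝ) : ℂ)) (2 * Real.pi)
  have h3 : (∫ t : ℝ, Complex.exp (Complex.I * w * t) *
      ((Real.sin g * (Real.cosh t - Real.cos g)⁻¹ : ℝ) : ℂ)) =
      Real.sin g * timeFourier (fun t => ((Real.cosh t - Real.cos g)⁻¹ : ℝ)) w := by
    rw [timeFourier, ← integral_const_mul]
    refine integral_congr_ae (ae_of_all _ fun t => ?_)
    push_cast
    ring
  rw [h3] at h2
  have h4 : (∫ t : ℝ, Complex.exp (Complex.I * ((-(2 * Real.pi) * -w : ℝ) : ℂ) * t) *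
      ((Real.sin g * (Real.cosh (-(2 * Real.pi) * t) - Real.cos g)⁻¹ : ℝ) : ℂ)) =
      ∫ t : ℝ, Complex.exp (Complex.I * w * ((2 * Real.pi * t : ℝ) : ℂ)) *
        ((Real.sin g * (Real.cosh (2 * Real.pi * t) - Real.cos g)⁻¹ : ℝ) : ℂ) := by
    refine integral_congr_ae (ae_of_all _ fun t => ?_)
    simp only
    rw [neg_mul (2 * Real.pi) t, Real.cosh_neg]
    congr 2
    push_cast
    ring
  rw [h4, h2, abs_of_pos (by positivity)] at h1
  have hs : (Real.sin g : ℂ) ≠ 0 := Complex.ofReal_ne_zero.2 hsin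
  have hp : (Real.pi : ℂ) ≠ 0 := Complex.ofReal_ne_zero.2 hpi.ne'
  rw [Complex.real_smul, hH] at h1
  rw [Complex.ofReal_div, eq_div_iff hs]
  generalize timeFourier _ w = T at h1 ⊢
  push_cast at h1 ⊢
  field_simp at h1
  linear_combination h1

end FourierKernel

/-! ### The spectral functions of the two-point kernel and of the horizon map -/

section Spectral

open Polynomial

/-- The eigenvalue, up to the factor `4π²`, of the kernel `1 / (cosh (t - t') - n·n')` on the mode
`e^{-iωt} Y_{lm}`. -/
def kernelCoeff (l : ℕ) (w : ℝ) : ℝ :=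
  ∫ g in (0 : ℝ)..Real.pi, (legendre l).eval (Real.cos g) * sinhRatio g w

/-- `∫₀^∞ e^{-iωτ} e^{-τ} p(e^{-τ}) dτ`. -/
def expMoment (p : ℝ[X]) (w : ℝ) : ℂ :=
  ∫ t in Set.Ioi (0 : ℝ), Complex.exp (-(1 + Complex.I * w) * t) * (p.eval (Real.exp (-t)) : ℝ)

/-- The factor by which the map from the boundary data to the derivative of the field on the
horizon multiplies the mode `e^{-iωt} Y_{lm}`, up to `-1/2`. -/
def horizonFactor (l : ℕ) (w : ℝ) : ℂ := 1 - expMoment (derivative (legendre l)) w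

theorem integrableOn_expMoment (p : ℝ[X]) (w : ℝ) :
    IntegrableOn (fun t : ℝ => Complex.exp (-(1 + Complex.I * w) * t) *
      (p.eval (Real.exp (-t)) : ℝ)) (Set.Ioi 0) := by
  induction p using Polynomial.induction_on' with
  | add p q hp hq =>
    refine (hp.add hq).congr (ae_of_all _ fun t => ?_)
    simp only [eval_add, Complex.ofReal_add, Pi.add_apply]
    ring
  | monomial k a =>
    have hre : (-(k + 1 + Complex.I * w) : ℂ).re < 0 := by
      simp
      linarith [(Nat.cast_nonneg k : (0 : ℝ) ≤ k)]
    refine ((integrableOn_exp_mul_complex_Ioi hre 0).const_mul (a : ℂ)).congr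
      (ae_of_all _ fun t => ?_)
    simp only [eval_monomial, ← Real.exp_nat_mul]
    push_cast
    rw [mul_left_comm, ← Complex.exp_add]
    ring_nf

theorem expMoment_add (p q : ℝ[X]) (w : ℝ) :
    expMoment (p + q) w = expMoment p w + expMoment q w := by
  unfold expMoment
  rw [← integral_add (integrableOn_expMoment p w) (integrableOn_expMoment q w)]
  simp_rw [eval_add, Complex.ofReal_add, mul_add]

theorem expMoment_C_mul (a : ℝ) (p : ℝ[X]) (w : ℝ) :
    expMoment (C a * p) w = a * expMoment p w := by
  unfold expMoment
  rw [← integral_const_mul]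
  simp_rw [eval_mul, eval_C, Complex.ofReal_mul, mul_left_comm]

theorem one_add_I_mul_ne_zero (k : ℕ) (w : ℝ) : ((k : ℂ) + 1 + Complex.I * w) ≠ 0 := by
  intro h
  have := congrArg Complex.re h
  simp at this
  norm_cast at this

theorem expMoment_X_pow (k : ℕ) (w : ℝ) : expMoment (X ^ k) w = 1 / (k + 1 + Complex.I * w) := by
  have hre : (-(k + 1 + Complex.I * w) : ℂ).re < 0 := by
    simp
    linarith [(Nat.cast_nonneg k : (0 : ℝ) ≤ k)]
  have h : expMoment (X ^ k) w =
      ∫ t in Set.Ioi (0 : ℝ), Complex.exp (-(k + 1 + Complex.I * w) * t) := by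
    refine integral_congr_ae (ae_of_all _ fun t => ?_)
    simp only [eval_pow, eval_X, ← Real.exp_nat_mul]
    push_cast
    rw [← Complex.exp_add]
    ring_nf
  rw [h, integral_exp_mul_complex_Ioi hre 0]
  simp only [Complex.ofReal_zero, mul_zero, Complex.exp_zero]
  rw [neg_div_neg_eq]

/-- Integration by parts. -/
theorem expMoment_X_mul_derivative (p : ℝ[X]) (w : ℝ) :
    expMoment (X * derivative p) w = p.eval 1 - (1 + Complex.I * w) * expMoment p w := by
  induction p using Polynomial.induction_on' with
  | add p q hp hq =>
    rw [derivative_add, mul_add, expMoment_add, expMoment_add, hp, hq, eval_add]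
    push_cast
    ring
  | monomial k a =>
    rcases k with _ | k
    · rw [monomial_zero_left, derivative_C, mul_zero, eval_C]
      have h0 : expMoment 0 w = 0 := by simp [expMoment]
      have h1 := expMoment_C_mul a (X ^ 0) w
      rw [pow_zero, mul_one, ← pow_zero X, expMoment_X_pow 0 w] at h1
      have h2 := one_add_I_mul_ne_zero 0 w
      rw [h0, h1]
      push_cast at h2 ⊢
      rw [zero_add] at h2 ⊢
      field_simp
      ring
    · have h2 := one_add_I_mul_ne_zero (k + 1) w
      rw [← C_mul_X_pow_eq_monomial, derivative_C_mul, derivative_X_pow, mul_left_comm,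
        mul_left_comm X, add_tsub_cancel_right, ← pow_succ', expMoment_C_mul, expMoment_C_mul,
        expMoment_C_mul, expMoment_X_pow]
      simp only [eval_mul, eval_C, eval_pow, eval_X, one_pow, mul_one]
      push_cast at h2 ⊢
      field_simp
      ring

theorem horizonFactor_zero (w : ℝ) : horizonFactor 0 w = 1 := by
  simp [horizonFactor, legendre_zero, expMoment]

theorem horizonFactor_one (w : ℝ) :
    horizonFactor 1 w = Complex.I * w / (1 + Complex.I * w) := by
  have h2 := one_add_I_mul_ne_zero 0 w
  rw [horizonFactor, legendre_one, derivative_X, ← pow_zero X, expMoment_X_pow]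
  push_cast at h2 ⊢
  rw [zero_add] at h2 ⊢
  field_simp
  ring

/-- Both `horizonFactor (l + 2)` and `horizonFactor l` are expressed through the moment of `P_{l+1}`,
by the recursions for the derivatives and integration by parts. -/
theorem horizonFactor_succ_succ (l : ℕ) (w : ℝ) :
    (l + 2 + Complex.I * w) * horizonFactor (l + 2) w =
      (Complex.I * w - (l + 1)) * horizonFactor l w := by
  unfold horizonFactor
  have h1 := congrArg (fun p => expMoment p w) (derivative_legendre_succ (l + 1))
  have h2 : derivative (legendre l) =
      X * derivative (legendre (l + 1)) + C (-((l : ℝ) + 1)) * legendre (l + 1) := by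
    rw [derivative_legendre l, C_neg]
    ring
  have h3 := congrArg (fun p => expMoment p w) h2
  simp only [expMoment_add, expMoment_C_mul, expMoment_X_mul_derivative, eval_one_legendre]
    at h1 h3
  rw [h1, h3]
  push_cast
  ring

theorem normSq_horizonFactor_succ_succ (l : ℕ) (w : ℝ) :
    ((l + 2) ^ 2 + w ^ 2) * ‖horizonFactor (l + 2) w‖ ^ 2 =
      ((l + 1) ^ 2 + w ^ 2) * ‖horizonFactor l w‖ ^ 2 := by
  have h := congrArg (fun z : ℂ => ‖z‖ ^ 2) (horizonFactor_succ_succ l w)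
  simp only [norm_mul, mul_pow] at h
  have h1 : ‖(l + 2 + Complex.I * w : ℂ)‖ ^ 2 = (l + 2) ^ 2 + w ^ 2 := by
    rw [← Complex.normSq_eq_norm_sq, Complex.normSq_apply]
    simp
    ring
  have h2 : ‖(Complex.I * w - (l + 1) : ℂ)‖ ^ 2 = (l + 1) ^ 2 + w ^ 2 := by
    rw [← Complex.normSq_eq_norm_sq, Complex.normSq_apply]
    simp
    ring
  rwa [h1, h2] at h

theorem continuous_legendre_cos_mul (l : ℕ) (w : ℝ) :
    Continuous fun g => (legendre l).eval (Real.cos g) * Real.sinh ((Real.pi - g) * w) :=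
  ((legendre l).continuous.comp Real.continuous_cos).mul (by fun_prop)

theorem kernelCoeff_eq (l : ℕ) (w : ℝ) : kernelCoeff l w =
    (∫ g in (0 : ℝ)..Real.pi, (legendre l).eval (Real.cos g) * Real.sinh ((Real.pi - g) * w)) /
      Real.sinh (Real.pi * w) := by
  unfold kernelCoeff sinhRatio
  simp_rw [mul_div_assoc']
  exact intervalIntegral.integral_div _ _

/-- The same recursion as `normSq_horizonFactor_succ_succ`.  The difference of the two integrands has
an explicit primitive, and its boundary values at `0` and `π` vanish. -/
theorem kernelCoeff_succ_succ (l : ℕ) (w : ℝ) :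
    ((l + 2) ^ 2 + w ^ 2) * kernelCoeff (l + 2) w = ((l + 1) ^ 2 + w ^ 2) * kernelCoeff l w := by
  have hd : ∀ g : ℝ, HasDerivAt (fun g : ℝ =>
      (2 * l + 3) * (Real.sin g * (legendre (l + 1)).eval (Real.cos g)) *
        Real.sinh ((Real.pi - g) * w) -
      w * ((legendre (l + 2)).eval (Real.cos g) - (legendre l).eval (Real.cos g)) *
        Real.cosh ((Real.pi - g) * w))
      (((l + 2) ^ 2 + w ^ 2) * ((legendre (l + 2)).eval (Real.cos g) *
          Real.sinh ((Real.pi - g) * w)) -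
        ((l + 1) ^ 2 + w ^ 2) * ((legendre l).eval (Real.cos g) *
          Real.sinh ((Real.pi - g) * w))) g := by
    intro g
    have hlin : HasDerivAt (fun g : ℝ => (Real.pi - g) * w) (-1 * w) g :=
      ((hasDerivAt_id g).const_sub Real.pi).mul_const w
    have hP : ∀ k, HasDerivAt (fun g => (legendre k).eval (Real.cos g))
        ((derivative (legendre k)).eval (Real.cos g) * -Real.sin g) g := fun k =>
      ((legendre k).hasDerivAt (Real.cos g)).comp g (Real.hasDerivAt_cos g)
    have h := ((((Real.hasDerivAt_sin g).mul (hP (l + 1))).const_mul (2 * (l : ℝ) + 3)).mul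
      hlin.sinh).sub ((((hP (l + 2)).sub (hP l)).const_mul w).mul hlin.cosh)
    refine h.congr_deriv ?_
    have e1 := congrArg (eval (Real.cos g)) (derivative_legendre_succ (l + 1))
    have e2 := congrArg (eval (Real.cos g)) (derivative_legendre l)
    have e3 := congrArg (eval (Real.cos g)) (X_sq_sub_one_mul_derivative_legendre (l + 1))
    have e4 := congrArg (eval (Real.cos g)) (X_sq_sub_one_mul_derivative_legendre_succ l)
    simp only [eval_mul, eval_add, eval_sub, eval_pow, eval_X, eval_C, eval_one] at e1 e2 e3 e4
    push_cast at e1 e3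
    have e5 := Real.sin_sq_add_cos_sq g
    simp only [Pi.sub_apply, Pi.mul_apply]
    rw [e1, e2]
    have e6 : Real.cos g ^ 2 - 1 = -Real.sin g ^ 2 := by linarith
    rw [e6] at e3 e4
    linear_combination ((l : ℝ) + 2) * Real.sinh ((Real.pi - g) * w) * e3 +
      ((l : ℝ) + 1) * Real.sinh ((Real.pi - g) * w) * e4
  have hc := fun k => continuous_legendre_cos_mul k w
  have h := intervalIntegral.integral_eq_sub_of_hasDerivAt (a := 0) (b := Real.pi)
    (fun g _ => hd g) ((((hc (l + 2)).const_mul _).sub ((hc l).const_mul _)).intervalIntegrable _ _)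
  rw [intervalIntegral.integral_sub (((hc (l + 2)).const_mul _).intervalIntegrable _ _)
    (((hc l).const_mul _).intervalIntegrable _ _), intervalIntegral.integral_const_mul,
    intervalIntegral.integral_const_mul] at h
  simp only [Real.sin_zero, Real.sin_pi, Real.cos_zero, Real.cos_pi, eval_one_legendre,
    eval_neg_one_legendre, pow_add, sub_self] at h
  rw [kernelCoeff_eq, kernelCoeff_eq, mul_div_assoc', mul_div_assoc']
  congr 1
  norm_num at h
  linarith

theorem kernelCoeff_zero {w : ℝ} (hw : 0 < w) :
    kernelCoeff 0 w = (Real.cosh (Real.pi * w) - 1) / w / Real.sinh (Real.pi * w) := by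
  have hd : ∀ g : ℝ, HasDerivAt (fun g : ℝ => -Real.cosh ((Real.pi - g) * w) / w)
      ((legendre 0).eval (Real.cos g) * Real.sinh ((Real.pi - g) * w)) g := by
    intro g
    have hlin : HasDerivAt (fun g : ℝ => (Real.pi - g) * w) (-1 * w) g :=
      ((hasDerivAt_id g).const_sub Real.pi).mul_const w
    refine (hlin.cosh.neg.div_const w).congr_deriv ?_
    rw [legendre_zero, eval_one]
    field_simp
  rw [kernelCoeff_eq, intervalIntegral.integral_eq_sub_of_hasDerivAt (fun g _ => hd g)
    ((continuous_legendre_cos_mul 0 w).intervalIntegrable _ _)]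
  simp
  ring

theorem kernelCoeff_one (w : ℝ) :
    kernelCoeff 1 w = w * (1 + Real.cosh (Real.pi * w)) / (1 + w ^ 2) / Real.sinh (Real.pi * w) := by
  have hd : ∀ g : ℝ, HasDerivAt (fun g : ℝ => (Real.sin g * Real.sinh ((Real.pi - g) * w) -
      w * Real.cos g * Real.cosh ((Real.pi - g) * w)) / (1 + w ^ 2))
      ((legendre 1).eval (Real.cos g) * Real.sinh ((Real.pi - g) * w)) g := by
    intro g
    have hlin : HasDerivAt (fun g : ℝ => (Real.pi - g) * w) (-1 * w) g :=
      ((hasDerivAt_id g).const_sub Real.pi).mul_const w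
    refine ((((Real.hasDerivAt_sin g).mul hlin.sinh).sub
      (((Real.hasDerivAt_cos g).const_mul w).mul hlin.cosh)).div_const _).congr_deriv ?_
    rw [legendre_one, eval_X]
    field_simp
    ring
  rw [kernelCoeff_eq, intervalIntegral.integral_eq_sub_of_hasDerivAt (fun g _ => hd g)
    ((continuous_legendre_cos_mul 1 w).intervalIntegrable _ _)]
  simp
  ring

/-- The two spectral functions are related by the thermal factor `tanh (π (ω + il) / 2)`. -/
theorem kernelCoeff_eq_modeTau {x : Mode} (hx : 0 < x.1) :
    kernelCoeff x.2.1 x.1 = modeTau x * ‖horizonFactor x.2.1 x.1‖ ^ 2 / x.1 := by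
  obtain ⟨w, l, j⟩ := x
  change 0 < w at hx
  change kernelCoeff l w = (1 - (-1) ^ l * Real.exp (-Real.pi * w)) /
    (1 + (-1) ^ l * Real.exp (-Real.pi * w)) * ‖horizonFactor l w‖ ^ 2 / w
  clear j
  have hs : 0 < Real.sinh (Real.pi * w) := Real.sinh_pos_iff.2 (mul_pos Real.pi_pos hx)
  set e := Real.exp (-Real.pi * w) with he
  have he0 : 0 < e := Real.exp_pos _
  have he1 : e < 1 := by
    rw [he, Real.exp_lt_one_iff]
    nlinarith [mul_pos Real.pi_pos hx]
  have hsinh : Real.sinh (Real.pi * w) = (1 / e - e) / 2 := by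
    rw [Real.sinh_eq, he, one_div, ← Real.exp_neg]
    simp
  have hcosh : Real.cosh (Real.pi * w) = (1 / e + e) / 2 := by
    rw [Real.cosh_eq, he, one_div, ← Real.exp_neg]
    simp
  have h1 : 1 - e ≠ 0 := by linarith
  have h2 : 1 + e ≠ 0 := by linarith
  have h3 : 1 - e ^ 2 ≠ 0 := by nlinarith
  -- both sides satisfy the same recursion in steps of two, which preserve `(-1)^l`
  induction l using Nat.strong_induction_on with
  | _ l ih =>
    match l with
    | 0 =>
      rw [kernelCoeff_zero hx, horizonFactor_zero, hsinh, hcosh]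
      simp only [pow_zero, one_mul, norm_one, one_pow, mul_one]
      field_simp
      ring
    | 1 =>
      have h4 : ‖horizonFactor 1 w‖ ^ 2 = w ^ 2 / (1 + w ^ 2) := by
        rw [horizonFactor_one, norm_div, div_pow, ← Complex.normSq_eq_norm_sq,
          ← Complex.normSq_eq_norm_sq, Complex.normSq_apply, Complex.normSq_apply]
        simp
        ring
      rw [kernelCoeff_one, h4, hsinh, hcosh]
      simp only [pow_one, neg_mul, one_mul, sub_neg_eq_add, ← sub_eq_add_neg]
      field_simp
      ring
    | l + 2 =>
      have h4 := ih l (by omega)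
      have h5 := kernelCoeff_succ_succ l w
      have h6 := normSq_horizonFactor_succ_succ l w
      have h7 : ((l : ℝ) + 2) ^ 2 + w ^ 2 ≠ 0 := by positivity
      refine mul_left_cancel₀ h7 ?_
      rw [h5, h4, pow_add, show ((-1 : ℝ)) ^ 2 = 1 by norm_num, mul_one]
      linear_combination (-(1 - (-1) ^ l * e) / (1 + (-1) ^ l * e) / w) * h6

end Spectral

/-! ### Boundary data in the observer's coordinates -/

section Data

/-- Archimedes' theorem: the coordinate along an axis is uniformly distributed on the sphere. -/
theorem map_inner_sphereMeasure (n : TwoSphere) :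
    sphereMeasure.map (fun n' : TwoSphere => inner ℝ (n : E3) n') =
      ENNReal.ofReal (2 * Real.pi) • volume.restrict (Set.Ioo (-1 : ℝ) 1) := by
  have hm : Measurable fun n' : TwoSphere => inner ℝ (n : E3) n' := by fun_prop
  have hY : ∀ n', sphereHarmonic 0 0 n' = (Real.sqrt (1 / (4 * Real.pi)) : ℝ) := by
    intro n'
    simp [sphereHarmonic, harmonicScalar, legendre_zero]
  have hY0 : ((Real.sqrt (1 / (4 * Real.pi)) : ℝ) : ℂ) ≠ 0 := by
    rw [Complex.ofReal_ne_zero]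
    exact (Real.sqrt_pos.2 (by have := Real.pi_pos; positivity)).ne'
  ext s hs
  have h := funk_hecke (l := 0) (m := 0) (by simp) (f := s.indicator 1)
    (measurable_one.indicator hs) ⟨1, fun x _ => by
      by_cases hx : x ∈ s <;> simp [hx]⟩ n
  simp only [hY, integral_mul_const, legendre_zero, Polynomial.eval_one, Complex.ofReal_one,
    mul_one] at h
  have h := mul_right_cancel₀ hY0 h
  have e1 : ∫ n' : TwoSphere, s.indicator (1 : ℝ → ℂ) (inner ℝ (n : E3) n') ∂sphereMeasure =
      (sphereMeasure.real ((fun n' : TwoSphere => inner ℝ (n : E3) n') ⁻¹' s) : ℂ) := by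
    have : ∀ n' : TwoSphere, s.indicator (1 : ℝ → ℂ) (inner ℝ (n : E3) n') =
        ((fun n' : TwoSphere => inner ℝ (n : E3) n') ⁻¹' s).indicator 1 n' := fun n' => rfl
    simp_rw [this]
    rw [integral_indicator (hm hs)]
    simp
  have e2 : ∫ x in Set.Ioo (-1 : ℝ) 1, s.indicator (1 : ℝ → ℂ) x =
      ((volume.restrict (Set.Ioo (-1 : ℝ) 1)).real s : ℂ) := by
    rw [integral_indicator hs]
    simp
  rw [e1, e2] at h
  have h' : sphereMeasure.real ((fun n' : TwoSphere => inner ℝ (n : E3) n') ⁻¹' s) =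
      2 * Real.pi * (volume.restrict (Set.Ioo (-1 : ℝ) 1)).real s := by exact_mod_cast h
  rw [Measure.map_apply hm hs, Measure.smul_apply, smul_eq_mul,
    ← ENNReal.ofReal_toReal (measure_ne_top sphereMeasure _),
    ← ENNReal.ofReal_toReal (measure_ne_top (volume.restrict (Set.Ioo (-1 : ℝ) 1)) s),
    ← ENNReal.ofReal_mul (by positivity)]
  exact congrArg _ h'

theorem lintegral_inner_sphereMeasure (n : TwoSphere) {g : ℝ → ℝ≥0∞} (hg : Measurable g) :
    ∫⁻ n' : TwoSphere, g (inner ℝ (n : E3) n') ∂sphereMeasure =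
      ENNReal.ofReal (2 * Real.pi) * ∫⁻ x in Set.Ioo (-1 : ℝ) 1, g x := by
  rw [← smul_eq_mul, ← lintegral_smul_measure, ← map_inner_sphereMeasure n,
    lintegral_map hg (by fun_prop)]

/-- The measure `dt dΩ` on the observer's cylinder. -/
abbrev cylinder : Measure (ℝ × TwoSphere) := (volume : Measure ℝ).prod sphereMeasure

/-- The boundary data as a function of the observer's coordinates. -/
def Observer.data (o : Observer) (P : BoundaryData) (p : ℝ × TwoSphere) : ℝ :=
  P.toFun (o.scriAt p.1 p.2)

/-- The null vector of `o.scriAt`, rescaled to be bounded. -/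
def Observer.unitAt (o : Observer) (p : ℝ × TwoSphere) : Mink :=
  (Real.cosh p.1)⁻¹ • o.scriAt p.1 p.2

theorem continuousOn_toFun (P : BoundaryData) : ContinuousOn P.toFun {x | 0 < x 0} :=
  P.smooth.continuousOn

theorem isOpen_future : IsOpen {x : Mink | 0 < x 0} :=
  isOpen_lt continuous_const (continuous_apply 0)

theorem hasFDerivAt_toFun (P : BoundaryData) {x : Mink} (hx : 0 < x 0) :
    HasFDerivAt P.toFun (fderiv ℝ P.toFun x) x :=
  ((P.smooth.differentiableOn (by simp)).differentiableAt
    (isOpen_future.mem_nhds hx)).hasFDerivAt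

theorem continuousOn_fderiv_toFun (P : BoundaryData) :
    ContinuousOn (fderiv ℝ P.toFun) {x | 0 < x 0} :=
  P.smooth.continuousOn_fderiv_of_isOpen isOpen_future (by simp)

theorem Observer.continuous_unitAt (o : Observer) : Continuous o.unitAt :=
  ((Real.continuous_cosh.comp continuous_fst).inv₀ fun _ => (Real.cosh_pos _).ne').smul
    o.continuous_scriAt

theorem Observer.isFutureNull_unitAt (o : Observer) (p : ℝ × TwoSphere) :
    0 < o.unitAt p 0 :=
  mul_pos (inv_pos.2 (Real.cosh_pos _)) (o.isFutureNull_scriAt p.1 p.2).1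

theorem Observer.data_eq (o : Observer) (P : BoundaryData) (p : ℝ × TwoSphere) :
    o.data P p = (Real.cosh p.1 ^ 2)⁻¹ * P.toFun (o.unitAt p) := by
  have h := P.weight_two _ (o.isFutureNull_scriAt p.1 p.2) _ (inv_pos.2 (Real.cosh_pos p.1))
  have h0 := (Real.cosh_pos p.1).ne'
  unfold Observer.unitAt Observer.data
  rw [h, inv_pow, inv_inv, ← mul_assoc, inv_mul_cancel₀ (pow_ne_zero 2 h0), one_mul]

/-- The rescaled null vectors stay in a compact set of future-pointing vectors. -/
theorem Observer.exists_compact (o : Observer) :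
    ∃ K : Set Mink, IsCompact K ∧ K ⊆ {x | 0 < x 0} ∧ ∀ p, o.unitAt p ∈ K := by
  set f : (ℝ × ℝ) × TwoSphere → Mink := fun q => o.frame.mulVec
    ![1, q.1.1, q.1.2 * (q.2 : E3) 0, q.1.2 * (q.2 : E3) 1, q.1.2 * (q.2 : E3) 2] with hf
  have hfc : Continuous f := by
    refine Continuous.matrix_mulVec continuous_const (continuous_pi fun i => ?_)
    fin_cases i <;> simp <;> fun_prop
  set S : Set ((ℝ × ℝ) × TwoSphere) := {q | q.1.1 ^ 2 + q.1.2 ^ 2 = 1} with hS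
  have hSc : IsCompact S := by
    have h1 : IsCompact ((Set.Icc (-1 : ℝ) 1 ×ˢ Set.Icc (-1 : ℝ) 1) ×ˢ
        (Set.univ : Set TwoSphere)) := (isCompact_Icc.prod isCompact_Icc).prod isCompact_univ
    refine h1.of_isClosed_subset (isClosed_eq (by fun_prop) continuous_const) fun q hq => ?_
    have hq : q.1.1 ^ 2 + q.1.2 ^ 2 = 1 := hq
    have h2 : |q.1.1| ≤ 1 := abs_le_one_iff_mul_self_le_one.2 (by nlinarith [sq_nonneg q.1.2])
    have h3 : |q.1.2| ≤ 1 := abs_le_one_iff_mul_self_le_one.2 (by nlinarith [sq_nonneg q.1.1])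
    exact ⟨⟨abs_le.1 h2, abs_le.1 h3⟩, Set.mem_univ _⟩
  refine ⟨f '' S, hSc.image hfc, ?_, fun p => ⟨((Real.tanh p.1, (Real.cosh p.1)⁻¹), p.2), ?_, ?_⟩⟩
  · rintro _ ⟨q, hq, rfl⟩
    have hq : q.1.1 ^ 2 + q.1.2 ^ 2 = 1 := hq
    refine (o.isFutureNull_mulVec ⟨by simp, ?_⟩).1
    have h := sum_sq_twoSphere q.2
    simp [mdot, Fin.sum_univ_four]
    linear_combination hq + q.1.2 ^ 2 * h
  · change Real.tanh p.1 ^ 2 + (Real.cosh p.1)⁻¹ ^ 2 = 1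
    have h0 := (Real.cosh_pos p.1).ne'
    rw [Real.tanh_eq_sinh_div_cosh]
    have := Real.cosh_sq p.1
    field_simp
    linarith
  · simp only [hf, Observer.unitAt, Observer.scriAt]
    rw [← Matrix.mulVec_smul]
    congr 1
    have h0 := (Real.cosh_pos p.1).ne'
    funext i
    fin_cases i <;> simp [Real.tanh_eq_sinh_div_cosh, h0]
    rw [div_eq_inv_mul]

theorem Observer.continuous_data (o : Observer) (P : BoundaryData) : Continuous (o.data P) :=
  (continuousOn_toFun P).comp_continuous o.continuous_scriAt
    fun p => (o.isFutureNull_scriAt p.1 p.2).1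

/-- The boundary data decay like `1 / cosh² t`. -/
theorem Observer.exists_abs_data_le (o : Observer) (P : BoundaryData) :
    ∃ C, 0 ≤ C ∧ ∀ p, |o.data P p| ≤ C * (Real.cosh p.1 ^ 2)⁻¹ := by
  obtain ⟨K, hK, hKs, hu⟩ := o.exists_compact
  obtain ⟨C, hC⟩ := hK.exists_bound_of_continuousOn ((continuousOn_toFun P).mono hKs)
  refine ⟨C, (norm_nonneg _).trans (hC _ (hu (0, pole))), fun p => ?_⟩
  rw [o.data_eq, abs_mul, abs_of_nonneg (by positivity), mul_comm]
  exact mul_le_mul_of_nonneg_right (hC _ (hu p)) (by positivity)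

/-- The derivative of the boundary data with respect to the observer's time. -/
theorem Observer.exists_deriv_data (o : Observer) (P : BoundaryData) :
    ∃ d : ℝ × TwoSphere → ℝ, Continuous d ∧
      (∀ t n, HasDerivAt (fun t => o.data P (t, n)) (d (t, n)) t) ∧
      ∃ C, 0 ≤ C ∧ ∀ p, |d p| ≤ C * (Real.cosh p.1 ^ 2)⁻¹ := by
  obtain ⟨K, hK, hKs, hu⟩ := o.exists_compact
  obtain ⟨C, hC⟩ := hK.exists_bound_of_continuousOn ((continuousOn_toFun P).mono hKs)
  obtain ⟨C', hC'⟩ := hK.exists_bound_of_continuousOn ((continuousOn_fderiv_toFun P).mono hKs)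
  obtain ⟨C'', hC''⟩ := hK.exists_bound_of_continuousOn (f := fun x => x) continuousOn_id
  -- the derivative of the rescaled null vector
  set A := (Matrix.mulVecLin o.frame).toContinuousLinearMap with hA
  set v : ℝ × TwoSphere → Mink := fun p =>
    A ![Real.sinh p.1, Real.cosh p.1, 0, 0, 0] with hv
  set u' : ℝ × TwoSphere → Mink := fun p =>
    (Real.cosh p.1)⁻¹ • v p - (Real.sinh p.1 * (Real.cosh p.1)⁻¹) • o.unitAt p with hu'
  have hcosh : ∀ t : ℝ, |Real.sinh t * (Real.cosh t)⁻¹| ≤ 1 := by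
    intro t
    rw [← div_eq_mul_inv, abs_div, abs_of_pos (Real.cosh_pos t), div_le_one (Real.cosh_pos t)]
    rw [← sq_le_sq₀ (abs_nonneg _) (Real.cosh_pos t).le, sq_abs, Real.cosh_sq]
    linarith
  have hvd : ∀ t n, HasDerivAt (fun t => o.scriAt t n) (v (t, n)) t := by
    intro t n
    refine A.hasFDerivAt.comp_hasDerivAt t (hasDerivAt_pi.2 fun i => ?_)
    fin_cases i
    · exact Real.hasDerivAt_cosh t
    · exact Real.hasDerivAt_sinh t
    · exact hasDerivAt_const t _
    · exact hasDerivAt_const t _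
    · exact hasDerivAt_const t _
  have hud : ∀ t n, HasDerivAt (fun t => o.unitAt (t, n)) (u' (t, n)) t := by
    intro t n
    have h0 := (Real.cosh_pos t).ne'
    refine (((Real.hasDerivAt_cosh t).inv h0).smul (hvd t n)).congr_deriv ?_
    simp only [hu', Observer.unitAt, smul_smul, sub_eq_add_neg, ← neg_smul]
    congr 2
    field_simp
  have hvc : Continuous v := A.continuous.comp (continuous_pi fun i => by
    fin_cases i <;> simp <;> fun_prop)
  have hcc : Continuous fun p : ℝ × TwoSphere => (Real.cosh p.1)⁻¹ :=
    (Real.continuous_cosh.comp continuous_fst).inv₀ fun p => (Real.cosh_pos _).ne'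
  have huc : Continuous u' := (hcc.smul hvc).sub
    (((Real.continuous_sinh.comp continuous_fst).mul hcc).smul o.continuous_unitAt)
  have hub : ∀ p, ‖u' p‖ ≤ ‖A‖ + C'' := by
    intro p
    refine (norm_sub_le _ _).trans (add_le_add ?_ ?_)
    · rw [hv, ← map_smul]
      refine (A.le_opNorm _).trans (mul_le_of_le_one_right (norm_nonneg _) ?_)
      rw [pi_norm_le_iff_of_nonneg zero_le_one]
      intro i
      have h0 := (Real.cosh_pos p.1).ne'
      have h1 := hcosh p.1
      rw [mul_comm] at h1
      fin_cases i <;> simp [h0]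
      rwa [abs_mul, abs_inv] at h1
    · rw [norm_smul]
      exact (mul_le_of_le_one_left (norm_nonneg _) (hcosh p.1)).trans (hC'' _ (hu p))
  have hP : Continuous fun p => P.toFun (o.unitAt p) :=
    (continuousOn_toFun P).comp_continuous o.continuous_unitAt o.isFutureNull_unitAt
  have hP' : Continuous fun p => fderiv ℝ P.toFun (o.unitAt p) :=
    (continuousOn_fderiv_toFun P).comp_continuous o.continuous_unitAt o.isFutureNull_unitAt
  have hC0 : 0 ≤ C := (norm_nonneg _).trans (hC _ (hu (0, pole)))
  have hC0' : 0 ≤ C' := (norm_nonneg _).trans (hC' _ (hu (0, pole)))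
  refine ⟨fun p => (Real.cosh p.1)⁻¹ ^ 2 * (fderiv ℝ P.toFun (o.unitAt p) (u' p) -
    2 * (Real.sinh p.1 * (Real.cosh p.1)⁻¹) * P.toFun (o.unitAt p)), ?_, fun t n => ?_,
    C' * (‖A‖ + C'') + 2 * C, ?_, fun p => ?_⟩
  · exact (hcc.pow 2).mul ((hP'.clm_apply huc).sub ((continuous_const.mul
      ((Real.continuous_sinh.comp continuous_fst).mul hcc)).mul hP))
  · have h0 := (Real.cosh_pos t).ne'
    have h1 := (((Real.hasDerivAt_cosh t).inv h0).pow 2).mul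
      ((hasFDerivAt_toFun P (o.isFutureNull_unitAt (t, n))).comp_hasDerivAt t (hud t n))
    have h2 : (fun t => o.data P (t, n)) =
        (Real.cosh⁻¹ ^ 2) * (P.toFun ∘ fun t => o.unitAt (t, n)) := by
      funext s
      rw [o.data_eq]
      simp
    rw [h2]
    refine h1.congr_deriv ?_
    have h3 : Real.cosh t * (Real.cosh t)⁻¹ = 1 := mul_inv_cancel₀ h0
    simp only [Function.comp_apply, Pi.inv_apply, Pi.pow_apply]
    field_simp
    linear_combination (-2 * Real.sinh t * P.toFun (o.unitAt (t, n))) * h3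
  · have : 0 ≤ ‖A‖ + C'' := (norm_nonneg _).trans (hub (0, pole))
    positivity
  · rw [abs_mul, inv_pow, abs_of_nonneg (by positivity), mul_comm]
    refine mul_le_mul_of_nonneg_right ((abs_sub _ _).trans (add_le_add ?_ ?_)) (by positivity)
    · refine ((fderiv ℝ P.toFun (o.unitAt p)).le_opNorm _).trans ?_
      exact mul_le_mul (hC' _ (hu p)) (hub p) (norm_nonneg _) hC0'
    · rw [abs_mul, abs_mul, abs_two]
      refine mul_le_mul ?_ (hC _ (hu p)) (abs_nonneg _) zero_le_two
      linarith [hcosh p.1]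

theorem integrable_inv_cosh_sq : Integrable fun t : ℝ => (Real.cosh t ^ 2)⁻¹ := by
  refine (integrable_inv_cosh_sub (x := 0) one_pos).mono' ?_ (ae_of_all _ fun t => ?_)
  · exact ((Real.continuous_cosh.pow 2).inv₀
      fun t => (pow_pos (Real.cosh_pos t) 2).ne').aestronglyMeasurable
  · rw [Real.norm_of_nonneg (by positivity), sub_zero]
    exact inv_anti₀ (Real.cosh_pos t) (le_self_pow₀ (Real.one_le_cosh t) two_ne_zero)

theorem integrable_of_abs_le_inv_cosh_sq {f : ℝ × TwoSphere → ℝ} (hf : Continuous f) {C : ℝ}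
    (hC : ∀ p, |f p| ≤ C * (Real.cosh p.1 ^ 2)⁻¹) : Integrable f cylinder :=
  ((integrable_inv_cosh_sq.const_mul C).comp_fst sphereMeasure).mono' hf.aestronglyMeasurable
    (ae_of_all _ hC)

theorem memLp_two_of_integrable_of_bounded {X E : Type*} [MeasurableSpace X] {μ : Measure X}
    [NormedAddCommGroup E] {f : X → E} (hf : Integrable f μ) {C : ℝ} (hC : ∀ p, ‖f p‖ ≤ C) :
    MemLp f 2 μ := by
  rw [memLp_two_iff_integrable_sq_norm hf.1]
  refine (hf.norm.const_mul C).mono' (hf.1.norm.pow 2) (ae_of_all _ fun p => ?_)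
  rw [Real.norm_of_nonneg (sq_nonneg _), pow_two]
  exact mul_le_mul_of_nonneg_right (hC p) (norm_nonneg _)

theorem inv_cosh_sq_le_one (t : ℝ) : (Real.cosh t ^ 2)⁻¹ ≤ 1 :=
  inv_le_one_of_one_le₀ (one_le_pow₀ (Real.one_le_cosh t))

theorem Observer.integrable_data (o : Observer) (P : BoundaryData) :
    Integrable (o.data P) cylinder := by
  obtain ⟨C, -, hC⟩ := o.exists_abs_data_le P
  exact integrable_of_abs_le_inv_cosh_sq (o.continuous_data P) hC

theorem Observer.memLp_data (o : Observer) (P : BoundaryData) : MemLp (o.data P) 2 cylinder := by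
  obtain ⟨C, hC0, hC⟩ := o.exists_abs_data_le P
  exact memLp_two_of_integrable_of_bounded (o.integrable_data P) fun p =>
    (hC p).trans (mul_le_of_le_one_right hC0 (inv_cosh_sq_le_one _))

theorem modeCoeff_eq_integral {f : ℝ × TwoSphere → ℝ} (h1 : Integrable f cylinder) (x : Mode) :
    Integrable (fun p : ℝ × TwoSphere => Complex.exp (Complex.I * x.1 * p.1) *
      (conj (sphereHarmonic x.2.1 x.2.m p.2) * (f p : ℂ))) cylinder ∧
    modeCoeff f x = ∫ p : ℝ × TwoSphere, Complex.exp (Complex.I * x.1 * p.1) *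
      (conj (sphereHarmonic x.2.1 x.2.m p.2) * (f p : ℂ)) ∂cylinder := by
  have h : Integrable (fun p : ℝ × TwoSphere => Complex.exp (Complex.I * x.1 * p.1) *
      (conj (sphereHarmonic x.2.1 x.2.m p.2) * (f p : ℂ))) cylinder :=
    (integrable_harmonic_mul h1 x.2.1 x.2.m).bdd_mul (c := 1)
      (by fun_prop) (ae_of_all _ fun p => (norm_exp_I_mul x.1 p.1).le)
  refine ⟨h, ?_⟩
  rw [integral_prod _ h]
  simp only [integral_const_mul]
  rfl

/-- The map from the observer's angular coordinates to the cylinder. -/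
theorem map_prod_solidAngle : ((volume : Measure ℝ).prod solidAngle).map
    (fun p => (p.1, sphericalPoint p.2.1 p.2.2)) = cylinder := by
  have h := Measure.map_prod_map (volume : Measure ℝ) solidAngle measurable_id
    continuous_sphericalPoint.measurable
  rw [Measure.map_id, map_solidAngle] at h
  exact h.symm

theorem measurable_prod_sphericalPoint : Measurable fun p : ℝ × (ℝ × ℝ) =>
    (p.1, sphericalPoint p.2.1 p.2.2) :=
  measurable_fst.prodMk (continuous_sphericalPoint.measurable.comp measurable_snd)

theorem Observer.coeff_eq_modeCoeff (o : Observer) (P : BoundaryData) (x : Mode) :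
    o.coeff P x = modeCoeff (o.data P) x := by
  obtain ⟨h1, h2⟩ := modeCoeff_eq_integral (o.integrable_data P) x
  rw [h2, ← map_prod_solidAngle, integral_map measurable_prod_sphericalPoint.aemeasurable
    (by rw [map_prod_solidAngle]; exact h1.1), Observer.coeff]
  refine integral_congr_ae (ae_of_all _ fun p => ?_)
  simp only [sphereHarmonic_sphericalPoint, Observer.data, o.scriAt_sphericalPoint, mul_assoc]

end Data

/-! ### The action in terms of the modes -/

section Action

/-- The boundary two-point function `1 / (cosh (t - t') - n·n')` on the observer's cylinder. -/
def cylKernel (p q : ℝ × TwoSphere) : ℝ :=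
  (Real.cosh (p.1 - q.1) - inner ℝ (p.2 : E3) q.2)⁻¹

theorem cylKernel_comm (p q : ℝ × TwoSphere) : cylKernel p q = cylKernel q p := by
  unfold cylKernel
  rw [real_inner_comm, ← Real.cosh_neg, neg_sub]

theorem inner_le_one (n n' : TwoSphere) : inner ℝ (n : E3) n' ≤ 1 := by
  have h := real_inner_le_norm (n : E3) n'
  rwa [mem_sphere_zero_iff_norm.1 n.2, mem_sphere_zero_iff_norm.1 n'.2, one_mul] at h

theorem cylKernel_nonneg (p q : ℝ × TwoSphere) : 0 ≤ cylKernel p q :=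
  inv_nonneg.2 (sub_nonneg.2 ((inner_le_one _ _).trans (Real.one_le_cosh _)))

theorem measurable_cylKernel :
    Measurable fun z : (ℝ × TwoSphere) × (ℝ × TwoSphere) => cylKernel z.1 z.2 := by
  unfold cylKernel
  refine Measurable.inv (Continuous.measurable ?_)
  fun_prop

theorem lintegral_inv_cosh_sub_lt_top :
    ∫⁻ x in Set.Ioo (-1 : ℝ) 1, ∫⁻ t, ENNReal.ofReal ((Real.cosh t - x)⁻¹) < ⊤ := by
  have h1 : IntegrableOn (fun x : ℝ => Real.pi * Real.sqrt 2 * (1 - x) ^ (-(1 / 2) : ℝ))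
      (Set.Ioo (-1) 1) := by
    refine Integrable.const_mul ?_ _
    have h2 := (intervalIntegral.intervalIntegrable_rpow' (a := 0) (b := 2)
      (r := -(1 / 2)) (by norm_num)).comp_sub_left 1
    norm_num at h2
    have h3 := h2.symm
    rw [intervalIntegrable_iff_integrableOn_Ioo_of_le (by norm_num)] at h3
    norm_num
    exact h3
  refine lt_of_le_of_lt (setLIntegral_mono' measurableSet_Ioo fun x hx => ?_)
    h1.lintegral_lt_top
  have hx : x < 1 := (Set.mem_Ioo.1 hx).2
  rw [← ofReal_integral_eq_lintegral_ofReal (integrable_inv_cosh_sub hx)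
    (ae_of_all _ fun t => inv_nonneg.2 (cosh_sub_pos hx t).le)]
  refine ENNReal.ofReal_le_ofReal ((integral_inv_cosh_sub_le hx).trans_eq ?_)
  rw [Real.rpow_neg (sub_nonneg.2 hx.le), ← Real.sqrt_eq_rpow, div_eq_mul_inv]

/-- The integral of the two-point function over the cylinder. -/
def kernelMass : ℝ≥0∞ := ENNReal.ofReal (2 * Real.pi) *
  ∫⁻ x in Set.Ioo (-1 : ℝ) 1, ∫⁻ t, ENNReal.ofReal ((Real.cosh t - x)⁻¹)

theorem kernelMass_lt_top : kernelMass < ⊤ :=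
  ENNReal.mul_lt_top ENNReal.ofReal_lt_top lintegral_inv_cosh_sub_lt_top

theorem lintegral_cylKernel (p : ℝ × TwoSphere) :
    ∫⁻ q, ENNReal.ofReal (cylKernel q p) ∂cylinder = kernelMass := by
  have hm : Measurable fun q : ℝ × TwoSphere => ENNReal.ofReal (cylKernel q p) :=
    (measurable_cylKernel.comp measurable_prodMk_right).ennreal_ofReal
  rw [lintegral_prod_symm _ hm.aemeasurable, kernelMass, ← lintegral_inner_sphereMeasure p.2
    (Measurable.lintegral_prod_right' (f := fun z : ℝ × ℝ =>
      ENNReal.ofReal ((Real.cosh z.2 - z.1)⁻¹)) (by fun_prop))]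
  refine lintegral_congr fun n => ?_
  rw [← lintegral_sub_right_eq_self (fun t => ENNReal.ofReal ((Real.cosh t - _)⁻¹)) p.1]
  simp only [cylKernel, real_inner_comm]

theorem integrable_cylKernel (p : ℝ × TwoSphere) : Integrable (fun q => cylKernel q p) cylinder := by
  refine ⟨(measurable_cylKernel.comp measurable_prodMk_right).aestronglyMeasurable, ?_⟩
  rw [hasFiniteIntegral_iff_ofReal (ae_of_all _ fun q => cylKernel_nonneg q p)]
  exact (lintegral_cylKernel p).trans_lt kernelMass_lt_top

theorem integrable_cylKernel_mul {f : ℝ × TwoSphere → ℝ} (hf : Integrable f cylinder) :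
    Integrable (fun z : (ℝ × TwoSphere) × (ℝ × TwoSphere) => cylKernel z.1 z.2 * f z.2)
      (cylinder.prod cylinder) := by
  have hm : AEStronglyMeasurable (fun z : (ℝ × TwoSphere) × (ℝ × TwoSphere) =>
      cylKernel z.1 z.2 * f z.2) (cylinder.prod cylinder) :=
    measurable_cylKernel.aestronglyMeasurable.mul hf.1.comp_snd
  refine ⟨hm, ?_⟩
  rw [HasFiniteIntegral, lintegral_prod_symm _ hm.enorm]
  have h1 : ∀ q, ∫⁻ p, ‖cylKernel p q * f q‖ₑ ∂cylinder = kernelMass * ‖f q‖ₑ := by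
    intro q
    simp_rw [enorm_mul]
    rw [lintegral_mul_const' _ _ (by simp), ← lintegral_cylKernel q]
    simp_rw [Real.enorm_of_nonneg (cylKernel_nonneg _ q)]
  simp_rw [h1]
  rw [lintegral_const_mul' _ _ kernelMass_lt_top.ne]
  exact ENNReal.mul_lt_top kernelMass_lt_top hf.2

/-- Convolution with the two-point function. -/
def cylPotential (f : ℝ × TwoSphere → ℝ) (p : ℝ × TwoSphere) : ℝ :=
  ∫ q, cylKernel p q * f q ∂cylinder

theorem integrable_cylPotential {f : ℝ × TwoSphere → ℝ} (hf : Integrable f cylinder) :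
    Integrable (cylPotential f) cylinder :=
  (integrable_cylKernel_mul hf).integral_prod_left

theorem abs_cylPotential_le {f : ℝ × TwoSphere → ℝ} {C : ℝ} (hC0 : 0 ≤ C)
    (hC : ∀ q, |f q| ≤ C) (p : ℝ × TwoSphere) : |cylPotential f p| ≤ C * kernelMass.toReal := by
  have h1 : ‖cylPotential f p‖ₑ ≤ ENNReal.ofReal C * kernelMass := by
    refine (enorm_integral_le_lintegral_enorm _).trans ?_
    rw [← lintegral_cylKernel p, ← lintegral_const_mul' _ _ ENNReal.ofReal_ne_top]
    refine lintegral_mono fun q => ?_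
    rw [enorm_mul, mul_comm, Real.enorm_of_nonneg (cylKernel_nonneg p q), cylKernel_comm p q]
    gcongr
    rw [← ofReal_norm]
    exact ENNReal.ofReal_le_ofReal (hC q)
  have h2 := ENNReal.toReal_mono
    (ENNReal.mul_ne_top ENNReal.ofReal_ne_top kernelMass_lt_top.ne) h1
  rwa [toReal_enorm, ENNReal.toReal_mul, ENNReal.toReal_ofReal hC0] at h2

/-- The angular and the temporal integral may be exchanged although `1 / (cosh t - x)` is singular at
`t = 0`, `x = 1`, because the singularity is integrable. -/
theorem integral_legendre_mul_inv_cosh (l : ℕ) {w : ℝ} (hw : w ≠ 0) :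
    Integrable (fun z : ℝ × ℝ => Complex.exp (Complex.I * w * z.1) *
        (((Real.cosh z.1 - z.2)⁻¹ : ℝ) * ((legendre l).eval z.2 : ℝ)))
      ((volume : Measure ℝ).prod (volume.restrict (Set.Ioo (-1 : ℝ) 1))) ∧
    ∫ t : ℝ, Complex.exp (Complex.I * w * t) * ∫ x in Set.Ioo (-1 : ℝ) 1,
        (((Real.cosh t - x)⁻¹ : ℝ) * ((legendre l).eval x : ℝ) : ℂ) =
      2 * Real.pi * kernelCoeff l w := by
  obtain ⟨B, hB⟩ := isCompact_Icc.exists_bound_of_continuousOn (s := Set.Icc (-1 : ℝ) 1)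
    (legendre l).continuous.continuousOn
  have hint : Integrable (fun z : ℝ × ℝ => (Real.cosh z.1 - z.2)⁻¹)
      ((volume : Measure ℝ).prod (volume.restrict (Set.Ioo (-1 : ℝ) 1))) := by
    have hm : Measurable fun z : ℝ × ℝ => (Real.cosh z.1 - z.2)⁻¹ := by fun_prop
    refine ⟨hm.aestronglyMeasurable, ?_⟩
    rw [HasFiniteIntegral, lintegral_prod_symm _ hm.enorm.aemeasurable]
    refine lt_of_eq_of_lt (setLIntegral_congr_fun measurableSet_Ioo fun x hx => ?_)
      lintegral_inv_cosh_sub_lt_top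
    refine lintegral_congr fun t => ?_
    exact Real.enorm_of_nonneg (inv_nonneg.2 (cosh_sub_pos (Set.mem_Ioo.1 hx).2 t).le)
  have hae : ∀ᵐ z ∂((volume : Measure ℝ).prod (volume.restrict (Set.Ioo (-1 : ℝ) 1))),
      z.2 ∈ Set.Ioo (-1 : ℝ) 1 :=
    Measure.quasiMeasurePreserving_snd.ae (ae_restrict_mem measurableSet_Ioo)
  have hint2 : Integrable (fun z : ℝ × ℝ => Complex.exp (Complex.I * w * z.1) *
        (((Real.cosh z.1 - z.2)⁻¹ : ℝ) * ((legendre l).eval z.2 : ℝ)))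
      ((volume : Measure ℝ).prod (volume.restrict (Set.Ioo (-1 : ℝ) 1))) := by
    refine Integrable.bdd_mul (c := 1) ?_ (by fun_prop)
      (ae_of_all _ fun z => (norm_exp_I_mul w z.1).le)
    refine hint.ofReal.mul_bdd (c := B) ?_ ?_
    · exact (Complex.continuous_ofReal.comp
        ((legendre l).continuous.comp continuous_snd)).aestronglyMeasurable
    · filter_upwards [hae] with z hz
      rw [Complex.norm_real]
      exact hB _ (Set.Ioo_subset_Icc_self hz)
  refine ⟨hint2, ?_⟩
  simp_rw [← integral_const_mul]
  rw [integral_integral_swap hint2]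
  have h1 : ∀ x ∈ Set.Ioo (-1 : ℝ) 1, (∫ t : ℝ, Complex.exp (Complex.I * w * t) *
      (((Real.cosh t - x)⁻¹ : ℝ) * ((legendre l).eval x : ℝ))) =
      ((legendre l).eval x : ℝ) * timeFourier (fun t => ((Real.cosh t - x)⁻¹ : ℝ)) w := by
    intro x _
    rw [timeFourier, ← integral_const_mul]
    refine integral_congr_ae (ae_of_all _ fun t => ?_)
    ring
  rw [setIntegral_congr_fun measurableSet_Ioo h1, ← integral_sin_comp_cos (fun x =>
    ((legendre l).eval x : ℝ) * timeFourier (fun t => ((Real.cosh t - x)⁻¹ : ℝ)) w)]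
  rw [kernelCoeff, intervalIntegral.integral_of_le Real.pi_pos.le, integral_Ioc_eq_integral_Ioo,
    ← integral_complex_ofReal, ← integral_const_mul]
  refine setIntegral_congr_fun measurableSet_Ioo fun g hg => ?_
  have hs : (Real.sin g : ℂ) ≠ 0 :=
    Complex.ofReal_ne_zero.2 (Real.sin_pos_of_mem_Ioo hg).ne'
  rw [timeFourier_inv_cosh_sub hg hw]
  push_cast at hs ⊢
  field_simp

/-- The Funk–Hecke formula in the angles and a Fourier transform in the time. -/
theorem integral_harmonic_cylKernel (q : ℝ × TwoSphere) {x : Mode} (hx : x.1 ≠ 0) :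
    ∫ p : ℝ × TwoSphere, Complex.exp (Complex.I * x.1 * p.1) *
      (conj (sphereHarmonic x.2.1 x.2.m p.2) * (cylKernel p q : ℂ)) ∂cylinder =
      4 * Real.pi ^ 2 * kernelCoeff x.2.1 x.1 *
        (Complex.exp (Complex.I * x.1 * q.1) * conj (sphereHarmonic x.2.1 x.2.m q.2)) := by
  obtain ⟨w, a⟩ := x
  have h1 := (modeCoeff_eq_integral (integrable_cylKernel q) (w, a)).2
  rw [← h1, modeCoeff, timeFourier]
  simp only
  have h2 : ∀ t : ℝ, t ≠ q.1 → ∫ n, conj (sphereHarmonic a.1 a.m n) * (cylKernel (t, n) q : ℂ)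
      ∂sphereMeasure = conj (sphereHarmonic a.1 a.m q.2) * (2 * Real.pi *
        ∫ x in Set.Ioo (-1 : ℝ) 1, (((Real.cosh (t - q.1) - x)⁻¹ : ℝ) *
          ((legendre a.1).eval x : ℝ) : ℂ)) := by
    intro t ht
    have hc : 1 < Real.cosh (t - q.1) := Real.one_lt_cosh.2 (sub_ne_zero.2 ht)
    have h3 := funk_hecke (l := a.1) (m := a.m) a.natAbs_m_le
      (f := fun x => (((Real.cosh (t - q.1) - x)⁻¹ : ℝ) : ℂ)) (by fun_prop)
      ⟨(Real.cosh (t - q.1) - 1)⁻¹, fun x hx => by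
        have h4 : x ≤ 1 := (Set.mem_Icc.1 hx).2
        rw [Complex.norm_real, Real.norm_of_nonneg (inv_nonneg.2 (by linarith))]
        exact inv_anti₀ (by linarith) (by linarith)⟩ q.2
    have h5 := congrArg conj h3
    simp only [← integral_conj, map_mul, Complex.conj_ofReal, map_ofNat] at h5
    rw [mul_comm (conj _) (2 * _ * _), ← h5]
    refine integral_congr_ae (ae_of_all _ fun n => ?_)
    simp only [cylKernel]
    rw [real_inner_comm, mul_comm]
  -- at `t = q.1` the kernel is unbounded and the Funk–Hecke formula does not apply
  have h6 : ∀ᵐ t : ℝ, t ≠ q.1 := by simp [ae_iff]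
  set H : ℝ → ℂ := fun s => conj (sphereHarmonic a.1 a.m q.2) * (2 * Real.pi) *
    Complex.exp (Complex.I * w * q.1) * (Complex.exp (Complex.I * w * s) *
      ∫ x in Set.Ioo (-1 : ℝ) 1, (((Real.cosh s - x)⁻¹ : ℝ) *
        ((legendre a.1).eval x : ℝ) : ℂ)) with hH
  have h7 : ∫ t : ℝ, Complex.exp (Complex.I * w * t) *
      ∫ n, conj (sphereHarmonic a.1 a.m n) * (cylKernel (t, n) q : ℂ) ∂sphereMeasure =
      ∫ t : ℝ, H (t - q.1) := by
    refine integral_congr_ae ?_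
    filter_upwards [h6] with t ht
    rw [h2 t ht]
    have : Complex.exp (Complex.I * w * t) =
        Complex.exp (Complex.I * w * q.1) * Complex.exp (Complex.I * w * (t - q.1 : ℝ)) := by
      rw [← Complex.exp_add]
      push_cast
      ring_nf
    rw [this]
    simp only [hH]
    ring
  refine (h7.trans (integral_sub_right_eq_self H q.1)).trans ?_
  rw [hH, integral_const_mul,
    (integral_legendre_mul_inv_cosh a.1 hx).2]
  ring

/-- The two-point function is diagonal on the modes. -/
theorem modeCoeff_cylPotential {f : ℝ × TwoSphere → ℝ} (hf : Integrable f cylinder)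
    {x : Mode} (hx : x.1 ≠ 0) :
    modeCoeff (cylPotential f) x = 4 * Real.pi ^ 2 * kernelCoeff x.2.1 x.1 * modeCoeff f x := by
  rw [(modeCoeff_eq_integral (integrable_cylPotential hf) x).2, (modeCoeff_eq_integral hf x).2]
  obtain ⟨B, hB⟩ := (isCompact_univ (X := TwoSphere)).exists_bound_of_continuousOn
    (continuous_sphereHarmonic x.2.1 x.2.m).continuousOn
  have h1 : Integrable (fun z : (ℝ × TwoSphere) × (ℝ × TwoSphere) =>
      Complex.exp (Complex.I * x.1 * z.1.1) * (conj (sphereHarmonic x.2.1 x.2.m z.1.2) *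
        ((cylKernel z.1 z.2 * f z.2 : ℝ) : ℂ))) (cylinder.prod cylinder) := by
    have hY := continuous_sphereHarmonic x.2.1 x.2.m
    refine Integrable.bdd_mul (c := 1) ?_ (by fun_prop)
      (ae_of_all _ fun z => (norm_exp_I_mul x.1 z.1.1).le)
    refine (integrable_cylKernel_mul hf).ofReal.bdd_mul (c := B) ?_ (ae_of_all _ fun z => ?_)
    · exact (Complex.continuous_conj.comp
        (hY.comp (continuous_snd.comp continuous_fst))).aestronglyMeasurable
    · rw [RCLike.norm_conj]
      exact hB _ (Set.mem_univ _)
  have h2 : ∀ p : ℝ × TwoSphere, Complex.exp (Complex.I * x.1 * p.1) *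
      (conj (sphereHarmonic x.2.1 x.2.m p.2) * (cylPotential f p : ℂ)) =
      ∫ q, Complex.exp (Complex.I * x.1 * p.1) * (conj (sphereHarmonic x.2.1 x.2.m p.2) *
        ((cylKernel p q * f q : ℝ) : ℂ)) ∂cylinder := by
    intro p
    rw [integral_const_mul, integral_const_mul, cylPotential, integral_complex_ofReal]
  simp_rw [h2]
  rw [integral_integral_swap h1, ← integral_const_mul]
  refine integral_congr_ae (ae_of_all _ fun q => ?_)
  simp only
  have h3 := integral_harmonic_cylKernel q hx
  have h4 : ∀ p : ℝ × TwoSphere, Complex.exp (Complex.I * x.1 * p.1) *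
      (conj (sphereHarmonic x.2.1 x.2.m p.2) * ((cylKernel p q * f q : ℝ) : ℂ)) =
      (f q : ℂ) * (Complex.exp (Complex.I * x.1 * p.1) *
      (conj (sphereHarmonic x.2.1 x.2.m p.2) * (cylKernel p q : ℂ))) := by
    intro p
    push_cast
    ring
  simp_rw [h4]
  rw [integral_const_mul, h3]
  ring

theorem Observer.mdot_scriAt (o : Observer) (p q : ℝ × TwoSphere) :
    mdot (o.scriAt p.1 p.2) (o.scriAt q.1 q.2) = -(cylKernel p q)⁻¹ := by
  unfold Observer.scriAt cylKernel
  rw [o.isometry, inv_inv, Real.cosh_sub, EuclideanSpace.inner_eq_star_dotProduct]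
  simp [mdot, Fin.sum_univ_four, Fin.sum_univ_three, dotProduct, Matrix.vecHead, Matrix.vecTail]
  ring

theorem mdot_smul_left (c : ℝ) (v w : Mink) : mdot (c • v) w = c * mdot v w := by
  simp only [mdot, Pi.smul_apply, smul_eq_mul, mul_add, Finset.mul_sum, mul_assoc]
  ring

theorem mdot_smul_right (c : ℝ) (v w : Mink) : mdot v (c • w) = c * mdot v w := by
  simp only [mdot, Pi.smul_apply, smul_eq_mul, mul_add, Finset.mul_sum, mul_left_comm _ c]
  ring

theorem continuous_roundSection : Continuous roundSection :=
  continuous_pi fun i => by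
    refine Fin.cases ?_ (fun k => ?_) i
    · exact continuous_const
    · change Continuous fun n : ThreeSphere => (n : E4) k
      fun_prop

theorem continuous_mdot : Continuous fun z : Mink × Mink => mdot z.1 z.2 := by
  unfold mdot
  fun_prop

/-- Change of variables from the round section to the observer's cylinder. -/
theorem Observer.integral_roundMeasure (o : Observer) {h : ThreeSphere → ℝ} (hh : Measurable h) :
    ∫ n, h n ∂roundMeasure =
      ∫ p : ℝ × TwoSphere, (o.scriAt p.1 p.2 0 ^ 3)⁻¹ * h (o.direction p) ∂cylinder := by
  have hρ : Measurable fun p : ℝ × TwoSphere => (o.scriAt p.1 p.2 0 ^ 3)⁻¹ :=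
    (((continuous_apply 0).comp o.continuous_scriAt).measurable.pow_const 3).inv
  rw [o.roundMeasure_eq_map, integral_map o.continuous_direction.measurable.aemeasurable
    hh.aestronglyMeasurable, integral_withDensity_eq_integral_toReal_smul hρ.ennreal_ofReal
    (ae_of_all _ fun p => ENNReal.ofReal_lt_top)]
  refine integral_congr_ae (ae_of_all _ fun p => ?_)
  have h0 := (o.isFutureNull_scriAt p.1 p.2).1
  simp only [smul_eq_mul]
  rw [ENNReal.toReal_ofReal (by positivity)]

theorem Observer.toFun_roundSection_direction (o : Observer) (P : BoundaryData)
    (p : ℝ × TwoSphere) :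
    P.toFun (roundSection (o.direction p)) = o.scriAt p.1 p.2 0 ^ 2 * o.data P p := by
  have h := o.isFutureNull_scriAt p.1 p.2
  rw [o.roundSection_direction, P.weight_two _ h _ (inv_pos.2 h.1), inv_pow, inv_inv]
  rfl

theorem measurable_toFun_roundSection (P : BoundaryData) :
    Measurable fun n => P.toFun (roundSection n) :=
  ((continuousOn_toFun P).comp_continuous continuous_roundSection fun n => by
    simp [roundSection]).measurable

theorem Observer.dirichletData_eq (o : Observer) (P : BoundaryData) (p : ℝ × TwoSphere) :
    dirichletData P (roundSection (o.direction p)) =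
      -(1 / (4 * Real.pi ^ 2)) * (o.scriAt p.1 p.2 0 * cylPotential (o.data P) p) := by
  have h0 := (o.isFutureNull_scriAt p.1 p.2).1
  unfold dirichletData cylPotential twoPoint
  rw [o.integral_roundMeasure, ← integral_const_mul, ← integral_const_mul]
  · refine integral_congr_ae (ae_of_all _ fun q => ?_)
    have h1 := (o.isFutureNull_scriAt q.1 q.2).1
    simp only
    rw [o.toFun_roundSection_direction, o.roundSection_direction, o.roundSection_direction,
      mdot_smul_left, mdot_smul_right, o.mdot_scriAt]
    field_simp
  · refine Measurable.mul (Measurable.const_mul (Measurable.const_div ?_ _) _)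
      (measurable_toFun_roundSection P)
    exact (continuous_mdot.comp ((continuous_const (y := roundSection (o.direction p))).prodMk
      continuous_roundSection)).measurable

theorem measurable_dirichletData (P : BoundaryData) :
    Measurable fun n => dirichletData P (roundSection n) := by
  have h : Measurable fun z : ThreeSphere × ThreeSphere =>
      twoPoint (roundSection z.1) (roundSection z.2) * P.toFun (roundSection z.2) := by
    refine Measurable.mul (Measurable.const_mul (Measurable.const_div ?_ _) _)
      ((measurable_toFun_roundSection P).comp measurable_snd)
    exact (continuous_mdot.comp ((continuous_roundSection.comp continuous_fst).prodMk
      (continuous_roundSection.comp continuous_snd))).measurable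
  have : IsFiniteMeasure roundMeasure := by unfold roundMeasure; infer_instance
  exact (h.stronglyMeasurable.integral_prod_right' (ν := roundMeasure)).measurable

theorem Observer.euclideanAction_eq (o : Observer) (P : BoundaryData) :
    euclideanAction P = 1 / (8 * Real.pi ^ 2) *
      ∫ p, cylPotential (o.data P) p * o.data P p ∂cylinder := by
  unfold euclideanAction
  have hm : Measurable fun n => dirichletData P (roundSection n) * P.toFun (roundSection n) :=
    (measurable_dirichletData P).mul (measurable_toFun_roundSection P)
  rw [o.integral_roundMeasure hm, ← integral_const_mul, ← integral_const_mul]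
  refine integral_congr_ae (ae_of_all _ fun p => ?_)
  have h0 := (o.isFutureNull_scriAt p.1 p.2).1
  simp only
  rw [o.toFun_roundSection_direction, o.dirichletData_eq]
  field_simp
  ring

theorem modeCoeff_add_const_mul {f g : ℝ × TwoSphere → ℝ} (hf : Integrable f cylinder)
    (hg : Integrable g cylinder) (c : ℝ) (x : Mode) :
    modeCoeff (fun p => f p + c * g p) x = modeCoeff f x + c * modeCoeff g x := by
  have hfg : Integrable (fun p => f p + c * g p) cylinder := hf.add (hg.const_mul c)
  rw [(modeCoeff_eq_integral hfg x).2, (modeCoeff_eq_integral hf x).2,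
    (modeCoeff_eq_integral hg x).2, ← integral_const_mul, ← integral_add
      (modeCoeff_eq_integral hf x).1 ((modeCoeff_eq_integral hg x).1.const_mul _)]
  refine integral_congr_ae (ae_of_all _ fun p => ?_)
  push_cast
  ring

theorem integral_sq_cylinder {f : ℝ × TwoSphere → ℝ} (h1 : Integrable f cylinder)
    (h2 : MemLp f 2 cylinder) :
    Integrable (fun x => ‖modeCoeff f x‖ ^ 2) modeMeasure ∧
      ∫ p, f p ^ 2 ∂cylinder = 2 * ∫ x, ‖modeCoeff f x‖ ^ 2 ∂modeMeasure := by
  have h := lintegral_enorm_sq_cylinder h1 h2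
  have hf2 := (memLp_two_iff_integrable_sq h2.1).1 h2
  have hm := ((measurable_modeCoeff h1).norm.pow_const 2)
  have e1 : ∫⁻ p, ‖f p‖ₑ ^ 2 ∂cylinder = ENNReal.ofReal (∫ p, f p ^ 2 ∂cylinder) := by
    rw [ofReal_integral_eq_lintegral_ofReal hf2 (ae_of_all _ fun p => sq_nonneg _)]
    refine lintegral_congr fun p => ?_
    rw [← ofReal_norm, ← ENNReal.ofReal_pow (norm_nonneg _), Real.norm_eq_abs, sq_abs]
  have e2 : ∀ x, ‖modeCoeff f x‖ₑ ^ 2 = ENNReal.ofReal (‖modeCoeff f x‖ ^ 2) := fun x => by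
    rw [← ofReal_norm, ← ENNReal.ofReal_pow (norm_nonneg _)]
  simp_rw [e2] at h
  rw [e1] at h
  have hfin : ∫⁻ x, ENNReal.ofReal (‖modeCoeff f x‖ ^ 2) ∂modeMeasure < ⊤ := by
    by_contra hcon
    rw [not_lt, top_le_iff] at hcon
    rw [hcon, ENNReal.mul_top two_ne_zero] at h
    exact ENNReal.ofReal_ne_top h
  have hint : Integrable (fun x => ‖modeCoeff f x‖ ^ 2) modeMeasure :=
    ⟨hm.aestronglyMeasurable, by
      rwa [hasFiniteIntegral_iff_ofReal (ae_of_all _ fun x => by positivity)]⟩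
  refine ⟨hint, ?_⟩
  rw [← ofReal_integral_eq_lintegral_ofReal hint (ae_of_all _ fun x => by positivity)] at h
  have h3 := congrArg ENNReal.toReal h
  rwa [ENNReal.toReal_mul, ENNReal.toReal_ofReal (integral_nonneg fun p => sq_nonneg _),
    ENNReal.toReal_ofReal (integral_nonneg fun p => by positivity)] at h3

/-- The Euclidean action as an integral over the modes. -/
theorem Observer.euclideanAction_eq_integral (o : Observer) (P : BoundaryData) :
    Integrable (fun x => kernelCoeff x.2.1 x.1 * ‖o.coeff P x‖ ^ 2) modeMeasure ∧
      euclideanAction P = ∫ x, kernelCoeff x.2.1 x.1 * ‖o.coeff P x‖ ^ 2 ∂modeMeasure := by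
  have hpi : (Real.pi : ℂ) ≠ 0 := Complex.ofReal_ne_zero.2 Real.pi_pos.ne'
  set f := o.data P with hf
  have hf1 : Integrable f cylinder := o.integrable_data P
  have hf2 : MemLp f 2 cylinder := o.memLp_data P
  have hg1 : Integrable (cylPotential f) cylinder := integrable_cylPotential hf1
  have hg2 : MemLp (cylPotential f) 2 cylinder := by
    obtain ⟨C, hC0, hC⟩ := o.exists_abs_data_le P
    exact memLp_two_of_integrable_of_bounded hg1 (abs_cylPotential_le hC0 fun q =>
      (hC q).trans (mul_le_of_le_one_right hC0 (inv_cosh_sq_le_one _)))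
  set c : ℝ := (4 * Real.pi ^ 2)⁻¹ with hc
  -- polarization of Parseval's identity
  have hS := integral_sq_cylinder (f := fun p => f p + c * cylPotential f p)
    (hf1.add (hg1.const_mul c)) (hf2.add (hg2.const_mul c))
  have hD := integral_sq_cylinder (f := fun p => f p + -c * cylPotential f p)
    (hf1.add (hg1.const_mul (-c))) (hf2.add (hg2.const_mul (-c)))
  have hcoef : (fun x => kernelCoeff x.2.1 x.1 * ‖o.coeff P x‖ ^ 2) =ᵐ[modeMeasure] fun x =>
      (1 / 4) * (‖modeCoeff (fun p => f p + c * cylPotential f p) x‖ ^ 2 -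
        ‖modeCoeff (fun p => f p + -c * cylPotential f p) x‖ ^ 2) := by
    filter_upwards [ae_freq_pos] with x hx
    rw [modeCoeff_add_const_mul hf1 hg1, modeCoeff_add_const_mul hf1 hg1,
      modeCoeff_cylPotential hf1 hx.ne', o.coeff_eq_modeCoeff]
    set z := modeCoeff f x
    set k := kernelCoeff x.2.1 x.1
    have e1 : z + (c : ℂ) * (4 * Real.pi ^ 2 * k * z) = ((1 + k : ℝ) : ℂ) * z := by
      rw [hc]
      push_cast
      field_simp
    have e2 : z + ((-c : ℝ) : ℂ) * (4 * Real.pi ^ 2 * k * z) = ((1 - k : ℝ) : ℂ) * z := by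
      rw [hc]
      push_cast
      field_simp
      ring
    rw [e1, e2, norm_mul, norm_mul, Complex.norm_real, Complex.norm_real, mul_pow, mul_pow,
      Real.norm_eq_abs, Real.norm_eq_abs, sq_abs, sq_abs]
    ring
  refine ⟨((hS.1.sub hD.1).const_mul _).congr hcoef.symm, ?_⟩
  rw [integral_congr_ae hcoef, integral_const_mul, integral_sub hS.1 hD.1, o.euclideanAction_eq]
  have hi : ∀ c : ℝ, Integrable (fun p => (f p + c * cylPotential f p) ^ 2) cylinder := fun c =>
    (memLp_two_iff_integrable_sq (hf2.add (hg2.const_mul c)).1).1 (hf2.add (hg2.const_mul c))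
  have h3 : ∫ p, cylPotential f p * f p ∂cylinder = (4 * c)⁻¹ *
      (∫ p, (f p + c * cylPotential f p) ^ 2 ∂cylinder -
        ∫ p, (f p + -c * cylPotential f p) ^ 2 ∂cylinder) := by
    rw [← integral_sub (hi c) (hi (-c)), ← integral_const_mul]
    refine integral_congr_ae (ae_of_all _ fun p => ?_)
    have : c ≠ 0 := by rw [hc]; positivity
    simp only
    field_simp
    ring
  rw [h3, hS.2, hD.2, hc]
  have := Real.pi_pos
  field_simp
  ring

end Action

/-! ### The field on the future horizon -/

section Horizon

/-- The point of the future horizon with coordinate `η` and direction `n ∈ S²`. -/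
def Observer.horizonAt (o : Observer) (η : ℝ) (n : TwoSphere) : Mink :=
  o.frame.mulVec ![Real.exp η, Real.exp η, (n : E3) 0, (n : E3) 1, (n : E3) 2]

theorem Observer.horizonAt_sphericalPoint (o : Observer) (η θ φ : ℝ) :
    o.horizonAt η (sphericalPoint θ φ) = o.horizon η θ φ := by
  simp [Observer.horizonAt, Observer.horizon, coe_sphericalPoint]

theorem Observer.mdot_horizonAt (o : Observer) (η : ℝ) (n₀ : TwoSphere) (p : ℝ × TwoSphere) :
    mdot (o.horizonAt η n₀) (o.scriAt p.1 p.2) = inner ℝ (n₀ : E3) p.2 - Real.exp (η - p.1) := by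
  unfold Observer.scriAt Observer.horizonAt
  rw [o.isometry, EuclideanSpace.inner_eq_star_dotProduct, sub_eq_add_neg η, Real.exp_add,
    ← Real.cosh_sub_sinh]
  simp [mdot, Fin.sum_univ_four, Fin.sum_univ_three, dotProduct]
  linear_combination -Real.exp η * Real.cosh_sub_sinh p.1

/-- The time component of `o.scriAt` is comparable to `cosh t`. -/
theorem Observer.exists_scriAt_bounds (o : Observer) : ∃ m M : ℝ, 0 < m ∧ 0 < M ∧
    ∀ p : ℝ × TwoSphere, m * Real.cosh p.1 ≤ o.scriAt p.1 p.2 0 ∧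
      o.scriAt p.1 p.2 0 ≤ M * Real.cosh p.1 := by
  obtain ⟨K, hK, hKs, hu⟩ := o.exists_compact
  have hne : K.Nonempty := ⟨_, hu (0, pole)⟩
  have hc : ContinuousOn (fun x : Mink => x 0) K := (continuous_apply 0).continuousOn
  obtain ⟨a, ha, hmin⟩ := hK.exists_isMinOn hne hc
  obtain ⟨b, hb, hmax⟩ := hK.exists_isMaxOn hne hc
  refine ⟨a 0, b 0, hKs ha, hKs hb, fun p => ?_⟩
  have h0 := Real.cosh_pos p.1
  have h1 : o.unitAt p 0 = o.scriAt p.1 p.2 0 / Real.cosh p.1 := by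
    simp [Observer.unitAt, div_eq_inv_mul]
  have h2 : a 0 ≤ o.unitAt p 0 := hmin (hu p)
  have h3 : o.unitAt p 0 ≤ b 0 := hmax (hu p)
  rw [h1] at h2 h3
  exact ⟨(le_div_iff₀ h0).1 h2, (div_le_iff₀ h0).1 h3⟩

/-- The substitution `e^{-t} = c (x - s v)`. -/
theorem integral_comp_neg_log (k : ℝ → ℝ) {c s : ℝ} (hc : 0 < c) (hs : s ≠ 0) (x : ℝ) :
    ∫ t, k t = |s| * c * ∫ v, (Set.Ioi (0 : ℝ)).indicator (fun y => y⁻¹ * k (-Real.log y))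
      (c * (x - s * v)) := by
  set H : ℝ → ℝ := (Set.Ioi (0 : ℝ)).indicator (fun y => y⁻¹ * k (-Real.log y)) with hH
  have himg : (fun y => -Real.log y) '' Set.Ioi 0 = Set.univ := by
    refine Set.eq_univ_of_forall fun t => ⟨Real.exp (-t), Real.exp_pos _, ?_⟩
    simp
  have h1 : ∫ t, k t = ∫ y, H y := by
    rw [← setIntegral_univ, ← himg, integral_image_eq_integral_abs_deriv_smul measurableSet_Ioi
      (f' := fun y => -y⁻¹), hH, integral_indicator measurableSet_Ioi]
    · refine setIntegral_congr_fun measurableSet_Ioi fun y hy => ?_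
      have hy : 0 < y := hy
      simp only [abs_neg, abs_inv, abs_of_pos hy, smul_eq_mul]
    · exact fun y hy => ((Real.hasDerivAt_log (ne_of_gt hy)).neg).hasDerivWithinAt
    · intro a ha b hb h
      exact Real.log_injOn_pos ha hb (neg_injective h)
  have h2 := Measure.integral_comp_mul_left (fun u => H (c * x + u)) (-(c * s))
  have h3 : ∫ u, H (c * x + u) = ∫ y, H y := integral_add_left_eq_self H (c * x)
  have h4 : ∀ v, c * (x - s * v) = c * x + -(c * s) * v := fun v => by ring
  simp_rw [h4]
  rw [h2, h3, h1, inv_neg, abs_neg, smul_eq_mul, ← mul_assoc, abs_inv, abs_mul, abs_of_pos hc,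
    mul_comm |s| c, mul_inv_cancel₀ (by positivity), one_mul]

/-- The change of the indicator function of `{x - e^{η-t} ≤ s ρ}` from `s = 0`. -/
def stepDiff (s r u : ℝ) : ℝ := (if u ≤ s * r then 1 else 0) - if u ≤ 0 then 1 else 0

theorem stepDiff_eq_of_pos {s r v : ℝ} (hs : 0 < s) :
    stepDiff s r (s * v) = (if v ≤ r then 1 else 0) - if v ≤ 0 then 1 else 0 := by
  have h : s * v ≤ 0 ↔ v ≤ 0 := by
    simpa only [mul_zero] using mul_le_mul_iff_right₀ (b := v) (c := 0) hs
  simp only [stepDiff, mul_le_mul_iff_right₀ hs, h]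

theorem stepDiff_eq_of_neg {s r v : ℝ} (hs : s < 0) :
    stepDiff s r (s * v) = (if r ≤ v then 1 else 0) - if 0 ≤ v then 1 else 0 := by
  have h : s * v ≤ 0 ↔ 0 ≤ v := by
    simpa only [mul_zero] using mul_le_mul_left_of_neg (a := v) (b := 0) hs
  simp only [stepDiff, mul_le_mul_left_of_neg hs, h]

theorem abs_stepDiff_le {s r v : ℝ} (hs : s ≠ 0) (hr : 0 ≤ r) :
    |stepDiff s r (s * v)| ≤ (Set.Icc 0 r).indicator 1 v := by
  simp only [Set.indicator_apply, Set.mem_Icc, Pi.one_apply]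
  rcases lt_or_gt_of_ne hs with h | h
  · rw [stepDiff_eq_of_neg h]
    split_ifs <;> first | (norm_num; done) | (exfalso; grind)
  · rw [stepDiff_eq_of_pos h]
    split_ifs <;> first | (norm_num; done) | (exfalso; grind)

theorem mul_stepDiff_eq {s r v : ℝ} (hs : s ≠ 0) (hr : 0 ≤ r) (hv0 : v ≠ 0) (hvr : v ≠ r) :
    s⁻¹ * |s| * stepDiff s r (s * v) = (Set.Icc 0 r).indicator 1 v := by
  simp only [Set.indicator_apply, Set.mem_Icc, Pi.one_apply]
  rcases lt_or_gt_of_ne hs with h | h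
  · rw [stepDiff_eq_of_neg h, abs_of_neg h, mul_neg, inv_mul_cancel₀ hs]
    split_ifs <;> first | (norm_num; done) | (exfalso; grind)
  · rw [stepDiff_eq_of_pos h, abs_of_pos h, inv_mul_cancel₀ hs]
    split_ifs <;> first | (norm_num; done) | (exfalso; grind)

/-- The density of the boundary data with respect to the coordinates of the cylinder. -/
def Observer.density (o : Observer) (P : BoundaryData) (p : ℝ × TwoSphere) : ℝ :=
  (o.scriAt p.1 p.2 0)⁻¹ * o.data P p

theorem Observer.continuous_scriAt_zero (o : Observer) :
    Continuous fun p : ℝ × TwoSphere => o.scriAt p.1 p.2 0 :=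
  (continuous_apply 0).comp o.continuous_scriAt

theorem Observer.continuous_density (o : Observer) (P : BoundaryData) :
    Continuous (o.density P) :=
  (o.continuous_scriAt_zero.inv₀ fun p => (o.isFutureNull_scriAt p.1 p.2).1.ne').mul
    (o.continuous_data P)

/-- The truncated integral over `{x·ℓ ≤ s}` whose derivative at `s = 0` defines the field at `x`. -/
theorem Observer.setIntegral_roundMeasure (o : Observer) (P : BoundaryData) (η s : ℝ)
    (n₀ : TwoSphere) :
    ∫ n in {n : ThreeSphere | mdot (o.horizonAt η n₀) (roundSection n) ≤ s},
      P.toFun (roundSection n) ∂roundMeasure =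
    ∫ p : ℝ × TwoSphere, o.density P p * (if inner ℝ (n₀ : E3) p.2 - Real.exp (η - p.1) ≤
      s * o.scriAt p.1 p.2 0 then 1 else 0) ∂cylinder := by
  have hS : MeasurableSet {n : ThreeSphere | mdot (o.horizonAt η n₀) (roundSection n) ≤ s} :=
    (isClosed_le (continuous_mdot.comp ((continuous_const (y := o.horizonAt η n₀)).prodMk
      continuous_roundSection)) continuous_const).measurableSet
  rw [← integral_indicator hS,
    o.integral_roundMeasure ((measurable_toFun_roundSection P).indicator hS)]
  refine integral_congr_ae (ae_of_all _ fun p => ?_)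
  have h0 := (o.isFutureNull_scriAt p.1 p.2).1
  have hiff : o.direction p ∈ {n : ThreeSphere | mdot (o.horizonAt η n₀) (roundSection n) ≤ s} ↔
      inner ℝ (n₀ : E3) p.2 - Real.exp (η - p.1) ≤ s * o.scriAt p.1 p.2 0 := by
    rw [Set.mem_ofPred_eq, o.roundSection_direction, mdot_smul_right, o.mdot_horizonAt,
      inv_mul_le_iff₀ h0, mul_comm s]
  simp only [Set.indicator_apply, hiff, Observer.density]
  split_ifs
  · rw [o.toFun_roundSection_direction]
    field_simp
  · simp

theorem Observer.exists_abs_density_le (o : Observer) (P : BoundaryData) :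
    ∃ C, 0 ≤ C ∧ ∀ p, |o.density P p| ≤ C * ((Real.cosh p.1)⁻¹ * (Real.cosh p.1 ^ 2)⁻¹) := by
  obtain ⟨C, hC0, hC⟩ := o.exists_abs_data_le P
  obtain ⟨m, M, hm, hM, hmM⟩ := o.exists_scriAt_bounds
  refine ⟨m⁻¹ * C, by positivity, fun p => ?_⟩
  have h0 := (o.isFutureNull_scriAt p.1 p.2).1
  have h1 := Real.cosh_pos p.1
  rw [Observer.density, abs_mul, abs_of_pos (inv_pos.2 h0)]
  calc _ ≤ (m * Real.cosh p.1)⁻¹ * (C * (Real.cosh p.1 ^ 2)⁻¹) :=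
        mul_le_mul (inv_anti₀ (by positivity) (hmM p).1) (hC p) (abs_nonneg _) (by positivity)
    _ = _ := by rw [mul_inv]; ring

theorem Observer.integrable_density (o : Observer) (P : BoundaryData) :
    Integrable (o.density P) cylinder := by
  obtain ⟨C, hC0, hC⟩ := o.exists_abs_density_le P
  refine integrable_of_abs_le_inv_cosh_sq (o.continuous_density P) (C := C) fun p => (hC p).trans ?_
  refine mul_le_mul_of_nonneg_left (mul_le_of_le_one_left (by positivity) ?_) hC0
  exact inv_le_one_of_one_le₀ (Real.one_le_cosh _)

/-- The integrand of the difference quotient of the integral over `{x·ℓ ≤ s}`, in the coordinate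
`v` with `e^{-t} = e^{-η} (n₀·n - s v)`. -/
def Observer.slopeFun (o : Observer) (P : BoundaryData) (η : ℝ) (n₀ : TwoSphere) (s : ℝ)
    (z : TwoSphere × ℝ) : ℝ :=
  (Set.Ioi (0 : ℝ)).indicator (fun y => y⁻¹ * (o.density P (-Real.log y, z.1) *
      (s⁻¹ * |s| * stepDiff s (o.scriAt (-Real.log y) z.1 0) (s * z.2))))
    (Real.exp (-η) * (inner ℝ (n₀ : E3) z.1 - s * z.2))

theorem Observer.measurable_slopeFun (o : Observer) (P : BoundaryData) (η : ℝ) (n₀ : TwoSphere)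
    (s : ℝ) : Measurable (o.slopeFun P η n₀ s) := by
  have hy : Measurable fun z : TwoSphere × ℝ =>
      Real.exp (-η) * (inner ℝ (n₀ : E3) z.1 - s * z.2) :=
    Continuous.measurable (by fun_prop)
  have hl : Measurable fun z : TwoSphere × ℝ =>
      (-Real.log (Real.exp (-η) * (inner ℝ (n₀ : E3) z.1 - s * z.2)), z.1) :=
    (Real.measurable_log.comp hy).neg.prodMk measurable_fst
  have hρ := o.continuous_scriAt_zero.measurable.comp hl
  have hst : Measurable fun z : TwoSphere × ℝ => stepDiff s (o.scriAt
      (-Real.log (Real.exp (-η) * (inner ℝ (n₀ : E3) z.1 - s * z.2))) z.1 0) (s * z.2) := by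
    unfold stepDiff
    refine Measurable.sub (Measurable.ite (measurableSet_le (by fun_prop) (hρ.const_mul s))
      measurable_const measurable_const) (Measurable.ite (measurableSet_le (by fun_prop)
      measurable_const) measurable_const measurable_const)
  have h := (hy.inv.mul (((o.continuous_density P).measurable.comp hl).mul
    (hst.const_mul (s⁻¹ * |s|)))).indicator
    (hy (measurableSet_Ioi (a := (0 : ℝ))))
  exact h

/-- A bound uniform in `s`.  The step difference is supported in `0 ≤ v ≤ ρ`, where `ρ` is comparable
to `cosh t`, so the decay of the density in `t` gives decay in `v`. -/
theorem Observer.exists_abs_slopeFun_le (o : Observer) (P : BoundaryData) :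
    ∃ C, 0 ≤ C ∧ ∀ η n₀ s z, s ≠ 0 → |o.slopeFun P η n₀ s z| ≤ C * (1 + z.2 ^ 2)⁻¹ := by
  obtain ⟨C, hC0, hC⟩ := o.exists_abs_density_le P
  obtain ⟨m, M, hm, hM, hmM⟩ := o.exists_scriAt_bounds
  refine ⟨2 * C * (1 + M ^ 2), by positivity, fun η n₀ s z hs => ?_⟩
  unfold Observer.slopeFun
  set y := Real.exp (-η) * (inner ℝ (n₀ : E3) z.1 - s * z.2)
  by_cases hy : 0 < y
  swap
  · rw [Set.indicator_of_notMem (fun h => hy (Set.mem_Ioi.1 h)), abs_zero]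
    positivity
  rw [Set.indicator_of_mem (Set.mem_Ioi.2 hy)]
  have hρ := (o.isFutureNull_scriAt (-Real.log y) z.1).1
  have hcosh : Real.cosh (-Real.log y) = (y + y⁻¹) / 2 := by
    rw [Real.cosh_eq, neg_neg, Real.exp_neg, Real.exp_log hy, add_comm]
  set k := Real.cosh (-Real.log y) with hk
  have hk1 : 1 ≤ k := Real.one_le_cosh _
  have h1 : y⁻¹ * k⁻¹ ≤ 2 := by
    rw [← mul_inv, hcosh]
    refine inv_le_of_inv_le₀ two_pos ?_
    rw [mul_div_assoc', mul_add, mul_inv_cancel₀ hy.ne']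
    nlinarith
  have h2 : abs (s⁻¹ * |s|) = 1 := by
    rw [abs_mul, abs_abs, abs_inv, inv_mul_cancel₀ (abs_ne_zero.2 hs)]
  have h3 := abs_stepDiff_le (v := z.2) hs hρ.le
  rw [abs_mul, abs_mul, abs_mul, h2, one_mul, abs_of_pos (inv_pos.2 hy)]
  rw [Set.indicator_apply] at h3
  split_ifs at h3 with hv
  · obtain ⟨hv0, hv1⟩ := Set.mem_Icc.1 hv
    have hvk : z.2 ≤ M * k := hv1.trans (hmM (-Real.log y, z.1)).2
    have h4 : (k ^ 2)⁻¹ ≤ (1 + M ^ 2) * (1 + z.2 ^ 2)⁻¹ := by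
      rw [← div_eq_mul_inv, inv_le_comm₀ (by positivity) (by positivity), inv_div,
        div_le_iff₀ (by positivity)]
      nlinarith [mul_self_le_mul_self hv0 hvk]
    calc _ ≤ y⁻¹ * (C * (k⁻¹ * (k ^ 2)⁻¹) * 1) := by
          refine mul_le_mul_of_nonneg_left ?_ (inv_pos.2 hy).le
          exact mul_le_mul (hC (-Real.log y, z.1)) h3 (abs_nonneg _) (by positivity)
      _ = C * ((y⁻¹ * k⁻¹) * (k ^ 2)⁻¹) := by ring
      _ ≤ C * (2 * ((1 + M ^ 2) * (1 + z.2 ^ 2)⁻¹)) := by gcongr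
      _ = _ := by ring
  · rw [abs_nonpos_iff.1 h3, abs_zero, mul_zero, mul_zero]
    positivity

/-- The substitution `e^{-t} = e^{-η} (n₀·n - s v)` spreads the thin shell `0 < x·ℓ ≤ s` over a
region of fixed size. -/
theorem Observer.slope_eq (o : Observer) (P : BoundaryData) (η : ℝ) (n₀ : TwoSphere) {s : ℝ}
    (hs : s ≠ 0) :
    s⁻¹ * ((∫ n in {n : ThreeSphere | mdot (o.horizonAt η n₀) (roundSection n) ≤ s},
        P.toFun (roundSection n) ∂roundMeasure) -
      ∫ n in {n : ThreeSphere | mdot (o.horizonAt η n₀) (roundSection n) ≤ 0},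
        P.toFun (roundSection n) ∂roundMeasure) =
    Real.exp (-η) * ∫ n, (∫ v, o.slopeFun P η n₀ s (n, v)) ∂sphereMeasure := by
  have hm : ∀ s : ℝ, Measurable fun p : ℝ × TwoSphere =>
      (if inner ℝ (n₀ : E3) p.2 - Real.exp (η - p.1) ≤ s * o.scriAt p.1 p.2 0 then (1 : ℝ)
        else 0) := fun s =>
    Measurable.ite (isClosed_le (by fun_prop)
      (o.continuous_scriAt_zero.const_smul s)).measurableSet measurable_const measurable_const
  have hi : ∀ s : ℝ, Integrable (fun p : ℝ × TwoSphere => o.density P p *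
      (if inner ℝ (n₀ : E3) p.2 - Real.exp (η - p.1) ≤ s * o.scriAt p.1 p.2 0 then (1 : ℝ)
        else 0)) cylinder := fun s => by
    refine (o.integrable_density P).mul_bdd (c := 1) (hm s).aestronglyMeasurable
      (ae_of_all _ fun p => ?_)
    split_ifs <;> simp
  have hi2 : Integrable (fun p : ℝ × TwoSphere => o.density P p *
      (if inner ℝ (n₀ : E3) p.2 - Real.exp (η - p.1) ≤ s * o.scriAt p.1 p.2 0 then (1 : ℝ)
        else 0) - o.density P p * (if inner ℝ (n₀ : E3) p.2 - Real.exp (η - p.1) ≤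
        0 * o.scriAt p.1 p.2 0 then (1 : ℝ) else 0)) cylinder := (hi s).sub (hi 0)
  rw [o.setIntegral_roundMeasure, o.setIntegral_roundMeasure, ← integral_sub (hi s) (hi 0),
    integral_prod_symm _ hi2, ← integral_const_mul, ← integral_const_mul]
  refine integral_congr_ae (ae_of_all _ fun n => ?_)
  simp only
  rw [integral_comp_neg_log _ (Real.exp_pos (-η)) hs (inner ℝ (n₀ : E3) n), ← integral_const_mul,
    ← integral_const_mul, ← integral_const_mul]
  refine integral_congr_ae (ae_of_all _ fun v => ?_)
  simp only [Observer.slopeFun, Set.indicator_apply, Set.mem_Ioi]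
  by_cases hy : 0 < Real.exp (-η) * (inner ℝ (n₀ : E3) n - s * v)
  · have h1 : inner ℝ (n₀ : E3) n - Real.exp (η - -Real.log
        (Real.exp (-η) * (inner ℝ (n₀ : E3) n - s * v))) = s * v := by
      rw [sub_neg_eq_add, Real.exp_add, Real.exp_log hy, ← mul_assoc, ← Real.exp_add]
      simp
    simp only [h1, stepDiff, zero_mul, if_pos hy]
    ring
  · simp only [if_neg hy, mul_zero]

theorem Observer.tendsto_slopeFun_of_neg (o : Observer) (P : BoundaryData) (η : ℝ)
    {n₀ n : TwoSphere} (hx : inner ℝ (n₀ : E3) n < 0) (v : ℝ) :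
    Tendsto (fun s => o.slopeFun P η n₀ s (n, v)) (𝓝[≠] 0) (𝓝 0) := by
  have hc : Continuous fun s : ℝ => Real.exp (-η) * (inner ℝ (n₀ : E3) n - s * v) := by fun_prop
  have h0 : Real.exp (-η) * (inner ℝ (n₀ : E3) n - 0 * v) < 0 := by
    rw [zero_mul, sub_zero]
    exact mul_neg_of_pos_of_neg (Real.exp_pos _) hx
  refine Tendsto.congr' ?_ tendsto_const_nhds
  filter_upwards [nhdsWithin_le_nhds (hc.tendsto 0 |>.eventually (gt_mem_nhds h0))] with s hs
  rw [Observer.slopeFun, Set.indicator_of_notMem]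
  exact fun h => absurd (Set.mem_Ioi.1 h) (not_lt.2 hs.le)

theorem Observer.tendsto_slopeFun_of_pos (o : Observer) (P : BoundaryData) (η : ℝ)
    {n₀ n : TwoSphere} {x : ℝ} (hxd : inner ℝ (n₀ : E3) n = x) (hx : 0 < x) {v : ℝ} (hv0 : v ≠ 0)
    (hv : v ≠ o.scriAt (η - Real.log x) n 0) :
    Tendsto (fun s => o.slopeFun P η n₀ s (n, v)) (𝓝[≠] 0)
      (𝓝 ((Real.exp (-η) * x)⁻¹ *
        (o.density P (η - Real.log x, n) * (Set.Icc 0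
        (o.scriAt (η - Real.log x) n 0)).indicator 1 v))) := by
  have hc : Continuous fun s : ℝ => Real.exp (-η) * (x - s * v) := by fun_prop
  have hy0 : Real.exp (-η) * (x - 0 * v) = Real.exp (-η) * x := by simp
  have hyp : 0 < Real.exp (-η) * x := mul_pos (Real.exp_pos _) hx
  have hyt : Tendsto (fun s : ℝ => Real.exp (-η) * (x - s * v)) (𝓝[≠] 0)
      (𝓝 (Real.exp (-η) * x)) := by
    rw [← hy0]
    exact (hc.tendsto 0).mono_left nhdsWithin_le_nhds
  have hlog : -Real.log (Real.exp (-η) * x) = η - Real.log x := by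
    rw [Real.log_mul (Real.exp_ne_zero _) hx.ne', Real.log_exp]
    ring
  have hp : Tendsto (fun s : ℝ => (-Real.log (Real.exp (-η) * (x - s * v)), n)) (𝓝[≠] 0)
      (𝓝 (η - Real.log x, n)) := by
    rw [← hlog]
    exact (hyt.log hyp.ne').neg.prodMk_nhds tendsto_const_nhds
  have hρ : Tendsto (fun s : ℝ => o.scriAt (-Real.log (Real.exp (-η) * (x - s * v))) n 0)
      (𝓝[≠] 0) (𝓝 (o.scriAt (η - Real.log x) n 0)) := by
    have h := (o.continuous_scriAt_zero.tendsto (η - Real.log x, n)).comp hp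
    simpa only [Function.comp_def] using h
  have hd : Tendsto (fun s : ℝ => o.density P (-Real.log (Real.exp (-η) * (x - s * v)), n))
      (𝓝[≠] 0) (𝓝 (o.density P (η - Real.log x, n))) := by
    have h := ((o.continuous_density P).tendsto (η - Real.log x, n)).comp hp
    simpa only [Function.comp_def] using h
  generalize o.density P (η - Real.log x, n) = d at hd ⊢
  have hlim := (hyt.inv₀ hyp.ne').mul (hd.mul_const
    ((Set.Icc 0 (o.scriAt (η - Real.log x) n 0)).indicator (1 : ℝ → ℝ) v))
  refine hlim.congr' ?_
  have hI : ∀ᶠ s in 𝓝[≠] (0 : ℝ), v ≠ o.scriAt (-Real.log (Real.exp (-η) * (x - s * v))) n 0 ∧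
      (v ≤ o.scriAt (-Real.log (Real.exp (-η) * (x - s * v))) n 0 ↔
        v ≤ o.scriAt (η - Real.log x) n 0) := by
    rcases lt_or_gt_of_ne hv with h | h
    · filter_upwards [hρ.eventually (lt_mem_nhds h)] with s hs
      exact ⟨hs.ne, iff_of_true hs.le h.le⟩
    · filter_upwards [hρ.eventually (gt_mem_nhds h)] with s hs
      exact ⟨hs.ne', iff_of_false hs.not_ge (not_le.2 h)⟩
  have hne : ∀ᶠ s in 𝓝[≠] (0 : ℝ), s ≠ 0 := self_mem_nhdsWithin
  have hpos : ∀ᶠ s in 𝓝[≠] (0 : ℝ), 0 < Real.exp (-η) * (x - s * v) :=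
    hyt.eventually (lt_mem_nhds hyp)
  filter_upwards [hpos, hI, hne] with s hs hI hs0
  simp only [Observer.slopeFun, hxd]
  rw [Set.indicator_of_mem (Set.mem_Ioi.2 hs), mul_stepDiff_eq hs0
    (o.isFutureNull_scriAt _ n).1.le hv0 hI.1]
  simp only [Set.indicator_apply, Set.mem_Icc, hI.2]

/-- The average `∫_{n₀·n > 0} k(η - log (n₀·n), n) / (n₀·n) dΩ` over a hemisphere, which gives the
field on the future horizon in terms of the boundary data. -/
def hemisphereIntegral (k : ℝ × TwoSphere → ℝ) (η : ℝ) (n₀ : TwoSphere) : ℝ :=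
  ∫ n, (if 0 < (inner ℝ (n₀ : E3) n : ℝ) then (inner ℝ (n₀ : E3) n)⁻¹ *
    k (η - Real.log (inner ℝ (n₀ : E3) n), n) else 0) ∂sphereMeasure

theorem ae_inner_ne_zero (n₀ : TwoSphere) :
    ∀ᵐ n : TwoSphere ∂sphereMeasure, inner ℝ (n₀ : E3) n ≠ 0 := by
  have h : ∀ᵐ x : ℝ ∂(sphereMeasure.map fun n : TwoSphere => inner ℝ (n₀ : E3) n), x ≠ 0 := by
    rw [map_inner_sphereMeasure]
    exact Measure.ae_smul_measure (ae_restrict_of_ae (by simp [ae_iff])) _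
  exact ae_of_ae_map (f := fun n : TwoSphere => (inner ℝ (n₀ : E3) n : ℝ)) (p := fun x => x ≠ 0)
    (by fun_prop) h

/-- The delta function concentrates on `e^{-t} = e^{-η} (n₀·n)`, which has a solution `t` precisely on
the hemisphere `n₀·n > 0`. -/
theorem Observer.fieldAt_horizonAt (o : Observer) (P : BoundaryData) (η : ℝ) (n₀ : TwoSphere) :
    fieldAt P (o.horizonAt η n₀) = 1 / (4 * Real.pi) * hemisphereIntegral (o.data P) η n₀ := by
  obtain ⟨C, hC0, hC⟩ := o.exists_abs_slopeFun_le P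
  have hint : Integrable fun v : ℝ => C * (1 + v ^ 2)⁻¹ := integrable_inv_one_add_sq.const_mul C
  have hs0 : ∀ᶠ s in 𝓝[≠] (0 : ℝ), s ≠ 0 := self_mem_nhdsWithin
  have hlim : Tendsto (fun s => ∫ n, (∫ v, o.slopeFun P η n₀ s (n, v)) ∂sphereMeasure) (𝓝[≠] 0)
      (𝓝 (∫ n, (Real.exp η * if 0 < (inner ℝ (n₀ : E3) n : ℝ) then (inner ℝ (n₀ : E3) n)⁻¹ *
        o.data P (η - Real.log (inner ℝ (n₀ : E3) n), n) else 0) ∂sphereMeasure)) := by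
    refine tendsto_integral_filter_of_dominated_convergence
      (fun _ => ∫ v : ℝ, C * (1 + v ^ 2)⁻¹) ?_ ?_ (integrable_const _) ?_
    · exact Eventually.of_forall fun s =>
        (o.measurable_slopeFun P η n₀ s).stronglyMeasurable.integral_prod_right'.aestronglyMeasurable
    · filter_upwards [hs0] with s hs
      exact ae_of_all _ fun n => norm_integral_le_of_norm_le hint
        (ae_of_all _ fun v => hC η n₀ s (n, v) hs)
    · filter_upwards [ae_inner_ne_zero n₀] with n hn
      have hdom : ∀ f : ℝ → ℝ, (∀ᵐ v : ℝ, Tendsto (fun s => o.slopeFun P η n₀ s (n, v)) (𝓝[≠] 0)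
          (𝓝 (f v))) → Tendsto (fun s => ∫ v, o.slopeFun P η n₀ s (n, v)) (𝓝[≠] 0)
          (𝓝 (∫ v, f v)) := fun f hf => by
        refine tendsto_integral_filter_of_dominated_convergence (fun v => C * (1 + v ^ 2)⁻¹)
          (Eventually.of_forall fun s => ((o.measurable_slopeFun P η n₀ s).comp
            measurable_prodMk_left).aestronglyMeasurable) ?_ hint hf
        filter_upwards [hs0] with s hs
        exact ae_of_all _ fun v => hC η n₀ s (n, v) hs
      -- the limit of `slopeFun` vanishes off the hemisphere, and on it is constant for `0 < v < ρ`
      rcases lt_or_gt_of_ne hn with hx | hx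
      · rw [if_neg (not_lt.2 hx.le), mul_zero]
        simpa using hdom 0 (ae_of_all _ fun v => o.tendsto_slopeFun_of_neg P η hx v)
      · rw [if_pos hx]
        convert hdom _ ?_ using 2
        rotate_left
        · exact fun v => (Real.exp (-η) * inner ℝ (n₀ : E3) n)⁻¹ *
            (o.density P (η - Real.log (inner ℝ (n₀ : E3) n), n) * (Set.Icc 0
            (o.scriAt (η - Real.log (inner ℝ (n₀ : E3) n)) n 0)).indicator 1 v)
        · filter_upwards [Measure.ae_ne volume (0 : ℝ), Measure.ae_ne volume
            (o.scriAt (η - Real.log (inner ℝ (n₀ : E3) n)) n 0)] with v h0 h1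
          exact o.tendsto_slopeFun_of_pos P η rfl hx h0 h1
        · have h0 := (o.isFutureNull_scriAt (η - Real.log (inner ℝ (n₀ : E3) n)) n).1
          rw [integral_const_mul, integral_const_mul, integral_indicator_one measurableSet_Icc,
            Real.volume_real_Icc_of_le h0.le, Observer.density, mul_inv, Real.exp_neg, inv_inv]
          field_simp
          simp
  have hder : HasDerivAt (fun s : ℝ => ∫ n in {n : ThreeSphere |
      mdot (o.horizonAt η n₀) (roundSection n) ≤ s}, P.toFun (roundSection n) ∂roundMeasure)
      (hemisphereIntegral (o.data P) η n₀) 0 := by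
    rw [hasDerivAt_iff_tendsto_slope]
    have h := hlim.const_mul (Real.exp (-η))
    rw [integral_const_mul, ← mul_assoc, ← Real.exp_add, neg_add_cancel, Real.exp_zero,
      one_mul] at h
    refine h.congr' ?_
    filter_upwards [hs0] with s hs
    rw [← o.slope_eq P η n₀ hs, slope_def_module, sub_zero, smul_eq_mul]
  rw [fieldAt, hder.deriv]

end Horizon

/-! ### The energy flux through the horizon -/

section HorizonEnergy

open Polynomial

theorem abs_inner_le_one (n n' : TwoSphere) : |(inner ℝ (n : E3) n' : ℝ)| ≤ 1 := by
  have h := abs_real_inner_le_norm (n : E3) n'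
  rwa [mem_sphere_zero_iff_norm.1 n.2, mem_sphere_zero_iff_norm.1 n'.2, one_mul] at h

/-- The decay `1 / cosh² t` at late times compensates the factor `1 / x` at the edge of the hemisphere. -/
theorem abs_hemisphere_le {k : ℝ × TwoSphere → ℝ} {C : ℝ} (hC0 : 0 ≤ C)
    (hC : ∀ p, |k p| ≤ C * (Real.cosh p.1 ^ 2)⁻¹) (η : ℝ) {x : ℝ} (hx : x ≤ 1) (n : TwoSphere) :
    |if 0 < x then x⁻¹ * k (η - Real.log x, n) else 0| ≤ 4 * C * Real.exp (-(2 * η)) := by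
  split_ifs with h0
  swap
  · rw [abs_zero]
    positivity
  have h1 : (Real.cosh (η - Real.log x) ^ 2)⁻¹ ≤ 4 * Real.exp (-(2 * η)) * x ^ 2 := by
    have h2 : Real.exp (η - Real.log x) / 2 ≤ Real.cosh (η - Real.log x) := by
      rw [Real.cosh_eq]
      linarith [Real.exp_pos (-(η - Real.log x))]
    have h3 : (Real.exp (η - Real.log x) / 2) ^ 2 ≤ Real.cosh (η - Real.log x) ^ 2 :=
      pow_le_pow_left₀ (by positivity) h2 2
    refine (inv_anti₀ (by positivity) h3).trans_eq ?_
    rw [Real.exp_sub, Real.exp_log h0, Real.exp_neg, two_mul, Real.exp_add]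
    field_simp
    norm_num
  rw [abs_mul, abs_of_pos (inv_pos.2 h0)]
  calc _ ≤ x⁻¹ * (C * (4 * Real.exp (-(2 * η)) * x ^ 2)) := by
        gcongr
        exact (hC _).trans (mul_le_mul_of_nonneg_left h1 hC0)
    _ = 4 * C * Real.exp (-(2 * η)) * x := by field_simp
    _ ≤ _ := mul_le_of_le_one_right (by positivity) hx

theorem measurable_hemisphere {k : ℝ × TwoSphere → ℝ} (hk : Continuous k) :
    Measurable fun q : (ℝ × TwoSphere) × TwoSphere =>
      if 0 < (inner ℝ (q.1.2 : E3) q.2 : ℝ) then (inner ℝ (q.1.2 : E3) q.2)⁻¹ *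
        k (q.1.1 - Real.log (inner ℝ (q.1.2 : E3) q.2), q.2) else 0 := by
  have hi : Measurable fun q : (ℝ × TwoSphere) × TwoSphere => (inner ℝ (q.1.2 : E3) q.2 : ℝ) :=
    Continuous.measurable (by fun_prop)
  refine Measurable.ite (measurableSet_lt measurable_const hi) (hi.inv.mul
    (hk.measurable.comp ?_)) measurable_const
  exact (measurable_fst.fst.sub (Real.measurable_log.comp hi)).prodMk measurable_snd

theorem measurable_hemisphereIntegral {k : ℝ × TwoSphere → ℝ} (hk : Continuous k) :
    Measurable fun p : ℝ × TwoSphere => hemisphereIntegral k p.1 p.2 :=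
  (measurable_hemisphere hk).stronglyMeasurable.integral_prod_right'.measurable

theorem abs_hemisphereIntegral_le {k : ℝ × TwoSphere → ℝ} {C : ℝ} (hC0 : 0 ≤ C)
    (hC : ∀ p, |k p| ≤ C * (Real.cosh p.1 ^ 2)⁻¹) (η : ℝ) (n₀ : TwoSphere) :
    |hemisphereIntegral k η n₀| ≤ 4 * C * Real.exp (-(2 * η)) * sphereMeasure.real Set.univ := by
  rw [hemisphereIntegral, ← Real.norm_eq_abs]
  refine norm_integral_le_of_norm_le_const (ae_of_all _ fun n => ?_)
  exact abs_hemisphere_le hC0 hC η ((le_abs_self _).trans (abs_inner_le_one n₀ n)) n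

/-- Differentiation under the integral. -/
theorem Observer.hasDerivAt_hemisphereIntegral (o : Observer) (P : BoundaryData)
    {d : ℝ × TwoSphere → ℝ} (hd : Continuous d)
    (hder : ∀ t n, HasDerivAt (fun t => o.data P (t, n)) (d (t, n)) t) {C : ℝ} (hC0 : 0 ≤ C)
    (hC : ∀ p, |d p| ≤ C * (Real.cosh p.1 ^ 2)⁻¹) (η : ℝ) (n₀ : TwoSphere) :
    HasDerivAt (fun η => hemisphereIntegral (o.data P) η n₀) (hemisphereIntegral d η n₀) η := by
  obtain ⟨C', hC0', hC'⟩ := o.exists_abs_data_le P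
  have hmeas : ∀ {k : ℝ × TwoSphere → ℝ}, Continuous k → ∀ η, Measurable fun n : TwoSphere =>
      if 0 < (inner ℝ (n₀ : E3) n : ℝ) then (inner ℝ (n₀ : E3) n)⁻¹ *
        k (η - Real.log (inner ℝ (n₀ : E3) n), n) else 0 := fun hk η =>
    (measurable_hemisphere hk).comp (measurable_prodMk_left (x := (η, n₀)))
  have hle : ∀ n : TwoSphere, (inner ℝ (n₀ : E3) n : ℝ) ≤ 1 := fun n =>
    (le_abs_self _).trans (abs_inner_le_one n₀ n)
  refine (hasDerivAt_integral_of_dominated_loc_of_deriv_le (μ := sphereMeasure)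
    (F := fun η n => if 0 < (inner ℝ (n₀ : E3) n : ℝ) then (inner ℝ (n₀ : E3) n)⁻¹ *
      o.data P (η - Real.log (inner ℝ (n₀ : E3) n), n) else 0)
    (F' := fun η n => if 0 < (inner ℝ (n₀ : E3) n : ℝ) then (inner ℝ (n₀ : E3) n)⁻¹ *
      d (η - Real.log (inner ℝ (n₀ : E3) n), n) else 0)
    (bound := fun _ => 4 * C * Real.exp (-(2 * (η - 1)))) (Ioi_mem_nhds (sub_one_lt η))
    (Eventually.of_forall fun η => (hmeas (o.continuous_data P) η).aestronglyMeasurable)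
    ?_ (hmeas hd η).aestronglyMeasurable (ae_of_all _ fun n y hy => ?_) (integrable_const _)
    (ae_of_all _ fun n y hy => ?_)).2
  · exact (integrable_const (4 * C' * Real.exp (-(2 * η)))).mono'
      (hmeas (o.continuous_data P) η).aestronglyMeasurable
      (ae_of_all _ fun n => abs_hemisphere_le hC0' hC' η (hle n) n)
  · refine (abs_hemisphere_le hC0 hC y (hle n) n).trans ?_
    have : η - 1 < y := hy
    gcongr
  · split_ifs with h0
    · exact ((hder _ n).comp_sub_const y _).const_mul _
    · exact hasDerivAt_const _ _

/-- The substitution `x = e^{-τ}` followed by an integration by parts. -/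
theorem integral_legendre_mul_deriv (l : ℕ) {g d : ℝ → ℝ}
    (hder : ∀ t, HasDerivAt g (d t) t) (hgi : Integrable g) (hdi : Integrable d)
    (hg0 : Tendsto g atTop (𝓝 0)) (η : ℝ) :
    ∫ x in Set.Ioo (-1 : ℝ) 1, (if 0 < x then x⁻¹ * d (η - Real.log x) else 0) *
        (legendre l).eval x =
      -(g η - ∫ τ in Set.Ioi (0 : ℝ), Real.exp (-τ) *
        (derivative (legendre l)).eval (Real.exp (-τ)) * g (η + τ)) := by
  have himg : (fun τ => Real.exp (-τ)) '' Set.Ioi 0 = Set.Ioo 0 1 := by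
    ext x
    constructor
    · rintro ⟨τ, hτ, rfl⟩
      exact ⟨Real.exp_pos _, Real.exp_lt_one_iff.2 (neg_neg_of_pos hτ)⟩
    · intro hx
      exact ⟨-Real.log x, neg_pos.2 (Real.log_neg hx.1 hx.2), by
        simp only [neg_neg, Real.exp_log hx.1]⟩
  have h1 : ∫ x in Set.Ioo (-1 : ℝ) 1, (if 0 < x then x⁻¹ * d (η - Real.log x) else 0) *
      (legendre l).eval x = ∫ τ in Set.Ioi (0 : ℝ), (legendre l).eval (Real.exp (-τ)) *
        d (η + τ) := by
    have h2 : ∫ x in Set.Ioo (-1 : ℝ) 1, (if 0 < x then x⁻¹ * d (η - Real.log x) else 0) *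
        (legendre l).eval x = ∫ x in Set.Ioo (0 : ℝ) 1, x⁻¹ * d (η - Real.log x) *
        (legendre l).eval x := by
      refine (setIntegral_eq_of_subset_of_forall_sdiff_eq_zero measurableSet_Ioo
        (Set.Ioo_subset_Ioo_left (by norm_num : (-1 : ℝ) ≤ 0)) fun x hx => ?_).trans
        (setIntegral_congr_fun measurableSet_Ioo fun x hx => ?_)
      · rw [if_neg (fun h => hx.2 ⟨h, hx.1.2⟩), zero_mul]
      · simp only [if_pos (Set.mem_Ioo.1 hx).1]
    rw [h2, ← himg, integral_image_eq_integral_abs_deriv_smul measurableSet_Ioi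
      (f' := fun τ => -Real.exp (-τ))]
    · refine setIntegral_congr_fun measurableSet_Ioi fun τ _ => ?_
      simp only [abs_neg, abs_of_pos (Real.exp_pos _), Real.log_exp, sub_neg_eq_add, smul_eq_mul]
      have := (Real.exp_pos (-τ)).ne'
      field_simp
    · exact fun τ _ => by simpa using ((hasDerivAt_neg τ).exp).hasDerivWithinAt
    · exact fun a _ b _ h => neg_injective (Real.exp_injective h)
  have hpoly : ∀ p : ℝ[X], ∃ B, ∀ τ : ℝ, 0 ≤ τ → |p.eval (Real.exp (-τ))| ≤ B := fun p => by
    obtain ⟨B, hB⟩ := (isCompact_Icc (a := (0 : ℝ)) (b := 1)).exists_bound_of_continuousOn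
      p.continuous.continuousOn
    exact ⟨B, fun τ hτ => hB _ ⟨(Real.exp_pos _).le, Real.exp_le_one_iff.2 (by linarith)⟩⟩
  have hprod : ∀ (p : ℝ[X]) {h : ℝ → ℝ}, Integrable h →
      IntegrableOn (fun τ => p.eval (Real.exp (-τ)) * h (η + τ)) (Set.Ioi 0) := fun p h hh => by
    obtain ⟨B, hB⟩ := hpoly p
    refine (hh.comp_add_left η).integrableOn.bdd_mul (c := B)
      (Continuous.aestronglyMeasurable (by fun_prop)) ?_
    filter_upwards [ae_restrict_mem measurableSet_Ioi] with τ hτ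
    exact hB τ (le_of_lt hτ)
  have hu : ∀ τ ∈ Set.Ioi (0 : ℝ), HasDerivAt (fun τ => (legendre l).eval (Real.exp (-τ)))
      (-(Real.exp (-τ) * (derivative (legendre l)).eval (Real.exp (-τ)))) τ := fun τ _ => by
    have h := ((legendre l).hasDerivAt (Real.exp (-τ))).comp τ ((hasDerivAt_neg τ).exp)
    refine h.congr_deriv ?_
    ring
  have hgc : Continuous g := continuous_iff_continuousAt.2 fun t => (hder t).continuousAt
  have hparts := integral_Ioi_mul_deriv_eq_deriv_mul (a := 0) (a' := g η) (b' := 0)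
    (u := fun τ => (legendre l).eval (Real.exp (-τ))) (v := fun τ => g (η + τ))
    (v' := fun τ => d (η + τ)) hu (fun τ _ => (hder (η + τ)).comp_const_add η τ)
    (hprod _ hdi) ?_ ?_ ?_
  · rw [h1, hparts]
    simp_rw [neg_mul]
    rw [integral_neg]
    ring
  · have h := (hprod (X * derivative (legendre l)) hgi).neg
    refine h.congr (ae_of_all _ fun τ => ?_)
    simp
  · have h : Continuous fun τ => (legendre l).eval (Real.exp (-τ)) * g (η + τ) := by fun_prop
    have h0 := h.tendsto 0
    simp only [neg_zero, Real.exp_zero, eval_one_legendre, add_zero, one_mul] at h0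
    exact h0.mono_left nhdsWithin_le_nhds
  · obtain ⟨B, hB⟩ := hpoly (legendre l)
    have hgη : Tendsto (fun τ => g (η + τ)) atTop (𝓝 0) :=
      hg0.comp (tendsto_atTop_add_const_left _ _ tendsto_id)
    refine bdd_le_mul_tendsto_zero' B ?_ hgη
    filter_upwards [eventually_ge_atTop 0] with τ hτ
    exact hB τ hτ

/-- The rotation-invariant kernel of `hemisphereIntegral` is diagonal in the spherical harmonics. -/
theorem integral_harmonic_mul_hemisphereIntegral {l : ℕ} {m : ℤ} (hm : m.natAbs ≤ l)
    {g d : ℝ × TwoSphere → ℝ} (hg : Continuous g) (hd : Continuous d)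
    (hder : ∀ t n, HasDerivAt (fun t => g (t, n)) (d (t, n)) t) {C : ℝ} (hC0 : 0 ≤ C)
    (hCg : ∀ p, |g p| ≤ C * (Real.cosh p.1 ^ 2)⁻¹) (hC : ∀ p, |d p| ≤ C * (Real.cosh p.1 ^ 2)⁻¹)
    (η : ℝ) :
    ∫ n, conj (sphereHarmonic l m n) * (hemisphereIntegral d η n : ℂ) ∂sphereMeasure =
      -(2 * Real.pi) * ((∫ n, conj (sphereHarmonic l m n) * (g (η, n) : ℂ) ∂sphereMeasure) -
        ∫ τ in Set.Ioi (0 : ℝ), (Real.exp (-τ) * (derivative (legendre l)).eval (Real.exp (-τ)) : ℝ) *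
          ∫ n, conj (sphereHarmonic l m n) * (g (η + τ, n) : ℂ) ∂sphereMeasure) := by
  have hI : Integrable fun t : ℝ => C * (Real.cosh t ^ 2)⁻¹ := integrable_inv_cosh_sq.const_mul C
  have hYc : Continuous fun n : TwoSphere => conj (sphereHarmonic l m n) :=
    Complex.continuous_conj.comp (continuous_sphereHarmonic l m)
  obtain ⟨B, hB⟩ := (isCompact_univ (X := TwoSphere)).exists_bound_of_continuousOn hYc.continuousOn
  have hle : ∀ n n' : TwoSphere, (inner ℝ (n : E3) n' : ℝ) ≤ 1 := fun n n' =>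
    (le_abs_self _).trans (abs_inner_le_one n n')
  set k : ℝ → ℝ := fun τ => Real.exp (-τ) * (derivative (legendre l)).eval (Real.exp (-τ)) with hk
  have hkc : Continuous k := by fun_prop
  have hki : IntegrableOn k (Set.Ioi 0) := by
    have h := (integrableOn_expMoment (derivative (legendre l)) 0).re
    refine h.congr (ae_of_all _ fun τ => ?_)
    simp only [hk, Complex.ofReal_zero, mul_zero, add_zero, neg_mul, one_mul]
    rw [← Complex.ofReal_neg, ← Complex.ofReal_exp, ← Complex.ofReal_mul]
    exact Complex.ofReal_re _
  -- for fixed `n`, the kernel depends on `n₀` only through `n₀·n`, and the Funk–Hecke formula applies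
  have hinner : ∀ n : TwoSphere, ∫ n₀ : TwoSphere, conj (sphereHarmonic l m n₀) *
      ((if 0 < (inner ℝ (n₀ : E3) n : ℝ) then (inner ℝ (n₀ : E3) n)⁻¹ *
        d (η - Real.log (inner ℝ (n₀ : E3) n), n) else 0 : ℝ) : ℂ) ∂sphereMeasure =
      -(2 * Real.pi) * (conj (sphereHarmonic l m n) * (g (η, n) : ℂ) -
        ∫ τ in Set.Ioi (0 : ℝ), conj (sphereHarmonic l m n) * ((k τ : ℝ) * (g (η + τ, n) : ℂ))) := by
    intro n
    have hdi : Integrable fun t => d (t, n) :=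
      hI.mono' (Continuous.aestronglyMeasurable (by fun_prop)) (ae_of_all _ fun t => hC (t, n))
    have hgi : Integrable fun t => g (t, n) :=
      hI.mono' (Continuous.aestronglyMeasurable (by fun_prop)) (ae_of_all _ fun t => hCg (t, n))
    have h1 := integral_legendre_mul_deriv l (fun t => hder t n) hgi hdi
      (tendsto_zero_of_hasDerivAt_of_integrableOn_Ioi (a := 0) (fun t _ => hder t n)
        hdi.integrableOn hgi.integrableOn) η
    have hfm : Measurable fun x : ℝ => if 0 < x then x⁻¹ * d (η - Real.log x, n) else 0 :=
      Measurable.ite measurableSet_Ioi (measurable_id.inv.mul (hd.measurable.comp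
        ((measurable_const.sub Real.measurable_log).prodMk measurable_const))) measurable_const
    have h2 := funk_hecke hm (f := fun x : ℝ =>
      ((if 0 < x then x⁻¹ * d (η - Real.log x, n) else 0 : ℝ) : ℂ))
      (Complex.measurable_ofReal.comp hfm) ⟨_, fun x hx => by
        rw [Complex.norm_real]
        exact abs_hemisphere_le hC0 hC η hx.2 n⟩ n
    have h3 := congrArg conj h2
    rw [← integral_conj] at h3
    simp only [map_mul, Complex.conj_ofReal, ← Complex.ofReal_mul, integral_complex_ofReal, h1,
      map_ofNat] at h3
    simp_rw [mul_comm (conj (sphereHarmonic l m _)), real_inner_comm (n : E3)]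
    rw [h3, integral_mul_const]
    simp_rw [← Complex.ofReal_mul, integral_complex_ofReal, hk]
    push_cast
    ring
  have hmeas : AEStronglyMeasurable (fun q : TwoSphere × TwoSphere =>
      conj (sphereHarmonic l m q.1) * ((if 0 < (inner ℝ (q.1 : E3) q.2 : ℝ) then
        (inner ℝ (q.1 : E3) q.2)⁻¹ * d (η - Real.log (inner ℝ (q.1 : E3) q.2), q.2)
        else 0 : ℝ) : ℂ)) (sphereMeasure.prod sphereMeasure) := by
    refine ((hYc.comp continuous_fst).measurable.mul (Complex.measurable_ofReal.comp ?_)).aestronglyMeasurable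
    exact (measurable_hemisphere hd).comp ((measurable_const.prodMk measurable_fst).prodMk
      measurable_snd : Measurable fun q : TwoSphere × TwoSphere => ((η, q.1), q.2))
  have hint : Integrable (fun q : TwoSphere × TwoSphere =>
      conj (sphereHarmonic l m q.1) * ((if 0 < (inner ℝ (q.1 : E3) q.2 : ℝ) then
        (inner ℝ (q.1 : E3) q.2)⁻¹ * d (η - Real.log (inner ℝ (q.1 : E3) q.2), q.2)
        else 0 : ℝ) : ℂ)) (sphereMeasure.prod sphereMeasure) := by
    refine (integrable_const (B * (4 * C * Real.exp (-(2 * η))))).mono' hmeas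
      (ae_of_all _ fun q => ?_)
    rw [norm_mul, Complex.norm_real]
    exact mul_le_mul (hB _ (Set.mem_univ _)) (abs_hemisphere_le hC0 hC η (hle _ _) _)
      (norm_nonneg _) ((norm_nonneg _).trans (hB q.1 (Set.mem_univ _)))
  have hint2 : Integrable (fun q : TwoSphere × ℝ => conj (sphereHarmonic l m q.1) *
      ((k q.2 : ℝ) * (g (η + q.2, q.1) : ℂ))) (sphereMeasure.prod (volume.restrict (Set.Ioi 0))) := by
    refine (((hki.norm.const_mul (B * C)).comp_snd sphereMeasure)).mono'
      ((hYc.comp continuous_fst).mul (by fun_prop)).aestronglyMeasurable (ae_of_all _ fun q => ?_)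
    rw [norm_mul, norm_mul, Complex.norm_real, Complex.norm_real]
    have h1 : ‖g (η + q.2, q.1)‖ ≤ C :=
      (hCg _).trans (mul_le_of_le_one_right hC0 (inv_cosh_sq_le_one _))
    calc _ ≤ B * (‖k q.2‖ * C) := mul_le_mul (hB _ (Set.mem_univ _))
          (mul_le_mul_of_nonneg_left h1 (norm_nonneg _)) (by positivity)
          ((norm_nonneg _).trans (hB q.1 (Set.mem_univ _)))
      _ = _ := by ring
  have hgc : Integrable (fun n => conj (sphereHarmonic l m n) * (g (η, n) : ℂ)) sphereMeasure :=
    Continuous.integrable_of_hasCompactSupport (by fun_prop) (HasCompactSupport.of_compactSpace _)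
  calc _ = ∫ n₀, (∫ n, conj (sphereHarmonic l m n₀) *
        ((if 0 < (inner ℝ (n₀ : E3) n : ℝ) then (inner ℝ (n₀ : E3) n)⁻¹ *
          d (η - Real.log (inner ℝ (n₀ : E3) n), n) else 0 : ℝ) : ℂ) ∂sphereMeasure)
          ∂sphereMeasure := by
        simp_rw [integral_const_mul, integral_complex_ofReal, hemisphereIntegral]
    _ = _ := by
        rw [integral_integral_swap hint]
        simp_rw [hinner]
        rw [integral_const_mul, integral_sub hgc hint2.integral_prod_left,
          integral_integral_swap hint2]
        congr 2
        refine setIntegral_congr_fun measurableSet_Ioi fun τ _ => ?_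
        rw [← integral_const_mul]
        exact integral_congr_ae (ae_of_all _ fun n => mul_left_comm _ _ _)

theorem measurable_expMoment (p : ℝ[X]) : Measurable (expMoment p) := by
  have h : StronglyMeasurable fun q : ℝ × ℝ => Complex.exp (-(1 + Complex.I * q.1) * q.2) *
      (p.eval (Real.exp (-q.2)) : ℝ) := Continuous.stronglyMeasurable (by fun_prop)
  exact (h.integral_prod_right' (ν := volume.restrict (Set.Ioi 0))).measurable

theorem measurable_horizonFactor (l : ℕ) : Measurable (horizonFactor l) :=
  measurable_const.sub (measurable_expMoment _)

/-- Convolution with `e^{-τ} p(e^{-τ})` multiplies the Fourier transform by `expMoment p`. -/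
theorem timeFourier_integral_exp_mul (p : ℝ[X]) {G : ℝ → ℂ} (hG : Integrable G)
    (hGc : Continuous G) {B : ℝ} (hB : ∀ t, ‖G t‖ ≤ B) :
    Integrable (fun η => ∫ τ in Set.Ioi (0 : ℝ),
      (Real.exp (-τ) * p.eval (Real.exp (-τ)) : ℝ) * G (η + τ)) ∧
    (∃ B', ∀ η, ‖∫ τ in Set.Ioi (0 : ℝ),
      (Real.exp (-τ) * p.eval (Real.exp (-τ)) : ℝ) * G (η + τ)‖ ≤ B') ∧
    ∀ w, timeFourier (fun η => ∫ τ in Set.Ioi (0 : ℝ),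
      (Real.exp (-τ) * p.eval (Real.exp (-τ)) : ℝ) * G (η + τ)) w =
      expMoment p w * timeFourier G w := by
  set k : ℝ → ℝ := fun τ => Real.exp (-τ) * p.eval (Real.exp (-τ)) with hk
  have hkc : Continuous k := by fun_prop
  have hki : IntegrableOn k (Set.Ioi 0) := by
    have h := (integrableOn_expMoment p 0).re
    refine h.congr (ae_of_all _ fun τ => ?_)
    simp only [hk, Complex.ofReal_zero, mul_zero, add_zero, neg_mul, one_mul]
    rw [← Complex.ofReal_neg, ← Complex.ofReal_exp, ← Complex.ofReal_mul]
    exact Complex.ofReal_re _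
  have hint : Integrable (fun q : ℝ × ℝ => ((k q.2 : ℝ) : ℂ) * G (q.1 + q.2))
      (volume.prod (volume.restrict (Set.Ioi 0))) := by
    rw [integrable_prod_iff' (Continuous.aestronglyMeasurable (by fun_prop))]
    refine ⟨ae_of_all _ fun τ => (hG.comp_add_right τ).const_mul ((k τ : ℝ) : ℂ), ?_⟩
    have h : ∀ τ, ∫ η, ‖((k τ : ℝ) : ℂ) * G (η + τ)‖ = ‖k τ‖ * ∫ η, ‖G η‖ := fun τ => by
      simp_rw [norm_mul, Complex.norm_real]
      rw [integral_const_mul, integral_add_right_eq_self (fun η => ‖G η‖) τ]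
    simp_rw [h]
    exact hki.norm.mul_const _
  refine ⟨hint.integral_prod_left, ⟨∫ τ in Set.Ioi (0 : ℝ), ‖k τ‖ * B, fun η =>
    norm_integral_le_of_norm_le (hki.norm.mul_const B) (ae_of_all _ fun τ => ?_)⟩, fun w => ?_⟩
  · rw [norm_mul, Complex.norm_real]
    exact mul_le_mul_of_nonneg_left (hB _) (norm_nonneg _)
  · have hint2 : Integrable (fun q : ℝ × ℝ => Complex.exp (Complex.I * w * q.1) *
        (((k q.2 : ℝ) : ℂ) * G (q.1 + q.2))) (volume.prod (volume.restrict (Set.Ioi 0))) :=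
      hint.bdd_mul (c := 1) (Continuous.aestronglyMeasurable (by fun_prop))
        (ae_of_all _ fun q => (norm_exp_I_mul w q.1).le)
    unfold timeFourier expMoment
    conv_lhs => simp only [← integral_const_mul]
    rw [integral_integral_swap hint2, ← integral_mul_const]
    refine setIntegral_congr_fun measurableSet_Ioi fun τ _ => ?_
    rw [← integral_add_right_eq_self (fun η : ℝ => Complex.exp (Complex.I * w * η) * G η) τ,
      ← integral_const_mul]
    refine integral_congr_ae (ae_of_all _ fun η => ?_)
    have h : Complex.exp (Complex.I * w * η) = Complex.exp (-(Complex.I * w * τ)) *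
        Complex.exp (Complex.I * w * ((η + τ : ℝ) : ℂ)) := by
      rw [← Complex.exp_add]
      congr 1
      push_cast
      ring
    have h2 : Complex.exp (-(1 + Complex.I * w) * τ) =
        Complex.exp (-(τ : ℂ)) * Complex.exp (-(Complex.I * w * τ)) := by
      rw [← Complex.exp_add]
      congr 1
      ring
    simp only [h, h2]
    push_cast
    ring

/-- The derivative of the field along the horizon has the coefficients of the boundary data multiplied
by `-horizonFactor / 2`, so Parseval's identity evaluates the flux. -/
theorem Observer.energy_eq (o : Observer) (P : BoundaryData) :
    o.energy P = ∫⁻ x, ENNReal.ofReal (‖horizonFactor x.2.1 x.1‖ ^ 2 / 2) * ‖o.coeff P x‖ₑ ^ 2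
      ∂modeMeasure := by
  obtain ⟨C₁, hC₁0, hC₁⟩ := o.exists_abs_data_le P
  obtain ⟨d, hd, hder, C₂, hC₂0, hC₂⟩ := o.exists_deriv_data P
  set C := max C₁ C₂
  have hC0 : 0 ≤ C := hC₁0.trans (le_max_left _ _)
  have hCg : ∀ p, |o.data P p| ≤ C * (Real.cosh p.1 ^ 2)⁻¹ := fun p =>
    (hC₁ p).trans (mul_le_mul_of_nonneg_right (le_max_left _ _) (by positivity))
  have hCd : ∀ p, |d p| ≤ C * (Real.cosh p.1 ^ 2)⁻¹ := fun p =>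
    (hC₂ p).trans (mul_le_mul_of_nonneg_right (le_max_right _ _) (by positivity))
  have hgc := o.continuous_data P
  set f : ℝ × TwoSphere → ℝ := fun p => 1 / (4 * Real.pi) * hemisphereIntegral d p.1 p.2 with hf
  have hfm : Measurable f := (measurable_hemisphereIntegral hd).const_mul _
  have hE : o.energy P = ∫⁻ p, ‖f p‖ₑ ^ 2 ∂cylinder := by
    rw [← map_prod_solidAngle, lintegral_map (hfm.enorm.pow_const 2) measurable_prod_sphericalPoint,
      Observer.energy]
    refine lintegral_congr fun p => ?_
    have h1 : (fun η => fieldAt P (o.horizon η p.2.1 p.2.2)) = fun η =>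
        1 / (4 * Real.pi) * hemisphereIntegral (o.data P) η (sphericalPoint p.2.1 p.2.2) := by
      funext η
      rw [← o.horizonAt_sphericalPoint, o.fieldAt_horizonAt]
    rw [h1, ((o.hasDerivAt_hemisphereIntegral P hd hder hC0 hCd _ _).const_mul _).deriv,
      ← sq_abs, ENNReal.ofReal_pow (abs_nonneg _), ← Real.enorm_eq_ofReal_abs]
  set G : AngLabel → ℝ → ℂ := fun a t =>
    ∫ n, conj (sphereHarmonic a.1 a.m n) * (o.data P (t, n) : ℂ) ∂sphereMeasure with hG
  have hYc : ∀ a : AngLabel, Continuous fun n : TwoSphere => conj (sphereHarmonic a.1 a.m n) :=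
    fun a => Complex.continuous_conj.comp (continuous_sphereHarmonic _ _)
  have hGi : ∀ a, Integrable (G a) := fun a => integrable_sphereCoeff (o.integrable_data P) _ _
  have hGb : ∀ a : AngLabel, ∃ B, ∀ t n, ‖conj (sphereHarmonic a.1 a.m n) * (o.data P (t, n) : ℂ)‖
      ≤ B := fun a => by
    obtain ⟨B, hB⟩ := (isCompact_univ (X := TwoSphere)).exists_bound_of_continuousOn
      (hYc a).continuousOn
    refine ⟨B * C, fun t n => ?_⟩
    rw [norm_mul, Complex.norm_real]
    exact mul_le_mul (hB _ (Set.mem_univ _)) ((hCg _).trans (mul_le_of_le_one_right hC0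
      (inv_cosh_sq_le_one _))) (norm_nonneg _) ((norm_nonneg _).trans (hB n (Set.mem_univ _)))
  have hGB : ∀ a, ∃ B, ∀ t, ‖G a t‖ ≤ B := fun a => by
    obtain ⟨B, hB⟩ := hGb a
    exact ⟨_, fun t => norm_integral_le_of_norm_le_const (ae_of_all _ (hB t))⟩
  have hGc : ∀ a, Continuous (G a) := fun a => by
    obtain ⟨B, hB⟩ := hGb a
    exact continuous_of_dominated (fun t => ((hYc a).mul (by fun_prop)).aestronglyMeasurable)
      (fun t => ae_of_all _ (hB t)) (integrable_const B) (ae_of_all _ fun n => by fun_prop)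
  -- `G a` is the projection of the data to a harmonic, `V a` a weighted integral over later times
  set V : AngLabel → ℝ → ℂ := fun a η => ∫ τ in Set.Ioi (0 : ℝ), (Real.exp (-τ) *
    (derivative (legendre a.1)).eval (Real.exp (-τ)) : ℝ) * G a (η + τ) with hV
  have hcoeff : ∀ a : AngLabel, (fun t => ∫ n, conj (sphereHarmonic a.1 a.m n) * (f (t, n) : ℂ)
      ∂sphereMeasure) = fun t => -(1 / 2) * (G a t - V a t) := fun a => by
    funext t
    have h := integral_harmonic_mul_hemisphereIntegral a.natAbs_m_le hgc hd hder hC0 hCg hCd t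
    simp only [hf, Complex.ofReal_mul, mul_left_comm (conj _)]
    rw [integral_const_mul, h]
    have hpi : (Real.pi : ℂ) ≠ 0 := Complex.ofReal_ne_zero.2 Real.pi_ne_zero
    push_cast
    simp only [hG, hV]
    field_simp
    push_cast
    ring
  have hVp : ∀ a : AngLabel, Integrable (V a) ∧ (∃ B, ∀ t, ‖V a t‖ ≤ B) ∧ ∀ w,
      timeFourier (V a) w = expMoment (derivative (legendre a.1)) w * timeFourier (G a) w :=
    fun a => by
      obtain ⟨B, hB⟩ := hGB a
      exact timeFourier_integral_exp_mul _ (hGi a) (hGc a) hB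
  have hi : ∀ a : AngLabel, Integrable fun t => -(1 / 2 : ℂ) * (G a t - V a t) := fun a =>
    ((hGi a).sub (hVp a).1).const_mul _
  have hmc : ∀ x, modeCoeff f x = -(1 / 2) * (horizonFactor x.2.1 x.1 * o.coeff P x) := fun x => by
    have h1 : o.coeff P x = timeFourier (G x.2) x.1 := by
      rw [o.coeff_eq_modeCoeff]
      rfl
    rw [modeCoeff, hcoeff, h1, horizonFactor, sub_mul, one_mul, ← (hVp x.2).2.2]
    unfold timeFourier
    rw [← integral_sub (integrable_exp_mul (hGi _) _) (integrable_exp_mul (hVp _).1 _),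
      ← integral_const_mul]
    refine integral_congr_ae (ae_of_all _ fun t => ?_)
    ring
  -- the derivative of the field grows like `e^{-2η}` in the available bounds as `η → -∞`, but its
  -- projections to harmonics are integrable, which is what Parseval's identity needs
  rw [hE, lintegral_enorm_sq_cylinder_of_coeff (hfm.enorm.pow_const 2).aemeasurable
    (ae_of_all _ fun t => ?_) (fun a => ?_) (fun a => ?_), ← lintegral_const_mul' _ _ (by simp)]
  · refine lintegral_congr fun x => ?_
    rw [hmc, ← ofReal_norm, ← ofReal_norm, ← ENNReal.ofReal_pow (norm_nonneg _),
      ← ENNReal.ofReal_pow (norm_nonneg _), ← ENNReal.ofReal_mul (by positivity),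
      ← ENNReal.ofReal_ofNat, ← ENNReal.ofReal_mul (by norm_num)]
    congr 1
    rw [norm_mul, norm_mul, norm_neg, norm_div, norm_one, Complex.norm_ofNat]
    ring
  · refine MemLp.of_bound (hfm.comp measurable_prodMk_left).aestronglyMeasurable
      (1 / (4 * Real.pi) * (4 * C * Real.exp (-(2 * t)) * sphereMeasure.real Set.univ))
      (ae_of_all _ fun n => ?_)
    rw [hf, norm_mul, Real.norm_of_nonneg (by positivity)]
    exact mul_le_mul_of_nonneg_left (abs_hemisphereIntegral_le hC0 hCd t n) (by positivity)
  · rw [hcoeff]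
    exact hi a
  · rw [hcoeff]
    obtain ⟨B, hB⟩ := hGB a
    obtain ⟨B', hB'⟩ := (hVp a).2.1
    refine memLp_two_of_integrable_of_bounded (hi a) (C := ‖(-(1 / 2) : ℂ)‖ * (B + B')) fun t => ?_
    rw [norm_mul]
    exact mul_le_mul_of_nonneg_left ((norm_sub_le _ _).trans (add_le_add (hB t) (hB' t)))
      (norm_nonneg _)

end HorizonEnergy

/-! ### Uniqueness of the normalization -/

section Uniqueness

/-- The Fourier transform of `cosh⁻ˢ` is a Beta function. -/
theorem timeFourier_inv_cosh_pow_ne_zero {s : ℕ} (hs : 0 < s) (w : ℝ) :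
    timeFourier (fun t => (((Real.cosh t ^ s)⁻¹ : ℝ) : ℂ)) w ≠ 0 := by
  set u : ℂ := (s + Complex.I * w) / 2 with hu
  set v : ℂ := (s - Complex.I * w) / 2 with hv
  have hs' : (0 : ℝ) < s := Nat.cast_pos.2 hs
  have hure : 0 < u.re := by simp [hu]; positivity
  have hvre : 0 < v.re := by simp [hv]; positivity
  have huv : u + v = s := by rw [hu, hv]; ring
  have hbeta : Complex.betaIntegral u v ≠ 0 := by
    intro h
    have h1 := Complex.Gamma_mul_Gamma_eq_betaIntegral hure hvre
    rw [h, mul_zero] at h1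
    exact mul_ne_zero (Complex.Gamma_ne_zero_of_re_pos hure)
      (Complex.Gamma_ne_zero_of_re_pos hvre) h1
  -- the substitution `x = (1 + tanh t) / 2` in the Beta integral
  have hφ0 : ∀ t : ℝ, (1 + Real.tanh t) / 2 = Real.exp t / (2 * Real.cosh t) := fun t => by
    rw [Real.tanh_eq_sinh_div_cosh, ← Real.cosh_add_sinh]
    field_simp [(Real.cosh_pos t).ne']
  have hφ1 : ∀ t : ℝ, 1 - (1 + Real.tanh t) / 2 = Real.exp (-t) / (2 * Real.cosh t) := fun t => by
    rw [Real.tanh_eq_sinh_div_cosh, ← Real.cosh_sub_sinh]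
    field_simp [(Real.cosh_pos t).ne']
    ring
  have himg : (fun t => (1 + Real.tanh t) / 2) '' Set.univ = Set.Ioo 0 1 := by
    ext x
    constructor
    · rintro ⟨t, -, rfl⟩
      have h0 := hφ0 t
      have h1 := hφ1 t
      have hc := Real.cosh_pos t
      have h2 : 0 < Real.exp t / (2 * Real.cosh t) := by positivity
      have h3 : 0 < Real.exp (-t) / (2 * Real.cosh t) := by positivity
      constructor
      · simp only
        linarith
      · simp only
        linarith
    · intro hx
      obtain ⟨t, ht⟩ : ∃ t, Real.tanh t = 2 * x - 1 := by
        refine ⟨Real.artanh (2 * x - 1), Real.tanh_artanh ⟨by linarith [hx.1], by linarith [hx.2]⟩⟩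
      exact ⟨t, trivial, by simp only [ht]; ring⟩
  have hmain : Complex.betaIntegral u v = (2 * (2 ^ s)⁻¹ : ℝ) *
      timeFourier (fun t => (((Real.cosh t ^ s)⁻¹ : ℝ) : ℂ)) w := by
    rw [Complex.betaIntegral, intervalIntegral.integral_of_le zero_le_one,
      integral_Ioc_eq_integral_Ioo, ← himg, integral_image_eq_integral_abs_deriv_smul
      MeasurableSet.univ (f' := fun t => (Real.cosh t ^ 2)⁻¹ / 2), setIntegral_univ, timeFourier,
      ← integral_const_mul]
    · refine integral_congr_ae (ae_of_all _ fun t => ?_)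
      have hc := Real.cosh_pos t
      have hpow : ∀ (r : ℝ) (z : ℂ), ((Real.exp r / (2 * Real.cosh t) : ℝ) : ℂ) ^ z =
          Complex.exp (r * z) * Complex.exp (-(Real.log (2 * Real.cosh t) : ℂ) * z) := fun r z => by
        have hpos : 0 < Real.exp r / (2 * Real.cosh t) := by positivity
        rw [Complex.cpow_def_of_ne_zero (Complex.ofReal_ne_zero.2 hpos.ne'),
          ← Complex.ofReal_log hpos.le, Real.log_div (Real.exp_pos _).ne' (by positivity),
          Real.log_exp, ← Complex.exp_add]
        congr 1
        push_cast
        ring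
      have h1 : (1 : ℂ) - (((1 + Real.tanh t) / 2 : ℝ) : ℂ) =
          ((Real.exp (-t) / (2 * Real.cosh t) : ℝ) : ℂ) := by
        rw [← hφ1]
        push_cast
        ring
      have hlog : Complex.exp (-(Real.log (2 * Real.cosh t) : ℂ) * s) =
          (((2 * Real.cosh t) ^ s)⁻¹ : ℝ) := by
        rw [neg_mul, Complex.exp_neg, mul_comm, Complex.exp_nat_mul, ← Complex.ofReal_exp,
          Real.exp_log (by positivity)]
        push_cast
        rfl
      have hlog2 : Complex.exp (-(Real.log (2 * Real.cosh t) : ℂ) * (-2)) =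
          ((2 * Real.cosh t) ^ 2 : ℝ) := by
        rw [neg_mul_neg, mul_comm, show (2 : ℂ) = ((2 : ℕ) : ℂ) by norm_num, Complex.exp_nat_mul,
          ← Complex.ofReal_exp, Real.exp_log (by positivity)]
        push_cast
        rfl
      have hcomb : Complex.exp (t * (u - 1)) * Complex.exp (-(Real.log (2 * Real.cosh t) : ℂ) *
          (u - 1)) * (Complex.exp ((-t : ℝ) * (v - 1)) *
          Complex.exp (-(Real.log (2 * Real.cosh t) : ℂ) * (v - 1))) =
          Complex.exp (Complex.I * w * t) * (Complex.exp (-(Real.log (2 * Real.cosh t) : ℂ) * s) *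
          Complex.exp (-(Real.log (2 * Real.cosh t) : ℂ) * (-2))) := by
        simp only [← Complex.exp_add]
        congr 1
        rw [← huv, hu, hv]
        push_cast
        ring
      simp only
      rw [h1, hφ0, hpow, hpow, hcomb, hlog, hlog2, abs_of_pos (by positivity), Complex.real_smul]
      have hcc : ((Real.cosh t : ℝ) : ℂ) ≠ 0 := Complex.ofReal_ne_zero.2 hc.ne'
      push_cast at hcc ⊢
      field_simp
      rw [mul_pow, mul_comm]
    · intro t _
      have hc := (Real.cosh_pos t).ne'
      have h := (((Real.hasDerivAt_sinh t).div (Real.hasDerivAt_cosh t) hc).const_add 1).div_const 2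
      rw [← pow_two, ← pow_two, Real.cosh_sq_sub_sinh_sq, one_div] at h
      refine (h.congr_of_eventuallyEq (Eventually.of_forall fun t => ?_)).hasDerivWithinAt
      simp only [Real.tanh_eq_sinh_div_cosh, Pi.div_apply]
    · intro a _ b _ h
      refine Real.tanh_injective ?_
      simp only at h
      linarith
  intro h
  rw [hmain, h, mul_zero] at hbeta
  exact hbeta rfl

theorem enorm_one_add_exp_sq (x : ℝ) :
    ‖1 + Complex.exp (Complex.I * x)‖ₑ ^ 2 = ENNReal.ofReal (2 + 2 * Real.cos x) := by
  rw [← ofReal_norm, ← ENNReal.ofReal_pow (norm_nonneg _), ← Complex.normSq_eq_norm_sq,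
    mul_comm, Complex.exp_mul_I, Complex.normSq_apply]
  congr 1
  simp [← Complex.ofReal_cos, ← Complex.ofReal_sin]
  nlinarith [Real.sin_sq_add_cos_sq x]

/-- A density on `(0, ∞)` is determined by its cosine transform. -/
theorem ae_eq_of_lintegral_mul_enorm_one_add_exp {α β : ℝ → ℝ≥0∞} (hα : Measurable α)
    (hβ : Measurable β) (hαf : ∫⁻ w in Set.Ioi (0 : ℝ), α w ≠ ⊤)
    (hβf : ∫⁻ w in Set.Ioi (0 : ℝ), β w ≠ ⊤)
    (h : ∀ t : ℝ, ∫⁻ w in Set.Ioi (0 : ℝ), α w * ‖1 + Complex.exp (Complex.I * (w * t : ℝ))‖ₑ ^ 2 =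
      ∫⁻ w in Set.Ioi (0 : ℝ), β w * ‖1 + Complex.exp (Complex.I * (w * t : ℝ))‖ₑ ^ 2) :
    α =ᵐ[volume.restrict (Set.Ioi 0)] β := by
  set μ := (volume.restrict (Set.Ioi (0 : ℝ))).withDensity α with hμ
  set ν := (volume.restrict (Set.Ioi (0 : ℝ))).withDensity β with hν
  have hμf : IsFiniteMeasure μ := isFiniteMeasure_withDensity hαf
  have hνf : IsFiniteMeasure ν := isFiniteMeasure_withDensity hβf
  have hcosi : ∀ (ρ : Measure ℝ) [IsFiniteMeasure ρ] (t : ℝ),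
      Integrable (fun w => Real.cos (w * t)) ρ := fun ρ _ t =>
    (integrable_const (1 : ℝ)).mono' (Continuous.aestronglyMeasurable (by fun_prop))
      (ae_of_all _ fun w => Real.abs_cos_le_one _)
  have hsq : ∀ t : ℝ, ∫ w, (2 + 2 * Real.cos (w * t)) ∂μ = ∫ w, (2 + 2 * Real.cos (w * t)) ∂ν := by
    intro t
    have hm : Measurable fun w : ℝ => ENNReal.ofReal (2 + 2 * Real.cos (w * t)) := by fun_prop
    have hnn : ∀ w : ℝ, 0 ≤ 2 + 2 * Real.cos (w * t) := fun w => by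
      linarith [Real.neg_one_le_cos (w * t)]
    have h1 := h t
    simp_rw [enorm_one_add_exp_sq] at h1
    rw [integral_eq_lintegral_of_nonneg_ae (ae_of_all _ hnn)
      (Continuous.aestronglyMeasurable (by fun_prop)),
      integral_eq_lintegral_of_nonneg_ae (ae_of_all _ hnn)
      (Continuous.aestronglyMeasurable (by fun_prop)), hμ, hν,
      lintegral_withDensity_eq_lintegral_mul _ hα hm,
      lintegral_withDensity_eq_lintegral_mul _ hβ hm]
    exact congrArg _ h1
  have hsplit : ∀ (ρ : Measure ℝ) [IsFiniteMeasure ρ] (t : ℝ), ∫ w, (2 + 2 * Real.cos (w * t)) ∂ρ =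
      2 * ρ.real Set.univ + 2 * ∫ w, Real.cos (w * t) ∂ρ := fun ρ _ t => by
    rw [integral_add (integrable_const _) ((hcosi ρ t).const_mul 2), integral_const,
      integral_const_mul, smul_eq_mul, mul_comm]
  have hmass : μ.real Set.univ = ν.real Set.univ := by
    have h1 := hsq 0
    rw [hsplit, hsplit] at h1
    simp at h1
    linarith
  have hcos : ∀ t : ℝ, ∫ w, Real.cos (w * t) ∂μ = ∫ w, Real.cos (w * t) ∂ν := fun t => by
    have h1 := hsq t
    rw [hsplit, hsplit, hmass] at h1
    linarith
  -- the cosine transform is the characteristic function of the symmetrized measure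
  have hchar : ∀ (ρ : Measure ℝ) [IsFiniteMeasure ρ] (t : ℝ), charFun (ρ + ρ.map Neg.neg) t =
      ((2 * ∫ w, Real.cos (w * t) ∂ρ : ℝ) : ℂ) := fun ρ _ t => by
    have hi : ∀ (ρ : Measure ℝ) [IsFiniteMeasure ρ],
        Integrable (fun w : ℝ => Complex.exp (t * w * Complex.I)) ρ := fun ρ _ => by
      refine (integrable_const (1 : ℝ)).mono' (Continuous.aestronglyMeasurable (by fun_prop))
        (ae_of_all _ fun w => ?_)
      rw [← Complex.ofReal_mul, Complex.norm_exp_ofReal_mul_I]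
    have hi2 : Integrable (fun w : ℝ => Complex.exp (t * (-w : ℝ) * Complex.I)) ρ :=
      (hi (ρ.map Neg.neg)).comp_measurable measurable_neg
    rw [charFun_apply_real, integral_add_measure (hi ρ) (hi _),
      integral_map measurable_neg.aemeasurable (Continuous.aestronglyMeasurable (by fun_prop)),
      ← integral_add (hi ρ) hi2, ← integral_const_mul, ← integral_complex_ofReal]
    refine integral_congr_ae (ae_of_all _ fun w => ?_)
    simp only
    rw [Complex.ofReal_mul, Complex.ofReal_cos, Complex.ofReal_ofNat, Complex.two_cos]
    push_cast
    congr 2 <;> ring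
  have hsym : μ + μ.map Neg.neg = ν + ν.map Neg.neg := by
    refine Measure.ext_of_charFun (funext fun t => ?_)
    rw [hchar, hchar, hcos]
  have hpos : ∀ {γ : ℝ → ℝ≥0∞} (s : Set ℝ), MeasurableSet s → s ⊆ Set.Ioi 0 →
      ((volume.restrict (Set.Ioi (0 : ℝ))).withDensity γ +
        ((volume.restrict (Set.Ioi (0 : ℝ))).withDensity γ).map Neg.neg) s =
      (volume.restrict (Set.Ioi (0 : ℝ))).withDensity γ s := fun {γ} s hs hsub => by
    rw [Measure.add_apply, Measure.map_apply measurable_neg hs]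
    refine (congrArg _ (withDensity_absolutelyContinuous _ _ ?_)).trans (add_zero _)
    rw [Measure.restrict_apply (measurable_neg hs)]
    refine measure_mono_null (t := ∅) (fun x hx => ?_) measure_empty
    have h1 : 0 < -x := hsub hx.1
    have h2 : 0 < x := hx.2
    exact absurd h1 (by linarith)
  have heq : μ = ν := by
    ext s hs
    have h0 : ∀ γ : ℝ → ℝ≥0∞, (volume.restrict (Set.Ioi (0 : ℝ))).withDensity γ s =
        (volume.restrict (Set.Ioi (0 : ℝ))).withDensity γ (s ∩ Set.Ioi 0) := fun γ => by
      rw [withDensity_apply _ hs, withDensity_apply _ (hs.inter measurableSet_Ioi),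
        Measure.restrict_restrict hs, Measure.restrict_restrict (hs.inter measurableSet_Ioi),
        Set.inter_assoc, Set.inter_self]
    have hm := hs.inter (measurableSet_Ioi (a := (0 : ℝ)))
    rw [hμ, hν, h0, h0, ← hpos _ hm Set.inter_subset_right, ← hpos _ hm Set.inter_subset_right,
      ← hμ, ← hν, hsym]
  exact (withDensity_eq_iff hα.aemeasurable hβ.aemeasurable hαf).1 heq

end Uniqueness

/-! ### Test data with a single angular momentum -/

section TestData

open Polynomial

/-- The projection of `Re (y + i z)^l` onto the spherical harmonic with label `a`. -/
def sectoralCoeff (l : ℕ) (a : AngLabel) : ℂ :=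
  ∫ n, conj (sphereHarmonic a.1 a.m n) * (((transverse n ^ l).re : ℝ) : ℂ) ∂sphereMeasure

theorem continuous_sectoral (l : ℕ) :
    Continuous fun n => (((transverse n ^ l).re : ℝ) : ℂ) := by
  have := continuous_transverse
  fun_prop

/-- `Re (y + iz)^l` is a combination of `Y_{l,l}` and `Y_{l,-l}`, which coincide for `l = 0`. -/
theorem exists_sectoral_eq (l : ℕ) : ∃ α β : ℂ, α ≠ 0 ∧ (l = 0 → α = β) ∧ ∀ n,
    (((transverse n ^ l).re : ℝ) : ℂ) = α * sphereHarmonic l l n + β * sphereHarmonic l (-l) n := by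
  set k : ℝ := (derivative^[l] (legendre l)).coeff 0 with hk
  have hp : derivative^[l] (legendre l) = C k := by
    refine eq_C_of_natDegree_le_zero ((natDegree_iterate_derivative _ _).trans ?_)
    have := natDegree_legendre_le l
    omega
  have hk0 : (k : ℂ) ≠ 0 := by
    rw [hk, coeff_iterate_derivative, zero_add, Nat.descFactorial_self, nsmul_eq_mul]
    exact Complex.ofReal_ne_zero.2 (mul_ne_zero (Nat.cast_ne_zero.2 l.factorial_ne_zero)
      (coeff_legendre_ne_zero l))
  have h1 := harmonicScalar_ne_zero l l
  have h2 := harmonicScalar_ne_zero l (-l)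
  refine ⟨(2 * (harmonicScalar l l * k))⁻¹, (2 * (harmonicScalar l (-l) * k))⁻¹,
    inv_ne_zero (mul_ne_zero two_ne_zero (mul_ne_zero h1 hk0)), fun h => by subst h; simp,
    fun n => ?_⟩
  have h3 : (((transverse n ^ l).re : ℝ) : ℂ) = (transverse n ^ l + conj (transverse n) ^ l) / 2 := by
    rw [Complex.re_eq_add_conj, map_pow]
  simp only [sphereHarmonic, Int.natAbs_neg, Int.natAbs_natCast, hp, eval_C, Int.toNat_natCast,
    neg_neg, Int.toNat_neg_natCast, pow_zero, one_mul, mul_one, h3]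
  field_simp

theorem sectoralCoeff_eq (l : ℕ) : ∃ α β : ℂ, α ≠ 0 ∧ (l = 0 → α = β) ∧ ∀ a : AngLabel,
    sectoralCoeff l a = (if a.1 = l ∧ a.m = l then α else 0) +
      (if a.1 = l ∧ a.m = -l then β else 0) := by
  obtain ⟨α, β, hα, hαβ, h⟩ := exists_sectoral_eq l
  refine ⟨α, β, hα, hαβ, fun a => ?_⟩
  have hi : ∀ m : ℤ, Integrable (fun n => conj (sphereHarmonic a.1 a.m n) * sphereHarmonic l m n)
      sphereMeasure := fun m =>
    Continuous.integrable_of_hasCompactSupport ((Complex.continuous_conj.comp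
      (continuous_sphereHarmonic _ _)).mul (continuous_sphereHarmonic _ _))
      (HasCompactSupport.of_compactSpace _)
  unfold sectoralCoeff
  simp_rw [h, mul_add, mul_left_comm (conj _)]
  rw [integral_add ((hi l).const_mul α) ((hi (-l)).const_mul β), integral_const_mul,
    integral_const_mul, integral_conj_sphereHarmonic_mul a.natAbs_m_le (by simp),
    integral_conj_sphereHarmonic_mul a.natAbs_m_le (by simp), mul_ite, mul_ite, mul_one, mul_one,
    mul_zero, mul_zero]

theorem sectoralCoeff_of_ne {l : ℕ} {a : AngLabel} (h : a.1 ≠ l) : sectoralCoeff l a = 0 := by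
  obtain ⟨α, β, -, -, hc⟩ := sectoralCoeff_eq l
  rw [hc, if_neg (fun h' => h h'.1), if_neg (fun h' => h h'.1), add_zero]

theorem tsum_enorm_sectoralCoeff_ne_zero (l : ℕ) : ∑' a, ‖sectoralCoeff l a‖ₑ ^ 2 ≠ 0 := by
  intro h
  obtain ⟨α, β, hα, hαβ, hc⟩ := sectoralCoeff_eq l
  obtain ⟨a, ha, hm⟩ := exists_angLabel (l := l) (m := l) (by simp)
  have h1 := ENNReal.tsum_eq_zero.1 h a
  rw [hc, if_pos ⟨ha, hm⟩] at h1
  have h2 := enorm_eq_zero.1 (pow_eq_zero_iff two_ne_zero |>.1 h1)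
  split_ifs at h2 with h3
  · have h4 : l = 0 := by omega
    rw [← hαβ h4, ← two_mul] at h2
    exact mul_ne_zero two_ne_zero hα h2
  · exact hα (by simpa using h2)

theorem tsum_enorm_sectoralCoeff_ne_top (l : ℕ) : ∑' a, ‖sectoralCoeff l a‖ₑ ^ 2 ≠ ⊤ := by
  have hL : MemLp (fun n => (((transverse n ^ l).re : ℝ) : ℂ)) 2 sphereMeasure := by
    obtain ⟨B, hB⟩ := (isCompact_univ (X := TwoSphere)).exists_bound_of_continuousOn
      (continuous_sectoral l).continuousOn
    exact MemLp.of_bound (continuous_sectoral l).aestronglyMeasurable B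
      (ae_of_all _ fun n => hB n (Set.mem_univ _))
  unfold sectoralCoeff
  rw [← lintegral_enorm_sq_sphere hL]
  exact ((lintegral_sq_lt_top_iff_memLp hL.1).2 hL).ne

/-- A function on `ℝ^{1,4}`, smooth away from the origin and homogeneous of degree `-2`, whose value
at `(cosh t, sinh t, n)` is `Re (y + i z)^l / cosh^{l+2} (t - a)`. -/
def sectoral (l : ℕ) (a : ℝ) (v : Mink) : ℝ :=
  ((v 3 + Complex.I * v 4 : ℂ) ^ l).re * (Real.cosh a * v 0 - Real.sinh a * v 1) ^ l /
    (((Real.cosh a * v 0 - Real.sinh a * v 1) ^ 2 + (Real.cosh a * v 1 - Real.sinh a * v 0) ^ 2 +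
      v 2 ^ 2 + v 3 ^ 2 + v 4 ^ 2) / 2) ^ (l + 1)

theorem sectoral_denom_ne_zero (a : ℝ) {v : Mink} (hv : v ≠ 0) :
    ((Real.cosh a * v 0 - Real.sinh a * v 1) ^ 2 + (Real.cosh a * v 1 - Real.sinh a * v 0) ^ 2 +
      v 2 ^ 2 + v 3 ^ 2 + v 4 ^ 2) / 2 ≠ 0 := by
  intro h
  have hcs := Real.cosh_sq_sub_sinh_sq a
  set c := Real.cosh a
  set s := Real.sinh a
  have h0 : c * v 0 - s * v 1 = 0 := by
    nlinarith [sq_nonneg (c * v 0 - s * v 1), sq_nonneg (c * v 1 - s * v 0), sq_nonneg (v 2),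
      sq_nonneg (v 3), sq_nonneg (v 4)]
  have h1 : c * v 1 - s * v 0 = 0 := by
    nlinarith [sq_nonneg (c * v 0 - s * v 1), sq_nonneg (c * v 1 - s * v 0), sq_nonneg (v 2),
      sq_nonneg (v 3), sq_nonneg (v 4)]
  rw [h0, h1] at h
  refine hv (funext fun i => ?_)
  fin_cases i
  · change v 0 = 0
    linear_combination c * h0 + s * h1 - v 0 * hcs
  · change v 1 = 0
    linear_combination c * h1 + s * h0 - v 1 * hcs
  · change v 2 = 0
    nlinarith [sq_nonneg (v 2), sq_nonneg (v 3), sq_nonneg (v 4)]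
  · change v 3 = 0
    nlinarith [sq_nonneg (v 2), sq_nonneg (v 3), sq_nonneg (v 4)]
  · change v 4 = 0
    nlinarith [sq_nonneg (v 2), sq_nonneg (v 3), sq_nonneg (v 4)]

theorem contDiffOn_sectoral (l : ℕ) (a : ℝ) : ContDiffOn ℝ ∞ (sectoral l a) {v | v ≠ 0} := by
  have hre : ContDiff ℝ ∞ fun v : Mink => ((v 3 + Complex.I * v 4 : ℂ) ^ l).re := by
    refine Complex.reCLM.contDiff.comp (ContDiff.pow (ContDiff.add ?_ (contDiff_const.mul ?_)) l)
    · exact Complex.ofRealCLM.contDiff.comp (contDiff_apply ℝ ℝ 3)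
    · exact Complex.ofRealCLM.contDiff.comp (contDiff_apply ℝ ℝ 4)
  have hc : ∀ i, ContDiff ℝ ∞ fun v : Mink => v i := fun i => contDiff_apply ℝ ℝ i
  have h0 := hc 0
  have h1 := hc 1
  have h2 := hc 2
  have h3 := hc 3
  have h4 := hc 4
  unfold sectoral
  exact (hre.mul (by fun_prop)).contDiffOn.div (ContDiff.contDiffOn (by fun_prop))
    fun v hv => pow_ne_zero _ (sectoral_denom_ne_zero a hv)

theorem sectoral_smul (l : ℕ) (a : ℝ) (v : Mink) {r : ℝ} (hr : 0 < r) :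
    sectoral l a (r • v) = (r ^ 2)⁻¹ * sectoral l a v := by
  have h1 : (((r • v) 3 : ℝ) + Complex.I * ((r • v) 4 : ℝ) : ℂ) ^ l =
      ((r ^ l : ℝ) : ℂ) * (v 3 + Complex.I * v 4 : ℂ) ^ l := by
    rw [Complex.ofReal_pow, ← mul_pow]
    congr 1
    simp only [Pi.smul_apply, smul_eq_mul]
    push_cast
    ring
  unfold sectoral
  rw [h1, Complex.re_ofReal_mul]
  simp only [Pi.smul_apply, smul_eq_mul]
  have h2 : Real.cosh a * (r * v 0) - Real.sinh a * (r * v 1) =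
      r * (Real.cosh a * v 0 - Real.sinh a * v 1) := by ring
  have h3 : Real.cosh a * (r * v 1) - Real.sinh a * (r * v 0) =
      r * (Real.cosh a * v 1 - Real.sinh a * v 0) := by ring
  rw [h2, h3]
  set A := Real.cosh a * v 0 - Real.sinh a * v 1
  set B := Real.cosh a * v 1 - Real.sinh a * v 0
  have h4 : ((r * A) ^ 2 + (r * B) ^ 2 + (r * v 2) ^ 2 + (r * v 3) ^ 2 + (r * v 4) ^ 2) / 2 =
      r ^ 2 * ((A ^ 2 + B ^ 2 + v 2 ^ 2 + v 3 ^ 2 + v 4 ^ 2) / 2) := by ring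
  rw [h4, mul_pow, mul_pow, ← pow_mul]
  have h5 : r ^ (2 * (l + 1)) = r ^ l * r ^ l * r ^ 2 := by ring
  rw [h5]
  field_simp

theorem sectoral_coordVec (l : ℕ) (a t : ℝ) (n : TwoSphere) :
    sectoral l a ![Real.cosh t, Real.sinh t, (n : E3) 0, (n : E3) 1, (n : E3) 2] =
      (Real.cosh (t - a) ^ (l + 2))⁻¹ * (transverse n ^ l).re := by
  have h1 : (((n : E3) 1 : ℝ) + Complex.I * ((n : E3) 2 : ℝ) : ℂ) = transverse n := by
    apply Complex.ext <;> simp [transverse]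
  have h2 : Real.cosh a * Real.cosh t - Real.sinh a * Real.sinh t = Real.cosh (t - a) := by
    rw [Real.cosh_sub]; ring
  have h3 : Real.cosh a * Real.sinh t - Real.sinh a * Real.cosh t = Real.sinh (t - a) := by
    rw [Real.sinh_sub]; ring
  have hn := sum_sq_twoSphere n
  have h4 := Real.cosh_sq (t - a)
  simp only [sectoral, Matrix.cons_val]
  rw [h1, h2, h3]
  have h5 : (Real.cosh (t - a) ^ 2 + Real.sinh (t - a) ^ 2 + (n : E3) 0 ^ 2 + (n : E3) 1 ^ 2 +
      (n : E3) 2 ^ 2) / 2 = Real.cosh (t - a) ^ 2 := by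
    linarith
  have hc := (Real.cosh_pos (t - a)).ne'
  rw [h5, ← pow_mul, show 2 * (l + 1) = l + (l + 2) by ring, pow_add _ l]
  field_simp

/-- Boundary data whose expansion has a single angular momentum `l`. -/
def Observer.testData (o : Observer) (l : ℕ) (a : ℝ) : BoundaryData where
  toFun x := sectoral l 0 (o.inv.frame.mulVec x) + sectoral l a (o.inv.frame.mulVec x)
  smooth := by
    have hlin : ContDiff ℝ ∞ fun x : Mink => o.inv.frame.mulVec x :=
      (LinearMap.toContinuousLinearMap (Matrix.mulVecLin o.inv.frame)).contDiff
    have hmaps : Set.MapsTo (fun x : Mink => o.inv.frame.mulVec x) {x | 0 < x 0} {v | v ≠ 0} := by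
      intro x hx h0
      have h1 := o.frame_mulVec_inv x
      have h0 : o.inv.frame.mulVec x = 0 := h0
      rw [h0, Matrix.mulVec_zero] at h1
      have h2 : 0 < x 0 := hx
      rw [← h1] at h2
      exact lt_irrefl _ h2
    exact ((contDiffOn_sectoral l 0).comp hlin.contDiffOn hmaps).add
      ((contDiffOn_sectoral l a).comp hlin.contDiffOn hmaps)
  weight_two v _ r hr := by
    rw [Matrix.mulVec_smul, sectoral_smul _ _ _ hr, sectoral_smul _ _ _ hr]
    ring

theorem integrable_inv_cosh_pow (l : ℕ) :
    Integrable fun t : ℝ => (((Real.cosh t ^ (l + 2))⁻¹ : ℝ) : ℂ) := by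
  have h : Integrable fun t : ℝ => (Real.cosh t ^ (l + 2))⁻¹ := by
    refine integrable_inv_cosh_sq.mono' (Continuous.inv₀
      (by fun_prop) fun t => pow_ne_zero _ (Real.cosh_pos t).ne').aestronglyMeasurable
      (ae_of_all _ fun t => ?_)
    have := Real.cosh_pos t
    rw [Real.norm_of_nonneg (by positivity)]
    exact inv_anti₀ (pow_pos this 2) (pow_le_pow_right₀ (Real.one_le_cosh t) (by omega))
  exact h.ofReal

theorem Observer.coeff_testData (o : Observer) (l : ℕ) (a : ℝ) (x : Mode) :
    o.coeff (o.testData l a) x = (1 + Complex.exp (Complex.I * (x.1 * a : ℝ))) *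
      timeFourier (fun t => (((Real.cosh t ^ (l + 2))⁻¹ : ℝ) : ℂ)) x.1 * sectoralCoeff l x.2 := by
  have hS := integrable_inv_cosh_pow l
  have hdata : ∀ p, o.data (o.testData l a) p = ((Real.cosh p.1 ^ (l + 2))⁻¹ +
      (Real.cosh (p.1 - a) ^ (l + 2))⁻¹) * (transverse p.2 ^ l).re := fun p => by
    simp only [Observer.data, Observer.testData, Observer.scriAt]
    rw [o.inv_mulVec_frame, sectoral_coordVec, sectoral_coordVec, sub_zero]
    ring
  rw [o.coeff_eq_modeCoeff, modeCoeff]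
  simp only [hdata]
  conv_lhs => simp only [Complex.ofReal_mul, mul_left_comm (conj _), integral_const_mul]
  change timeFourier (fun t => _ * sectoralCoeff l x.2) x.1 = _
  set S : ℝ → ℂ := fun t => (((Real.cosh t ^ (l + 2))⁻¹ : ℝ) : ℂ) with hSd
  have hsh : timeFourier (fun t => S (t - a)) x.1 =
      Complex.exp (Complex.I * (x.1 * a : ℝ)) * timeFourier S x.1 := by
    unfold timeFourier
    rw [← integral_const_mul, ← integral_sub_right_eq_self (fun t : ℝ =>
      Complex.exp (Complex.I * (x.1 * a : ℝ)) * (Complex.exp (Complex.I * x.1 * t) * S t)) a]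
    refine integral_congr_ae (ae_of_all _ fun t => ?_)
    have h : Complex.exp (Complex.I * x.1 * t) = Complex.exp (Complex.I * (x.1 * a : ℝ)) *
        Complex.exp (Complex.I * x.1 * (t - a : ℝ)) := by
      rw [← Complex.exp_add]
      congr 1
      push_cast
      ring
    refine (congrArg (· * S (t - a)) h).trans ?_
    simp only [mul_assoc]
  rw [add_mul, one_mul, ← hsh]
  unfold timeFourier
  rw [← integral_add (integrable_exp_mul hS _) (integrable_exp_mul (hS.comp_sub_right a) _),
    ← integral_mul_const]
  refine integral_congr_ae (ae_of_all _ fun t => ?_)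
  simp only [hSd, Complex.ofReal_add]
  ring

theorem exists_norm_horizonFactor_le (l : ℕ) : ∃ H, ∀ w, ‖horizonFactor l w‖ ≤ H := by
  refine ⟨1 + ∫ t in Set.Ioi (0 : ℝ), ‖Complex.exp (-(1 + Complex.I * (0 : ℝ)) * t) *
    ((derivative (legendre l)).eval (Real.exp (-t)) : ℝ)‖, fun w => ?_⟩
  refine (norm_sub_le _ _).trans (add_le_add (by simp) ?_)
  refine (norm_integral_le_integral_norm _).trans_eq ?_
  refine integral_congr_ae (ae_of_all _ fun t => ?_)
  simp only [norm_mul, Complex.norm_exp]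
  simp

/-- The energy determines the modulus of the normalization. -/
theorem Observer.IsNormalization.ae_eq {o : Observer} {N : ℕ → ℝ → ℂ} (hN : o.IsNormalization N)
    (l : ℕ) : ∀ᵐ w ∂volume.restrict (Set.Ioi (0 : ℝ)),
      ENNReal.ofReal w * ‖N l w‖ₑ ^ 2 = ENNReal.ofReal (‖horizonFactor l w‖ ^ 2 / 2) := by
  set S : ℝ → ℂ := fun t => (((Real.cosh t ^ (l + 2))⁻¹ : ℝ) : ℂ) with hSd
  have hS : Integrable S := integrable_inv_cosh_pow l
  have hS2 : MemLp S 2 := by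
    refine memLp_two_of_integrable_of_bounded hS (C := 1) fun t => ?_
    have := Real.cosh_pos t
    rw [hSd, Complex.norm_real, Real.norm_of_nonneg (by positivity)]
    exact inv_le_one_of_one_le₀ (one_le_pow₀ (Real.one_le_cosh t))
  set T := ∑' a, ‖sectoralCoeff l a‖ₑ ^ 2 with hT
  have hT0 : T ≠ 0 := tsum_enorm_sectoralCoeff_ne_zero l
  have hTt : T ≠ ⊤ := tsum_enorm_sectoralCoeff_ne_top l
  have hSm : Measurable (timeFourier S) := (continuous_timeFourier hS).measurable
  have hsum : ∀ {K : ℕ → ℝ → ℝ≥0∞}, (∀ l, Measurable (K l)) → ∀ a : ℝ,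
      ∫⁻ x, K x.2.1 x.1 * ‖o.coeff (o.testData l a) x‖ₑ ^ 2 ∂modeMeasure =
      ENNReal.ofReal ((2 * Real.pi)⁻¹) * ∫⁻ w in Set.Ioi (0 : ℝ),
        K l w * (‖timeFourier S w‖ₑ ^ 2 * T) *
          ‖1 + Complex.exp (Complex.I * (w * a : ℝ))‖ₑ ^ 2 := fun {K} hK a => by
    have hm : Measurable fun x : Mode => K x.2.1 x.1 * ‖o.coeff (o.testData l a) x‖ₑ ^ 2 := by
      refine measurable_from_prod_countable_left fun b => (hK b.1).mul ?_
      simp_rw [o.coeff_testData]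
      exact ((((Continuous.measurable (by fun_prop)).mul hSm).mul_const _).enorm.pow_const 2)
    rw [lintegral_modeMeasure hm]
    congr 1
    refine lintegral_congr fun w => ?_
    rw [← mul_assoc (K l w), mul_right_comm, hT, ← ENNReal.tsum_mul_left]
    refine tsum_congr fun b => ?_
    rw [o.coeff_testData]
    by_cases hb : b.1 = l
    · rw [hb]
      simp only [enorm_mul, mul_pow]
      ring
    · simp [sectoralCoeff_of_ne hb]
  have hA : ∀ l, Measurable fun w => ENNReal.ofReal w * ‖N l w‖ₑ ^ 2 := fun l =>
    ENNReal.measurable_ofReal.mul ((hN.1 l).enorm.pow_const 2)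
  have hB : ∀ l, Measurable fun w => ENNReal.ofReal (‖horizonFactor l w‖ ^ 2 / 2) := fun l =>
    (((measurable_horizonFactor l).norm.pow_const 2).div_const 2).ennreal_ofReal
  have hST : Measurable fun w => ‖timeFourier S w‖ₑ ^ 2 * T := (hSm.enorm.pow_const 2).mul_const _
  have hAm : Measurable fun w => ENNReal.ofReal w * ‖N l w‖ₑ ^ 2 * (‖timeFourier S w‖ₑ ^ 2 * T) :=
    (hA l).mul hST
  have hBm : Measurable fun w => ENNReal.ofReal (‖horizonFactor l w‖ ^ 2 / 2) *
    (‖timeFourier S w‖ₑ ^ 2 * T) := (hB l).mul hST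
  -- the energies of the test data give the same cosine transform on both sides
  have h : ∀ a : ℝ, ∫⁻ w in Set.Ioi (0 : ℝ), ENNReal.ofReal w * ‖N l w‖ₑ ^ 2 *
      (‖timeFourier S w‖ₑ ^ 2 * T) * ‖1 + Complex.exp (Complex.I * (w * a : ℝ))‖ₑ ^ 2 =
      ∫⁻ w in Set.Ioi (0 : ℝ), ENNReal.ofReal (‖horizonFactor l w‖ ^ 2 / 2) *
      (‖timeFourier S w‖ₑ ^ 2 * T) * ‖1 + Complex.exp (Complex.I * (w * a : ℝ))‖ₑ ^ 2 := fun a => by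
    have h1 := hN.2 (o.testData l a)
    have h2 := hsum hA a
    have h3 : ∀ x : Mode, ENNReal.ofReal x.1 * ‖o.oscillator N (o.testData l a) x‖ₑ ^ 2 =
        ENNReal.ofReal x.1 * ‖N x.2.1 x.1‖ₑ ^ 2 * ‖o.coeff (o.testData l a) x‖ₑ ^ 2 := fun x => by
      rw [Observer.oscillator, enorm_mul, mul_pow, mul_assoc]
    simp_rw [h3] at h1
    rw [o.energy_eq, hsum hB a, h2] at h1
    exact ((ENNReal.mul_right_inj (ENNReal.ofReal_pos.2 (by positivity)).ne'
      ENNReal.ofReal_ne_top).1 h1).symm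
  have hSfin : ∫⁻ w, ‖timeFourier S w‖ₑ ^ 2 ≠ ⊤ := by
    have h1 := lintegral_enorm_sq_eq_timeFourier hS hS2
    have h2 := ((lintegral_sq_lt_top_iff_memLp hS2.1).2 hS2).ne
    intro h3
    rw [h1, h3, ENNReal.mul_top (ENNReal.ofReal_pos.2 (by positivity)).ne'] at h2
    exact h2 rfl
  obtain ⟨H, hH⟩ := exists_norm_horizonFactor_le l
  have hBfin : ∫⁻ w in Set.Ioi (0 : ℝ), ENNReal.ofReal (‖horizonFactor l w‖ ^ 2 / 2) *
      (‖timeFourier S w‖ₑ ^ 2 * T) ≠ ⊤ := by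
    refine ne_top_of_le_ne_top (ENNReal.mul_ne_top (ENNReal.mul_ne_top
      (ENNReal.ofReal_ne_top (r := H ^ 2 / 2)) hTt) hSfin) ?_
    rw [← lintegral_const_mul _ (hSm.enorm.pow_const 2)]
    refine (setLIntegral_le_lintegral _ _).trans (lintegral_mono fun w => ?_)
    rw [mul_comm _ T, ← mul_assoc]
    gcongr
    exact hH w
  -- at `a = 0` the identity of energies also shows that the left-hand density is integrable
  have hle : ∀ g : ℝ → ℝ≥0∞, Measurable g → ∫⁻ w in Set.Ioi (0 : ℝ), g w *
      ‖1 + Complex.exp (Complex.I * (w * (0 : ℝ) : ℝ))‖ₑ ^ 2 =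
      (∫⁻ w in Set.Ioi (0 : ℝ), g w) * 4 := fun g hg => by
    rw [← lintegral_mul_const _ hg]
    refine lintegral_congr fun w => ?_
    rw [enorm_one_add_exp_sq, mul_zero, Real.cos_zero]
    norm_num
  have hAfin : ∫⁻ w in Set.Ioi (0 : ℝ), ENNReal.ofReal w * ‖N l w‖ₑ ^ 2 *
      (‖timeFourier S w‖ₑ ^ 2 * T) ≠ ⊤ := by
    have h0 := h 0
    rw [hle _ hAm, hle _ hBm] at h0
    rw [(ENNReal.mul_left_inj (by norm_num) (by norm_num)).1 h0]
    exact hBfin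
  filter_upwards [ae_eq_of_lintegral_mul_enorm_one_add_exp hAm hBm hAfin
    hBfin h] with w hw
  -- the factor due to the test data vanishes nowhere and can be cancelled
  have hne : ‖timeFourier S w‖ₑ ^ 2 * T ≠ 0 := mul_ne_zero (pow_ne_zero 2
    (enorm_ne_zero.2 (timeFourier_inv_cosh_pow_ne_zero (by omega) w))) hT0
  exact (ENNReal.mul_left_inj hne (ENNReal.mul_ne_top (by simp) hTt)).1 hw

/-- `|N_l(ω)|² = |horizonFactor|² / 2ω`. -/
theorem Observer.exists_isNormalization (o : Observer) :
    ∃ N : ℕ → ℝ → ℂ, o.IsNormalization N := by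
  refine ⟨fun l w => ((‖horizonFactor l w‖ / Real.sqrt (2 * w) : ℝ) : ℂ), fun l =>
    Complex.measurable_ofReal.comp ((measurable_horizonFactor l).norm.div (by fun_prop)),
    fun P => ?_⟩
  rw [o.energy_eq]
  refine lintegral_congr_ae ?_
  filter_upwards [ae_freq_pos] with x hx
  rw [Observer.oscillator, enorm_mul, mul_pow, ← mul_assoc]
  congr 1
  rw [← ofReal_norm, ← ENNReal.ofReal_pow (norm_nonneg _), ← ENNReal.ofReal_mul hx.le,
    Complex.norm_real, Real.norm_of_nonneg (by positivity), div_pow,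
    Real.sq_sqrt (by positivity)]
  congr 1
  field_simp

/-- The normalization turns the spectral function of the action into the thermal factor, by
`kernelCoeff_eq_modeTau`. -/
theorem Observer.IsNormalization.hartleHawking_eq {o : Observer} {N : ℕ → ℝ → ℂ}
    (hN : o.IsNormalization N) (P : BoundaryData) :
    Integrable (fun x => modeTanh x * (‖o.oscillator N P x‖ ^ 2 : ℝ)) modeMeasure ∧
      (hartleHawking P : ℂ) = hhGaussian (o.oscillator N P) := by
  have hae : ∀ᵐ x ∂modeMeasure, ENNReal.ofReal x.1 * ‖N x.2.1 x.1‖ₑ ^ 2 =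
      ENNReal.ofReal (‖horizonFactor x.2.1 x.1‖ ^ 2 / 2) := by
    have hm : MeasurableSet {x : Mode | ENNReal.ofReal x.1 * ‖N x.2.1 x.1‖ₑ ^ 2 =
        ENNReal.ofReal (‖horizonFactor x.2.1 x.1‖ ^ 2 / 2)} :=
      measurableSet_eq_fun
        (measurable_from_prod_countable_left fun a =>
          ENNReal.measurable_ofReal.mul ((hN.1 a.1).enorm.pow_const 2))
        (measurable_from_prod_countable_left fun a =>
          (((measurable_horizonFactor a.1).norm.pow_const 2).div_const 2).ennreal_ofReal)
    unfold modeMeasure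
    rw [Measure.ae_prod_iff_ae_ae hm]
    refine Measure.ae_smul_measure ?_ _
    filter_upwards [ae_all_iff.2 hN.ae_eq] with w hw
    exact ae_of_all _ fun a => hw a.1
  have hterm : (fun x => modeTanh x * (‖o.oscillator N P x‖ ^ 2 : ℝ)) =ᵐ[modeMeasure]
      fun x => ((1 / 2 * (kernelCoeff x.2.1 x.1 * ‖o.coeff P x‖ ^ 2) : ℝ) : ℂ) := by
    filter_upwards [hae, ae_freq_pos] with x h1 hx
    rw [← ofReal_norm, ← ENNReal.ofReal_pow (norm_nonneg _), ← ENNReal.ofReal_mul hx.le,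
      ENNReal.ofReal_eq_ofReal_iff (by positivity) (by positivity)] at h1
    rw [modeTanh_eq_modeTau hx, kernelCoeff_eq_modeTau hx, Observer.oscillator, norm_mul, mul_pow,
      ← Complex.ofReal_mul, Complex.ofReal_inj]
    field_simp
    linear_combination 2 * modeTau x * ‖o.coeff P x‖ ^ 2 * h1
  obtain ⟨hi, hS⟩ := o.euclideanAction_eq_integral P
  refine ⟨((hi.const_mul (1 / 2)).ofReal).congr hterm.symm, ?_⟩
  rw [hhGaussian, integral_congr_ae hterm, integral_complex_ofReal, integral_const_mul, ← hS,
    hartleHawking, Complex.ofReal_exp]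
  congr 1
  push_cast
  ring

end TestData

end EllipticDS

end

open EllipticDS in
theorem mainTheorem4 :
    -- in every observer's normalized oscillator variables, `e^{-S_E}` is one and the same Gaussian
    (∀ o : Observer, (∃ N : ℕ → ℝ → ℂ, o.IsNormalization N) ∧
      ∀ N : ℕ → ℝ → ℂ, o.IsNormalization N → ∀ P : BoundaryData,
        MeasureTheory.Integrable
          (fun x => modeTanh x * (‖o.oscillator N P x‖ ^ 2 : ℝ)) modeMeasure ∧
        (hartleHawking P : ℂ) = hhGaussian (o.oscillator N P)) ∧
    -- the Wigner–Weyl transform of this Gaussian is `R̂ e^{-πĤ}`, up to normalization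
    (∃ D : OneParticle → Fock →L[ℂ] Fock,
      IsWeylSystem D ∧ (∀ D' : OneParticle → Fock →L[ℂ] Fock, IsWeylSystem D' → D' = D) ∧
      IsWeylTransform D finiteAction hhGaussian
        (antipodalOperator * expNegHamiltonian NNReal.pi)) ∧
    -- its square is `e^{-2πĤ}`, the thermal operator at temperature `1/2π`
    (antipodalOperator * expNegHamiltonian NNReal.pi) ^ 2 = expNegHamiltonian (2 * NNReal.pi) ∧
    expNegHamiltonian (2 * NNReal.pi) = thermalOperator (1 / (2 * NNReal.pi)) ∧
    -- `Ĥ = ∫ dω/2π ∑ ω a†a` and `L̂ = ∫ dω/2π ∑ l a†a`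
    IsModeSum (fun x => x.1) energyOf ∧
    IsModeSum (fun x => (x.2.1 : ℝ)) (fun y => (angularOf y : ℝ)) ∧
    -- `(-1)^l` is the action of the antipodal map of `S²` on the modes
    (∀ (l : ℕ) (m : ℤ) (θ φ : ℝ), m.natAbs ≤ l →
      sphericalHarmonic l m (Real.pi - θ) (φ + Real.pi) = (-1) ^ l * sphericalHarmonic l m θ φ) := by
  refine ⟨fun o => ⟨o.exists_isNormalization, fun N hN P => hN.hartleHawking_eq P⟩,
    ⟨weylOp, isWeylSystem_weylOp, fun D' h => isWeylSystem_weylOp.eq h,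
    isWeylTransform_hhGaussian⟩, antipodal_mul_expNeg_sq, expNegHamiltonian_eq_thermal,
    isModeSum_energyOf, isModeSum_angularOf,
    fun l m θ φ _ => sphericalHarmonic_antipode l m θ φ⟩
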